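/- Let $\mathcal R_1$ be the Riesz transform on $\mathbb R^2$ with symbol $-i\xi_1/|\xi|$, let $\nabla^\perp=(-\partial_2,\partial_1)$, and let $\|f\|_{H^n}=\|(1-\Delta)^{n/2}f\|_{L^2(\mathbb R^2)}$. For $\kappa>0$ consider the dispersive SQG equation for real-valued $\theta=\theta(t,x)$, $x\in\mathbb R^2$: $$\partial_t\theta+u\cdot\nabla\theta=\kappa\,\mathcal R_1\theta,\qquad u=\nabla^\perp(-\Delta)^{-1/2}\theta,\qquad \theta(0,\cdot)=\theta_0 .\tag{1}$$ **Theorem.** Let $n>3$ be a real number. There exists a constant $C_n>0$, depending only on $n$, such that for every $\kappa>0$, every $\varepsilon>0$ and every real-valued $\theta_0\in H^n(\mathbb R^2)$ with $\|\theta_0\|_{H^n}=\varepsilon$ there exist a time $$T\ge C_n\,\kappa^{1/3}\,\varepsilon^{-4/3}$$ and a unique solution $\theta\in C([0,T],H^n(\mathbb R^2))$ of (1) on $[0,T]$ with initial datum $\theta_0$. Here a solution $\theta\in C([0,T],H^n(\mathbb R^2))$ of (1) is one that is differentiable in time on $[0,T]$ as an $L^2(\mathbb R^2)$-valued function (one-sidedly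 at the end points) and satisfies the equation in $L^2(\mathbb R^2)$ at every $t\in[0,T]$. -/

import Mathlib

open MeasureTheory Set Filter Topology FourierTransform LineDeriv
open scoped ENNReal SchwartzMap

noncomputable section

namespace DispersiveSQG

/-- The Euclidean plane `ℝ²`. -/
abbrev Plane : Type := EuclideanSpace ℝ (Fin 2)

/-- Real-valued square-integrable functions on the plane. -/
abbrev RealL2 : Type := Lp ℝ 2 (volume : Measure Plane)

/-- Complex-valued square-integrable functions on the plane. -/
abbrev ComplexL2 : Type := Lp ℂ 2 (volume : Measure Plane)

/-- A real-valued `L²` function regarded as a complex-valued one. -/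
def toComplex (f : RealL2) : ComplexL2 := Complex.ofRealCLM.compLp f

/-- The Sobolev norm `‖f‖_{H^s} = ‖(1 - Δ)^{s/2} f‖_{L²}`, with value `∞` if `f` is not in `H^s`.
In Mathlib's convention `𝓕 f ξ = ∫ exp (-2πi x·ξ) f x dx` the Fourier transform is unitary on `L²`
and `1 - Δ` has the symbol `1 + (2π|ξ|)²`. -/
def sobolevENorm (s : ℝ) (f : RealL2) : ℝ≥0∞ :=
  eLpNorm (fun ξ : Plane =>
    (((1 + (2 * Real.pi * ‖ξ‖) ^ 2) ^ (s / 2) : ℝ) : ℂ) * (𝓕 (toComplex f) : ComplexL2) ξ) 2 volume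

/-- `θ` restricts to an element of `C([0,T], H^s(ℝ²))`. -/
def ContinuousInSobolev (s T : ℝ) (θ : ℝ → RealL2) : Prop :=
  (∀ t ∈ Icc 0 T, sobolevENorm s (θ t) < ∞) ∧
  ∀ t ∈ Icc 0 T, Tendsto (fun r => sobolevENorm s (θ r - θ t)) (𝓝[Icc 0 T] t) (𝓝 0)

/-- The Fourier multiplier on `L²` with bounded symbol `m`: `f ↦ 𝓕⁻¹ (m · 𝓕 f)`. -/
def multiplier (m : Plane → ℂ) (hm : MemLp m ∞ volume) (f : ComplexL2) : ComplexL2 :=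
  𝓕⁻ (hm.toLp m • (𝓕 f : ComplexL2) : ComplexL2)

/-- The symbol `i ξ_j / |ξ|` of `∂_j (-Δ)^{-1/2}`. It is homogeneous of degree `0`, so that it is the
same for every normalization of the frequency; its value at the single point `0` is irrelevant. -/
def gradSymbol (j : Fin 2) (ξ : Plane) : ℂ := Complex.I * ((ξ j / ‖ξ‖ : ℝ) : ℂ)

/-- The symbol `-i ξ_j / |ξ|` of the Riesz transform in the `j`-th coordinate. -/
def rieszSymbol (j : Fin 2) (ξ : Plane) : ℂ := -Complex.I * ((ξ j / ‖ξ‖ : ℝ) : ℂ)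

theorem memLp_gradSymbol (j : Fin 2) : MemLp (gradSymbol j) ∞ volume := by
  refine memLp_top_of_bound (C := 1) ?_ ?_
  · unfold gradSymbol
    exact Measurable.aestronglyMeasurable (by fun_prop)
  · refine Eventually.of_forall fun ξ => ?_
    rw [gradSymbol, norm_mul, Complex.norm_I, one_mul, Complex.norm_real, norm_div, norm_norm]
    exact div_le_one_of_le₀ (PiLp.norm_apply_le ξ j) (norm_nonneg _)

theorem memLp_rieszSymbol (j : Fin 2) : MemLp (rieszSymbol j) ∞ volume := by
  have h : rieszSymbol j = -gradSymbol j := by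
    ext ξ
    simp [rieszSymbol, gradSymbol]
  rw [h]
  exact (memLp_gradSymbol j).neg

/-- The operator `∂_j (-Δ)^{-1/2}` on `L²`. -/
def gradInvSqrtLaplacian (j : Fin 2) : ComplexL2 → ComplexL2 :=
  multiplier (gradSymbol j) (memLp_gradSymbol j)

/-- The Riesz transform in the `j`-th coordinate on `L²`. -/
def riesz (j : Fin 2) : ComplexL2 → ComplexL2 :=
  multiplier (rieszSymbol j) (memLp_rieszSymbol j)

/-- The velocity `u = ∇^⊥ (-Δ)^{-1/2} f`, where `∇^⊥ = (-∂₁, ∂₀)` for coordinates numbered `0`, `1`. -/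
def velocity (f : RealL2) : Fin 2 → ComplexL2 :=
  ![-gradInvSqrtLaplacian 1 (toComplex f), gradInvSqrtLaplacian 0 (toComplex f)]

/-- `g` is the (distributional) gradient of `f`, and its components are in `L²`. -/
def IsGradient (f : RealL2) (g : Fin 2 → ComplexL2) : Prop :=
  ∀ j : Fin 2, ((g j : ComplexL2) : 𝓢'(Plane, ℂ)) =
    ∂_{(EuclideanSpace.single j (1 : ℝ) : Plane)} ((toComplex f : ComplexL2) : 𝓢'(Plane, ℂ))

/-- `θ ∈ C([0,T], H^s(ℝ²))` solves `∂_t θ + u · ∇θ = κ R₁ θ`, `u = ∇^⊥ (-Δ)^{-1/2} θ`, on `[0,T]` with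
`θ(0) = θ₀`. The time derivative is that of an `L²`-valued function (one-sided at the end points),
and the equation holds as an identity in `L²` at every time. All the complex-valued functions that
occur in it are real almost everywhere. -/
structure IsSolution (s κ T : ℝ) (θ₀ : RealL2) (θ : ℝ → RealL2) : Prop where
  continuous : ContinuousInSobolev s T θ
  initial : θ 0 = θ₀
  equation : ∀ t ∈ Icc 0 T, ∃ (θ' : RealL2) (g : Fin 2 → ComplexL2),
    HasDerivWithinAt θ θ' (Icc 0 T) t ∧ IsGradient (θ t) g ∧
    ∀ᵐ x : Plane, ((θ' x : ℝ) : ℂ) + ∑ j : Fin 2, velocity (θ t) j x * g j x =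
      (κ : ℂ) * riesz 0 (toComplex (θ t)) x

end DispersiveSQG

end

open MeasureTheory Set Filter Topology FourierTransform LineDeriv
open scoped ENNReal SchwartzMap

noncomputable section

namespace DispersiveSQG

/-! The time scale comes from a bootstrap for a single number, X(t) = ∫₀ᵗ N(θ(s)) ds. Here N is
`dispN`, a Lipschitz norm of Besov type: on the dyadic shell of frequencies of size 2^k it measures
∇θ, 2^k u and ∇u in L^∞, and the shells are summed. Three estimates feed the bootstrap.

Energy (`exists_energy_bound`). The Riesz term is skew-adjoint and drops out of every energy
identity with a Fourier weight. Transport by a real divergence free field is antisymmetric, so only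
a commutator is left, and it costs one L^∞ norm of ∇u or ∇θ. Grönwall gives ‖θ(t)‖_{H^n} ≤
‖θ₀‖_{H^n} exp(C X(t)).

Product (`exists_product_bound`). The nonlinearity satisfies ‖u·∇θ‖_{H^{n-1}} ≤ C N(θ) ‖θ‖_{H^n}.

Dispersion (`exists_integral_dispN_le`). For the forced linear equation, X(T) ≤ C κ^{-1/4} T^{3/4}
(‖θ₀‖_{H^{n-1}} + ∫ ‖u·∇θ‖_{H^{n-1}}).

As long as X ≤ 1 the first two estimates bound the bracket by a multiple of ε, so X ≤ S κ^{-1/4}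
T^{3/4} ε. For T = c κ^{1/3} ε^{-4/3} the right side is 1/2, and by continuity X never reaches 1.
This is `exists_apriori_bound`.

The dispersive estimate starts from decay at the rate |τ|^{-1/2} (`exists_decay`). The phase ξ₁/|ξ|
is constant along rays, so only the angular integral oscillates; it is of Bessel type, and the
radial integral then meets an integrable inverse square root singularity. A TT* argument follows,
carried out on finitely many equidistant times (`exists_integral_norm_sum_sq_le`,
`exists_strichartz_sampled`): it needs nothing but Cauchy-Schwarz and the sum of |i - j|^{-1/2}. The
hypothesis n > 3 enters here: with r = n - 1 > 2 derivatives there is room both for an integrable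
weight on the plane and for a geometric factor that sums the shells.

The multilinear estimates live on the Fourier side, as trilinear integrals over pairs (ξ, η) with
advecting frequency ξ - η. A factor is estimated in L^∞ through `supF`, the supremum of its inverse
transform. Weights are moved between comparable frequencies by symbols H(log⟨ξ⟩ - log⟨η⟩) with H
Schwartz; expanding H by Fourier inversion turns them into averages of products of unimodular
functions, so they cost only ‖𝓕 H‖₁ (`norm_schur_trilinear_le`).

Existence is by truncating frequencies (`exists_galerkin`), which leaves an ordinary differential
equation in L² with conserved norm. The bounds above are uniform in the truncation, and the
approximations are Cauchy in L² at the rate 2^{-K}. Convergence and time continuity in H^n itself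
come from the tail weights x^{2n+2}/(x² + R): their energies are propagated uniformly in R and K, so
high frequencies stay uniformly small. Uniqueness is an L² energy estimate for the difference.
Finally, real functions correspond to Hermitian Fourier transforms, and `equation_iff` translates
the equation from one side to the other. -/

/-! ### Fourier transforms of integrable functions, Young's inequality and trilinear forms. -/

open Convolution in
/-- On `L¹ ∩ L²` the inverse Fourier transform of `L²` is given by the integral. -/
theorem fourierInv_toLp_ae_eq {w : Plane → ℂ} (h1 : Integrable w) (h2 : MemLp w 2) :
    ((𝓕⁻ (h2.toLp w : ComplexL2) : ComplexL2) : Plane → ℂ) =ᵐ[volume] 𝓕⁻ w := by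
  have hcont : Continuous (𝓕⁻ w) :=
    VectorFourier.fourierIntegral_continuous Real.continuous_fourierChar
      (continuous_inner (𝕜 := ℝ) (E := Plane)).neg h1
  -- Both sides are tested against smooth compactly supported functions. The left pairing moves `𝓕⁻`
  -- to the test function by definition on tempered distributions, the right one by Fubini.
  apply ae_eq_of_integral_contDiff_smul_eq
  · exact (Lp.memLp _).locallyIntegrable (by norm_num)
  · exact hcont.locallyIntegrable
  intro g g_smooth g_cpt
  have hg₁ : HasCompactSupport (Complex.ofRealCLM ∘ g) := g_cpt.comp_left rfl
  have hg₂ : ContDiff ℝ (⊤ : ℕ∞) (Complex.ofRealCLM ∘ g) :=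
    Complex.ofRealCLM.contDiff.comp g_smooth
  set φ : 𝓢(Plane, ℂ) := hg₁.toSchwartzMap hg₂
  have hφ : ∀ x, φ x = (g x : ℂ) := fun x => by simp [φ]
  have e1 : ∫ x, g x • ((𝓕⁻ (h2.toLp w : ComplexL2) : ComplexL2) : Plane → ℂ) x =
      Lp.toTemperedDistribution (𝓕⁻ (h2.toLp w : ComplexL2) : ComplexL2) φ := by
    simp [hφ]
  rw [e1, ← Lp.fourierInv_toTemperedDistribution_eq, TemperedDistribution.fourierInv_apply,
    Lp.toTemperedDistribution_apply]
  have e2 : ∫ x, (𝓕⁻ φ : 𝓢(Plane, ℂ)) x • (h2.toLp w : Plane → ℂ) x =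
      ∫ x, (𝓕⁻ (φ : Plane → ℂ)) x • w x := by
    apply integral_congr_ae
    filter_upwards [h2.coeFn_toLp] with x hx
    rw [hx, SchwartzMap.fourierInv_coe]
  have e3 := VectorFourier.integral_fourierIntegral_smul_eq_flip (𝕜 := ℝ) (e := Real.fourierChar)
    (μ := (volume : Measure Plane)) (ν := (volume : Measure Plane)) (L := -innerₗ Plane)
    (f := (φ : Plane → ℂ)) (g := w) Real.continuous_fourierChar
    (continuous_inner (𝕜 := ℝ) (E := Plane)).neg φ.integrable h1
  have e4 : (-innerₗ Plane).flip = -innerₗ Plane := by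
    ext x y; simp [real_inner_comm]
  rw [e4] at e3
  rw [e2]
  refine e3.trans ?_
  apply integral_congr_ae
  filter_upwards with x
  rw [hφ]
  simp
  exact Or.inl rfl

/-- The Cauchy-Schwarz inequality for the lower Lebesgue integral. -/
theorem lintegral_mul_sq_le {α : Type*} [MeasurableSpace α] {μ : Measure α} {f g : α → ℝ≥0∞}
    (hf : AEMeasurable f μ) (hg : AEMeasurable g μ) :
    (∫⁻ x, f x * g x ∂μ) ^ 2 ≤ (∫⁻ x, f x ^ 2 ∂μ) * ∫⁻ x, g x ^ 2 ∂μ := by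
  have h := ENNReal.lintegral_mul_le_Lp_mul_Lq μ (p := 2) (q := 2) Real.HolderConjugate.two_two hf hg
  have h2 := pow_le_pow_left₀ (zero_le) h 2
  refine h2.trans (le_of_eq ?_)
  rw [mul_pow, ← ENNReal.rpow_natCast, ← ENNReal.rpow_natCast, ← ENNReal.rpow_mul,
    ← ENNReal.rpow_mul]
  norm_num

/-- Young's inequality `‖A ⋆ G‖₂ ≤ ‖A‖₁ ‖G‖₂`. -/
theorem lintegral_conv_sq_le {A G : Plane → ℝ≥0∞} (hA : Measurable A) (hG : Measurable G) :
    ∫⁻ ξ, (∫⁻ η, A (ξ - η) * G η) ^ 2 ≤ (∫⁻ ξ, A ξ) ^ 2 * ∫⁻ η, G η ^ 2 := by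
  have h1 : ∀ ξ : Plane, (∫⁻ η, A (ξ - η) * G η) ^ 2 ≤
      (∫⁻ ξ, A ξ) * ∫⁻ η, A (ξ - η) * G η ^ 2 := by
    intro ξ
    have hm : Measurable fun η => A (ξ - η) := hA.comp (measurable_const.sub measurable_id)
    -- Cauchy-Schwarz with respect to the measure A(ξ - η) dη, written by splitting A into two
    -- square roots.
    have := lintegral_mul_sq_le (μ := volume) (f := fun η => A (ξ - η) ^ (1 / 2 : ℝ))
      (g := fun η => A (ξ - η) ^ (1 / 2 : ℝ) * G η) (hm.pow_const _).aemeasurable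
      ((hm.pow_const _).mul hG).aemeasurable
    have hs : ∀ a : ℝ≥0∞, a ^ (1 / 2 : ℝ) * a ^ (1 / 2 : ℝ) = a := by
      intro a
      rw [← ENNReal.rpow_add_of_nonneg _ _ (by norm_num) (by norm_num)]
      norm_num
    have hs2 : ∀ a : ℝ≥0∞, (a ^ (1 / 2 : ℝ)) ^ 2 = a := by
      intro a; rw [sq, hs]
    simp only [mul_pow, hs2, ← mul_assoc, hs] at this
    rwa [lintegral_sub_left_eq_self A ξ] at this
  calc ∫⁻ ξ, (∫⁻ η, A (ξ - η) * G η) ^ 2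
      ≤ ∫⁻ ξ, (∫⁻ ξ, A ξ) * ∫⁻ η, A (ξ - η) * G η ^ 2 := lintegral_mono h1
    _ = (∫⁻ ξ, A ξ) * ∫⁻ ξ, ∫⁻ η, A (ξ - η) * G η ^ 2 := by
        rw [lintegral_const_mul]
        apply Measurable.lintegral_prod_right' (f := fun p : Plane × Plane => A (p.1 - p.2) * G p.2 ^ 2)
        fun_prop
    _ = (∫⁻ ξ, A ξ) * ∫⁻ η, ∫⁻ ξ, A (ξ - η) * G η ^ 2 := by
        rw [lintegral_lintegral_swap]
        fun_prop
    _ = (∫⁻ ξ, A ξ) ^ 2 * ∫⁻ η, G η ^ 2 := by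
        have : ∀ η : Plane, ∫⁻ ξ, A (ξ - η) * G η ^ 2 = (∫⁻ ξ, A ξ) * G η ^ 2 := by
          intro η
          rw [lintegral_mul_const _ (by fun_prop), lintegral_sub_right_eq_self A η]
        simp_rw [this]
        rw [lintegral_const_mul _ (by fun_prop)]
        ring

/-- The trilinear form of Young's inequality. -/
theorem lintegral_trilinear_sq_le {A G H : Plane → ℝ≥0∞} (hA : Measurable A) (hG : Measurable G)
    (hH : Measurable H) :
    (∫⁻ p : Plane × Plane, A (p.1 - p.2) * G p.2 * H p.1) ^ 2 ≤
      (∫⁻ ξ, A ξ) ^ 2 * (∫⁻ η, G η ^ 2) * ∫⁻ ξ, H ξ ^ 2 := by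
  have e : ∫⁻ p : Plane × Plane, A (p.1 - p.2) * G p.2 * H p.1 =
      ∫⁻ ξ, (∫⁻ η, A (ξ - η) * G η) * H ξ := by
    rw [Measure.volume_eq_prod, lintegral_prod _ (by fun_prop)]
    refine lintegral_congr fun ξ => ?_
    change ∫⁻ y, A (ξ - y) * G y * H ξ = _
    exact lintegral_mul_const (H ξ) (f := fun y => A (ξ - y) * G y) (by fun_prop)
  rw [e]
  refine (lintegral_mul_sq_le ?_ hH.aemeasurable).trans ?_
  · apply Measurable.aemeasurable
    exact Measurable.lintegral_prod_right' (f := fun p : Plane × Plane => A (p.1 - p.2) * G p.2)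
      (by fun_prop)
  · gcongr
    exact lintegral_conv_sq_le hA hG

/-- The `L²` norm of a function on the plane. -/
abbrev l2 (f : Plane → ℂ) : ℝ := lpNorm f 2 volume

theorem l2_nonneg (f : Plane → ℂ) : 0 ≤ l2 f := lpNorm_nonneg

theorem l2_sq {f : Plane → ℂ} (hf : MemLp f 2) : l2 f ^ 2 = ∫ ξ, ‖f ξ‖ ^ 2 := by
  rw [l2, lpNorm_eq_integral_norm_rpow_toReal (by norm_num) (by norm_num) hf.1,
    ← Real.rpow_natCast, ← Real.rpow_mul (by positivity)]
  norm_num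

theorem enorm_l2_sq {f : Plane → ℂ} (hf : MemLp f 2) :
    ENNReal.ofReal (l2 f ^ 2) = ∫⁻ ξ, ‖f ξ‖ₑ ^ 2 := by
  rw [l2_sq hf, ofReal_integral_eq_lintegral_ofReal (hf.integrable_norm_pow (by norm_num))
    (by filter_upwards with x; positivity)]
  refine lintegral_congr fun ξ => ?_
  rw [ENNReal.ofReal_pow (norm_nonneg _), ofReal_norm]

theorem memLp_two_iff {f : Plane → ℂ} (hf : AEStronglyMeasurable f volume) :
    MemLp f 2 ↔ ∫⁻ ξ, ‖f ξ‖ₑ ^ 2 < ∞ := by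
  rw [MemLp, and_iff_right hf, eLpNorm_lt_top_iff_lintegral_rpow_enorm_lt_top (by norm_num)
    (by norm_num)]
  norm_num

theorem l2_mono {f g : Plane → ℂ} {c : ℝ} (hc : 0 ≤ c) (hg : MemLp g 2)
    (h : ∀ ξ, ‖f ξ‖ ≤ c * ‖g ξ‖) : l2 f ≤ c * l2 g := by
  have h' := lpNorm_mono_real (p := 2) (μ := volume) (f := f) (g := fun ξ => c * ‖g ξ‖)
    (hg.norm.const_mul c) h
  refine h'.trans (le_of_eq ?_)
  have := lpNorm_const_smul (𝕜 := ℝ) (p := 2) c (fun ξ => ‖g ξ‖) (volume : Measure Plane)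
  simp only [Pi.smul_def, smul_eq_mul] at this
  rw [show (fun ξ => c * ‖g ξ‖) = (c • fun ξ => ‖g ξ‖) from rfl]
  rw [show (c • fun ξ => ‖g ξ‖) = fun ξ => c * ‖g ξ‖ from rfl, this, lpNorm_norm hg.1,
    coe_nnnorm, Real.norm_of_nonneg hc]

/-- The integrand of the trilinear form is integrable. -/
theorem integrable_trilinear {w g h : Plane → ℂ} (hw : Integrable w) (hg : MemLp g 2)
    (hh : MemLp h 2) :
    Integrable fun p : Plane × Plane => w (p.1 - p.2) * g p.2 * (starRingEnd ℂ) (h p.1) := by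
  obtain ⟨w', hw'm, hww'⟩ := hw.1
  obtain ⟨g', hg'm, hgg'⟩ := hg.1
  obtain ⟨h', hh'm, hhh'⟩ := hh.1
  -- The factors are only almost everywhere measurable, so they are replaced by Borel
  -- representatives; this is harmless after composition because the subtraction map and the two
  -- projections pull null sets back to null sets.
  have q1 : Measure.QuasiMeasurePreserving (fun p : Plane × Plane => p.1 - p.2)
      (volume.prod volume) volume := quasiMeasurePreserving_sub_of_right_invariant volume volume
  have a1 : ∀ᵐ p : Plane × Plane, w (p.1 - p.2) = w' (p.1 - p.2) := q1.ae_eq_comp hww'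
  have a2 : ∀ᵐ p : Plane × Plane, g p.2 = g' p.2 :=
    Measure.quasiMeasurePreserving_snd.ae_eq_comp hgg'
  have a3 : ∀ᵐ p : Plane × Plane, h p.1 = h' p.1 :=
    Measure.quasiMeasurePreserving_fst.ae_eq_comp hhh'
  have key : Integrable fun p : Plane × Plane =>
      w' (p.1 - p.2) * g' p.2 * (starRingEnd ℂ) (h' p.1) := by
    refine ⟨?_, ?_⟩
    · have := hw'm.measurable
      have := hg'm.measurable
      have := hh'm.measurable
      have hc : Measurable (starRingEnd ℂ) := Complex.continuous_conj.measurable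
      apply Measurable.aestronglyMeasurable
      fun_prop
    · rw [hasFiniteIntegral_iff_enorm]
      simp only [enorm_mul, RCLike.enorm_conj]
      have := lintegral_trilinear_sq_le hw'm.measurable.enorm hg'm.measurable.enorm
        hh'm.measurable.enorm
      have f1 : ∫⁻ ξ, ‖w' ξ‖ₑ < ∞ := (hw.congr hww').2
      have f2 := (memLp_two_iff hg'm.aestronglyMeasurable).1 (hg.ae_eq hgg')
      have f3 := (memLp_two_iff hh'm.aestronglyMeasurable).1 (hh.ae_eq hhh')
      by_contra hcon
      rw [not_lt, top_le_iff] at hcon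
      rw [hcon] at this
      have h4 : (∫⁻ ξ, ‖w' ξ‖ₑ) ^ 2 * (∫⁻ η, ‖g' η‖ₑ ^ 2) * ∫⁻ ξ, ‖h' ξ‖ₑ ^ 2 < ∞ :=
        ENNReal.mul_lt_top (ENNReal.mul_lt_top (ENNReal.pow_lt_top f1) f2) f3
      simp at this
      exact absurd this h4.ne
  refine key.congr ?_
  filter_upwards [a1, a2, a3] with p b1 b2 b3
  rw [b1, b2, b3]

/-- The supremum of the inverse Fourier transform of an integrable function. -/
def supF (w : Plane → ℂ) : ℝ := ⨆ x, ‖𝓕⁻ w x‖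

theorem norm_fourierInv_le_integral (w : Plane → ℂ) (x : Plane) : ‖𝓕⁻ w x‖ ≤ ∫ ξ, ‖w ξ‖ :=
  VectorFourier.norm_fourierIntegral_le_integral_norm _ _ _ _ _

theorem bddAbove_fourierInv (w : Plane → ℂ) : BddAbove (Set.range fun x => ‖𝓕⁻ w x‖) :=
  ⟨_, by rintro _ ⟨x, rfl⟩; exact norm_fourierInv_le_integral w x⟩

theorem norm_fourierInv_le_supF (w : Plane → ℂ) (x : Plane) : ‖𝓕⁻ w x‖ ≤ supF w :=
  le_ciSup (bddAbove_fourierInv w) x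

theorem supF_nonneg (w : Plane → ℂ) : 0 ≤ supF w :=
  (norm_nonneg _).trans (norm_fourierInv_le_supF w 0)

open ContinuousLinearMap in
/-- Young's inequality: the convolution of `L¹` and `L²` is in `L²`. -/
theorem memLp_conv {w g : Plane → ℂ} (hw : Integrable w) (hg : MemLp g 2) :
    MemLp (fun ξ => ∫ η, w (ξ - η) * g η) 2 ∧
      l2 (fun ξ => ∫ η, w (ξ - η) * g η) ≤ (∫ ξ, ‖w ξ‖) * l2 g := by
  obtain ⟨w', hw'm, hww'⟩ := hw.1
  obtain ⟨g', hg'm, hgg'⟩ := hg.1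
  have hg2 := hg.ae_eq hgg'
  have hw2 := hw.congr hww'
  have e : (fun ξ => ∫ η, w (ξ - η) * g η) = fun ξ => ∫ η, w' (ξ - η) * g' η := by
    ext ξ
    apply integral_congr_ae
    have : ∀ᵐ η, w (ξ - η) = w' (ξ - η) :=
      (quasiMeasurePreserving_sub_left_of_right_invariant volume ξ).ae_eq_comp hww'
    filter_upwards [this, hgg'] with η h1 h2
    rw [h1, h2]
  have em : ∫ ξ, ‖w ξ‖ = ∫ ξ, ‖w' ξ‖ := integral_congr_ae (by filter_upwards [hww'] with x hx; rw [hx])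
  have el : l2 g = l2 g' := by
    rw [l2, l2, ← toReal_eLpNorm hg.1, ← toReal_eLpNorm hg2.1, eLpNorm_congr_ae hgg']
  rw [e, em, el]
  have := hw'm.measurable
  have := hg'm.measurable
  have hsm : AEStronglyMeasurable (fun ξ => ∫ η, w' (ξ - η) * g' η) volume := by
    apply StronglyMeasurable.aestronglyMeasurable
    apply StronglyMeasurable.integral_prod_right' (f := fun p : Plane × Plane => w' (p.1 - p.2) * g' p.2)
    apply Measurable.stronglyMeasurable
    fun_prop
  have hY := lintegral_conv_sq_le hw'm.measurable.enorm hg'm.measurable.enorm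
  have h1 : ∫⁻ ξ, ‖∫ η, w' (ξ - η) * g' η‖ₑ ^ 2 ≤ (∫⁻ ξ, ‖w' ξ‖ₑ) ^ 2 * ∫⁻ η, ‖g' η‖ₑ ^ 2 := by
    refine le_trans (lintegral_mono fun ξ => ?_) hY
    gcongr
    refine (enorm_integral_le_lintegral_enorm _).trans (le_of_eq ?_)
    simp only [enorm_mul]
  have hmem : MemLp (fun ξ => ∫ η, w' (ξ - η) * g' η) 2 := by
    rw [memLp_two_iff hsm]
    refine h1.trans_lt (ENNReal.mul_lt_top (ENNReal.pow_lt_top hw2.2) ?_)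
    exact (memLp_two_iff hg2.1).1 hg2
  refine ⟨hmem, ?_⟩
  have hl := l2_nonneg g'
  rw [← enorm_l2_sq hmem, ← enorm_l2_sq hg2, ← ofReal_integral_norm_eq_lintegral_enorm hw2,
    ← ENNReal.ofReal_pow (by positivity), ← ENNReal.ofReal_mul (by positivity),
    ENNReal.ofReal_le_ofReal_iff (by positivity), ← mul_pow] at h1
  exact le_of_abs_le (abs_le_of_sq_le_sq h1 (mul_nonneg (by positivity) hl))

theorem norm_toLp_eq_l2 {f : Plane → ℂ} (hf : MemLp f 2) : ‖(hf.toLp f : ComplexL2)‖ = l2 f := by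
  rw [Lp.norm_toLp, l2, toReal_eLpNorm hf.1]

open ContinuousLinearMap Convolution in
theorem fourierInv_conv {w g : Plane → ℂ} (hw : Integrable w) (hg : Integrable g) (x : Plane) :
    𝓕⁻ (fun ξ => ∫ η, w (ξ - η) * g η) x = 𝓕⁻ w x * 𝓕⁻ g x := by
  have e : (fun ξ => ∫ η, w (ξ - η) * g η) = g ⋆[mul ℂ ℂ] w := by
    ext ξ
    rw [convolution]
    refine integral_congr_ae (by filter_upwards with η; simp [mul_comm])
  rw [e, Real.fourierInv_eq_fourier_neg, Real.fourierInv_eq_fourier_neg,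
    Real.fourierInv_eq_fourier_neg, Real.fourier_mul_convolution_eq hg hw, mul_comm]

open ContinuousLinearMap Convolution in
theorem integrable_conv {w g : Plane → ℂ} (hw : Integrable w) (hg : Integrable g) :
    Integrable (fun ξ => ∫ η, w (ξ - η) * g η) := by
  have e : (fun ξ => ∫ η, w (ξ - η) * g η) = g ⋆[mul ℂ ℂ] w := by
    ext ξ
    rw [convolution]
    refine integral_congr_ae (by filter_upwards with η; simp [mul_comm])
  rw [e]
  exact hg.integrable_convolution _ hw

/-- Multiplication by a bounded function is bounded on `L²`, on the Fourier side. -/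
theorem l2_conv_le_supF {w g : Plane → ℂ} (hw : Integrable w) (hg1 : Integrable g)
    (hg : MemLp g 2) : l2 (fun ξ => ∫ η, w (ξ - η) * g η) ≤ supF w * l2 g := by
  have hc1 := integrable_conv hw hg1
  have hc2 := (memLp_conv hw hg).1
  rw [← norm_toLp_eq_l2 hc2, ← norm_toLp_eq_l2 hg]
  have i1 : ∀ f : ComplexL2, ‖f‖ = ‖(𝓕⁻ f : ComplexL2)‖ := fun f => by
    rw [← Lp.norm_fourier_eq (𝓕⁻ f : ComplexL2), FourierTransform.fourier_fourierInv_eq]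
  rw [i1, i1 (hg.toLp g)]
  apply Lp.norm_le_mul_norm_of_ae_le_mul
  filter_upwards [fourierInv_toLp_ae_eq hc1 hc2, fourierInv_toLp_ae_eq hg1 hg] with x h1 h2
  rw [h1, h2, fourierInv_conv hw hg1, norm_mul]
  gcongr
  exact norm_fourierInv_le_supF w x

theorem norm_integral_mul_conj_le {c h : Plane → ℂ} (hc : MemLp c 2) (hh : MemLp h 2) :
    ‖∫ ξ, c ξ * (starRingEnd ℂ) (h ξ)‖ ≤ l2 c * l2 h := by
  have := norm_inner_le_norm (𝕜 := ℂ) (hh.toLp h : ComplexL2) (hc.toLp c)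
  rw [L2.inner_def, norm_toLp_eq_l2, norm_toLp_eq_l2, mul_comm (l2 h)] at this
  refine le_trans (le_of_eq ?_) this
  congr 1
  apply integral_congr_ae
  filter_upwards [hc.coeFn_toLp, hh.coeFn_toLp] with x h1 h2
  rw [h1, h2]
  rfl

theorem integral_trilinear {w g h : Plane → ℂ} (hw : Integrable w)
    (hg : MemLp g 2) (hh : MemLp h 2) :
    ∫ p : Plane × Plane, w (p.1 - p.2) * g p.2 * (starRingEnd ℂ) (h p.1) =
      ∫ ξ, (∫ η, w (ξ - η) * g η) * (starRingEnd ℂ) (h ξ) := by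
  have hi := integrable_trilinear hw hg hh
  rw [Measure.volume_eq_prod] at hi ⊢
  rw [integral_prod _ hi]
  refine integral_congr_ae (by filter_upwards with ξ; rw [← integral_mul_const])

/-- The trilinear form with an `L^∞` factor given by its Fourier transform. -/
theorem norm_trilinear_le_supF {w g h : Plane → ℂ} (hw : Integrable w) (hg1 : Integrable g)
    (hg : MemLp g 2) (hh : MemLp h 2) :
    ‖∫ p : Plane × Plane, w (p.1 - p.2) * g p.2 * (starRingEnd ℂ) (h p.1)‖ ≤
      supF w * l2 g * l2 h := by
  rw [integral_trilinear hw hg hh]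
  refine (norm_integral_mul_conj_le (memLp_conv hw hg).1 hh).trans ?_
  exact mul_le_mul_of_nonneg_right (l2_conv_le_supF hw hg1 hg) (l2_nonneg h)

/-- The trilinear form with an `L¹` factor. -/
theorem norm_trilinear_le_integral {w g h : Plane → ℂ} (hw : Integrable w)
    (hg : MemLp g 2) (hh : MemLp h 2) :
    ‖∫ p : Plane × Plane, w (p.1 - p.2) * g p.2 * (starRingEnd ℂ) (h p.1)‖ ≤
      (∫ ξ, ‖w ξ‖) * l2 g * l2 h := by
  rw [integral_trilinear hw hg hh]
  refine (norm_integral_mul_conj_le (memLp_conv hw hg).1 hh).trans ?_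
  exact mul_le_mul_of_nonneg_right (memLp_conv hw hg).2 (l2_nonneg h)

/-! ### Changes of frequency variables and Schur multipliers. -/

/-- The involution `(ξ, η) ↦ (ξ, ξ - η)`. -/
def subEquiv : Plane × Plane ≃ᵐ Plane × Plane where
  toFun p := (p.1, p.1 - p.2)
  invFun p := (p.1, p.1 - p.2)
  left_inv p := by simp
  right_inv p := by simp
  measurable_toFun := by simp only [Equiv.coe_fn_mk]; fun_prop
  measurable_invFun := by simp only [Equiv.coe_fn_symm_mk]; fun_prop

theorem measurePreserving_subEquiv : MeasurePreserving subEquiv volume volume := by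
  have h1 := measurePreserving_prod_sub (volume : Measure Plane) (volume : Measure Plane)
  have h2 := (MeasurePreserving.id (volume : Measure Plane)).prod
    (Measure.measurePreserving_neg (volume : Measure Plane))
  have h3 := h2.comp h1
  convert! h3 using 1
  ext p : 1
  simp [subEquiv, Prod.map]

theorem integral_comp_sub_snd (F : Plane × Plane → ℂ) :
    ∫ p : Plane × Plane, F (p.1, p.1 - p.2) = ∫ p : Plane × Plane, F p :=
  measurePreserving_subEquiv.integral_comp' F

theorem integral_comp_swap (F : Plane × Plane → ℂ) :
    ∫ p : Plane × Plane, F (p.2, p.1) = ∫ p : Plane × Plane, F p := by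
  rw [Measure.volume_eq_prod]
  exact integral_prod_swap F

/-- The Schur multiplier norm of `H (φ ξ - φ η)` is at most `‖𝓕 H‖₁`. -/
theorem norm_schur_trilinear_le (H : 𝓢(ℝ, ℂ)) {φ : Plane → ℝ} (hφ : Measurable φ)
    {w g h : Plane → ℂ} (hw : Integrable w) (hg1 : Integrable g) (hg : MemLp g 2)
    (hh : MemLp h 2) :
    ‖∫ p : Plane × Plane, H (φ p.1 - φ p.2) *
        (w (p.1 - p.2) * g p.2 * (starRingEnd ℂ) (h p.1))‖ ≤
      (∫ τ, ‖𝓕 (H : ℝ → ℂ) τ‖) * supF w * l2 g * l2 h := by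
  set ρ : ℝ → ℂ := 𝓕 (H : ℝ → ℂ) with hρ
  have hρi : Integrable ρ := by
    rw [hρ, ← SchwartzMap.fourier_coe]; exact (𝓕 H : 𝓢(ℝ, ℂ)).integrable
  set χ : ℝ → ℂ := fun t => Complex.exp (((2 * Real.pi * t : ℝ) : ℂ) * Complex.I) with hχd
  have hχ : Measurable χ := by fun_prop
  have hχn : ∀ t, ‖χ t‖ = 1 := fun t => Complex.norm_exp_ofReal_mul_I _
  -- Fourier inversion writes H as a superposition of characters with the integrable density ρ.
  have hH : ∀ s, H s = ∫ τ, χ (τ * s) * ρ τ := by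
    intro s
    have h1 := congrFun (H.continuous.fourierInv_fourier_eq H.integrable hρi) s
    rw [← h1, Real.fourierInv_eq]
    refine integral_congr_ae ?_
    filter_upwards with τ
    rw [Circle.smul_def, Real.fourierChar_apply, smul_eq_mul]
    simp only [RCLike.inner_apply, conj_trivial, hχd]
    rw [mul_comm s τ]
  set e : ℝ → Plane → ℂ := fun τ ξ => χ (-(τ * φ ξ)) with he
  have hem : ∀ τ, Measurable (e τ) := fun τ => by
    simp only [he]
    exact hχ.comp (by fun_prop : Measurable fun ξ => -(τ * φ ξ))
  have hen : ∀ τ ξ, ‖e τ ξ‖ = 1 := fun τ ξ => hχn _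
  have hmul : ∀ τ (f : Plane → ℂ), MemLp f 2 → MemLp (fun ξ => e τ ξ * f ξ) 2 ∧
      l2 (fun ξ => e τ ξ * f ξ) ≤ l2 f := by
    intro τ f hf
    have hn : ∀ ξ, ‖e τ ξ * f ξ‖ = ‖f ξ‖ := fun ξ => by rw [norm_mul, hen, one_mul]
    refine ⟨hf.of_le ((hem τ).aestronglyMeasurable.mul hf.1) ?_, ?_⟩
    · filter_upwards with ξ; exact (hn ξ).le
    · have := l2_mono (f := fun ξ => e τ ξ * f ξ) (g := f) zero_le_one hf
        (fun ξ => by rw [one_mul, hn])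
      rwa [one_mul] at this
  have hF := integrable_trilinear hw hg hh
  set F : Plane × Plane → ℂ := fun p => w (p.1 - p.2) * g p.2 * (starRingEnd ℂ) (h p.1) with hFd
  have hfull : Integrable (fun q : ℝ × (Plane × Plane) =>
      χ (q.1 * (φ q.2.1 - φ q.2.2)) * (ρ q.1 * F q.2))
      (volume.prod volume) := by
    refine (hρi.mul_prod hF).bdd_mul (c := 1) ?_ ?_
    · apply Measurable.aestronglyMeasurable
      exact hχ.comp (by fun_prop :
        Measurable fun q : ℝ × (Plane × Plane) => q.1 * (φ q.2.1 - φ q.2.2))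
    · filter_upwards with q; exact (hχn _).le
  -- A character of φ(ξ) - φ(η) is a unimodular function of ξ times one of η. These are absorbed
  -- into h and g without changing their L² norms, while w stays untouched, so each τ contributes a
  -- trilinear form with the same bound.
  have e1 : ∫ p : Plane × Plane, H (φ p.1 - φ p.2) * F p =
      ∫ τ, ρ τ * ∫ p : Plane × Plane, w (p.1 - p.2) * (e τ p.2 * g p.2) *
        (starRingEnd ℂ) (e τ p.1 * h p.1) := by
    calc ∫ p : Plane × Plane, H (φ p.1 - φ p.2) * F p
        = ∫ p : Plane × Plane, ∫ τ,
          χ (τ * (φ p.1 - φ p.2)) * (ρ τ * F p) := by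
          refine integral_congr_ae ?_
          filter_upwards with p
          rw [hH, ← integral_mul_const]
          refine integral_congr_ae ?_
          filter_upwards with τ
          rw [mul_assoc]
      _ = ∫ τ, ∫ p : Plane × Plane,
          χ (τ * (φ p.1 - φ p.2)) * (ρ τ * F p) := by
          exact integral_integral_swap hfull.swap
      _ = _ := by
          refine integral_congr_ae ?_
          filter_upwards with τ
          rw [← integral_const_mul]
          refine integral_congr_ae ?_
          filter_upwards with p
          have : χ (τ * (φ p.1 - φ p.2)) =
              e τ p.2 * (starRingEnd ℂ) (e τ p.1) := by
            simp only [he]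
            rw [hχd, ← Complex.exp_conj, ← Complex.exp_add]
            simp only [map_mul, Complex.conj_ofReal, Complex.conj_I]
            congr 1
            push_cast
            ring
          rw [this, hFd, map_mul]
          ring
  rw [e1]
  refine (norm_integral_le_integral_norm _).trans ?_
  have hb : ∀ τ, ‖ρ τ * ∫ p : Plane × Plane, w (p.1 - p.2) * (e τ p.2 * g p.2) *
        (starRingEnd ℂ) (e τ p.1 * h p.1)‖ ≤ ‖ρ τ‖ * (supF w * l2 g * l2 h) := by
    intro τ
    rw [norm_mul]
    gcongr
    have hg1' : Integrable fun ξ => e τ ξ * g ξ :=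
      hg1.bdd_mul (c := 1) (hem τ).aestronglyMeasurable (by filter_upwards with ξ; rw [hen])
    refine (norm_trilinear_le_supF hw hg1' (hmul τ g hg).1 (hmul τ h hh).1).trans ?_
    have := supF_nonneg w
    have l1 := (hmul τ g hg).2
    have l3 := (hmul τ h hh).2
    have l4 := l2_nonneg g
    have l5 := l2_nonneg fun ξ => e τ ξ * h ξ
    gcongr
  refine (integral_mono_of_nonneg (by filter_upwards with τ; positivity)
    (hρi.norm.mul_const _) (by filter_upwards with τ; exact hb τ)).trans ?_
  rw [integral_mul_const]
  apply le_of_eq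
  ring

/-! ### The Japanese bracket and the symbols of velocity, gradient and advection. -/

/-- The squared Japanese bracket `1 + (2π|ξ|)²`. -/
def J (ξ : Plane) : ℝ := 1 + (2 * Real.pi * ‖ξ‖) ^ 2

/-- The Japanese bracket. -/
def br (ξ : Plane) : ℝ := Real.sqrt (J ξ)

theorem continuous_J : Continuous J := by unfold J; fun_prop

@[fun_prop] theorem measurable_J : Measurable J := continuous_J.measurable

theorem continuous_br : Continuous br := continuous_J.sqrt

@[fun_prop] theorem measurable_br : Measurable br := continuous_br.measurable

theorem one_le_J (ξ : Plane) : 1 ≤ J ξ := by unfold J; nlinarith [sq_nonneg (2 * Real.pi * ‖ξ‖)]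

theorem J_pos (ξ : Plane) : 0 < J ξ := one_pos.trans_le (one_le_J ξ)

theorem J_neg (ξ : Plane) : J (-ξ) = J ξ := by simp [J]

theorem br_sq (ξ : Plane) : br ξ ^ 2 = J ξ := Real.sq_sqrt (J_pos ξ).le

theorem one_le_br (ξ : Plane) : 1 ≤ br ξ := Real.one_le_sqrt.2 (one_le_J ξ)

theorem br_pos (ξ : Plane) : 0 < br ξ := one_pos.trans_le (one_le_br ξ)

theorem br_neg (ξ : Plane) : br (-ξ) = br ξ := by rw [br, br, J_neg]

theorem norm_le_br (ξ : Plane) : 2 * Real.pi * ‖ξ‖ ≤ br ξ := by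
  apply Real.le_sqrt_of_sq_le
  unfold J
  linarith

/-- `br ξ` is the Euclidean length of the vector (1, 2πξ), so this is the triangle inequality. -/
theorem br_le_add (ξ η : Plane) : br ξ ≤ br η + 2 * Real.pi * ‖ξ - η‖ := by
  have hπ := Real.pi_pos
  have h2 := br_sq η
  have h3 := norm_le_br η
  have h4 := br_pos η
  apply Real.sqrt_le_iff.2
  constructor
  · positivity
  have h1 : ‖ξ‖ ≤ ‖η‖ + ‖ξ - η‖ := by
    have := norm_add_le η (ξ - η)
    rwa [add_sub_cancel] at this
  unfold J at *
  have h5 : 2 * Real.pi * ‖ξ‖ ≤ 2 * Real.pi * ‖η‖ + 2 * Real.pi * ‖ξ - η‖ := by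
    rw [← mul_add]; gcongr
  have h6 : 0 ≤ 2 * Real.pi * ‖ξ‖ := by positivity
  have h7 : 0 ≤ 2 * Real.pi * ‖ξ - η‖ := by positivity
  nlinarith [mul_le_mul_of_nonneg_right h3 h7]

theorem br_le_add_br (ξ η : Plane) : br ξ ≤ br (ξ - η) + br η := by
  linarith [br_le_add ξ η, norm_le_br (ξ - η)]

theorem br_le_two_mul (ξ η : Plane) : br ξ ≤ 2 * (br (ξ - η) * br η) := by
  nlinarith [br_le_add_br ξ η, one_le_br (ξ - η), one_le_br η]

theorem J_rpow_half (ξ : Plane) (s : ℝ) : J ξ ^ (s / 2) = br ξ ^ s := by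
  rw [br, Real.sqrt_eq_rpow, ← Real.rpow_mul (J_pos ξ).le]
  congr 1
  ring

/-- The symbol of the `l`-th component of the velocity. -/
def vsym (l : Fin 2) : Plane → ℂ := ![fun ξ => -gradSymbol 1 ξ, gradSymbol 0] l

/-- The symbol of the `l`-th partial derivative. -/
def dsym (l : Fin 2) (ξ : Plane) : ℂ := 2 * Real.pi * Complex.I * (ξ l : ℂ)

@[fun_prop] theorem measurable_vsym (l : Fin 2) : Measurable (vsym l) := by
  fin_cases l <;> simp [vsym] <;> unfold gradSymbol <;> fun_prop

theorem continuous_dsym (l : Fin 2) : Continuous (dsym l) := by unfold dsym; fun_prop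

@[fun_prop] theorem measurable_dsym (l : Fin 2) : Measurable (dsym l) :=
  (continuous_dsym l).measurable

theorem norm_gradSymbol_le (j : Fin 2) (ξ : Plane) : ‖gradSymbol j ξ‖ ≤ 1 := by
  rw [gradSymbol, norm_mul, Complex.norm_I, one_mul, Complex.norm_real, norm_div, norm_norm]
  exact div_le_one_of_le₀ (PiLp.norm_apply_le ξ j) (norm_nonneg _)

theorem norm_vsym_le (l : Fin 2) (ξ : Plane) : ‖vsym l ξ‖ ≤ 1 := by
  fin_cases l <;> simp [vsym, norm_gradSymbol_le]

theorem norm_dsym_le (l : Fin 2) (ξ : Plane) : ‖dsym l ξ‖ ≤ br ξ := by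
  refine le_trans ?_ (norm_le_br ξ)
  rw [dsym]
  simp only [norm_mul, Complex.norm_I, Complex.norm_real, mul_one, Complex.norm_ofNat]
  rw [Real.norm_of_nonneg Real.pi_pos.le]
  have := Real.pi_pos
  gcongr
  exact PiLp.norm_apply_le ξ l

theorem vsym_neg (l : Fin 2) (ξ : Plane) : vsym l (-ξ) = (starRingEnd ℂ) (vsym l ξ) := by
  fin_cases l <;> simp [vsym, gradSymbol, neg_div]

theorem dsym_neg (l : Fin 2) (ξ : Plane) : dsym l (-ξ) = -dsym l ξ := by simp [dsym]

theorem dsym_sub (l : Fin 2) (ξ η : Plane) : dsym l (ξ - η) = dsym l ξ - dsym l η := by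
  simp [dsym]; ring

theorem conj_dsym (l : Fin 2) (ξ : Plane) : (starRingEnd ℂ) (dsym l ξ) = -dsym l ξ := by
  simp only [dsym, map_mul, Complex.conj_I, Complex.conj_ofReal, Complex.conj_ofNat]
  ring

theorem sum_vsym_mul_dsym_self (ξ : Plane) : ∑ l, vsym l ξ * dsym l ξ = 0 := by
  simp [Fin.sum_univ_two, vsym, dsym, gradSymbol]
  ring

/-- The symbol of the bilinear form `(a, b) ↦ u_a · ∇ b`. -/
def bsym (ζ η : Plane) : ℂ := ∑ l, vsym l ζ * dsym l η

/-- Incompressibility: the velocity symbol at ξ - η is orthogonal to ξ - η, so the derivative may be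
read at the output frequency as well as at the input frequency. -/
theorem bsym_sub_left (ξ η : Plane) : bsym (ξ - η) ξ = bsym (ξ - η) η := by
  have h := sum_vsym_mul_dsym_self (ξ - η)
  simp only [dsym_sub, mul_sub, Finset.sum_sub_distrib] at h
  exact sub_eq_zero.1 h

/-- The velocity symbol is Hermitian while the derivative symbol is purely imaginary; the resulting
sign is the source of the antisymmetry of transport. -/
theorem bsym_neg_left (ζ η : Plane) : bsym (-ζ) η = -(starRingEnd ℂ) (bsym ζ η) := by
  simp [bsym, vsym_neg, conj_dsym]
  ring

theorem norm_bsym_le (ζ η : Plane) : ‖bsym ζ η‖ ≤ 2 * br η := by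
  rw [bsym, Fin.sum_univ_two, two_mul]
  refine (norm_add_le _ _).trans ?_
  rw [norm_mul, norm_mul]
  have h := fun l => norm_vsym_le l ζ
  have h' := fun l => norm_dsym_le l η
  have := br_pos η
  nlinarith [h 0, h 1, h' 0, h' 1, norm_nonneg (vsym 0 ζ), norm_nonneg (vsym 1 ζ),
    norm_nonneg (dsym 0 η), norm_nonneg (dsym 1 η)]

/-! ### Antisymmetry of the trilinear energy form. -/

/-- Hermitian symmetry: the Fourier transform of a real function. -/
def Herm (f : Plane → ℂ) : Prop := ∀ ξ, f (-ξ) = (starRingEnd ℂ) (f ξ)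

/-- The kernel of the trilinear energy form. -/
def ker3 (a g h : Plane → ℂ) (p : Plane × Plane) : ℂ :=
  bsym (p.1 - p.2) p.2 * a (p.1 - p.2) * g p.2 * (starRingEnd ℂ) (h p.1)

/-- Exchanging ξ and η reverses the advecting frequency. Hermitian symmetry of a turns the reversal
into a conjugate, and incompressibility moves the derivative back to the other frequency. -/
theorem ker3_swap {a : Plane → ℂ} (ha : Herm a) (g : Plane → ℂ) (p : Plane × Plane) :
    ker3 a g g p.swap = -(starRingEnd ℂ) (ker3 a g g p) := by
  simp only [ker3, Prod.fst_swap, Prod.snd_swap, map_mul, Complex.conj_conj]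
  rw [← neg_sub p.1 p.2, ha, bsym_neg_left, bsym_sub_left]
  ring

/-- Antisymmetry of transport by a divergence free field. -/
theorem re_integral_ker3_swap {a : Plane → ℂ} (ha : Herm a) (g : Plane → ℂ)
    (q : Plane → Plane → ℝ) :
    (∫ p : Plane × Plane, (q p.1 p.2 : ℂ) * ker3 a g g p).re =
      -(∫ p : Plane × Plane, (q p.2 p.1 : ℂ) * ker3 a g g p).re := by
  rw [← integral_comp_swap (fun p : Plane × Plane => (q p.1 p.2 : ℂ) * ker3 a g g p)]
  have : (fun p : Plane × Plane => (q (p.2, p.1).1 (p.2, p.1).2 : ℂ) * ker3 a g g (p.2, p.1)) =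
      fun p : Plane × Plane => -(starRingEnd ℂ) ((q p.2 p.1 : ℂ) * ker3 a g g p) := by
    ext p
    have := ker3_swap ha g p
    rw [Prod.swap] at this
    rw [this, map_mul, Complex.conj_ofReal]
    ring
  rw [this, integral_neg, integral_conj, Complex.neg_re, Complex.conj_re]

/-- Averaging the form with its image under the exchange of ξ and η replaces the weight by its
difference. This is where the commutator in the energy estimates comes from. -/
theorem re_integral_ker3_symm {a : Plane → ℂ} (ha : Herm a) (g : Plane → ℂ)
    (q : Plane → Plane → ℝ)
    (h1 : Integrable fun p : Plane × Plane => (q p.1 p.2 : ℂ) * ker3 a g g p)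
    (h2 : Integrable fun p : Plane × Plane => (q p.2 p.1 : ℂ) * ker3 a g g p) :
    2 * (∫ p : Plane × Plane, (q p.1 p.2 : ℂ) * ker3 a g g p).re =
      (∫ p : Plane × Plane, ((q p.1 p.2 - q p.2 p.1 : ℝ) : ℂ) * ker3 a g g p).re := by
  have : (fun p : Plane × Plane => ((q p.1 p.2 - q p.2 p.1 : ℝ) : ℂ) * ker3 a g g p) =
      fun p : Plane × Plane => (q p.1 p.2 : ℂ) * ker3 a g g p -
        (q p.2 p.1 : ℂ) * ker3 a g g p := by
    ext p; push_cast; ring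
  rw [this, integral_sub h1 h2, Complex.sub_re, two_mul]
  nth_rewrite 2 [re_integral_ker3_swap ha]
  ring

/-! ### Dyadic shells and band-limited functions. -/

/-- The index of the dyadic shell of a frequency. -/
def blk (ξ : Plane) : ℕ := Nat.log 4 ⌊J ξ⌋₊

@[fun_prop] theorem measurable_blk : Measurable blk :=
  (measurable_from_top (f := Nat.log 4)).comp (Nat.measurable_floor.comp measurable_J)

theorem le_blk_iff (k : ℕ) (ξ : Plane) : k ≤ blk ξ ↔ (4 : ℝ) ^ k ≤ J ξ := by
  rw [blk, Nat.le_log_iff_pow_le (by norm_num), Nat.le_floor_iff (J_pos ξ).le]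
  · push_cast; rfl
  · exact (Nat.floor_pos.2 (one_le_J ξ)).ne'

theorem blk_lt_iff (k : ℕ) (ξ : Plane) : blk ξ < k ↔ J ξ < (4 : ℝ) ^ k := by
  rw [← not_le, le_blk_iff, not_le]

theorem four_pow_blk_le (ξ : Plane) : (4 : ℝ) ^ blk ξ ≤ J ξ := (le_blk_iff _ _).1 le_rfl

theorem J_lt_four_pow (ξ : Plane) : J ξ < (4 : ℝ) ^ (blk ξ + 1) :=
  (blk_lt_iff _ _).1 (Nat.lt_succ_self _)

theorem two_pow_blk_le (ξ : Plane) : (2 : ℝ) ^ blk ξ ≤ br ξ := by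
  apply Real.le_sqrt_of_sq_le
  rw [← pow_mul, mul_comm, pow_mul]
  norm_num
  exact four_pow_blk_le ξ

theorem br_lt_two_pow (ξ : Plane) : br ξ < (2 : ℝ) ^ (blk ξ + 1) := by
  rw [br, Real.sqrt_lt' (by positivity), ← pow_mul, mul_comm, pow_mul]
  norm_num
  exact J_lt_four_pow ξ

theorem blk_neg (ξ : Plane) : blk (-ξ) = blk ξ := by rw [blk, blk, J_neg]

/-- Square integrable functions with frequencies in `J < 4 ^ K`. -/
structure BL (K : ℕ) (f : Plane → ℂ) : Prop where
  memLp : MemLp f 2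
  supp : ∀ ξ, K ≤ blk ξ → f ξ = 0

theorem measure_blk_lt (K : ℕ) : volume {ξ : Plane | blk ξ < K} < ∞ := by
  refine lt_of_le_of_lt (measure_mono (t := Metric.closedBall 0 ((2 : ℝ) ^ K)) ?_)
    measure_closedBall_lt_top
  intro ξ hξ
  rw [mem_closedBall_zero_iff]
  have h1 := norm_le_br ξ
  have h2 := br_lt_two_pow ξ
  have h3 : (2 : ℝ) ^ (blk ξ + 1) ≤ 2 ^ K := pow_le_pow_right₀ (by norm_num) hξ
  nlinarith [norm_nonneg ξ, Real.pi_gt_three]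

theorem measurableSet_blk_lt (K : ℕ) : MeasurableSet {ξ : Plane | blk ξ < K} :=
  measurable_blk (measurableSet_Iio (a := K))

theorem BL.mul {K : ℕ} {f m : Plane → ℂ} (hf : BL K f) (hm : Measurable m) {C : ℝ}
    (hC : ∀ ξ, blk ξ < K → ‖m ξ‖ ≤ C) : BL K (fun ξ => m ξ * f ξ) := by
  refine ⟨?_, fun ξ h => by rw [hf.supp ξ h, mul_zero]⟩
  refine MemLp.of_le_mul (c := C) hf.memLp (hm.aestronglyMeasurable.mul hf.memLp.1) ?_
  filter_upwards with ξ
  rcases lt_or_ge (blk ξ) K with h | h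
  · rw [norm_mul]
    gcongr
    exact hC ξ h
  · simp [hf.supp ξ h]

theorem BL.integrable {K : ℕ} {f : Plane → ℂ} (hf : BL K f) : Integrable f := by
  have h : IntegrableOn f {ξ | blk ξ < K} := by
    have : IsFiniteMeasure (volume.restrict {ξ : Plane | blk ξ < K}) :=
      ⟨by simpa using measure_blk_lt K⟩
    exact (hf.memLp.restrict _).integrable (by norm_num)
  refine (integrableOn_iff_integrable_of_support_subset ?_).1 h
  intro ξ hξ
  by_contra hc
  exact hξ (hf.supp ξ (not_lt.1 hc))

theorem BL.indicator {K : ℕ} {f : Plane → ℂ} (hf : BL K f) {s : Set Plane}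
    (hs : MeasurableSet s) : BL K (s.indicator f) :=
  ⟨hf.memLp.indicator hs, fun ξ h => by simp [hf.supp ξ h]⟩

theorem br_le_of_blk_lt {K : ℕ} {ξ : Plane} (h : blk ξ < K) : br ξ ≤ 2 ^ K :=
  (br_lt_two_pow ξ).le.trans (pow_le_pow_right₀ (by norm_num) h)

theorem BL.vsym_mul {K : ℕ} {f : Plane → ℂ} (hf : BL K f) (l : Fin 2) :
    BL K (fun ξ => vsym l ξ * f ξ) :=
  hf.mul (measurable_vsym l) fun ξ _ => norm_vsym_le l ξ

theorem BL.dsym_mul {K : ℕ} {f : Plane → ℂ} (hf : BL K f) (l : Fin 2) :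
    BL K (fun ξ => dsym l ξ * f ξ) :=
  hf.mul (measurable_dsym l) fun ξ h => (norm_dsym_le l ξ).trans (br_le_of_blk_lt h)

theorem BL.br_rpow_mul {K : ℕ} {f : Plane → ℂ} (hf : BL K f) (r : ℝ) :
    BL K (fun ξ => ((br ξ ^ r : ℝ) : ℂ) * f ξ) := by
  refine hf.mul (C := ((2 : ℝ) ^ K) ^ |r|) (by fun_prop) fun ξ h => ?_
  rw [Complex.norm_real, Real.norm_of_nonneg (Real.rpow_nonneg (br_pos ξ).le _)]
  exact (Real.rpow_le_rpow_of_exponent_le (one_le_br ξ) (le_abs_self r)).trans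
    (Real.rpow_le_rpow (br_pos ξ).le (br_le_of_blk_lt h) (abs_nonneg r))

/-! ### Schwartz functions that carry powers of comparable frequencies. -/

/-- Every smooth function on the line agrees with a Schwartz function on `[-1, 1]`. -/
theorem exists_schwartz_eqOn {ψ : ℝ → ℂ} (hψ : ContDiff ℝ (⊤ : ℕ∞) ψ) :
    ∃ H : 𝓢(ℝ, ℂ), ∀ s, |s| ≤ 1 → H s = ψ s := by
  let χ : ContDiffBump (0 : ℝ) := ⟨1, 2, by norm_num, by norm_num⟩
  have hc : HasCompactSupport fun s => (χ s : ℂ) * ψ s := by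
    have h0 := χ.hasCompactSupport.comp_left (g := fun x : ℝ => (x : ℂ)) Complex.ofReal_zero
    exact HasCompactSupport.mul_right (f := fun s => (χ s : ℂ)) h0
  have hd : ContDiff ℝ (⊤ : ℕ∞) fun s => (χ s : ℂ) * ψ s :=
    (Complex.ofRealCLM.contDiff.comp χ.contDiff).mul hψ
  refine ⟨hc.toSchwartzMap hd, fun s hs => ?_⟩
  have h1 : χ s = 1 := χ.one_of_mem_closedBall (by simpa [χ] using hs)
  simp [h1]

/-- The quotient `(e^{nz} - 1) / z` extended to an entire function. -/
theorem exists_entire_quotient (n : ℝ) : ∃ D : ℂ → ℂ, Differentiable ℂ D ∧ D 0 = n ∧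
    ∀ z, Complex.exp (n * z) - 1 = z * D z := by
  have hd : Differentiable ℂ fun z : ℂ => Complex.exp (n * z) := by fun_prop
  refine ⟨dslope (fun z : ℂ => Complex.exp (n * z)) 0, ?_, ?_, fun z => ?_⟩
  · rw [← differentiableOn_univ, Complex.differentiableOn_dslope univ_mem]
    exact hd.differentiableOn
  · rw [dslope_same]
    have : HasDerivAt (fun z : ℂ => Complex.exp (n * z)) (Complex.exp (n * 0) * (n * 1)) 0 :=
      ((hasDerivAt_id (0 : ℂ)).const_mul (n : ℂ)).cexp
    rw [this.deriv]
    simp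
  · have := sub_smul_dslope (fun z : ℂ => Complex.exp (n * z)) 0 z
    simp at this
    exact this.symm

/-- The smooth function `e^{-as} (e^{ns} - 1) / (e^s - 1)`. -/
theorem exists_exp_quotient (n a : ℝ) : ∃ ψ : ℝ → ℂ, ContDiff ℝ (⊤ : ℕ∞) ψ ∧ ψ 0 = n ∧
    ∀ s : ℝ, (((Real.exp (n * s) - 1) * Real.exp (-(a * s)) : ℝ) : ℂ) =
      ((Real.exp s - 1 : ℝ) : ℂ) * ψ s := by
  obtain ⟨D, hD, hD0, hDe⟩ := exists_entire_quotient n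
  obtain ⟨D1, hD1, hD10, hD1e⟩ := exists_entire_quotient 1
  -- Only real arguments are needed: the entire function (e^z - 1)/z does vanish at the nonzero
  -- multiples of 2πi.
  have hne : ∀ s : ℝ, D1 s ≠ 0 := by
    intro s hs
    rcases eq_or_ne s 0 with rfl | h0
    · simp [hD10] at hs
    · have := hD1e s
      rw [hs, mul_zero, Complex.ofReal_one, one_mul, ← Complex.ofReal_exp, sub_eq_zero] at this
      have h1 : Real.exp s = 1 := by exact_mod_cast this
      exact h0 (Real.exp_eq_one_iff s |>.1 h1)
  have hsm : ∀ F : ℂ → ℂ, Differentiable ℂ F → ContDiff ℝ (⊤ : ℕ∞) fun s : ℝ => F s := fun F hF =>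
    (hF.contDiff.restrict_scalars ℝ).comp Complex.ofRealCLM.contDiff
  refine ⟨fun s => D s * Complex.exp (-(a * s)) * (D1 s)⁻¹, ?_, by simp [hD0, hD10], fun s => ?_⟩
  · refine ContDiff.mul ?_ ((hsm D1 hD1).inv hne)
    exact hsm (fun z => D z * Complex.exp (-(a * z))) (by fun_prop)
  · have e1 := hDe s
    have e2 := hD1e s
    have := hne s
    push_cast at e1 e2 ⊢
    rw [one_mul] at e2
    rw [e1, e2]
    field_simp

theorem memLp_shift_bound {φ : Plane → ℝ} (hφ : Measurable φ) (H : 𝓢(ℝ, ℂ))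
    {F : Plane × Plane → ℂ} (hF : Integrable F) :
    Integrable fun p : Plane × Plane => H (φ p.1 - φ p.2) * F p := by
  obtain ⟨C, hC⟩ : ∃ C, ∀ s, ‖H s‖ ≤ C := by
    obtain ⟨C, hC⟩ := H.decay 0 0
    exact ⟨C, fun s => by simpa using hC.2 s⟩
  refine hF.bdd_mul (c := C) ?_ ?_
  · apply Measurable.aestronglyMeasurable
    exact H.continuous.measurable.comp (by fun_prop : Measurable fun p : Plane × Plane => φ p.1 - φ p.2)
  · filter_upwards with p using hC _

theorem integrable_schur_trilinear (H : 𝓢(ℝ, ℂ)) {φ : Plane → ℝ} (hφ : Measurable φ)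
    {w g h : Plane → ℂ} (hw : Integrable w) (hg : MemLp g 2) (hh : MemLp h 2) :
    Integrable fun p : Plane × Plane => H (φ p.1 - φ p.2) *
        (w (p.1 - p.2) * g p.2 * (starRingEnd ℂ) (h p.1)) :=
  memLp_shift_bound hφ H (integrable_trilinear hw hg hh)

/-- The involution (ξ, η) ↦ (ξ, ξ - η) exchanges the advecting and the advected frequency, which
puts the L^∞ factor at η and lets H compare ξ with ξ - η. -/
theorem schur_trilinear_sub (H : 𝓢(ℝ, ℂ)) {φ : Plane → ℝ} (hφ : Measurable φ)
    {w g h : Plane → ℂ} (hw : Integrable w) (hg1 : Integrable g) (hg : MemLp g 2)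
    (hh : MemLp h 2) :
    (Integrable fun p : Plane × Plane => H (φ p.1 - φ (p.1 - p.2)) *
        (w p.2 * g (p.1 - p.2) * (starRingEnd ℂ) (h p.1))) ∧
    ‖∫ p : Plane × Plane, H (φ p.1 - φ (p.1 - p.2)) *
        (w p.2 * g (p.1 - p.2) * (starRingEnd ℂ) (h p.1))‖ ≤
      (∫ τ, ‖𝓕 (H : ℝ → ℂ) τ‖) * supF w * l2 g * l2 h := by
  have e := integral_comp_sub_snd fun p : Plane × Plane => H (φ p.1 - φ p.2) *
        (w (p.1 - p.2) * g p.2 * (starRingEnd ℂ) (h p.1))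
  have hi := measurePreserving_subEquiv.integrable_comp_of_integrable
    (integrable_schur_trilinear H hφ hw hg hh)
  simp only [subEquiv, Function.comp_def, MeasurableEquiv.coe_mk, Equiv.coe_fn_mk,
    sub_sub_cancel] at hi
  simp only [sub_sub_cancel] at e
  exact ⟨hi, by rw [e]; exact norm_schur_trilinear_le H hφ hw hg1 hg hh⟩

theorem trilinear_sub {w g h : Plane → ℂ} (hw : Integrable w) (hg1 : Integrable g)
    (hg : MemLp g 2) (hh : MemLp h 2) :
    (Integrable fun p : Plane × Plane => w p.2 * g (p.1 - p.2) * (starRingEnd ℂ) (h p.1)) ∧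
    ‖∫ p : Plane × Plane, w p.2 * g (p.1 - p.2) * (starRingEnd ℂ) (h p.1)‖ ≤
      supF w * l2 g * l2 h := by
  have e := integral_comp_sub_snd fun p : Plane × Plane =>
        w (p.1 - p.2) * g p.2 * (starRingEnd ℂ) (h p.1)
  have hi := measurePreserving_subEquiv.integrable_comp_of_integrable
    (integrable_trilinear hw hg hh)
  simp only [subEquiv, Function.comp_def, MeasurableEquiv.coe_mk, Equiv.coe_fn_mk,
    sub_sub_cancel] at hi
  simp only [sub_sub_cancel] at e
  exact ⟨hi, by rw [e]; exact norm_trilinear_le_supF hw hg1 hg hh⟩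

/-! ### The dispersive norm and the frequency interactions without commutator structure. -/

/-- The restriction to a dyadic shell of frequencies. -/
def shell (k : ℕ) (f : Plane → ℂ) : Plane → ℂ := {ξ | blk ξ = k}.indicator f

/-- The symbols whose dyadic pieces are measured in `L^∞`. -/
def msym (k : ℕ) : Fin 2 ⊕ Fin 2 ⊕ (Fin 2 × Fin 2) → Plane → ℂ
  | Sum.inl l => dsym l
  | Sum.inr (Sum.inl l) => fun ξ => 2 ^ k * vsym l ξ
  | Sum.inr (Sum.inr q) => fun ξ => dsym q.2 ξ * vsym q.1 ξ

/-- The Lipschitz type norm, summed over dyadic shells, that is controlled by dispersion. -/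
def dispN (K : ℕ) (f : Plane → ℂ) : ℝ :=
  ∑ k ∈ Finset.range K, ∑ i, supF (fun ξ => msym k i ξ * shell k f ξ)

theorem measurable_msym (k : ℕ) (i) : Measurable (msym k i) := by
  rcases i with l | l | q <;> simp only [msym] <;> fun_prop

theorem norm_msym_le {k : ℕ} (i) {ξ : Plane} (h : blk ξ = k) : ‖msym k i ξ‖ ≤ br ξ := by
  rcases i with l | l | q
  · exact norm_dsym_le l ξ
  · simp only [msym, norm_mul, norm_pow, Complex.norm_ofNat]
    have h1 := two_pow_blk_le ξ
    rw [h] at h1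
    have := norm_vsym_le l ξ
    have : (0 : ℝ) < 2 ^ k := by positivity
    nlinarith [norm_nonneg (vsym l ξ)]
  · simp only [msym, norm_mul]
    have h1 := norm_dsym_le q.2 ξ
    have := norm_vsym_le q.1 ξ
    nlinarith [norm_nonneg (vsym q.1 ξ), norm_nonneg (dsym q.2 ξ)]

theorem dispN_nonneg (K : ℕ) (f : Plane → ℂ) : 0 ≤ dispN K f :=
  Finset.sum_nonneg fun _ _ => Finset.sum_nonneg fun _ _ => supF_nonneg _

theorem BL.shell {K : ℕ} {f : Plane → ℂ} (hf : BL K f) (k : ℕ) : BL K (shell k f) :=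
  hf.indicator (measurable_blk (measurableSet_singleton k))

theorem BL.msym_shell {K : ℕ} {f : Plane → ℂ} (hf : BL K f) (k : ℕ) (i) :
    BL K (fun ξ => msym k i ξ * DispersiveSQG.shell k f ξ) := by
  have h1 : (fun ξ => msym k i ξ * DispersiveSQG.shell k f ξ) =
      fun ξ => ({ξ | blk ξ = k}.indicator (msym k i)) ξ * f ξ := by
    ext ξ
    by_cases h : blk ξ = k <;> simp [DispersiveSQG.shell, h]
  rw [h1]
  refine hf.mul (C := 2 ^ K)
    ((measurable_msym k i).indicator (measurable_blk (measurableSet_singleton k))) fun ξ h => ?_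
  by_cases h2 : blk ξ = k
  · simp only [Set.indicator_apply, Set.mem_ofPred_eq, h2, if_true]
    exact (norm_msym_le i h2).trans (br_le_of_blk_lt h)
  · simp [h2]

/-- These are the terms ∇θ and 2^k u of the norm, all that the product estimates use; the terms ∇u
are kept for the commutator. -/
theorem sum_supF_le_dispN {K : ℕ} (f : Plane → ℂ) :
    ∑ k ∈ Finset.range K, ∑ l : Fin 2, (supF (fun ξ => dsym l ξ * shell k f ξ) +
      supF (fun ξ => (2 ^ k * vsym l ξ) * shell k f ξ)) ≤ dispN K f := by
  rw [dispN]
  refine Finset.sum_le_sum fun k _ => ?_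
  rw [Fintype.sum_sum_type, Fintype.sum_sum_type, Finset.sum_add_distrib, ← add_assoc]
  simp only [msym]
  linarith [Finset.sum_nonneg fun (q : Fin 2 × Fin 2) (_ : q ∈ Finset.univ) =>
    supF_nonneg (fun ξ => dsym q.2 ξ * vsym q.1 ξ * shell k f ξ)]

/-- Whether the two high frequencies dominate the advecting frequency. -/
def farRegion (p : Plane × Plane) : Prop :=
  blk (p.1 - p.2) + 3 ≤ blk p.2 ∧ blk (p.1 - p.2) + 3 ≤ blk p.1

theorem measurableSet_farRegion : MeasurableSet {p | farRegion p} := by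
  have h1 : Measurable fun p : Plane × Plane => blk (p.1 - p.2) + 3 := by fun_prop
  exact (measurableSet_le h1 (by fun_prop : Measurable fun p : Plane × Plane => blk p.2)).inter
    (measurableSet_le h1 (by fun_prop : Measurable fun p : Plane × Plane => blk p.1))

/-- A frequency of size at least 8·2^k moves by at most 2·2^k, so the two brackets agree up to a
factor 2, and log 2 < 1. The gap of three shells is what brings the logarithms into the interval
where the cut-off functions are exact. -/
theorem abs_log_br_sub_le {k : ℕ} {ξ η : Plane} (h1 : br (ξ - η) ≤ 2 ^ (k + 1) ∨
    2 * Real.pi * ‖ξ - η‖ ≤ 2 ^ (k + 1)) (h2 : (2 : ℝ) ^ (k + 3) ≤ br ξ) :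
    |Real.log (br ξ) - Real.log (br η)| ≤ 1 := by
  have h3 : 2 * Real.pi * ‖ξ - η‖ ≤ 2 ^ (k + 1) := by
    rcases h1 with h | h
    · exact (norm_le_br _).trans h
    · exact h
  have a1 := br_le_add ξ η
  have a2 := br_le_add η ξ
  rw [norm_sub_rev] at a2
  have e1 : (2 : ℝ) ^ (k + 1) = 2 * 2 ^ k := by ring
  have e2 : (2 : ℝ) ^ (k + 3) = 8 * 2 ^ k := by ring
  rw [e1] at h3
  rw [e2] at h2
  have hx := br_pos ξ
  have hy := br_pos η
  have b1 : br ξ ≤ 2 * br η := by linarith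
  have b2 : br η ≤ 2 * br ξ := by linarith
  have l2 : Real.log 2 ≤ 1 := by linarith [Real.log_two_lt_d9]
  have c1 := Real.log_le_log hx b1
  have c2 := Real.log_le_log hy b2
  rw [Real.log_mul (by norm_num) hy.ne'] at c1
  rw [Real.log_mul (by norm_num) hx.ne'] at c2
  rw [abs_le]
  constructor <;> linarith

/-- The quotient x^r / y^r is e^{rs} with s = log x - log y, and for |s| ≤ 1 the exponential may be
cut off to a Schwartz function. -/
theorem exists_schwartz_exp (r : ℝ) : ∃ H : 𝓢(ℝ, ℂ), ∀ x y : ℝ, 0 < x → 0 < y →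
    |Real.log x - Real.log y| ≤ 1 →
    H (Real.log x - Real.log y) * ((y ^ r : ℝ) : ℂ) = ((x ^ r : ℝ) : ℂ) := by
  obtain ⟨H, hH⟩ := exists_schwartz_eqOn (ψ := fun s : ℝ => ((Real.exp (r * s) : ℝ) : ℂ))
    (Complex.ofRealCLM.contDiff.comp (Real.contDiff_exp.comp (contDiff_const.mul contDiff_id)))
  refine ⟨H, fun x y hx hy h => ?_⟩
  rw [hH _ h, ← Complex.ofReal_mul, Real.rpow_def_of_pos hx, Real.rpow_def_of_pos hy,
    ← Real.exp_add]
  congr 2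
  ring

theorem l2_le_of_norm_le {f g : Plane → ℂ} (hg : MemLp g 2) (h : ∀ ξ, ‖f ξ‖ ≤ ‖g ξ‖) :
    l2 f ≤ l2 g := by
  have := l2_mono (f := f) zero_le_one hg fun ξ => by rw [one_mul]; exact h ξ
  rwa [one_mul] at this

theorem norm_ofReal_rpow_br (ξ : Plane) (r : ℝ) : ‖((br ξ ^ r : ℝ) : ℂ)‖ = br ξ ^ r := by
  rw [Complex.norm_real, Real.norm_of_nonneg (Real.rpow_nonneg (br_pos ξ).le _)]

/-- The part of the `l`-th product in which the differentiated frequency `η` lies in the shell `j`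
and does not dominate, and `ξ` lies above it. -/
theorem exists_advection_high_le (r : ℝ) : ∃ C : ℝ, 0 ≤ C ∧
    ∀ (K : ℕ) (f h : Plane → ℂ), BL K f → MemLp h 2 →
    ∀ (l : Fin 2) (j : ℕ),
    (Integrable fun p : Plane × Plane => if blk p.2 = j ∧ j ≤ blk (p.1 - p.2) + 2 ∧ j + 3 ≤ blk p.1
      then ((br p.1 ^ r : ℝ) : ℂ) * (vsym l (p.1 - p.2) * dsym l p.2 * f (p.1 - p.2) * f p.2 *
        (starRingEnd ℂ) (h p.1)) else 0) ∧
    ‖∫ p : Plane × Plane, if blk p.2 = j ∧ j ≤ blk (p.1 - p.2) + 2 ∧ j + 3 ≤ blk p.1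
      then ((br p.1 ^ r : ℝ) : ℂ) * (vsym l (p.1 - p.2) * dsym l p.2 * f (p.1 - p.2) * f p.2 *
        (starRingEnd ℂ) (h p.1)) else 0‖ ≤
      C * supF (fun ξ => dsym l ξ * shell j f ξ) * l2 (fun ξ => ((br ξ ^ r : ℝ) : ℂ) * f ξ) *
        l2 h := by
  obtain ⟨H, hH⟩ := exists_schwartz_exp r
  refine ⟨∫ τ, ‖𝓕 (H : ℝ → ℂ) τ‖, by positivity, fun K f h hf hh l j => ?_⟩
  have hφ : Measurable fun ξ => Real.log (br ξ) := by fun_prop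
  have hw := ((hf.shell j).dsym_mul l).integrable
  set g : Plane → ℂ := {ξ | j ≤ blk ξ + 2}.indicator
    (fun ξ => vsym l ξ * (((br ξ ^ r : ℝ) : ℂ) * f ξ)) with hg
  have hgB : BL K g := ((hf.br_rpow_mul r).vsym_mul l).indicator
    (measurableSet_le measurable_const (by fun_prop))
  set h' : Plane → ℂ := {ξ | j + 3 ≤ blk ξ}.indicator h with hh'
  have hh'm : MemLp h' 2 := hh.indicator (measurableSet_le measurable_const (by fun_prop))
  -- Since ξ lies three shells above η, the brackets of ξ and ξ - η are comparable. The weight moves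
  -- onto the advecting factor, and the shell of ∇f at η is the L^∞ factor.
  have key := schur_trilinear_sub H hφ hw hgB.integrable hgB.memLp hh'm
  have e : (fun p : Plane × Plane => if blk p.2 = j ∧ j ≤ blk (p.1 - p.2) + 2 ∧ j + 3 ≤ blk p.1
      then ((br p.1 ^ r : ℝ) : ℂ) * (vsym l (p.1 - p.2) * dsym l p.2 * f (p.1 - p.2) * f p.2 *
        (starRingEnd ℂ) (h p.1)) else 0) = fun p : Plane × Plane =>
      H (Real.log (br p.1) - Real.log (br (p.1 - p.2))) *
        (dsym l p.2 * shell j f p.2 * g (p.1 - p.2) * (starRingEnd ℂ) (h' p.1)) := by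
    ext p
    by_cases c1 : blk p.2 = j
    · by_cases c2 : j ≤ blk (p.1 - p.2) + 2
      · by_cases c3 : j + 3 ≤ blk p.1
        · have hlog : |Real.log (br p.1) - Real.log (br (p.1 - p.2))| ≤ 1 := by
            apply abs_log_br_sub_le (k := j)
            · left
              rw [sub_sub_cancel, ← c1]
              exact (br_lt_two_pow p.2).le
            · exact (pow_le_pow_right₀ (by norm_num) c3).trans (two_pow_blk_le p.1)
          have := hH _ _ (br_pos p.1) (br_pos (p.1 - p.2)) hlog
          simp only [c1, c2, c3, and_self, if_true, hg, hh', shell, Set.indicator_apply,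
            Set.mem_ofPred_eq]
          rw [← this]
          ring
        · simp [c3, hh']
      · simp [c2, hg]
    · simp [c1, shell]
  simp only [e] at *
  refine ⟨key.1, key.2.trans ?_⟩
  have n1 : l2 g ≤ l2 (fun ξ => ((br ξ ^ r : ℝ) : ℂ) * f ξ) := by
    apply l2_le_of_norm_le (hf.br_rpow_mul r).memLp
    intro ξ
    by_cases c : j ≤ blk ξ + 2
    · simp only [hg, Set.indicator_apply, Set.mem_ofPred_eq, c, if_true]
      rw [norm_mul (vsym l ξ)]
      exact mul_le_of_le_one_left (norm_nonneg _) (norm_vsym_le l ξ)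
    · simp only [hg, Set.indicator_apply, Set.mem_ofPred_eq, c, if_false, norm_zero]
      positivity
  have n2 : l2 h' ≤ l2 h := l2_le_of_norm_le hh fun ξ => by
    by_cases c : j + 3 ≤ blk ξ <;> simp [hh', c]
  have s1 := supF_nonneg fun ξ => dsym l ξ * shell j f ξ
  have s2 := l2_nonneg g
  have s3 := l2_nonneg h'
  have s4 : 0 ≤ ∫ τ, ‖𝓕 (H : ℝ → ℂ) τ‖ := by positivity
  have s5 := s2.trans n1
  exact mul_le_mul (mul_le_mul_of_nonneg_left n1 (mul_nonneg s4 s1)) n2 s3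
    (mul_nonneg (mul_nonneg s4 s1) s5)

/-- The part in which `η` lies in the shell `j` and does not dominate, and `ξ` is not above it. -/
theorem advection_comparable_le {r : ℝ} (hr : 0 ≤ r) {K : ℕ} {f h : Plane → ℂ} (hf : BL K f)
    (hh : MemLp h 2) (l : Fin 2) (j : ℕ) :
    (Integrable fun p : Plane × Plane => if blk p.2 = j ∧ j ≤ blk (p.1 - p.2) + 2 ∧ blk p.1 < j + 3
      then ((br p.1 ^ r : ℝ) : ℂ) * (vsym l (p.1 - p.2) * dsym l p.2 * f (p.1 - p.2) * f p.2 *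
        (starRingEnd ℂ) (h p.1)) else 0) ∧
    ‖∫ p : Plane × Plane, if blk p.2 = j ∧ j ≤ blk (p.1 - p.2) + 2 ∧ blk p.1 < j + 3
      then ((br p.1 ^ r : ℝ) : ℂ) * (vsym l (p.1 - p.2) * dsym l p.2 * f (p.1 - p.2) * f p.2 *
        (starRingEnd ℂ) (h p.1)) else 0‖ ≤
      (4 ^ r * 8 ^ r) * supF (fun ξ => dsym l ξ * shell j f ξ) *
        l2 (fun ξ => ((br ξ ^ r : ℝ) : ℂ) * f ξ) * l2 h := by
  have hw := ((hf.shell j).dsym_mul l).integrable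
  have h2j : (0 : ℝ) < 2 ^ j := by positivity
  -- The number 2^{jr} mediates between the two weights: br ξ^r ≤ 8^r c because ξ lies below shell j
  -- + 3, and c ≤ 4^r br(ξ - η)^r because j ≤ blk(ξ - η) + 2. No comparison symbol is needed.
  set c : ℝ := (2 ^ j : ℝ) ^ r with hc
  have hc0 : 0 < c := Real.rpow_pos_of_pos h2j r
  set g : Plane → ℂ := {ξ | j ≤ blk ξ + 2}.indicator (fun ξ => ((c : ℂ) * vsym l ξ) * f ξ) with hg
  have hgB : BL K g := by
    refine BL.indicator (hf.mul (C := c) (by fun_prop) fun ξ _ => ?_)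
      (measurableSet_le measurable_const (by fun_prop))
    rw [norm_mul, Complex.norm_real, Real.norm_of_nonneg hc0.le]
    exact mul_le_of_le_one_right hc0.le (norm_vsym_le l ξ)
  have e8 : (8 * 2 ^ j : ℝ) ^ r = 8 ^ r * c := Real.mul_rpow (by norm_num) h2j.le
  have hbr : ∀ ξ, blk ξ < j + 3 → br ξ ^ r ≤ 8 ^ r * c := by
    intro ξ hξ
    rw [← e8]
    apply Real.rpow_le_rpow (br_pos ξ).le _ hr
    refine (br_le_of_blk_lt hξ).trans (le_of_eq ?_)
    ring
  set h' : Plane → ℂ := {ξ | blk ξ < j + 3}.indicator (fun ξ => ((c⁻¹ * br ξ ^ r : ℝ) : ℂ) * h ξ)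
    with hh'
  have hn' : ∀ ξ, ‖h' ξ‖ ≤ 8 ^ r * ‖h ξ‖ := by
    intro ξ
    by_cases hξ : blk ξ < j + 3
    · simp only [hh', Set.indicator_apply, Set.mem_ofPred_eq, hξ, if_true]
      rw [norm_mul, Complex.norm_real, Real.norm_of_nonneg (mul_nonneg (by positivity)
        (Real.rpow_nonneg (br_pos ξ).le _))]
      gcongr
      rw [inv_mul_le_iff₀ hc0, mul_comm c]
      exact hbr ξ hξ
    · simp only [hh', Set.indicator_apply, Set.mem_ofPred_eq, hξ, if_false, norm_zero]
      positivity
  have hh'm : MemLp h' 2 := by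
    refine MemLp.of_le_mul (c := 8 ^ r) hh ?_ (by filter_upwards with ξ using hn' ξ)
    refine AEStronglyMeasurable.indicator (AEStronglyMeasurable.mul ?_ hh.1)
      (measurableSet_lt (by fun_prop) measurable_const)
    exact Measurable.aestronglyMeasurable (by fun_prop)
  have key := trilinear_sub hw hgB.integrable hgB.memLp hh'm
  have e : (fun p : Plane × Plane => if blk p.2 = j ∧ j ≤ blk (p.1 - p.2) + 2 ∧ blk p.1 < j + 3
      then ((br p.1 ^ r : ℝ) : ℂ) * (vsym l (p.1 - p.2) * dsym l p.2 * f (p.1 - p.2) * f p.2 *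
        (starRingEnd ℂ) (h p.1)) else 0) = fun p : Plane × Plane =>
        (dsym l p.2 * shell j f p.2 * g (p.1 - p.2) * (starRingEnd ℂ) (h' p.1)) := by
    ext p
    by_cases c1 : blk p.2 = j
    · by_cases c2 : j ≤ blk (p.1 - p.2) + 2
      · by_cases c3 : blk p.1 < j + 3
        · simp only [c1, c2, c3, and_self, if_true, hg, hh', shell, Set.indicator_apply,
            Set.mem_ofPred_eq, map_mul, Complex.conj_ofReal]
          push_cast
          have : (c : ℂ) ≠ 0 := by exact_mod_cast hc0.ne'
          field_simp
        · simp [c3, hh']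
      · simp [c2, hg]
    · simp [c1, shell]
  simp only [e] at *
  refine ⟨key.1, key.2.trans ?_⟩
  have n1 : l2 g ≤ 4 ^ r * l2 (fun ξ => ((br ξ ^ r : ℝ) : ℂ) * f ξ) := by
    apply l2_mono (by positivity) (hf.br_rpow_mul r).memLp
    intro ξ
    by_cases c2 : j ≤ blk ξ + 2
    · simp only [hg, Set.indicator_apply, Set.mem_ofPred_eq, c2, if_true]
      rw [norm_mul, norm_mul, Complex.norm_real, Real.norm_of_nonneg hc0.le, norm_mul,
        norm_ofReal_rpow_br, ← mul_assoc, ← Real.mul_rpow (by norm_num) (br_pos ξ).le]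
      gcongr
      refine (mul_le_of_le_one_right hc0.le (norm_vsym_le l ξ)).trans ?_
      apply Real.rpow_le_rpow h2j.le _ hr
      have := two_pow_blk_le ξ
      have h3 : (2 : ℝ) ^ j ≤ 2 ^ (blk ξ + 2) := pow_le_pow_right₀ (by norm_num) c2
      rw [pow_add] at h3
      linarith
    · simp only [hg, Set.indicator_apply, Set.mem_ofPred_eq, c2, if_false, norm_zero]
      positivity
  have n2 : l2 h' ≤ 8 ^ r * l2 h := l2_mono (by positivity) hh hn'
  have s1 := supF_nonneg fun ξ => dsym l ξ * shell j f ξ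
  have s3 := l2_nonneg h'
  have s5 := (l2_nonneg g).trans n1
  calc _ ≤ supF (fun ξ => dsym l ξ * shell j f ξ) *
        (4 ^ r * l2 (fun ξ => ((br ξ ^ r : ℝ) : ℂ) * f ξ)) * (8 ^ r * l2 h) :=
        mul_le_mul (mul_le_mul_of_nonneg_left n1 s1) n2 s3 (mul_nonneg s1 s5)
    _ = _ := by ring

/-- The part in which `η` dominates the advecting frequency, but `ξ` does not. -/
theorem advection_low_le {r : ℝ} (hr : 0 ≤ r) {K : ℕ} {f h : Plane → ℂ} (hf : BL K f)
    (hh : MemLp h 2) (l : Fin 2) (k : ℕ) :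
    (Integrable fun p : Plane × Plane => if blk (p.1 - p.2) = k ∧ k + 3 ≤ blk p.2 ∧ blk p.1 < k + 3
      then ((br p.1 ^ r : ℝ) : ℂ) * (vsym l (p.1 - p.2) * dsym l p.2 * f (p.1 - p.2) * f p.2 *
        (starRingEnd ℂ) (h p.1)) else 0) ∧
    ‖∫ p : Plane × Plane, if blk (p.1 - p.2) = k ∧ k + 3 ≤ blk p.2 ∧ blk p.1 < k + 3
      then ((br p.1 ^ r : ℝ) : ℂ) * (vsym l (p.1 - p.2) * dsym l p.2 * f (p.1 - p.2) * f p.2 *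
        (starRingEnd ℂ) (h p.1)) else 0‖ ≤
      (10 * 8 ^ r) * supF (fun ξ => (2 ^ k * vsym l ξ) * shell k f ξ) *
        l2 (fun ξ => ((br ξ ^ r : ℝ) : ℂ) * f ξ) * l2 h := by
  have hw := (hf.msym_shell k (Sum.inr (Sum.inl l))).integrable
  simp only [msym] at hw
  have h2j : (0 : ℝ) < 2 ^ k := by positivity
  set c : ℝ := (2 ^ k : ℝ) ^ r with hc
  have hc0 : 0 < c := Real.rpow_pos_of_pos h2j r
  -- In this region br η ≤ br(ξ - η) + br ξ < 2·2^k + 8·2^k, so η is confined to a few shells and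
  -- its derivative costs only 10·2^k, which the L^∞ factor 2^k u compensates.
  set s : Set Plane := {ξ | k + 3 ≤ blk ξ ∧ br ξ ≤ 10 * 2 ^ k} with hs
  have hsm : MeasurableSet s := by
    have m1 : MeasurableSet {ξ | k + 3 ≤ blk ξ} := measurableSet_le measurable_const (by fun_prop)
    exact m1.inter (measurableSet_le measurable_br measurable_const)
  set g : Plane → ℂ := s.indicator (fun ξ => ((((2 ^ k)⁻¹ * c : ℝ) : ℂ) * dsym l ξ) * f ξ) with hg
  have hgB : BL K g := by
    refine BL.indicator (hf.mul (C := (2 ^ k)⁻¹ * c * 2 ^ K) (by fun_prop) fun ξ hξ => ?_) hsm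
    rw [norm_mul, Complex.norm_real, Real.norm_of_nonneg (by positivity)]
    gcongr
    exact (norm_dsym_le l ξ).trans (br_le_of_blk_lt hξ)
  have e8 : (8 * 2 ^ k : ℝ) ^ r = 8 ^ r * c := Real.mul_rpow (by norm_num) h2j.le
  have hbr : ∀ ξ, blk ξ < k + 3 → br ξ ^ r ≤ 8 ^ r * c := by
    intro ξ hξ
    rw [← e8]
    apply Real.rpow_le_rpow (br_pos ξ).le _ hr
    refine (br_le_of_blk_lt hξ).trans (le_of_eq ?_)
    ring
  set h' : Plane → ℂ := {ξ | blk ξ < k + 3}.indicator (fun ξ => ((c⁻¹ * br ξ ^ r : ℝ) : ℂ) * h ξ)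
    with hh'
  have hn' : ∀ ξ, ‖h' ξ‖ ≤ 8 ^ r * ‖h ξ‖ := by
    intro ξ
    by_cases hξ : blk ξ < k + 3
    · simp only [hh', Set.indicator_apply, Set.mem_ofPred_eq, hξ, if_true]
      rw [norm_mul, Complex.norm_real, Real.norm_of_nonneg (mul_nonneg (by positivity)
        (Real.rpow_nonneg (br_pos ξ).le _))]
      gcongr
      rw [inv_mul_le_iff₀ hc0, mul_comm c]
      exact hbr ξ hξ
    · simp only [hh', Set.indicator_apply, Set.mem_ofPred_eq, hξ, if_false, norm_zero]
      positivity
  have hh'm : MemLp h' 2 := by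
    refine MemLp.of_le_mul (c := 8 ^ r) hh ?_ (by filter_upwards with ξ using hn' ξ)
    refine AEStronglyMeasurable.indicator (AEStronglyMeasurable.mul ?_ hh.1)
      (measurableSet_lt (by fun_prop) measurable_const)
    exact Measurable.aestronglyMeasurable (by fun_prop)
  have key1 := integrable_trilinear hw hgB.memLp hh'm
  have key2 := norm_trilinear_le_supF hw hgB.integrable hgB.memLp hh'm
  have e : (fun p : Plane × Plane => if blk (p.1 - p.2) = k ∧ k + 3 ≤ blk p.2 ∧ blk p.1 < k + 3
      then ((br p.1 ^ r : ℝ) : ℂ) * (vsym l (p.1 - p.2) * dsym l p.2 * f (p.1 - p.2) * f p.2 *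
        (starRingEnd ℂ) (h p.1)) else 0) = fun p : Plane × Plane =>
        (2 ^ k * vsym l (p.1 - p.2) * shell k f (p.1 - p.2) * g p.2 *
          (starRingEnd ℂ) (h' p.1)) := by
    ext p
    by_cases c1 : blk (p.1 - p.2) = k
    · by_cases c2 : k + 3 ≤ blk p.2
      · by_cases c3 : blk p.1 < k + 3
        · have c4 : br p.2 ≤ 10 * 2 ^ k := by
            have a1 := br_le_add_br p.2 p.1
            rw [← br_neg (p.2 - p.1), neg_sub] at a1
            have a2 := br_lt_two_pow (p.1 - p.2)
            have a3 := br_le_of_blk_lt c3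
            rw [c1, pow_add] at a2
            rw [pow_add] at a3
            linarith
          simp only [c1, c2, c3, c4, and_self, if_true, hg, hh', hs, shell, Set.indicator_apply,
            Set.mem_ofPred_eq, map_mul, Complex.conj_ofReal]
          push_cast
          have : (c : ℂ) ≠ 0 := by exact_mod_cast hc0.ne'
          field_simp
        · simp [c3, hh']
      · simp [c2, hg, hs]
    · simp [c1, shell]
  simp only [e] at *
  refine ⟨key1, key2.trans ?_⟩
  have n1 : l2 g ≤ 10 * l2 (fun ξ => ((br ξ ^ r : ℝ) : ℂ) * f ξ) := by
    apply l2_mono (by positivity) (hf.br_rpow_mul r).memLp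
    intro ξ
    by_cases c2 : ξ ∈ s
    · simp only [hg, Set.indicator_apply, c2, if_true]
      rw [norm_mul, norm_mul, Complex.norm_real, Real.norm_of_nonneg (by positivity), norm_mul,
        norm_ofReal_rpow_br, ← mul_assoc]
      refine mul_le_mul_of_nonneg_right ?_ (norm_nonneg _)
      have b1 : c ≤ br ξ ^ r := by
        apply Real.rpow_le_rpow h2j.le _ hr
        exact (pow_le_pow_right₀ (by norm_num) (by have := c2.1; omega)).trans (two_pow_blk_le ξ)
      have b2 := (norm_dsym_le l ξ).trans c2.2
      calc (2 ^ k)⁻¹ * c * ‖dsym l ξ‖ ≤ (2 ^ k)⁻¹ * c * (10 * 2 ^ k) := by gcongr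
        _ = 10 * c := by field_simp
        _ ≤ _ := by gcongr
    · simp only [hg, Set.indicator_apply, c2, if_false, norm_zero]
      positivity
  have n2 : l2 h' ≤ 8 ^ r * l2 h := l2_mono (by positivity) hh hn'
  have s1 := supF_nonneg fun ξ => (2 ^ k * vsym l ξ) * shell k f ξ
  have s3 := l2_nonneg h'
  have s5 := (l2_nonneg g).trans n1
  calc _ ≤ supF (fun ξ => (2 ^ k * vsym l ξ) * shell k f ξ) *
        (10 * l2 (fun ξ => ((br ξ ^ r : ℝ) : ℂ) * f ξ)) * (8 ^ r * l2 h) :=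
        mul_le_mul (mul_le_mul_of_nonneg_left n1 s1) n2 s3 (mul_nonneg s1 s5)
    _ = _ := by ring

theorem ker3_eq_sum (a g h : Plane → ℂ) (p : Plane × Plane) :
    ker3 a g h p = ∑ l, vsym l (p.1 - p.2) * dsym l p.2 * a (p.1 - p.2) * g p.2 *
      (starRingEnd ℂ) (h p.1) := by
  simp only [ker3, bsym, Finset.sum_mul]

theorem integrable_vsym_mul {a : Plane → ℂ} (ha : Integrable a) (l : Fin 2) :
    Integrable fun ξ => vsym l ξ * a ξ :=
  ha.bdd_mul (c := 1) (measurable_vsym l).aestronglyMeasurable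
    (by filter_upwards with ξ using norm_vsym_le l ξ)

theorem integrable_ker3 {a g h : Plane → ℂ} (ha : Integrable a)
    (hg : ∀ l, MemLp (fun ξ => dsym l ξ * g ξ) 2) (hh : MemLp h 2) :
    Integrable (ker3 a g h) := by
  have : ker3 a g h = fun p : Plane × Plane => ∑ l, vsym l (p.1 - p.2) * a (p.1 - p.2) *
      (dsym l p.2 * g p.2) * (starRingEnd ℂ) (h p.1) := by
    ext p
    rw [ker3_eq_sum]
    refine Finset.sum_congr rfl fun l _ => ?_
    ring
  rw [this]
  refine integrable_finsetSum _ fun l _ => ?_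
  have := integrable_trilinear (integrable_vsym_mul ha l) (hg l) hh
  exact this

theorem sum_range_ite {K b : ℕ} (hb : b < K) (P : ℕ → Prop) [DecidablePred P] (T : ℂ) :
    ∑ j ∈ Finset.range K, (if b = j ∧ P j then T else 0) = if P b then T else 0 := by
  simp [ite_and, hb]

/-- The bound for the part of the trilinear form that needs no commutator structure. -/
theorem exists_remainder_bound {r : ℝ} (hr : 0 ≤ r) : ∃ C : ℝ, 0 ≤ C ∧
    ∀ (K : ℕ) (f h : Plane → ℂ), BL K f → MemLp h 2 →
    ‖∫ p : Plane × Plane, {p | farRegion p}ᶜ.indicator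
      (fun p => ((br p.1 ^ r : ℝ) : ℂ) * ker3 f f h p) p‖ ≤
      C * dispN K f * l2 (fun ξ => ((br ξ ^ r : ℝ) : ℂ) * f ξ) * l2 h := by
  obtain ⟨C1, hC1, hA⟩ := exists_advection_high_le r
  obtain ⟨C2, hC2, hC2d⟩ : ∃ C2 : ℝ, 0 ≤ C2 ∧ C2 = 4 ^ r * 8 ^ r := ⟨_, by positivity, rfl⟩
  obtain ⟨C3, hC3, hC3d⟩ : ∃ C3 : ℝ, 0 ≤ C3 ∧ C3 = 10 * 8 ^ r := ⟨_, by positivity, rfl⟩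
  refine ⟨C1 + C2 + C3, by positivity, fun K f h hf hh => ?_⟩
  classical
  let T : Fin 2 → Plane × Plane → ℂ := fun l p => ((br p.1 ^ r : ℝ) : ℂ) *
    (vsym l (p.1 - p.2) * dsym l p.2 * f (p.1 - p.2) * f p.2 * (starRingEnd ℂ) (h p.1))
  let A : Fin 2 → ℕ → Plane × Plane → ℂ := fun l j p =>
    if blk p.2 = j ∧ j ≤ blk (p.1 - p.2) + 2 ∧ j + 3 ≤ blk p.1 then T l p else 0
  let B : Fin 2 → ℕ → Plane × Plane → ℂ := fun l j p =>
    if blk p.2 = j ∧ j ≤ blk (p.1 - p.2) + 2 ∧ blk p.1 < j + 3 then T l p else 0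
  let D : Fin 2 → ℕ → Plane × Plane → ℂ := fun l j p =>
    if blk (p.1 - p.2) = j ∧ j + 3 ≤ blk p.2 ∧ blk p.1 < j + 3 then T l p else 0
  have hA' : ∀ l j, Integrable (A l j) ∧ ‖∫ p, A l j p‖ ≤ C1 *
      supF (fun ξ => dsym l ξ * shell j f ξ) * l2 (fun ξ => ((br ξ ^ r : ℝ) : ℂ) * f ξ) * l2 h :=
    fun l j => hA K f h hf hh l j
  have hB' : ∀ l j, Integrable (B l j) ∧ ‖∫ p, B l j p‖ ≤ C2 *
      supF (fun ξ => dsym l ξ * shell j f ξ) * l2 (fun ξ => ((br ξ ^ r : ℝ) : ℂ) * f ξ) * l2 h := by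
    rw [hC2d]
    exact fun l j => advection_comparable_le hr hf hh l j
  have hD' : ∀ l j, Integrable (D l j) ∧ ‖∫ p, D l j p‖ ≤ C3 *
      supF (fun ξ => (2 ^ j * vsym l ξ) * shell j f ξ) *
        l2 (fun ξ => ((br ξ ^ r : ℝ) : ℂ) * f ξ) * l2 h := by
    rw [hC3d]
    exact fun l j => advection_low_le hr hf hh l j
  -- Off the far region either η does not dominate the advecting frequency, with ξ above η (A) or
  -- not (B), or η dominates while ξ does not (D). Exactly one case applies, for exactly one shell
  -- index, and indices at least K contribute nothing because f is band-limited.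
  have e : (fun p : Plane × Plane => {p | farRegion p}ᶜ.indicator
      (fun p => ((br p.1 ^ r : ℝ) : ℂ) * ker3 f f h p) p) = fun p =>
      ∑ j ∈ Finset.range K, ∑ l, (A l j p + B l j p + D l j p) := by
    ext p
    rw [Finset.sum_comm]
    have e1 : {p | farRegion p}ᶜ.indicator
      (fun p => ((br p.1 ^ r : ℝ) : ℂ) * ker3 f f h p) p = ∑ l, if farRegion p then 0 else T l p := by
      by_cases hp : farRegion p
      · simp [hp]
      · simp only [Set.indicator_apply, Set.mem_compl_iff, Set.mem_ofPred_eq, hp, not_false_eq_true,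
          if_true, if_false, T, ker3_eq_sum, Finset.mul_sum]
    rw [e1]
    refine Finset.sum_congr rfl fun l _ => ?_
    by_cases hb : blk p.2 < K
    · by_cases ha : blk (p.1 - p.2) < K
      · rw [Finset.sum_add_distrib, Finset.sum_add_distrib]
        simp only [A, B, D]
        rw [sum_range_ite hb, sum_range_ite hb, sum_range_ite ha]
        unfold farRegion
        split_ifs <;> first | omega | simp
      · have h0 : T l p = 0 := by simp [T, hf.supp _ (not_lt.1 ha)]
        simp [A, B, D, h0]
    · have h0 : T l p = 0 := by simp [T, hf.supp _ (not_lt.1 hb)]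
      simp [A, B, D, h0]
  clear_value A B D
  have hABD : ∀ l j, Integrable fun p => A l j p + B l j p + D l j p :=
    fun l j => ((hA' l j).1.add (hB' l j).1).add (hD' l j).1
  rw [e, integral_finsetSum _ fun j _ => integrable_finsetSum _ fun l _ => hABD l j]
  set M := l2 (fun ξ => ((br ξ ^ r : ℝ) : ℂ) * f ξ) * l2 h with hM
  have hM0 : 0 ≤ M := mul_nonneg (l2_nonneg _) (l2_nonneg _)
  calc ‖∑ j ∈ Finset.range K, ∫ p, ∑ l, (A l j p + B l j p + D l j p)‖
      ≤ ∑ j ∈ Finset.range K, ∑ l, (C1 + C2 + C3) * (supF (fun ξ => dsym l ξ * shell j f ξ) +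
          supF (fun ξ => (2 ^ j * vsym l ξ) * shell j f ξ)) * M := by
        refine (norm_sum_le _ _).trans (Finset.sum_le_sum fun j _ => ?_)
        rw [integral_finsetSum _ fun l _ => hABD l j]
        refine (norm_sum_le _ _).trans (Finset.sum_le_sum fun l _ => ?_)
        rw [integral_add (f := fun p => A l j p + B l j p) ((hA' l j).1.add (hB' l j).1) (hD' l j).1,
          integral_add (hA' l j).1 (hB' l j).1]
        refine (norm_add₃_le ..).trans ?_
        have b1 := (hA' l j).2
        have b2 := (hB' l j).2
        have b3 := (hD' l j).2
        rw [mul_assoc, ← hM] at b1 b2 b3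
        have s1 := supF_nonneg fun ξ => dsym l ξ * shell j f ξ
        have s2 := supF_nonneg fun ξ => (2 ^ j * vsym l ξ) * shell j f ξ
        refine (add_le_add (add_le_add b1 b2) b3).trans ?_
        rw [← add_mul, ← add_mul]
        apply mul_le_mul_of_nonneg_right _ hM0
        nlinarith [mul_nonneg hC1 s2, mul_nonneg hC2 s2, mul_nonneg hC3 s1]
    _ = (C1 + C2 + C3) * (∑ j ∈ Finset.range K, ∑ l,
          (supF (fun ξ => dsym l ξ * shell j f ξ) +
          supF (fun ξ => (2 ^ j * vsym l ξ) * shell j f ξ))) * M := by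
        simp only [Finset.mul_sum, Finset.sum_mul]
    _ ≤ (C1 + C2 + C3) * dispN K f * M := by
        gcongr
        exact sum_supF_le_dispN f
    _ = _ := by rw [hM]; ring

/-! ### The tame product estimate. -/

/-- The part in which both `ξ` and `η` dominate the advecting frequency in the shell `k`. -/
theorem exists_advection_far_le {r : ℝ} : ∃ C : ℝ, 0 ≤ C ∧
    ∀ (K : ℕ) (f h : Plane → ℂ), BL K f → MemLp h 2 →
    ∀ (l : Fin 2) (k : ℕ),
    (Integrable fun p : Plane × Plane => if blk (p.1 - p.2) = k ∧ k + 3 ≤ blk p.2 ∧ k + 3 ≤ blk p.1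
      then ((br p.1 ^ r : ℝ) : ℂ) * (vsym l (p.1 - p.2) * dsym l p.2 * f (p.1 - p.2) * f p.2 *
        (starRingEnd ℂ) (h p.1)) else 0) ∧
    ‖∫ p : Plane × Plane, if blk (p.1 - p.2) = k ∧ k + 3 ≤ blk p.2 ∧ k + 3 ≤ blk p.1
      then ((br p.1 ^ r : ℝ) : ℂ) * (vsym l (p.1 - p.2) * dsym l p.2 * f (p.1 - p.2) * f p.2 *
        (starRingEnd ℂ) (h p.1)) else 0‖ ≤
      C * supF (fun ξ => (2 ^ k * vsym l ξ) * shell k f ξ) *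
        l2 (fun ξ => ((br ξ ^ (r + 1) : ℝ) : ℂ) * f ξ) * l2 h := by
  obtain ⟨H, hH⟩ := exists_schwartz_exp r
  refine ⟨∫ τ, ‖𝓕 (H : ℝ → ℂ) τ‖, by positivity, fun K f h hf hh l k => ?_⟩
  have hφ : Measurable fun ξ => Real.log (br ξ) := by fun_prop
  have hw := (hf.msym_shell k (Sum.inr (Sum.inl l))).integrable
  simp only [msym] at hw
  set s : Set Plane := {ξ | k + 3 ≤ blk ξ} with hs
  have hsm : MeasurableSet s := measurableSet_le measurable_const (by fun_prop)
  -- The factor 2^{-k} compensates 2^k in the L^∞ factor and is then bounded by 1. The derivative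
  -- stays on the high frequency η, hence the loss of one derivative, to r + 1, in this region.
  set g : Plane → ℂ := s.indicator (fun ξ => ((2 ^ k)⁻¹ * dsym l ξ) * (((br ξ ^ r : ℝ) : ℂ) * f ξ))
    with hg
  have hgB : BL K g := by
    refine BL.indicator ((hf.br_rpow_mul r).mul (C := (2 ^ k)⁻¹ * 2 ^ K) (by fun_prop)
      fun ξ hξ => ?_) hsm
    rw [norm_mul, norm_inv, norm_pow, Complex.norm_ofNat]
    gcongr
    exact (norm_dsym_le l ξ).trans (br_le_of_blk_lt hξ)
  set h' : Plane → ℂ := s.indicator h with hh'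
  have hh'm : MemLp h' 2 := hh.indicator hsm
  have key1 := integrable_schur_trilinear H hφ hw hgB.memLp hh'm
  have key2 := norm_schur_trilinear_le H hφ hw hgB.integrable hgB.memLp hh'm
  have e : (fun p : Plane × Plane => if blk (p.1 - p.2) = k ∧ k + 3 ≤ blk p.2 ∧ k + 3 ≤ blk p.1
      then ((br p.1 ^ r : ℝ) : ℂ) * (vsym l (p.1 - p.2) * dsym l p.2 * f (p.1 - p.2) * f p.2 *
        (starRingEnd ℂ) (h p.1)) else 0) = fun p : Plane × Plane =>
      H (Real.log (br p.1) - Real.log (br p.2)) *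
        (2 ^ k * vsym l (p.1 - p.2) * shell k f (p.1 - p.2) * g p.2 * (starRingEnd ℂ) (h' p.1)) := by
    ext p
    by_cases c1 : blk (p.1 - p.2) = k
    · by_cases c2 : k + 3 ≤ blk p.2
      · by_cases c3 : k + 3 ≤ blk p.1
        · have hlog : |Real.log (br p.1) - Real.log (br p.2)| ≤ 1 := by
            apply abs_log_br_sub_le (k := k)
            · left
              rw [← c1]
              exact (br_lt_two_pow _).le
            · exact (pow_le_pow_right₀ (by norm_num) c3).trans (two_pow_blk_le p.1)
          have := hH _ _ (br_pos p.1) (br_pos p.2) hlog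
          simp only [c1, c2, c3, and_self, if_true, hg, hh', hs, shell, Set.indicator_apply,
            Set.mem_ofPred_eq]
          rw [← this]
          field_simp
        · simp [c3, hh', hs]
      · simp [c2, hg, hs]
    · simp [c1, shell]
  simp only [e] at *
  refine ⟨key1, key2.trans ?_⟩
  have n1 : l2 g ≤ l2 (fun ξ => ((br ξ ^ (r + 1) : ℝ) : ℂ) * f ξ) := by
    apply l2_le_of_norm_le (hf.br_rpow_mul (r + 1)).memLp
    intro ξ
    by_cases c : ξ ∈ s
    · simp only [hg, Set.indicator_apply, c, if_true]
      rw [norm_mul, norm_mul, norm_mul, norm_mul, norm_ofReal_rpow_br, norm_ofReal_rpow_br,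
        Real.rpow_add_one (br_pos ξ).ne', ← mul_assoc]
      refine mul_le_mul_of_nonneg_right ?_ (norm_nonneg _)
      rw [norm_inv, norm_pow, Complex.norm_ofNat, mul_comm]
      refine mul_le_mul_of_nonneg_left ?_ (Real.rpow_nonneg (br_pos ξ).le _)
      have h1 : (1 : ℝ) ≤ 2 ^ k := one_le_pow₀ (by norm_num)
      have h2 := norm_dsym_le l ξ
      calc ((2 : ℝ) ^ k)⁻¹ * ‖dsym l ξ‖ ≤ 1 * ‖dsym l ξ‖ := by
            gcongr
            exact inv_le_one_of_one_le₀ h1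
        _ ≤ br ξ := by linarith
    · simp only [hg, Set.indicator_apply, c, if_false, norm_zero]
      positivity
  have n2 : l2 h' ≤ l2 h := l2_le_of_norm_le hh fun ξ => by
    by_cases c : ξ ∈ s <;> simp [hh', c]
  have s1 := supF_nonneg fun ξ => (2 ^ k * vsym l ξ) * shell k f ξ
  have s3 := l2_nonneg h'
  have s4 : 0 ≤ ∫ τ, ‖𝓕 (H : ℝ → ℂ) τ‖ := by positivity
  have s5 := (l2_nonneg g).trans n1
  exact mul_le_mul (mul_le_mul_of_nonneg_left n1 (mul_nonneg s4 s1)) n2 s3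
    (mul_nonneg (mul_nonneg s4 s1) s5)

theorem l2_br_rpow_mono {K : ℕ} {f : Plane → ℂ} (hf : BL K f) {r s : ℝ} (h : r ≤ s) :
    l2 (fun ξ => ((br ξ ^ r : ℝ) : ℂ) * f ξ) ≤ l2 (fun ξ => ((br ξ ^ s : ℝ) : ℂ) * f ξ) := by
  apply l2_le_of_norm_le (hf.br_rpow_mul s).memLp
  intro ξ
  rw [norm_mul, norm_mul, norm_ofReal_rpow_br, norm_ofReal_rpow_br]
  exact mul_le_mul_of_nonneg_right (Real.rpow_le_rpow_of_exponent_le (one_le_br ξ) h) (norm_nonneg _)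

/-- The tame estimate of `u · ∇ θ` in `H^r`, in dual form. -/
theorem exists_product_bound {r : ℝ} (hr : 0 ≤ r) : ∃ C : ℝ, 0 ≤ C ∧
    ∀ (K : ℕ) (f h : Plane → ℂ), BL K f → BL K h →
    ‖∫ p : Plane × Plane, ((br p.1 ^ r : ℝ) : ℂ) * ker3 f f h p‖ ≤
      C * dispN K f * l2 (fun ξ => ((br ξ ^ (r + 1) : ℝ) : ℂ) * f ξ) * l2 h := by
  obtain ⟨C1, hC1, hA⟩ := exists_advection_far_le (r := r)
  obtain ⟨C2, hC2, hR⟩ := exists_remainder_bound hr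
  refine ⟨C1 + C2, by positivity, fun K f h hf hh => ?_⟩
  have hi : Integrable fun p : Plane × Plane => ((br p.1 ^ r : ℝ) : ℂ) * ker3 f f h p := by
    have : (fun p : Plane × Plane => ((br p.1 ^ r : ℝ) : ℂ) * ker3 f f h p) =
        ker3 f f fun ξ => ((br ξ ^ r : ℝ) : ℂ) * h ξ := by
      ext p
      simp only [ker3, map_mul, Complex.conj_ofReal]
      ring
    rw [this]
    exact integrable_ker3 hf.integrable (fun l => (hf.dsym_mul l).memLp) (hh.br_rpow_mul r).memLp
  rw [← integral_add_compl measurableSet_farRegion hi, ← integral_indicator measurableSet_farRegion,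
    ← integral_indicator measurableSet_farRegion.compl]
  refine (norm_add_le _ _).trans ?_
  have hR' := hR K f h hf hh.memLp
  set M := l2 (fun ξ => ((br ξ ^ (r + 1) : ℝ) : ℂ) * f ξ) * l2 h with hM
  have hM0 : 0 ≤ M := mul_nonneg (l2_nonneg _) (l2_nonneg _)
  have hA' := fun l k => hA K f h hf hh.memLp l k
  have e : (fun p : Plane × Plane => {p | farRegion p}.indicator
      (fun p => ((br p.1 ^ r : ℝ) : ℂ) * ker3 f f h p) p) = fun p =>
      ∑ k ∈ Finset.range K, ∑ l,
      if blk (p.1 - p.2) = k ∧ k + 3 ≤ blk p.2 ∧ k + 3 ≤ blk p.1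
      then ((br p.1 ^ r : ℝ) : ℂ) * (vsym l (p.1 - p.2) * dsym l p.2 * f (p.1 - p.2) * f p.2 *
        (starRingEnd ℂ) (h p.1)) else 0 := by
    ext p
    rw [Finset.sum_comm]
    by_cases ha : blk (p.1 - p.2) < K
    · simp only [sum_range_ite ha]
      by_cases hp : farRegion p
      · have hp2 := hp
        unfold farRegion at hp2
        rw [Set.indicator_of_mem (by exact hp)]
        simp only [hp2, and_self, if_true, ker3_eq_sum, Finset.mul_sum]
      · have hp2 := hp
        unfold farRegion at hp2
        rw [Set.indicator_of_notMem (by exact hp)]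
        simp only [hp2, if_false, Finset.sum_const_zero]
    · have h0 := hf.supp _ (not_lt.1 ha)
      simp [ker3, h0]
  have hF : ‖∫ p : Plane × Plane, {p | farRegion p}.indicator
      (fun p => ((br p.1 ^ r : ℝ) : ℂ) * ker3 f f h p) p‖ ≤ C1 * dispN K f * M := by
    rw [e, integral_finsetSum _ fun k _ => integrable_finsetSum _ fun l _ => (hA' l k).1]
    calc _
      _ ≤ ∑ k ∈ Finset.range K, ∑ l, C1 * (supF (fun ξ => dsym l ξ * shell k f ξ) +
          supF (fun ξ => (2 ^ k * vsym l ξ) * shell k f ξ)) * M := by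
        refine (norm_sum_le _ _).trans (Finset.sum_le_sum fun k _ => ?_)
        rw [integral_finsetSum _ fun l _ => (hA' l k).1]
        refine (norm_sum_le _ _).trans (Finset.sum_le_sum fun l _ => ?_)
        refine (hA' l k).2.trans ?_
        rw [mul_assoc, ← hM]
        gcongr
        linarith [supF_nonneg fun ξ => dsym l ξ * shell k f ξ]
      _ = C1 * (∑ k ∈ Finset.range K, ∑ l, (supF (fun ξ => dsym l ξ * shell k f ξ) +
          supF (fun ξ => (2 ^ k * vsym l ξ) * shell k f ξ))) * M := by
        simp only [Finset.mul_sum, Finset.sum_mul]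
      _ ≤ _ := by
        gcongr
        exact sum_supF_le_dispN f
  have hmono : l2 (fun ξ => ((br ξ ^ r : ℝ) : ℂ) * f ξ) ≤
      l2 (fun ξ => ((br ξ ^ (r + 1) : ℝ) : ℂ) * f ξ) := l2_br_rpow_mono hf (by linarith)
  calc _ ≤ C1 * dispN K f * M + C2 * dispN K f * M := by
        refine add_le_add hF (hR'.trans ?_)
        rw [mul_assoc, hM]
        refine mul_le_mul_of_nonneg_left ?_ (mul_nonneg hC2 (dispN_nonneg K f))
        exact mul_le_mul_of_nonneg_right hmono (l2_nonneg h)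
    _ = _ := by rw [hM]; ring

/-! ### The commutator and the energy estimate in H^n. -/

/-- This is |ξ|² - |η|² = (ξ - η)·(ξ + η), the sign being i². The factor at ξ - η differentiates the
velocity, so the commutator yields ∇u. -/
theorem J_sub_J (ξ η : Plane) : ((J ξ - J η : ℝ) : ℂ) =
    -∑ m, dsym m (ξ - η) * (dsym m ξ + dsym m η) := by
  have h : ∀ ζ : Plane, ‖ζ‖ ^ 2 = ζ 0 ^ 2 + ζ 1 ^ 2 := fun ζ => by
    rw [EuclideanSpace.norm_sq_eq, Fin.sum_univ_two, Real.norm_eq_abs, Real.norm_eq_abs, sq_abs,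
      sq_abs]
  simp only [J, mul_pow, h, Fin.sum_univ_two, dsym, PiLp.sub_apply]
  push_cast
  linear_combination (4 * Real.pi ^ 2 * ((ξ 0 : ℂ) ^ 2 - (η 0 : ℂ) ^ 2 + (ξ 1 : ℂ) ^ 2 -
    (η 1 : ℂ) ^ 2)) * Complex.I_sq

/-- The factor of a difference of powers, localized to comparable arguments. -/
theorem exists_schwartz_sub_quotient (n b : ℝ) : ∃ H : 𝓢(ℝ, ℂ), H 0 = n ∧ ∀ x y : ℝ, 0 < x → 0 < y →
    |Real.log x - Real.log y| ≤ 1 →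
    ((x ^ (2 * n) - y ^ (2 * n) : ℝ) : ℂ) = ((x ^ 2 - y ^ 2 : ℝ) : ℂ) *
      (H (Real.log x - Real.log y) * ((x ^ b * y ^ (2 * n - 2 - b) : ℝ) : ℂ)) := by
  -- With s = log x - log y the required function is e^{-bs} (e^{2ns} - 1)/(e^{2s} - 1). The
  -- quotient is formed in the squares x² and y², hence the argument 2s and the exponent b/2.
  obtain ⟨ψ, hψ, hψ0, hq⟩ := exists_exp_quotient n (b / 2)
  obtain ⟨H, hH⟩ := exists_schwartz_eqOn (ψ := fun s : ℝ => ψ (2 * s))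
    (hψ.comp (contDiff_const.mul contDiff_id))
  refine ⟨H, by rw [hH 0 (by simp), mul_zero, hψ0], fun x y hx hy h => ?_⟩
  rw [hH _ h]
  set s := Real.log x - Real.log y with hs
  have hxy : x = y * Real.exp s := by
    rw [hs, Real.exp_sub, Real.exp_log hx, Real.exp_log hy]
    field_simp
  have h1 := hq (2 * s)
  have e1 : x ^ (2 * n) = y ^ (2 * n) * Real.exp (n * (2 * s)) := by
    rw [hxy, Real.mul_rpow hy.le (Real.exp_pos _).le, ← Real.exp_mul]
    congr 2
    ring
  have e2 : x ^ 2 = y ^ 2 * Real.exp (2 * s) := by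
    rw [hxy, mul_pow, ← Real.exp_nat_mul]
    norm_num
  have e3 : x ^ b = y ^ b * Real.exp (b * s) := by
    rw [hxy, Real.mul_rpow hy.le (Real.exp_pos _).le, ← Real.exp_mul]
    congr 2
    ring
  have e4 : y ^ 2 * y ^ b * y ^ (2 * n - 2 - b) = y ^ (2 * n) := by
    rw [← Real.rpow_natCast, ← Real.rpow_add hy, ← Real.rpow_add hy]
    congr 1
    push_cast
    ring
  have e5 : Real.exp (b * s) * Real.exp (-(b / 2 * (2 * s))) = 1 := by
    rw [← Real.exp_add]
    simp
    ring
  have e6 : x ^ (2 * n) - y ^ (2 * n) = y ^ (2 * n) * Real.exp (b * s) *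
      ((Real.exp (n * (2 * s)) - 1) * Real.exp (-(b / 2 * (2 * s)))) := by
    rw [e1]
    linear_combination (-y ^ (2 * n) * (Real.exp (n * (2 * s)) - 1)) * e5
  have e7 : (x ^ 2 - y ^ 2) * (x ^ b * y ^ (2 * n - 2 - b)) =
      (Real.exp (2 * s) - 1) * (y ^ (2 * n) * Real.exp (b * s)) := by
    rw [e2, e3, ← e4]
    ring
  rw [e6, Complex.ofReal_mul, h1, mul_left_comm, mul_left_comm _ (ψ _),
    mul_comm _ (ψ _), mul_left_comm, ← Complex.ofReal_mul, ← Complex.ofReal_mul, e7]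

theorem Herm.shell {f : Plane → ℂ} (hf : Herm f) (k : ℕ) : Herm (shell k f) := by
  intro ξ
  by_cases h : blk ξ = k <;> simp [DispersiveSQG.shell, blk_neg, h, hf ξ]

/-- The energy estimate for transport of the high frequencies by the shell `k`. -/
theorem exists_commutator_bound (n : ℝ) : ∃ C : ℝ, 0 ≤ C ∧
    ∀ (K : ℕ) (f : Plane → ℂ), BL K f → Herm f → ∀ (k : ℕ),
    |(∫ p : Plane × Plane, ((br p.1 ^ (2 * n) : ℝ) : ℂ) *
      ker3 (shell k f) ({ξ | k + 3 ≤ blk ξ}.indicator f) ({ξ | k + 3 ≤ blk ξ}.indicator f) p).re| ≤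
      C * (∑ q : Fin 2 × Fin 2, supF (fun ξ => msym k (Sum.inr (Sum.inr q)) ξ * shell k f ξ)) *
        l2 (fun ξ => ((br ξ ^ n : ℝ) : ℂ) * f ξ) ^ 2 := by
  -- The weight is distributed so that each high-frequency factor carries n derivatives in total. If
  -- the extra derivative falls on ξ, both sides get the power n - 1 besides one derivative each. If
  -- it falls on η, which already carries the gradient, ξ gets n and η gets n - 2 besides two
  -- derivatives.
  obtain ⟨H1, hH10, hH1⟩ := exists_schwartz_sub_quotient n (n - 1)
  obtain ⟨H2, hH20, hH2⟩ := exists_schwartz_sub_quotient n n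
  obtain ⟨c1, hc1, hc1d⟩ : ∃ c : ℝ, 0 ≤ c ∧ c = ∫ τ, ‖𝓕 (H1 : ℝ → ℂ) τ‖ :=
    ⟨_, by positivity, rfl⟩
  obtain ⟨c2, hc2, hc2d⟩ : ∃ c : ℝ, 0 ≤ c ∧ c = ∫ τ, ‖𝓕 (H2 : ℝ → ℂ) τ‖ :=
    ⟨_, by positivity, rfl⟩
  refine ⟨c1 + c2, by positivity, fun K f hf hherm k => ?_⟩
  have hφ : Measurable fun ξ => Real.log (br ξ) := by fun_prop
  set s : Set Plane := {ξ | k + 3 ≤ blk ξ} with hs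
  have hsm : MeasurableSet s := measurableSet_le measurable_const (by fun_prop)
  have hFB : BL K (s.indicator f) := hf.indicator hsm
  obtain ⟨F, hF⟩ : ∃ F, F = s.indicator f := ⟨_, rfl⟩
  rw [← hF] at hFB ⊢
  have hFle : ∀ ξ, ‖F ξ‖ ≤ ‖f ξ‖ := fun ξ => by rw [hF]; exact norm_indicator_le_norm_self _ _
  set M := l2 (fun ξ => ((br ξ ^ n : ℝ) : ℂ) * f ξ) with hM
  have hM0 : 0 ≤ M := l2_nonneg _
  let w : Fin 2 × Fin 2 → Plane → ℂ := fun q ξ => msym k (Sum.inr (Sum.inr q)) ξ * shell k f ξ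
  have hw : ∀ q, Integrable (w q) := fun q => (hf.msym_shell k (Sum.inr (Sum.inr q))).integrable
  let g1 : Fin 2 → Plane → ℂ := fun l ξ => ((br ξ ^ (n - 1) : ℝ) : ℂ) * (dsym l ξ * F ξ)
  let g2 : Fin 2 × Fin 2 → Plane → ℂ := fun q ξ =>
    ((br ξ ^ (n - 2) : ℝ) : ℂ) * (dsym q.2 ξ * (dsym q.1 ξ * F ξ))
  let h2 : Plane → ℂ := fun ξ => ((br ξ ^ n : ℝ) : ℂ) * F ξ
  have hg1 : ∀ l, BL K (g1 l) := fun l => (hFB.dsym_mul l).br_rpow_mul _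
  have hg2 : ∀ q, BL K (g2 q) := fun q => ((hFB.dsym_mul q.1).dsym_mul q.2).br_rpow_mul _
  have hh2 : BL K h2 := hFB.br_rpow_mul n
  have ng1 : ∀ l, l2 (g1 l) ≤ M := fun l => l2_le_of_norm_le (hf.br_rpow_mul n).memLp fun ξ => by
    simp only [g1]
    rw [norm_mul, norm_mul, norm_mul, norm_ofReal_rpow_br, norm_ofReal_rpow_br,
      show n = n - 1 + 1 by ring, Real.rpow_add_one (br_pos ξ).ne', ← mul_assoc]
    have := Real.rpow_nonneg (br_pos ξ).le (n - 1)
    rw [add_sub_cancel_right]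
    have := br_pos ξ
    gcongr
    · exact norm_dsym_le l ξ
    · exact hFle ξ
  have ng2 : ∀ q, l2 (g2 q) ≤ M := fun q => l2_le_of_norm_le (hf.br_rpow_mul n).memLp fun ξ => by
    simp only [g2]
    rw [norm_mul, norm_mul, norm_mul, norm_mul, norm_ofReal_rpow_br, norm_ofReal_rpow_br,
      show br ξ ^ n = br ξ ^ (n - 2) * br ξ * br ξ by
        rw [← Real.rpow_add_one (br_pos ξ).ne', ← Real.rpow_add_one (br_pos ξ).ne']
        congr 1
        ring, ← mul_assoc, ← mul_assoc]
    have := Real.rpow_nonneg (br_pos ξ).le (n - 2)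
    have := br_pos ξ
    gcongr
    · exact norm_dsym_le q.2 ξ
    · exact norm_dsym_le q.1 ξ
    · exact hFle ξ
  have nh2 : l2 h2 ≤ M := l2_le_of_norm_le (hf.br_rpow_mul n).memLp fun ξ => by
    simp only [h2]
    rw [norm_mul, norm_mul]
    gcongr
    exact hFle ξ
  have hi1 : Integrable fun p : Plane × Plane => ((br p.1 ^ (2 * n) : ℝ) : ℂ) *
      ker3 (shell k f) F F p := by
    have : (fun p : Plane × Plane => ((br p.1 ^ (2 * n) : ℝ) : ℂ) * ker3 (shell k f) F F p) =
        ker3 (shell k f) F fun ξ => ((br ξ ^ (2 * n) : ℝ) : ℂ) * F ξ := by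
      ext p
      simp only [ker3, map_mul, Complex.conj_ofReal]
      ring
    rw [this]
    exact integrable_ker3 (hf.shell k).integrable (fun l => (hFB.dsym_mul l).memLp)
      (hFB.br_rpow_mul _).memLp
  have hi2 : Integrable fun p : Plane × Plane => ((br p.2 ^ (2 * n) : ℝ) : ℂ) *
      ker3 (shell k f) F F p := by
    have : (fun p : Plane × Plane => ((br p.2 ^ (2 * n) : ℝ) : ℂ) * ker3 (shell k f) F F p) =
        ker3 (shell k f) (fun ξ => ((br ξ ^ (2 * n) : ℝ) : ℂ) * F ξ) F := by
      ext p
      simp only [ker3]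
      ring
    rw [this]
    exact integrable_ker3 (hf.shell k).integrable
      (fun l => ((hFB.br_rpow_mul _).dsym_mul l).memLp) hFB.memLp
  have hsym := re_integral_ker3_symm (hherm.shell k) F (fun ξ _ => br ξ ^ (2 * n)) hi1 hi2
  let A : Fin 2 × Fin 2 → Plane × Plane → ℂ := fun q p =>
    H1 (Real.log (br p.1) - Real.log (br p.2)) *
      (w q (p.1 - p.2) * g1 q.1 p.2 * (starRingEnd ℂ) (g1 q.2 p.1))
  let B : Fin 2 × Fin 2 → Plane × Plane → ℂ := fun q p =>
    H2 (Real.log (br p.1) - Real.log (br p.2)) *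
      (w q (p.1 - p.2) * g2 q p.2 * (starRingEnd ℂ) (h2 p.1))
  have hA : ∀ q, Integrable (A q) ∧ ‖∫ p, A q p‖ ≤ c1 * supF (w q) * M * M := fun q => by
    refine ⟨integrable_schur_trilinear H1 hφ (hw q) (hg1 q.1).memLp (hg1 q.2).memLp, ?_⟩
    refine (norm_schur_trilinear_le H1 hφ (hw q) (hg1 q.1).integrable (hg1 q.1).memLp
      (hg1 q.2).memLp).trans ?_
    rw [← hc1d]
    have := supF_nonneg (w q)
    exact mul_le_mul (mul_le_mul_of_nonneg_left (ng1 q.1) (by positivity)) (ng1 q.2)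
      (l2_nonneg _) (by positivity)
  have hB : ∀ q, Integrable (B q) ∧ ‖∫ p, B q p‖ ≤ c2 * supF (w q) * M * M := fun q => by
    refine ⟨integrable_schur_trilinear H2 hφ (hw q) (hg2 q).memLp hh2.memLp, ?_⟩
    refine (norm_schur_trilinear_le H2 hφ (hw q) (hg2 q).integrable (hg2 q).memLp
      hh2.memLp).trans ?_
    rw [← hc2d]
    have := supF_nonneg (w q)
    exact mul_le_mul (mul_le_mul_of_nonneg_left (ng2 q) (by positivity)) nh2
      (l2_nonneg _) (by positivity)
  -- The minus sign between A and B arises because the derivative at ξ sits in the conjugated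
  -- factor, where it changes sign.
  have e : (fun p : Plane × Plane => ((br p.1 ^ (2 * n) - br p.2 ^ (2 * n) : ℝ) : ℂ) *
      ker3 (shell k f) F F p) = fun p => ∑ q, (A q p - B q p) := by
    ext p
    by_cases c1 : blk (p.1 - p.2) = k
    swap
    · simp [ker3, A, B, w, shell, c1]
    by_cases c2 : p.2 ∈ s
    swap
    · have : F p.2 = 0 := by rw [hF, Set.indicator_of_notMem c2]
      simp [ker3, A, B, g1, g2, this]
    by_cases c3 : p.1 ∈ s
    swap
    · have : F p.1 = 0 := by rw [hF, Set.indicator_of_notMem c3]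
      simp [ker3, A, B, g1, h2, this]
    have hlog : |Real.log (br p.1) - Real.log (br p.2)| ≤ 1 := by
      apply abs_log_br_sub_le (k := k)
      · left
        rw [← c1]
        exact (br_lt_two_pow _).le
      · exact (pow_le_pow_right₀ (by norm_num) c3).trans (two_pow_blk_le p.1)
    have i1 := hH1 _ _ (br_pos p.1) (br_pos p.2) hlog
    have i2 := hH2 _ _ (br_pos p.1) (br_pos p.2) hlog
    rw [show 2 * n - 2 - (n - 1) = n - 1 by ring] at i1
    rw [show 2 * n - 2 - n = n - 2 by ring] at i2
    have hJ := J_sub_J p.1 p.2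
    rw [br_sq, br_sq] at i1 i2
    set X1 := H1 (Real.log (br p.1) - Real.log (br p.2))
    set X2 := H2 (Real.log (br p.1) - Real.log (br p.2))
    have hd : ((br p.1 ^ (2 * n) - br p.2 ^ (2 * n) : ℝ) : ℂ) =
        -∑ m, dsym m (p.1 - p.2) *
          (dsym m p.1 * (X1 * ((br p.1 ^ (n - 1) * br p.2 ^ (n - 1) : ℝ) : ℂ)) +
           dsym m p.2 * (X2 * ((br p.1 ^ n * br p.2 ^ (n - 2) : ℝ) : ℂ))) := by
      -- The two factorizations of the weight difference have the same quotient wherever J ξ ≠ J η,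
      -- by cancellation. On the set J ξ = J η both quotients are fixed instead by the common value
      -- H(0) = n.
      have hz : X1 * ((br p.1 ^ (n - 1) * br p.2 ^ (n - 1) : ℝ) : ℂ) =
          X2 * ((br p.1 ^ n * br p.2 ^ (n - 2) : ℝ) : ℂ) ∨ ((J p.1 - J p.2 : ℝ) : ℂ) = 0 := by
        rw [i1] at i2
        rcases eq_or_ne ((J p.1 - J p.2 : ℝ) : ℂ) 0 with h | h
        · exact Or.inr h
        · exact Or.inl (mul_left_cancel₀ h i2)
      rcases hz with hz | hz
      · rw [i1, hJ, ← hz]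
        simp only [Fin.sum_univ_two]
        ring
      · have hJ' : J p.1 = J p.2 := sub_eq_zero.1 (by exact_mod_cast hz)
        have hb : br p.1 = br p.2 := by rw [br, br, hJ']
        have hX1 : X1 = n := by simp only [X1, hb, sub_self, hH10]
        have hX2 : X2 = n := by simp only [X2, hb, sub_self, hH20]
        have hpow : br p.2 ^ n * br p.2 ^ (n - 2) = br p.2 ^ (n - 1) * br p.2 ^ (n - 1) := by
          rw [← Real.rpow_add (br_pos _), ← Real.rpow_add (br_pos _)]
          congr 1
          ring
        rw [hz] at hJ
        rw [hb, sub_self, hX1, hX2, hpow]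
        simp only [Fin.sum_univ_two] at hJ ⊢
        push_cast
        linear_combination (n * ((br p.2 ^ (n - 1) : ℝ) : ℂ) * ((br p.2 ^ (n - 1) : ℝ) : ℂ)) * hJ
    rw [hd]
    simp only [ker3, bsym, Fin.sum_univ_two, Fintype.sum_prod_type, A, B, w, g1, g2, h2, msym,
      map_mul, Complex.conj_ofReal, conj_dsym]
    push_cast
    ring
  have hAB : ∀ q, Integrable fun p => A q p - B q p := fun q => (hA q).1.sub (hB q).1
  rw [e, integral_finsetSum _ fun q _ => hAB q] at hsym
  have hfin : |2 * (∫ p : Plane × Plane, ((br p.1 ^ (2 * n) : ℝ) : ℂ) *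
      ker3 (shell k f) F F p).re| ≤ (c1 + c2) * (∑ q, supF (w q)) * M ^ 2 := by
    rw [hsym]
    refine (Complex.abs_re_le_norm _).trans ((norm_sum_le _ _).trans ?_)
    rw [Finset.mul_sum, Finset.sum_mul]
    refine Finset.sum_le_sum fun q _ => ?_
    rw [integral_sub (hA q).1 (hB q).1]
    refine (norm_sub_le _ _).trans ((add_le_add (hA q).2 (hB q).2).trans (le_of_eq ?_))
    ring
  rw [abs_mul, abs_two] at hfin
  have := abs_nonneg (∫ p : Plane × Plane, ((br p.1 ^ (2 * n) : ℝ) : ℂ) *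
      ker3 (shell k f) F F p).re
  linarith

theorem sum_supF_mul_le_dispN {K : ℕ} (f : Plane → ℂ) :
    ∑ k ∈ Finset.range K, ∑ q : Fin 2 × Fin 2,
      supF (fun ξ => msym k (Sum.inr (Sum.inr q)) ξ * shell k f ξ) ≤ dispN K f := by
  rw [dispN]
  refine Finset.sum_le_sum fun k _ => ?_
  rw [Fintype.sum_sum_type, Fintype.sum_sum_type, ← add_assoc]
  refine le_add_of_nonneg_left (add_nonneg ?_ ?_) <;>
  exact Finset.sum_nonneg fun _ _ => supF_nonneg _

/-- The energy estimate in `H^n`. -/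
theorem exists_energy_bound {n : ℝ} (hn : 0 ≤ n) : ∃ C : ℝ, 0 ≤ C ∧
    ∀ (K : ℕ) (f : Plane → ℂ), BL K f → Herm f →
    |(∫ p : Plane × Plane, ((br p.1 ^ (2 * n) : ℝ) : ℂ) * ker3 f f f p).re| ≤
      C * dispN K f * l2 (fun ξ => ((br ξ ^ n : ℝ) : ℂ) * f ξ) ^ 2 := by
  obtain ⟨C1, hC1, hA⟩ := exists_commutator_bound n
  obtain ⟨C2, hC2, hR⟩ := exists_remainder_bound hn
  refine ⟨C1 + C2, by positivity, fun K f hf hherm => ?_⟩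
  have hint : ∀ (a g h : Plane → ℂ), BL K a → BL K g → BL K h →
      Integrable fun p : Plane × Plane => ((br p.1 ^ (2 * n) : ℝ) : ℂ) * ker3 a g h p := by
    intro a g h ha hg hh
    have : (fun p : Plane × Plane => ((br p.1 ^ (2 * n) : ℝ) : ℂ) * ker3 a g h p) =
        ker3 a g fun ξ => ((br ξ ^ (2 * n) : ℝ) : ℂ) * h ξ := by
      ext p
      simp only [ker3, map_mul, Complex.conj_ofReal]
      ring
    rw [this]
    exact integrable_ker3 ha.integrable (fun l => (hg.dsym_mul l).memLp) (hh.br_rpow_mul _).memLp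
  set M := l2 (fun ξ => ((br ξ ^ n : ℝ) : ℂ) * f ξ) with hM
  -- Taking h = br^n f doubles the weight: the factor br ξ^n of the form and that of h combine to br
  -- ξ^{2n}.
  have hR' := hR K f _ hf (hf.br_rpow_mul n).memLp
  have e0 : (fun p : Plane × Plane => ((br p.1 ^ n : ℝ) : ℂ) *
      ker3 f f (fun ξ => ((br ξ ^ n : ℝ) : ℂ) * f ξ) p) =
      fun p => ((br p.1 ^ (2 * n) : ℝ) : ℂ) * ker3 f f f p := by
    ext p
    rw [two_mul, Real.rpow_add (br_pos _)]
    simp only [ker3, map_mul, Complex.conj_ofReal]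
    push_cast
    ring
  simp only [e0] at hR'
  have hi := hint f f f hf hf hf
  rw [← integral_add_compl measurableSet_farRegion hi, ← integral_indicator measurableSet_farRegion,
    ← integral_indicator measurableSet_farRegion.compl, Complex.add_re]
  -- The far region imposes the same condition on ξ and on η, so for each advecting shell the form
  -- has the same cut-off function in both slots. This keeps the antisymmetry available.
  let F : ℕ → Plane → ℂ := fun k => {ξ | k + 3 ≤ blk ξ}.indicator f
  have hF : ∀ k, BL K (F k) := fun k =>
    hf.indicator (measurableSet_le measurable_const (by fun_prop))
  have e : (fun p : Plane × Plane => {p | farRegion p}.indicator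
      (fun p => ((br p.1 ^ (2 * n) : ℝ) : ℂ) * ker3 f f f p) p) = fun p =>
      ∑ k ∈ Finset.range K, ((br p.1 ^ (2 * n) : ℝ) : ℂ) * ker3 (shell k f) (F k) (F k) p := by
    ext p
    by_cases ha : blk (p.1 - p.2) < K
    · rw [Finset.sum_eq_single_of_mem (blk (p.1 - p.2)) (Finset.mem_range.2 ha)]
      · by_cases hp : farRegion p
        · rw [Set.indicator_of_mem (by exact hp)]
          simp [ker3, shell, F, hp.1, hp.2]
        · rw [Set.indicator_of_notMem (by exact hp)]
          unfold farRegion at hp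
          rcases not_and_or.1 hp with h | h <;> simp [ker3, F, h]
      · intro k _ hk
        simp [ker3, shell, hk.symm]
    · have h0 := hf.supp _ (not_lt.1 ha)
      rw [Finset.sum_eq_zero]
      · simp [ker3, h0]
      · intro k _
        simp [ker3, shell, h0]
  have hI : |(∫ p : Plane × Plane, {p | farRegion p}.indicator
      (fun p => ((br p.1 ^ (2 * n) : ℝ) : ℂ) * ker3 f f f p) p).re| ≤ C1 * dispN K f * M ^ 2 := by
    rw [e, integral_finsetSum _ fun k _ => hint _ _ _ (hf.shell k) (hF k) (hF k), Complex.re_sum]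
    refine (Finset.abs_sum_le_sum_abs _ _).trans ((Finset.sum_le_sum fun k _ =>
      hA K f hf hherm k).trans ?_)
    rw [← Finset.sum_mul, ← Finset.mul_sum]
    gcongr
    exact sum_supF_mul_le_dispN f
  refine (abs_add_le _ _).trans ((add_le_add hI ((Complex.abs_re_le_norm _).trans hR')).trans
    (le_of_eq ?_))
  rw [hM]
  ring

/-! ### Energy estimates for frequency tails. -/

/-- The weight `x ^ m / (x ^ 2 + R)`. -/
def wt (m R x : ℝ) : ℝ := x ^ m / (x ^ 2 + R)

theorem wt_nonneg {m R x : ℝ} (hR : 0 ≤ R) (hx : 0 ≤ x) : 0 ≤ wt m R x := by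
  unfold wt
  have := Real.rpow_nonneg hx m
  positivity

/-- The weight is x^{m-2} times x²/(x² + R), and both factors are nondecreasing. -/
theorem wt_mono {m R x y : ℝ} (hm : 2 ≤ m) (hR : 0 ≤ R) (hx : 0 < x) (hxy : x ≤ y) :
    wt m R x ≤ wt m R y := by
  have hy := hx.trans_le hxy
  have e : ∀ z : ℝ, 0 < z → wt m R z = z ^ (m - 2) * (z ^ 2 / (z ^ 2 + R)) := fun z hz => by
    have : z ^ m = z ^ (m - 2) * z ^ 2 := by
      rw [← Real.rpow_natCast, ← Real.rpow_add hz]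
      congr 1
      push_cast
      ring
    rw [wt, this, mul_div_assoc]
  rw [e x hx, e y hy]
  have h1 : x ^ (m - 2) ≤ y ^ (m - 2) := Real.rpow_le_rpow hx.le hxy (by linarith)
  have h2 : x ^ 2 / (x ^ 2 + R) ≤ y ^ 2 / (y ^ 2 + R) := by
    rw [div_le_div_iff₀ (by positivity) (by positivity)]
    have : x ^ 2 ≤ y ^ 2 := by gcongr
    nlinarith
  have h3 : 0 ≤ x ^ 2 / (x ^ 2 + R) := by positivity
  exact mul_le_mul h1 h2 h3 (Real.rpow_nonneg hy.le _)

theorem wt_two_mul_le {m R x : ℝ} (hR : 0 ≤ R) (hx : 0 < x) :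
    wt m R (2 * x) ≤ 2 ^ m * wt m R x := by
  rw [wt, wt, Real.mul_rpow (by norm_num) hx.le, mul_div_assoc]
  have := Real.rpow_nonneg hx.le m
  gcongr
  nlinarith

/-- Bernoulli's inequality for the ratio y/x. -/
theorem rpow_sub_rpow_le {m x y : ℝ} (hm : 1 ≤ m) (hy : 0 < y) (hyx : y ≤ x) :
    x ^ m - y ^ m ≤ m * x ^ (m - 1) * (x - y) := by
  have hx := hy.trans_le hyx
  have h := one_add_mul_self_le_rpow_one_add (s := y / x - 1) (by
    have : 0 ≤ y / x := by positivity
    linarith) hm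
  rw [add_sub_cancel, Real.div_rpow hy.le hx.le] at h
  have hxm := Real.rpow_pos_of_pos hx m
  rw [le_div_iff₀ hxm] at h
  have e : x ^ m = x ^ (m - 1) * x := by
    rw [← Real.rpow_add_one hx.ne']
    simp
  have e2 : (1 + m * (y / x - 1)) * x ^ m = x ^ m - m * x ^ (m - 1) * (x - y) := by
    rw [e]
    field_simp
    ring
  rw [e2] at h
  linarith

/-- Differences of the weight are controlled uniformly in `R`. -/
theorem wt_sub_mul_le {m R u v z : ℝ} (hm : 2 ≤ m) (hR : 0 ≤ R) (hv : 0 < v) (hz : 0 < z)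
    (hvu : v ≤ u) (huvz : u - v ≤ z) :
    (wt m R u - wt m R v) * v ≤ m * 2 ^ m * (z * (√(wt m R u) * √(wt m R v)) +
      v * (√(wt m R z) * √(wt m R u))) := by
  have hu := hv.trans_le hvu
  have gu := wt_nonneg (m := m) hR hu.le
  have gv := wt_nonneg (m := m) hR hv.le
  have gz := wt_nonneg (m := m) hR hz.le
  have hmono := wt_mono hm hR hv hvu
  have h2m : (0 : ℝ) < 2 ^ m := by positivity
  have hsu := Real.sqrt_nonneg (wt m R u)
  have hsv := Real.sqrt_nonneg (wt m R v)
  have hsz := Real.sqrt_nonneg (wt m R z)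
  rw [mul_add]
  -- If u ≤ 2v, the denominator is frozen at v and the mean value bound applies to the powers. If u
  -- > 2v, then z ≥ u - v ≥ u/2, so the weight at u is at most 2^m times the weight at z and
  -- cancellation is not needed.
  rcases le_total u (2 * v) with h | h
  · have h1 : wt m R u - wt m R v ≤ (u ^ m - v ^ m) / (v ^ 2 + R) := by
      rw [sub_div]
      apply sub_le_sub_right
      unfold wt
      have := Real.rpow_nonneg hu.le m
      gcongr
    have h2 : u ^ m - v ^ m ≤ m * (2 ^ m * v ^ (m - 1)) * z := by
      refine (rpow_sub_rpow_le (by linarith) hv hvu).trans ?_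
      have : u ^ (m - 1) ≤ 2 ^ m * v ^ (m - 1) := by
        refine (Real.rpow_le_rpow hu.le h (by linarith)).trans ?_
        rw [Real.mul_rpow (by norm_num) hv.le]
        have := Real.rpow_nonneg hv.le (m - 1)
        gcongr
        · norm_num
        · linarith
      have h0 := Real.rpow_nonneg hu.le (m - 1)
      have : 0 ≤ u - v := by linarith
      gcongr
    have e : v ^ m = v ^ (m - 1) * v := by
      rw [← Real.rpow_add_one hv.ne']
      simp
    have h3 : (wt m R u - wt m R v) * v ≤ m * 2 ^ m * (z * wt m R v) := by
      calc _ ≤ (m * (2 ^ m * v ^ (m - 1)) * z) / (v ^ 2 + R) * v := by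
            refine mul_le_mul_of_nonneg_right (h1.trans ?_) hv.le
            gcongr
        _ = _ := by
            rw [wt, e]
            ring
    have h4 : wt m R v ≤ √(wt m R u) * √(wt m R v) := by
      nth_rewrite 1 [← Real.mul_self_sqrt gv]
      gcongr
    have h5 : m * 2 ^ m * (z * wt m R v) ≤ m * 2 ^ m * (z * (√(wt m R u) * √(wt m R v))) := by
      gcongr
    have h6 : 0 ≤ m * 2 ^ m * (v * (√(wt m R z) * √(wt m R u))) := by positivity
    linarith
  · have hu2 : u ≤ 2 * z := by linarith
    have h1 : wt m R u ≤ 2 ^ m * wt m R z := (wt_mono hm hR hu hu2).trans (wt_two_mul_le hR hz)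
    have h2 : √(wt m R u) ≤ 2 ^ m * √(wt m R z) := by
      refine (Real.sqrt_le_sqrt h1).trans ?_
      rw [Real.sqrt_mul h2m.le]
      have : √((2 : ℝ) ^ m) ≤ 2 ^ m := by
        rw [Real.sqrt_le_left h2m.le]
        have : (1 : ℝ) ≤ 2 ^ m := Real.one_le_rpow (by norm_num) (by linarith)
        nlinarith
      gcongr
    have h3 : wt m R u ≤ 2 ^ m * (√(wt m R z) * √(wt m R u)) := by
      nth_rewrite 1 [← Real.mul_self_sqrt gu]
      rw [← mul_assoc]
      gcongr
    have h4 : (wt m R u - wt m R v) * v ≤ 2 ^ m * (v * (√(wt m R z) * √(wt m R u))) := by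
      have : (wt m R u - wt m R v) * v ≤ wt m R u * v := by gcongr; linarith
      refine this.trans ((mul_le_mul_of_nonneg_right h3 hv.le).trans (le_of_eq ?_))
      ring
    have h5 : 0 ≤ 2 ^ m * (v * (√(wt m R z) * √(wt m R u))) := by positivity
    have h6 : 0 ≤ m * 2 ^ m * (z * (√(wt m R u) * √(wt m R v))) := by positivity
    nlinarith

theorem abs_wt_sub_mul_le {m R u v z : ℝ} (hm : 2 ≤ m) (hR : 0 ≤ R) (hu : 0 < u) (hv : 0 < v)
    (hz : 0 < z) (h1 : u - v ≤ z) (h2 : v - u ≤ z) :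
    |wt m R u - wt m R v| * min u v ≤ m * 2 ^ m * (z * (√(wt m R u) * √(wt m R v)) +
      v * (√(wt m R z) * √(wt m R u)) + u * (√(wt m R z) * √(wt m R v))) := by
  have hsu := Real.sqrt_nonneg (wt m R u)
  have hsv := Real.sqrt_nonneg (wt m R v)
  have hsz := Real.sqrt_nonneg (wt m R z)
  have h2m : (0 : ℝ) < 2 ^ m := by positivity
  have hm0 : 0 ≤ m := by linarith
  rcases le_total v u with h | h
  · rw [min_eq_right h, abs_of_nonneg (sub_nonneg.2 (wt_mono hm hR hv h))]
    have := wt_sub_mul_le hm hR hv hz h h1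
    have h0 : 0 ≤ m * 2 ^ m * (u * (√(wt m R z) * √(wt m R v))) := by positivity
    linarith
  · rw [min_eq_left h, abs_sub_comm, abs_of_nonneg (sub_nonneg.2 (wt_mono hm hR hu h))]
    have := wt_sub_mul_le hm hR hu hz h h2
    have h0 : 0 ≤ m * 2 ^ m * (v * (√(wt m R z) * √(wt m R u))) := by positivity
    linarith

/-- By incompressibility the derivative may be placed at whichever of the two frequencies is
smaller. -/
theorem norm_bsym_sub_le_min (ξ η : Plane) : ‖bsym (ξ - η) η‖ ≤ 2 * min (br ξ) (br η) := by
  rcases le_total (br ξ) (br η) with h | h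
  · rw [min_eq_left h, ← bsym_sub_left]
    exact norm_bsym_le _ _
  · rw [min_eq_right h]
    exact norm_bsym_le _ _

theorem measurable_wt_br (m R : ℝ) : Measurable fun ξ => wt m R (br ξ) := by
  unfold wt
  fun_prop

theorem measurable_sqrt_wt_br (m R : ℝ) : Measurable fun ξ => √(wt m R (br ξ)) :=
  (measurable_wt_br m R).sqrt

theorem integrable_trilinear_norm {w g h : Plane → ℂ} (hw : Integrable w) (hg : MemLp g 2)
    (hh : MemLp h 2) :
    (Integrable fun p : Plane × Plane => ‖w (p.1 - p.2)‖ * ‖g p.2‖ * ‖h p.1‖) ∧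
    ∫ p : Plane × Plane, ‖w (p.1 - p.2)‖ * ‖g p.2‖ * ‖h p.1‖ ≤ (∫ ξ, ‖w ξ‖) * l2 g * l2 h := by
  have h1 := (integrable_trilinear hw hg hh).norm
  simp only [norm_mul, RCLike.norm_conj] at h1
  refine ⟨h1, ?_⟩
  have key := norm_trilinear_le_integral (w := fun ξ => (‖w ξ‖ : ℂ)) (g := fun ξ => (‖g ξ‖ : ℂ))
    (h := fun ξ => (‖h ξ‖ : ℂ)) hw.norm.ofReal hg.norm.ofReal hh.norm.ofReal
  have l2n : ∀ {f : Plane → ℂ}, MemLp f 2 → l2 (fun ξ => (‖f ξ‖ : ℂ)) = l2 f := fun {f} hf => by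
    refine le_antisymm (l2_le_of_norm_le hf fun ξ => by simp)
      (l2_le_of_norm_le hf.norm.ofReal fun ξ => by simp)
  simp only [Complex.conj_ofReal, Complex.norm_real, norm_norm, l2n hg, l2n hh] at key
  refine le_trans (le_trans (le_abs_self _) (le_of_eq ?_)) key
  rw [← Real.norm_eq_abs, ← Complex.norm_real, ← integral_complex_ofReal]
  push_cast
  rfl

/-- The energy estimate with the weight `wt`, uniform in the parameter `R`. -/
theorem weighted_energy_bound {m R : ℝ} (hm : 2 ≤ m) (hR : 0 ≤ R) {K : ℕ} {f : Plane → ℂ}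
    (hf : BL K f) (hherm : Herm f) :
    |(∫ p : Plane × Plane, ((wt m R (br p.1) : ℝ) : ℂ) * ker3 f f f p).re| ≤
      (3 * (m * 2 ^ m)) * (∫ ξ, ‖(br ξ : ℂ) * f ξ‖) *
        l2 (fun ξ => ((√(wt m R (br ξ)) : ℝ) : ℂ) * f ξ) ^ 2 := by
  have hm0 : 0 ≤ m := by linarith
  have h2m : (0 : ℝ) < 2 ^ m := by positivity
  have hbd : ∀ ξ, blk ξ < K → wt m R (br ξ) ≤ wt m R (2 ^ K) := fun ξ h =>
    wt_mono hm hR (br_pos ξ) (br_le_of_blk_lt h)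
  have hQ : BL K fun ξ => ((wt m R (br ξ) : ℝ) : ℂ) * f ξ :=
    hf.mul (Complex.measurable_ofReal.comp (measurable_wt_br m R)) fun ξ h => by
      rw [Complex.norm_real, Real.norm_of_nonneg (wt_nonneg hR (br_pos ξ).le)]
      exact hbd ξ h
  obtain ⟨g, hg⟩ : ∃ g, g = fun ξ => ((√(wt m R (br ξ)) : ℝ) : ℂ) * f ξ := ⟨_, rfl⟩
  have hgB : BL K g := by
    rw [hg]
    exact hf.mul (Complex.measurable_ofReal.comp (measurable_sqrt_wt_br m R)) fun ξ h => by
      rw [Complex.norm_real, Real.norm_of_nonneg (Real.sqrt_nonneg _)]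
      exact Real.sqrt_le_sqrt (hbd ξ h)
  have ng : ∀ ξ, ‖g ξ‖ = √(wt m R (br ξ)) * ‖f ξ‖ := fun ξ => by
    rw [hg, norm_mul, Complex.norm_real, Real.norm_of_nonneg (Real.sqrt_nonneg _)]
  obtain ⟨w, hw⟩ : ∃ w, w = fun ξ => (br ξ : ℂ) * f ξ := ⟨_, rfl⟩
  have hwB : BL K w := by
    rw [hw]
    exact hf.mul (by fun_prop) fun ξ h => by
      rw [Complex.norm_real, Real.norm_of_nonneg (br_pos ξ).le]
      exact br_le_of_blk_lt h
  have nw : ∀ ξ, ‖w ξ‖ = br ξ * ‖f ξ‖ := fun ξ => by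
    rw [hw, norm_mul, Complex.norm_real, Real.norm_of_nonneg (br_pos ξ).le]
  have ew : (fun ξ => ‖(br ξ : ℂ) * f ξ‖) = fun ξ => ‖w ξ‖ := by rw [hw]
  rw [← hg, ew]
  have nneg : ∀ ξ, ‖f (-ξ)‖ = ‖f ξ‖ := fun ξ => by rw [hherm, RCLike.norm_conj]
  have hi1 : Integrable fun p : Plane × Plane => ((wt m R (br p.1) : ℝ) : ℂ) * ker3 f f f p := by
    have : (fun p : Plane × Plane => ((wt m R (br p.1) : ℝ) : ℂ) * ker3 f f f p) =
        ker3 f f fun ξ => ((wt m R (br ξ) : ℝ) : ℂ) * f ξ := by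
      ext p
      simp only [ker3, map_mul, Complex.conj_ofReal]
      ring
    rw [this]
    exact integrable_ker3 hf.integrable (fun l => (hf.dsym_mul l).memLp) hQ.memLp
  have hi2 : Integrable fun p : Plane × Plane => ((wt m R (br p.2) : ℝ) : ℂ) * ker3 f f f p := by
    have : (fun p : Plane × Plane => ((wt m R (br p.2) : ℝ) : ℂ) * ker3 f f f p) =
        ker3 f (fun ξ => ((wt m R (br ξ) : ℝ) : ℂ) * f ξ) f := by
      ext p
      simp only [ker3]
      ring
    rw [this]
    exact integrable_ker3 hf.integrable (fun l => (hQ.dsym_mul l).memLp) hf.memLp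
  have hsym := re_integral_ker3_symm hherm f (fun ξ _ => wt m R (br ξ)) hi1 hi2
  have t1 := integrable_trilinear_norm hwB.integrable hgB.memLp hgB.memLp
  let T : Plane × Plane → ℝ := fun p => ‖w (p.1 - p.2)‖ * ‖g p.2‖ * ‖g p.1‖
  have ht1 : Integrable T ∧ ∫ p, T p ≤ (∫ ξ, ‖w ξ‖) * l2 g * l2 g := t1
  -- The three densities differ by which of the frequencies ξ - η, η, ξ carries the L¹ factor w.
  -- They are permuted by measure preserving maps, using that |g| is even, so all have the same
  -- integral.
  let T2 : Plane × Plane → ℝ := fun p => ‖w p.2‖ * ‖g (p.1 - p.2)‖ * ‖g p.1‖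
  let T3 : Plane × Plane → ℝ := fun p => ‖w p.1‖ * ‖g (p.1 - p.2)‖ * ‖g p.2‖
  have e2 : T2 = fun p => T (subEquiv p) := by
    ext p
    simp [T, T2, subEquiv]
  have gneg : ∀ ξ, ‖g (-ξ)‖ = ‖g ξ‖ := fun ξ => by rw [ng, ng, br_neg, nneg]
  have e3 : T3 = fun p => T2 p.swap := by
    ext p
    simp only [T3, T2, Prod.fst_swap, Prod.snd_swap]
    rw [← gneg (p.1 - p.2), neg_sub]
  have i2 : Integrable T2 ∧ ∫ p, T2 p = ∫ p, T p := by
    rw [e2]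
    exact ⟨(measurePreserving_subEquiv.integrable_comp_emb
      subEquiv.measurableEmbedding).2 t1.1, measurePreserving_subEquiv.integral_comp' T⟩
  have i3 : Integrable T3 ∧ ∫ p, T3 p = ∫ p, T2 p := by
    rw [e3]
    exact ⟨i2.1.swap, integral_prod_swap T2⟩
  have hpt : ∀ p : Plane × Plane, ‖((wt m R (br p.1) - wt m R (br p.2) : ℝ) : ℂ) * ker3 f f f p‖ ≤
      2 * (m * 2 ^ m) * (T p + T2 p + T3 p) := by
    intro p
    have h1 : br p.1 - br p.2 ≤ br (p.1 - p.2) := by linarith [br_le_add_br p.1 p.2]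
    have h2 : br p.2 - br p.1 ≤ br (p.1 - p.2) := by
      have := br_le_add_br p.2 p.1
      rw [← br_neg (p.2 - p.1), neg_sub] at this
      linarith
    have k1 := abs_wt_sub_mul_le hm hR (br_pos p.1) (br_pos p.2) (br_pos (p.1 - p.2)) h1 h2
    have k2 := norm_bsym_sub_le_min p.1 p.2
    simp only [T, T2, T3, ng, nw]
    rw [norm_mul, Complex.norm_real, Real.norm_eq_abs, ker3, norm_mul, norm_mul, norm_mul,
      RCLike.norm_conj]
    have h0 : 0 ≤ ‖f (p.1 - p.2)‖ * ‖f p.2‖ * ‖f p.1‖ := by positivity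
    calc |wt m R (br p.1) - wt m R (br p.2)| * (‖bsym (p.1 - p.2) p.2‖ * ‖f (p.1 - p.2)‖ *
          ‖f p.2‖ * ‖f p.1‖) = |wt m R (br p.1) - wt m R (br p.2)| * ‖bsym (p.1 - p.2) p.2‖ *
            (‖f (p.1 - p.2)‖ * ‖f p.2‖ * ‖f p.1‖) := by ring
      _ ≤ |wt m R (br p.1) - wt m R (br p.2)| * (2 * min (br p.1) (br p.2)) *
            (‖f (p.1 - p.2)‖ * ‖f p.2‖ * ‖f p.1‖) := by gcongr
      _ = 2 * (|wt m R (br p.1) - wt m R (br p.2)| * min (br p.1) (br p.2)) *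
            (‖f (p.1 - p.2)‖ * ‖f p.2‖ * ‖f p.1‖) := by ring
      _ ≤ _ := mul_le_mul_of_nonneg_right (mul_le_mul_of_nonneg_left k1 zero_le_two) h0
      _ = _ := by ring
  have hfin : |2 * (∫ p : Plane × Plane, ((wt m R (br p.1) : ℝ) : ℂ) * ker3 f f f p).re| ≤
      2 * (m * 2 ^ m) * (3 * ((∫ ξ, ‖w ξ‖) * l2 g * l2 g)) := by
    rw [hsym]
    refine (Complex.abs_re_le_norm _).trans ((norm_integral_le_of_norm_le
      (((ht1.1.add i2.1).add i3.1).const_mul (2 * (m * 2 ^ m))) (by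
        filter_upwards with p using hpt p)).trans ?_)
    rw [integral_const_mul]
    have : ∫ p, (T + T2 + T3) p = (∫ p, T p) + (∫ p, T p) + ∫ p, T p := by
      rw [integral_add' (ht1.1.add i2.1) i3.1, integral_add' ht1.1 i2.1, i3.2, i2.2]
    gcongr
    refine (le_of_eq this).trans ?_
    linarith [ht1.2]
  rw [abs_mul, abs_two] at hfin
  linarith

/-! ### Oscillatory integrals and dispersive decay. -/

/-- The stationary points of the phase are the end points 0 and π. Intervals of length δ = A^{-1/2}
there are estimated trivially. In between, integration by parts gains 1/(A sin θ), of order 1/(Aδ) =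
δ. For A < 1 the trivial bound is enough. -/
theorem norm_integral_exp_cos_half_le {A : ℝ} (hA : 0 < A) :
    ‖∫ θ in (0 : ℝ)..Real.pi, Complex.exp (((A * Real.cos θ : ℝ) : ℂ) * Complex.I)‖ ≤
      10 * A ^ (-(1 / 2) : ℝ) := by
  have hπ := Real.pi_pos
  have hcont : Continuous fun θ : ℝ => Complex.exp (((A * Real.cos θ : ℝ) : ℂ) * Complex.I) := by
    fun_prop
  have hn : ∀ θ : ℝ, ‖Complex.exp (((A * Real.cos θ : ℝ) : ℂ) * Complex.I)‖ = 1 := fun θ =>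
    Complex.norm_exp_ofReal_mul_I _
  have hbd : ∀ a b : ℝ, ‖∫ θ in a..b, Complex.exp (((A * Real.cos θ : ℝ) : ℂ) * Complex.I)‖ ≤
      1 * |b - a| := fun a b =>
    intervalIntegral.norm_integral_le_of_norm_le_const fun θ _ => (hn θ).le
  rcases lt_or_ge A 1 with h1 | h1
  · refine (hbd _ _).trans ?_
    have : (1 : ℝ) ≤ A ^ (-(1 / 2) : ℝ) :=
      Real.one_le_rpow_of_pos_of_le_one_of_nonpos hA h1.le (by norm_num)
    rw [sub_zero, abs_of_pos hπ]
    linarith [Real.pi_lt_four]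
  obtain ⟨δ, hδ⟩ : ∃ δ, δ = A ^ (-(1 / 2) : ℝ) := ⟨_, rfl⟩
  have hδ0 : 0 < δ := hδ ▸ Real.rpow_pos_of_pos hA _
  have hδ1 : δ ≤ 1 := hδ ▸ Real.rpow_le_one_of_one_le_of_nonpos h1 (by norm_num)
  have hδA : A * (δ * δ) = 1 := by
    rw [hδ, ← Real.rpow_add hA]
    norm_num
    rw [Real.rpow_neg_one, mul_inv_cancel₀ hA.ne']
  rw [← hδ]
  have hπ3 := Real.pi_gt_three
  have hπ4 := Real.pi_lt_four
  have hsin : δ / 2 ≤ Real.sin δ := by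
    have := Real.mul_le_sin hδ0.le (by linarith)
    refine le_trans ?_ this
    have h2 : (1 : ℝ) / 2 ≤ 2 / Real.pi := by
      rw [div_le_div_iff₀ (by norm_num) hπ]
      linarith
    nlinarith
  have hsin0 : 0 < Real.sin δ := by linarith
  have hpos : ∀ θ ∈ Set.uIcc δ (Real.pi - δ), 0 < Real.sin θ := fun θ hθ => by
    rw [Set.uIcc_of_le (by linarith)] at hθ
    exact Real.sin_pos_of_pos_of_lt_pi (by linarith [hθ.1]) (by linarith [hθ.2])
  obtain ⟨e, he⟩ : ∃ e : ℝ → ℂ, e = fun θ => Complex.exp (((A * Real.cos θ : ℝ) : ℂ) * Complex.I) :=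
    ⟨_, rfl⟩
  have hen : ∀ θ, ‖e θ‖ = 1 := fun θ => by rw [he]; exact hn θ
  have hec : Continuous e := by rw [he]; exact hcont
  have hed : ∀ θ, HasDerivAt e (e θ * (((A * -Real.sin θ : ℝ) : ℂ) * Complex.I)) θ := fun θ => by
    rw [he]
    have h2 : HasDerivAt (fun θ : ℝ => ((A * Real.cos θ : ℝ) : ℂ) * Complex.I)
        (((A * -Real.sin θ : ℝ) : ℂ) * Complex.I) θ :=
      (((Real.hasDerivAt_cos θ).const_mul A).ofReal_comp).mul_const Complex.I
    exact h2.cexp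
  -- After integration by parts the remaining integrand is at most 1/sin², whose primitive is -cot;
  -- this gives 2 cot δ ≤ 2/sin δ.
  have hcot : ∀ θ ∈ Set.uIcc δ (Real.pi - δ),
      HasDerivAt (fun θ => -(Real.cos θ / Real.sin θ)) (1 / Real.sin θ ^ 2) θ := fun θ hθ => by
    have h0 := (hpos θ hθ).ne'
    have h2 := ((Real.hasDerivAt_cos θ).div (Real.hasDerivAt_sin θ) h0).neg
    refine HasDerivAt.congr_deriv h2 ?_
    field_simp
    linarith [Real.sin_sq_add_cos_sq θ]
  have hgd : ∀ θ ∈ Set.uIcc δ (Real.pi - δ), HasDerivAt (fun θ => e θ / (Real.sin θ : ℂ))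
      (-(A : ℂ) * Complex.I * e θ - e θ * ((Real.cos θ / Real.sin θ ^ 2 : ℝ) : ℂ)) θ :=
    fun θ hθ => by
    have h0 : ((Real.sin θ : ℝ) : ℂ) ≠ 0 := by exact_mod_cast (hpos θ hθ).ne'
    have h2 := (hed θ).div ((Real.hasDerivAt_sin θ).ofReal_comp) h0
    refine HasDerivAt.congr_deriv h2 ?_
    push_cast
    push_cast at h0
    field_simp
  have hc1 : ContinuousOn (fun θ => e θ * ((Real.cos θ / Real.sin θ ^ 2 : ℝ) : ℂ))
      (Set.uIcc δ (Real.pi - δ)) := by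
    refine hec.continuousOn.mul (Complex.continuous_ofReal.comp_continuousOn ?_)
    exact Real.continuous_cos.continuousOn.div (by fun_prop) fun θ hθ => by
      have := hpos θ hθ
      positivity
  have hc2 : ContinuousOn (fun θ => 1 / Real.sin θ ^ 2) (Set.uIcc δ (Real.pi - δ)) :=
    continuousOn_const.div (by fun_prop) fun θ hθ => by
      have := hpos θ hθ
      positivity
  have hc3 : ContinuousOn (fun θ => -(A : ℂ) * Complex.I * e θ) (Set.uIcc δ (Real.pi - δ)) :=
    continuousOn_const.mul hec.continuousOn
  have hI := intervalIntegral.integral_eq_sub_of_hasDerivAt hgd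
    ((hc3.sub hc1).intervalIntegrable)
  rw [intervalIntegral.integral_sub hc3.intervalIntegrable
    hc1.intervalIntegrable, intervalIntegral.integral_const_mul] at hI
  have hI2 := intervalIntegral.integral_eq_sub_of_hasDerivAt hcot hc2.intervalIntegrable
  have hb1 : ‖∫ θ in δ..(Real.pi - δ), e θ * ((Real.cos θ / Real.sin θ ^ 2 : ℝ) : ℂ)‖ ≤
      2 / Real.sin δ := by
    refine (intervalIntegral.norm_integral_le_of_norm_le (by linarith)
      (g := fun θ => 1 / Real.sin θ ^ 2) ?_ hc2.intervalIntegrable).trans ?_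
    · filter_upwards with θ hθ
      rw [norm_mul, hen, one_mul, Complex.norm_real, norm_div, norm_pow, Real.norm_eq_abs,
        Real.norm_eq_abs, sq_abs]
      gcongr
      exact Real.abs_cos_le_one θ
    · rw [hI2, Real.cos_pi_sub, Real.sin_pi_sub]
      have := Real.cos_le_one δ
      rw [div_eq_mul_inv, div_eq_mul_inv, div_eq_mul_inv]
      have h3 : 0 < (Real.sin δ)⁻¹ := by positivity
      nlinarith
  have hb2 : A * ‖∫ θ in δ..(Real.pi - δ), e θ‖ ≤ 4 / Real.sin δ := by
    have h4 : -(A : ℂ) * Complex.I * ∫ θ in δ..(Real.pi - δ), e θ =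
        e (Real.pi - δ) / (Real.sin (Real.pi - δ) : ℂ) - e δ / (Real.sin δ : ℂ) +
        ∫ θ in δ..(Real.pi - δ), e θ * ((Real.cos θ / Real.sin θ ^ 2 : ℝ) : ℂ) := by
      rw [← hI]
      ring
    have h5 := congrArg norm h4
    rw [norm_mul, norm_mul, norm_neg, Complex.norm_I, mul_one, Complex.norm_real,
      Real.norm_of_nonneg hA.le] at h5
    rw [h5, Real.sin_pi_sub]
    refine (norm_add_le _ _).trans ((add_le_add (norm_sub_le _ _) hb1).trans (le_of_eq ?_))
    rw [norm_div, norm_div, hen, hen, Complex.norm_real, Real.norm_of_nonneg hsin0.le]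
    ring
  have hb3 : ‖∫ θ in δ..(Real.pi - δ), e θ‖ ≤ 8 * δ := by
    refine le_of_mul_le_mul_left (hb2.trans ?_) hA
    rw [div_le_iff₀ hsin0]
    calc (4 : ℝ) = 8 * (A * (δ * δ)) / 2 := by rw [hδA]; norm_num
      _ = A * (8 * δ) * (δ / 2) := by ring
      _ ≤ _ := by gcongr
  have hsplit : ∫ θ in (0 : ℝ)..Real.pi, e θ = (∫ θ in (0 : ℝ)..δ, e θ) +
      (∫ θ in δ..(Real.pi - δ), e θ) + ∫ θ in (Real.pi - δ)..Real.pi, e θ := by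
    rw [intervalIntegral.integral_add_adjacent_intervals, intervalIntegral.integral_add_adjacent_intervals]
    all_goals exact hec.intervalIntegrable _ _
  have r1 := hbd 0 δ
  have r2 := hbd (Real.pi - δ) Real.pi
  rw [← he] at r1 r2 ⊢
  rw [hsplit]
  refine norm_add₃_le.trans ?_
  rw [sub_zero, abs_of_pos hδ0] at r1
  rw [sub_sub_cancel, abs_of_pos hδ0] at r2
  linarith

/-- The phase is B cos(θ - ψ) in polar coordinates of a + ib. Periodicity removes ψ, and evenness
reduces the full circle to two copies of [0, π]. -/
theorem norm_integral_exp_cos_add_sin_le {a b A : ℝ} (hA : 0 < A) (h : A ^ 2 ≤ a ^ 2 + b ^ 2) :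
    ‖∫ θ in (-Real.pi)..Real.pi,
      Complex.exp (((a * Real.cos θ + b * Real.sin θ : ℝ) : ℂ) * Complex.I)‖ ≤
      20 * A ^ (-(1 / 2) : ℝ) := by
  obtain ⟨B, ψ, hB, ha, hb⟩ : ∃ B ψ : ℝ, A ≤ B ∧ a = B * Real.cos ψ ∧ b = B * Real.sin ψ := by
    refine ⟨‖(⟨a, b⟩ : ℂ)‖, Complex.arg ⟨a, b⟩, ?_, ?_, ?_⟩
    · rw [Complex.norm_def]
      apply Real.le_sqrt_of_sq_le
      rw [Complex.normSq_mk]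
      linarith
    · rw [Complex.norm_mul_cos_arg]
    · rw [Complex.norm_mul_sin_arg]
  have hB0 := hA.trans_le hB
  let e : ℝ → ℂ := fun θ => Complex.exp (((B * Real.cos θ : ℝ) : ℂ) * Complex.I)
  have hec : Continuous e := by fun_prop
  have e1 : ∀ θ, Complex.exp (((a * Real.cos θ + b * Real.sin θ : ℝ) : ℂ) * Complex.I) =
      e (θ - ψ) := fun θ => by
    simp only [e]
    rw [Real.cos_sub, ha, hb]
    congr 3
    ring
  have hper : Function.Periodic e (2 * Real.pi) := fun θ => by
    simp only [e, Real.cos_add_two_pi]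
  have e2 : ∫ θ in (-Real.pi)..Real.pi, e (θ - ψ) = ∫ θ in (-Real.pi)..Real.pi, e θ := by
    rw [intervalIntegral.integral_comp_sub_right]
    have := hper.intervalIntegral_add_eq (-Real.pi - ψ) (-Real.pi)
    rw [show -Real.pi - ψ + 2 * Real.pi = Real.pi - ψ by ring,
      show -Real.pi + 2 * Real.pi = Real.pi by ring] at this
    exact this
  have e3 : ∫ θ in (-Real.pi)..0, e θ = ∫ θ in (0 : ℝ)..Real.pi, e θ := by
    have := intervalIntegral.integral_comp_neg (f := e) (a := 0) (b := Real.pi)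
    rw [neg_zero] at this
    rw [← this]
    simp only [e, Real.cos_neg]
  simp only [e1]
  rw [e2, ← intervalIntegral.integral_add_adjacent_intervals (b := 0) (hec.intervalIntegrable _ _)
    (hec.intervalIntegrable _ _), e3]
  have h1 := norm_integral_exp_cos_half_le hB0
  have h2 : B ^ (-(1 / 2) : ℝ) ≤ A ^ (-(1 / 2) : ℝ) :=
    Real.rpow_le_rpow_of_nonpos hA hB (by norm_num)
  refine (norm_add_le _ _).trans ?_
  linarith

/-- A majorant of a radial integral with an inverse square root singularity. -/
theorem exists_radial_majorant {W : ℝ → ℝ} (hW : ∀ r, 0 < r → 0 ≤ W r)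
    (hW1 : ∀ r, 0 < r → W r ≤ 1 / r) (hWi : IntegrableOn W (Ioi 0)) {l μ : ℝ} (hl : 0 < l)
    (hμ : 0 ≤ μ) : ∃ M : ℝ → ℝ, IntegrableOn M (Ioi 0) ∧
      (∀ r, 0 < r → l ≠ μ * r → W r * |l - μ * r| ^ (-(1 / 2) : ℝ) ≤ M r) ∧
      ∫ r in Ioi 0, M r ≤ (2 * (∫ r in Ioi 0, W r) + 8) * l ^ (-(1 / 2) : ℝ) := by
  have hl2 : 0 < l ^ (-(1 / 2) : ℝ) := Real.rpow_pos_of_pos hl _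
  have hfar : ∀ r, 0 < r → l / 2 ≤ |l - μ * r| →
      W r * |l - μ * r| ^ (-(1 / 2) : ℝ) ≤ 2 * l ^ (-(1 / 2) : ℝ) * W r := fun r hr h => by
    rw [mul_comm]
    refine mul_le_mul_of_nonneg_right ?_ (hW r hr)
    refine (Real.rpow_le_rpow_of_nonpos (by positivity) h (by norm_num)).trans ?_
    rw [Real.div_rpow hl.le zero_le_two, div_eq_mul_inv, mul_comm, ← Real.rpow_neg zero_le_two]
    have h2 : (2 : ℝ) ^ (-(-(1 / 2)) : ℝ) ≤ 2 ^ (1 : ℝ) :=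
      Real.rpow_le_rpow_of_exponent_le (by norm_num) (by norm_num)
    rw [Real.rpow_one] at h2
    exact mul_le_mul_of_nonneg_right h2 hl2.le
  rcases hμ.eq_or_lt with rfl | hμ
  · refine ⟨fun r => 2 * l ^ (-(1 / 2) : ℝ) * W r, hWi.const_mul _, fun r hr _ => hfar r hr ?_, ?_⟩
    · rw [zero_mul, sub_zero, abs_of_pos hl]
      linarith
    · rw [integral_const_mul]
      nlinarith
  -- The singularity sits at r = a. Where |l - μr| < l/2 one has |r - a| < a/2, so W ≤ 1/r ≤ 2/a
  -- there, while |r - a|^{-1/2} on |r - a| ≤ a integrates to 4√a. The product is 8 l^{-1/2},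
  -- independent of μ.
  obtain ⟨a, ha⟩ : ∃ a, a = l / μ := ⟨_, rfl⟩
  have ha0 : 0 < a := ha ▸ div_pos hl hμ
  have hla : l = μ * a := by rw [ha]; field_simp
  let h : ℝ → ℝ := (Ioc 0 a).indicator fun s => s ^ (-(1 / 2) : ℝ)
  have hval : ∫ s : ℝ, h |s| = 4 * a ^ (1 / 2 : ℝ) := by
    rw [integral_comp_abs, setIntegral_indicator measurableSet_Ioc,
      Set.inter_eq_right.2 Ioc_subset_Ioi_self, ← intervalIntegral.integral_of_le ha0.le,
      integral_rpow (Or.inl (by norm_num))]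
    norm_num
    ring
  -- The integral of a non-integrable function is 0 by convention, so the nonzero value just
  -- computed proves integrability.
  have hi2 : Integrable fun s : ℝ => h |s| := by
    by_contra hc
    rw [integral_undef hc] at hval
    exact absurd hval (by positivity)
  have hnn : ∀ s, 0 ≤ h s := fun s => Set.indicator_nonneg (fun s hs => by
    have := hs.1; positivity) s
  refine ⟨fun r => 2 * l ^ (-(1 / 2) : ℝ) * W r + (2 / a) * μ ^ (-(1 / 2) : ℝ) * h |r - a|,
    (hWi.const_mul _).add ((hi2.comp_sub_right a).const_mul _).integrableOn, fun r hr hne => ?_, ?_⟩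
  · have e : |l - μ * r| = μ * |r - a| := by
      rw [hla, ← mul_sub, abs_mul, abs_of_pos hμ, abs_sub_comm]
    rcases le_or_gt (l / 2) |l - μ * r| with hc | hc
    · refine (hfar r hr hc).trans (le_add_of_nonneg_right ?_)
      exact mul_nonneg (by positivity) (hnn _)
    · have hp : 0 < |r - a| := by
        rw [abs_pos, sub_ne_zero]
        rintro rfl
        exact hne hla
      have h1 : |r - a| < a / 2 := by
        rw [e, hla] at hc
        have : μ * |r - a| < μ * (a / 2) := by linarith
        exact lt_of_mul_lt_mul_left this hμ.le
      have h2 := (abs_lt.1 h1).1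
      have h3 : W r ≤ 2 / a := (hW1 r hr).trans (by
        rw [div_le_div_iff₀ hr ha0]
        linarith)
      have h4 : h |r - a| = |r - a| ^ (-(1 / 2) : ℝ) :=
        Set.indicator_of_mem (show |r - a| ∈ Ioc 0 a from ⟨hp, by linarith⟩) _
      beta_reduce
      rw [h4, e, Real.mul_rpow hμ.le hp.le]
      have h5 := hW r hr
      have h6 : W r * (μ ^ (-(1 / 2) : ℝ) * |r - a| ^ (-(1 / 2) : ℝ)) ≤
          2 / a * (μ ^ (-(1 / 2) : ℝ) * |r - a| ^ (-(1 / 2) : ℝ)) := by gcongr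
      have h7 : 0 ≤ 2 * l ^ (-(1 / 2) : ℝ) * W r := by positivity
      linarith
  · rw [integral_add (hWi.const_mul _) ((hi2.comp_sub_right a).const_mul _).integrableOn,
      integral_const_mul, integral_const_mul]
    have h1 : ∫ r in Ioi 0, h |r - a| ≤ 4 * a ^ (1 / 2 : ℝ) := by
      rw [← hval, ← integral_sub_right_eq_self (fun s => h |s|) a]
      exact setIntegral_le_integral (hi2.comp_sub_right a) (by filter_upwards with r using hnn _)
    have h2 : 2 / a * μ ^ (-(1 / 2) : ℝ) * (4 * a ^ (1 / 2 : ℝ)) = 8 * l ^ (-(1 / 2) : ℝ) := by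
      rw [hla, Real.mul_rpow hμ.le ha0.le]
      have : a ^ (1 / 2 : ℝ) = a * a ^ (-(1 / 2) : ℝ) := by
        nth_rewrite 2 [← Real.rpow_one a]
        rw [← Real.rpow_add ha0]
        norm_num
      rw [this]
      field_simp
      norm_num
    have h3 : 0 ≤ 2 / a * μ ^ (-(1 / 2) : ℝ) := by positivity
    have h4 := mul_le_mul_of_nonneg_left h1 h3
    rw [h2] at h4
    linarith

/-- The dispersion relation. -/
def disp (ξ : Plane) : ℝ := ξ 0 / ‖ξ‖

@[fun_prop] theorem measurable_disp : Measurable disp := by unfold disp; fun_prop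

theorem integrable_br_rpow {q : ℝ} (hq : 2 < q) : Integrable fun ξ => br ξ ^ (-q) := by
  have h := integrable_rpow_neg_one_add_norm_sq (E := Plane) (μ := volume) (r := q) (by simpa using hq)
  refine h.mono' (measurable_br.pow_const _).aestronglyMeasurable ?_
  filter_upwards with ξ
  rw [Real.norm_of_nonneg (Real.rpow_nonneg (br_pos ξ).le _)]
  have h1 : (1 + ‖ξ‖ ^ 2) ^ (-q / 2) = (√(1 + ‖ξ‖ ^ 2)) ^ (-q) := by
    rw [Real.sqrt_eq_rpow, ← Real.rpow_mul (by positivity)]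
    congr 1
    ring
  rw [h1]
  apply Real.rpow_le_rpow_of_nonpos (by positivity) _ (by linarith)
  apply Real.sqrt_le_sqrt
  unfold J
  have := Real.pi_gt_three
  have h2 : ‖ξ‖ ≤ 2 * Real.pi * ‖ξ‖ := by nlinarith [norm_nonneg ξ]
  gcongr

/-- Polar coordinates in the plane. -/
def polarPt (p : ℝ × ℝ) : Plane := !₂[p.1 * Real.cos p.2, p.1 * Real.sin p.2]

theorem polarPt_eq (p : ℝ × ℝ) :
    Complex.orthonormalBasisOneI.repr (Complex.polarCoord.symm p) = polarPt p := by
  ext i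
  rw [Complex.orthonormalBasisOneI_repr_apply, Complex.polarCoord_symm_apply, polarPt]
  fin_cases i <;> simp [-Complex.ofReal_cos, -Complex.ofReal_sin]

theorem continuous_polarPt : Continuous polarPt := by unfold polarPt; fun_prop

theorem norm_polarPt {p : ℝ × ℝ} (hp : 0 ≤ p.1) : ‖polarPt p‖ = p.1 := by
  rw [EuclideanSpace.norm_eq, Fin.sum_univ_two, polarPt]
  simp only [Matrix.cons_val_zero, Matrix.cons_val_one, Real.norm_eq_abs, sq_abs]
  rw [Real.sqrt_eq_iff_mul_self_eq (by positivity) hp]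
  nlinarith [Real.sin_sq_add_cos_sq p.2]

theorem integral_plane_eq_polar {f : Plane → ℂ} (hf : Integrable f) (hm : Measurable f) :
    ∫ ξ, f ξ = ∫ r in Ioi (0 : ℝ), (r : ℂ) * ∫ θ in (-Real.pi)..Real.pi, f (polarPt (r, θ)) := by
  have hpres := Complex.orthonormalBasisOneI.repr.measurePreserving
  have hemb := Complex.orthonormalBasisOneI.repr.toHomeomorph.measurableEmbedding
  have h1 := hpres.integral_comp hemb f
  have h2 : ∫⁻ z, ‖f (Complex.orthonormalBasisOneI.repr z)‖ₑ = ∫⁻ ξ, ‖f ξ‖ₑ :=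
    hpres.lintegral_comp_emb hemb fun ξ => ‖f ξ‖ₑ
  have htar : polarCoord.target = Ioi (0 : ℝ) ×ˢ Ioo (-Real.pi) Real.pi := rfl
  rw [← Complex.lintegral_comp_polarCoord_symm, htar] at h2
  rw [← h1, ← Complex.integral_comp_polarCoord_symm, htar]
  simp only [polarPt_eq] at h2 ⊢
  have hmeas : Measurable fun p : ℝ × ℝ => p.1 • f (polarPt p) :=
    measurable_fst.smul (hm.comp continuous_polarPt.measurable)
  -- Integrability in the polar variables, needed for Fubini, follows from the change of variables
  -- for the lower Lebesgue integral.
  have hint : IntegrableOn (fun p : ℝ × ℝ => p.1 • f (polarPt p))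
      (Ioi (0 : ℝ) ×ˢ Ioo (-Real.pi) Real.pi) := by
    refine ⟨hmeas.aestronglyMeasurable, ?_⟩
    rw [hasFiniteIntegral_iff_enorm]
    refine lt_of_le_of_lt (le_of_eq ?_) (h2.trans_lt hf.2)
    refine setLIntegral_congr_fun (measurableSet_Ioi.prod measurableSet_Ioo) fun p hp => ?_
    simp only [enorm_smul, smul_eq_mul]
    rw [Real.enorm_of_nonneg (le_of_lt hp.1)]
  rw [Measure.volume_eq_prod] at hint ⊢
  rw [setIntegral_prod _ hint]
  refine setIntegral_congr_fun measurableSet_Ioi fun r _ => ?_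
  simp only [Complex.real_smul]
  rw [integral_const_mul, intervalIntegral.integral_of_le (by linarith [Real.pi_pos]),
    integral_Ioc_eq_integral_Ioo]

/-- The dispersive decay estimate. -/
theorem exists_decay {q : ℝ} (hq : 2 < q) : ∃ C : ℝ, 0 < C ∧ ∀ (x : Plane) (τ : ℝ), τ ≠ 0 →
    ‖∫ ξ, ((br ξ ^ (-q) : ℝ) : ℂ) *
      Complex.exp (((2 * Real.pi * (x 0 * ξ 0 + x 1 * ξ 1) - τ * disp ξ : ℝ) : ℂ) * Complex.I)‖ ≤
      C * |τ| ^ (-(1 / 2) : ℝ) := by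
  let b : ℝ → ℝ := fun r => √(1 + (2 * Real.pi * r) ^ 2)
  have hb1 : ∀ r, 1 ≤ b r := fun r => Real.one_le_sqrt.2 (by nlinarith [sq_nonneg (2 * Real.pi * r)])
  have hb2 : ∀ r, |r| ≤ b r := fun r => by
    apply Real.le_sqrt_of_sq_le
    rw [sq_abs, mul_pow]
    have := Real.pi_gt_three
    nlinarith [sq_nonneg r, mul_nonneg (sq_nonneg r) (sub_nonneg.2 this.le)]
  -- The radial density with the Jacobian r. The condition q > 2 makes it integrable and gives the
  -- bound 1/r.
  let W : ℝ → ℝ := fun r => r * b r ^ (-q)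
  have hW : ∀ r, 0 < r → 0 ≤ W r := fun r hr => by positivity
  have hW1 : ∀ r, 0 < r → W r ≤ 1 / r := fun r hr => by
    have h1 : r ^ 2 ≤ b r ^ q := by
      calc r ^ 2 ≤ b r ^ 2 := by
            have := hb2 r
            rw [abs_of_pos hr] at this
            gcongr
        _ = b r ^ (2 : ℝ) := by norm_cast
        _ ≤ _ := Real.rpow_le_rpow_of_exponent_le (hb1 r) hq.le
    have h2 : 0 < b r ^ q := Real.rpow_pos_of_pos (by linarith [hb1 r]) _
    simp only [W]
    rw [Real.rpow_neg (by linarith [hb1 r]), ← div_eq_mul_inv, div_le_div_iff₀ h2 hr]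
    linarith
  have hbm : Measurable b := by fun_prop
  have hWi : IntegrableOn W (Ioi 0) := by
    have h := integrable_rpow_neg_one_add_norm_sq (E := ℝ) (μ := volume) (r := q - 1)
      (by simp; linarith)
    refine (h.mono' (measurable_id.mul (hbm.pow_const _)).aestronglyMeasurable ?_).integrableOn
    filter_upwards with r
    have hbp : 0 < b r := by linarith [hb1 r]
    simp only [Pi.mul_apply, id]
    rw [norm_mul, Real.norm_of_nonneg (Real.rpow_nonneg hbp.le _)]
    have h1 : (1 + ‖r‖ ^ 2) ^ (-(q - 1) / 2) = (√(1 + ‖r‖ ^ 2)) ^ (-(q - 1)) := by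
      rw [Real.sqrt_eq_rpow, ← Real.rpow_mul (by positivity)]
      congr 1
      ring
    have h2 : √(1 + ‖r‖ ^ 2) ≤ b r := by
      apply Real.sqrt_le_sqrt
      rw [Real.norm_eq_abs, sq_abs, mul_pow]
      have := Real.pi_gt_three
      nlinarith [sq_nonneg r, mul_nonneg (sq_nonneg r) (sub_nonneg.2 this.le)]
    rw [h1]
    refine le_trans ?_ (Real.rpow_le_rpow_of_nonpos (by positivity) h2 (by linarith))
    rw [show -(q - 1) = -q + 1 by ring, Real.rpow_add_one hbp.ne', mul_comm]
    have := Real.rpow_nonneg hbp.le (-q)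
    gcongr
    exact hb2 r
  have hWint : 0 ≤ ∫ r in Ioi 0, W r := setIntegral_nonneg measurableSet_Ioi fun r hr => hW r hr
  refine ⟨20 * (2 * (∫ r in Ioi 0, W r) + 8), by positivity, fun x τ hτ => ?_⟩
  have hτ0 := abs_pos.2 hτ
  obtain ⟨M, hMi, hM, hMint⟩ := exists_radial_majorant hW hW1 hWi hτ0
    (μ := 2 * Real.pi * ‖x‖) (by positivity)
  rw [integral_plane_eq_polar]
  · have key : ∀ᵐ r : ℝ ∂(volume.restrict (Ioi (0 : ℝ))), ‖(r : ℂ) * ∫ θ in (-Real.pi)..Real.pi,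
        ((br (polarPt (r, θ)) ^ (-q) : ℝ) : ℂ) * Complex.exp (((2 * Real.pi *
          (x 0 * polarPt (r, θ) 0 + x 1 * polarPt (r, θ) 1) - τ * disp (polarPt (r, θ)) : ℝ) : ℂ) *
          Complex.I)‖ ≤ 20 * M r := by
      have hne : ∀ᵐ r : ℝ ∂(volume.restrict (Ioi (0 : ℝ))), |τ| ≠ 2 * Real.pi * ‖x‖ * r := by
        apply ae_restrict_of_ae
        rcases eq_or_ne (2 * Real.pi * ‖x‖) 0 with h0 | h0
        · filter_upwards with r
          rw [h0, zero_mul]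
          exact hτ0.ne'
        · have : ∀ᵐ r : ℝ, r ≠ |τ| / (2 * Real.pi * ‖x‖) := by
            simp [ae_iff]
          filter_upwards [this] with r hr h
          exact hr (eq_div_of_mul_eq h0 (by rw [h, mul_comm]))
      filter_upwards [hne, ae_restrict_mem measurableSet_Ioi] with r hr1 hr0
      have hr0 : 0 < r := hr0
      have e : ∀ θ, ((br (polarPt (r, θ)) ^ (-q) : ℝ) : ℂ) * Complex.exp (((2 * Real.pi *
          (x 0 * polarPt (r, θ) 0 + x 1 * polarPt (r, θ) 1) - τ * disp (polarPt (r, θ)) : ℝ) : ℂ) *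
          Complex.I) = ((b r ^ (-q) : ℝ) : ℂ) * Complex.exp ((((2 * Real.pi * r * x 0 - τ) *
            Real.cos θ + (2 * Real.pi * r * x 1) * Real.sin θ : ℝ) : ℂ) * Complex.I) := fun θ => by
        have n1 : ‖polarPt (r, θ)‖ = r := norm_polarPt hr0.le
        rw [br, J, disp, n1]
        simp only [polarPt, Matrix.cons_val_zero, Matrix.cons_val_one, b]
        congr 3
        field_simp
        norm_cast
        ring
      simp only [e]
      rw [intervalIntegral.integral_const_mul, ← mul_assoc, ← Complex.ofReal_mul, norm_mul,
        Complex.norm_real, Real.norm_of_nonneg (hW r hr0)]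
      have hA : 0 < |(|τ| - 2 * Real.pi * ‖x‖ * r)| := abs_pos.2 (sub_ne_zero.2 hr1)
      -- On the circle of radius r the phase is the inner product of (cos θ, sin θ) with 2πr x - τe,
      -- where e is the first unit vector; the length of this vector is at least ||τ| - 2π|x| r|.
      have := norm_integral_exp_cos_add_sin_le (a := 2 * Real.pi * r * x 0 - τ)
        (b := 2 * Real.pi * r * x 1) hA (by
          have hx : ‖x‖ ^ 2 = x 0 ^ 2 + x 1 ^ 2 := by
            rw [EuclideanSpace.norm_sq_eq, Fin.sum_univ_two, Real.norm_eq_abs, Real.norm_eq_abs,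
              sq_abs, sq_abs]
          have h1 : τ * x 0 ≤ |τ| * ‖x‖ := by
            refine (le_abs_self _).trans ?_
            rw [abs_mul]
            gcongr
            exact PiLp.norm_apply_le x 0
          have h2 : 0 < 2 * Real.pi * r := by positivity
          have h3 := mul_le_mul_of_nonneg_left h1 h2.le
          have h4 := sq_abs τ
          have h5 : (2 * Real.pi * r) ^ 2 * ‖x‖ ^ 2 = (2 * Real.pi * r) ^ 2 * (x 0 ^ 2 + x 1 ^ 2) := by
            rw [hx]
          rw [sq_abs]
          linarith)
      calc W r * _ ≤ W r * (20 * |(|τ| - 2 * Real.pi * ‖x‖ * r)| ^ (-(1 / 2) : ℝ)) :=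
            mul_le_mul_of_nonneg_left this (hW r hr0)
        _ = 20 * (W r * |(|τ| - 2 * Real.pi * ‖x‖ * r)| ^ (-(1 / 2) : ℝ)) := by ring
        _ ≤ _ := by
          gcongr
          exact hM r hr0 hr1
    refine (norm_integral_le_of_norm_le (hMi.const_mul 20) key).trans ?_
    rw [integral_const_mul]
    linarith
  · refine (integrable_br_rpow hq).ofReal.mul_bdd (c := 1) ?_ ?_
    · exact Measurable.aestronglyMeasurable (by fun_prop)
    · filter_upwards with ξ using (Complex.norm_exp_ofReal_mul_I _).le
  · have := measurable_br.pow_const (-q)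
    fun_prop

/-! ### The linear group on the Fourier side. -/

/-- Multiplication by a bounded function as an operator on `L²`. -/
def mulOp {m : Plane → ℂ} (hm : MemLp m ∞) : ComplexL2 →L[ℂ] ComplexL2 :=
  (ContinuousLinearMap.mul ℂ ℂ).holderL volume ∞ 2 2 (hm.toLp m)

theorem coeFn_mulOp {m : Plane → ℂ} (hm : MemLp m ∞) (g : ComplexL2) :
    mulOp hm g =ᵐ[volume] fun ξ => m ξ * g ξ := by
  have h1 : mulOp hm g = (ContinuousLinearMap.mul ℂ ℂ).holder 2 (hm.toLp m) g := rfl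
  rw [h1]
  filter_upwards [(ContinuousLinearMap.mul ℂ ℂ).coeFn_holder (r := 2) (hm.toLp m) g, hm.coeFn_toLp]
    with ξ h2 h3
  rw [h2, h3]
  rfl

theorem norm_mulOp_le {m : Plane → ℂ} (hm : MemLp m ∞) {c : ℝ} (h : ∀ ξ, ‖m ξ‖ ≤ c)
    (g : ComplexL2) : ‖mulOp hm g‖ ≤ c * ‖g‖ := by
  refine Lp.norm_le_mul_norm_of_ae_le_mul ?_
  filter_upwards [coeFn_mulOp hm g] with ξ h1
  rw [h1, norm_mul]
  gcongr
  exact h ξ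

/-- The symbol of the group generated by the Riesz transform. -/
def prop (τ : ℝ) (ξ : Plane) : ℂ := Complex.exp (((-(τ * disp ξ) : ℝ) : ℂ) * Complex.I)

@[fun_prop] theorem measurable_prop (τ : ℝ) : Measurable (prop τ) := by unfold prop; fun_prop

theorem norm_prop (τ : ℝ) (ξ : Plane) : ‖prop τ ξ‖ = 1 := Complex.norm_exp_ofReal_mul_I _

theorem prop_zero (ξ : Plane) : prop 0 ξ = 1 := by simp [prop]

theorem prop_add (s t : ℝ) (ξ : Plane) : prop (s + t) ξ = prop s ξ * prop t ξ := by
  rw [prop, prop, prop, ← Complex.exp_add]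
  congr 1
  push_cast
  ring

theorem abs_disp_le (ξ : Plane) : |disp ξ| ≤ 1 := by
  rw [disp, abs_div, abs_norm]
  exact div_le_one_of_le₀ (PiLp.norm_apply_le ξ 0) (norm_nonneg _)

theorem rieszSymbol_eq_disp (ξ : Plane) : rieszSymbol 0 ξ = -(disp ξ : ℂ) * Complex.I := by
  simp [rieszSymbol, disp, mul_comm]

theorem memLp_prop (τ : ℝ) : MemLp (prop τ) ∞ :=
  memLp_top_of_bound (measurable_prop τ).aestronglyMeasurable 1
    (by filter_upwards with ξ using (norm_prop τ ξ).le)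

/-- The group generated by the Riesz transform, on the Fourier side. -/
def propOp (τ : ℝ) : ComplexL2 →L[ℂ] ComplexL2 := mulOp (memLp_prop τ)

/-- The generator has a symbol bounded by 1, so |e^z - 1 - z| ≤ |z|² holds uniformly in the
frequency and the group is differentiable in operator norm. -/
theorem hasDerivAt_propOp (τ : ℝ) :
    HasDerivAt propOp ((mulOp (memLp_rieszSymbol 0)).comp (propOp τ)) τ := by
  rw [hasDerivAt_iff_isLittleO]
  refine Asymptotics.IsBigO.trans_isLittleO ?_ (Asymptotics.isLittleO_pow_sub_sub τ one_lt_two)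
  refine Asymptotics.IsBigO.of_bound 1 ?_
  filter_upwards [Metric.ball_mem_nhds τ one_pos] with s hs
  rw [one_mul, norm_pow, norm_norm]
  refine ContinuousLinearMap.opNorm_le_bound _ (by positivity) fun g => ?_
  refine Lp.norm_le_mul_norm_of_ae_le_mul ?_
  set A := mulOp (memLp_rieszSymbol 0) with hA
  have e : (propOp s - propOp τ - (s - τ) • A.comp (propOp τ)) g =
      propOp s g - propOp τ g - (s - τ) • A (propOp τ g) := rfl
  rw [e]
  filter_upwards [Lp.coeFn_sub (propOp s g - propOp τ g) ((s - τ) • A (propOp τ g)),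
    Lp.coeFn_sub (propOp s g) (propOp τ g), Lp.coeFn_smul (s - τ) (A (propOp τ g)),
    coeFn_mulOp (memLp_prop s) g, coeFn_mulOp (memLp_prop τ) g,
    coeFn_mulOp (memLp_rieszSymbol 0) (propOp τ g)] with ξ h1 h2 h3 h4 h5 h6
  have h5' : (propOp τ g : ComplexL2) ξ = prop τ ξ * g ξ := h5
  have h4' : (propOp s g : ComplexL2) ξ = prop s ξ * g ξ := h4
  rw [h1, Pi.sub_apply, h2, Pi.sub_apply, h3, Pi.smul_apply, hA, h6, h5', h4',
    rieszSymbol_eq_disp, ← sub_add_cancel s τ, prop_add, add_sub_cancel_right, Complex.real_smul]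
  set z : ℂ := ((-((s - τ) * disp ξ) : ℝ) : ℂ) * Complex.I with hz
  have e2 : prop (s - τ) ξ * prop τ ξ * g ξ - prop τ ξ * g ξ -
      ((s - τ : ℝ) : ℂ) * (-(disp ξ : ℂ) * Complex.I * (prop τ ξ * g ξ)) =
      (Complex.exp z - 1 - z) * (prop τ ξ * g ξ) := by
    rw [prop, ← hz, hz]
    push_cast
    ring
  have hzn : ‖z‖ ≤ ‖s - τ‖ := by
    rw [hz, norm_mul, Complex.norm_I, mul_one, Complex.norm_real, norm_neg, norm_mul]
    exact mul_le_of_le_one_right (norm_nonneg _) (abs_disp_le ξ)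
  have hs1 : ‖s - τ‖ ≤ 1 := by
    rw [← dist_eq_norm]
    exact (Metric.mem_ball.1 hs).le
  rw [e2, norm_mul, norm_mul, norm_prop, one_mul]
  gcongr
  refine (Complex.norm_exp_sub_one_sub_id_le (hzn.trans hs1)).trans ?_
  gcongr

/-! ### Almost orthogonality of plane waves at discrete times. -/

theorem rpow_neg_half_le {k : ℝ} (hk : 1 ≤ k) :
    k ^ (-(1 / 2) : ℝ) ≤ 2 * (√k - √(k - 1)) := by
  have h0 : 0 < k := by linarith
  have h1 : 0 < √k := Real.sqrt_pos.2 h0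
  have h2 : √(k - 1) ≤ √k := Real.sqrt_le_sqrt (by linarith)
  have h3 := Real.sqrt_nonneg (k - 1)
  have e1 := Real.mul_self_sqrt h0.le
  have e2 := Real.mul_self_sqrt (show 0 ≤ k - 1 by linarith)
  rw [Real.rpow_neg h0.le, ← Real.sqrt_eq_rpow, inv_le_iff_one_le_mul₀ h1]
  nlinarith

/-- The sum is compared with a telescoping one on both sides of i. Square roots of negative numbers
are 0, which makes a single primitive G serve both sides, and the diagonal term is 0 because
0^{-1/2} = 0 by convention. -/
theorem sum_abs_sub_rpow_le (M : ℕ) {i : ℕ} (hi : i < M) :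
    ∑ j ∈ Finset.range M, |(i : ℝ) - j| ^ (-(1 / 2) : ℝ) ≤ 4 * √M := by
  let G : ℕ → ℝ := fun j => 2 * √((j : ℝ) - 1 - i) - 2 * √((i : ℝ) - j)
  have h : ∀ j : ℕ, |(i : ℝ) - j| ^ (-(1 / 2) : ℝ) ≤ G (j + 1) - G j := by
    intro j
    simp only [G]
    push_cast
    rcases lt_trichotomy i j with h | h | h
    · have h1 : (i : ℝ) + 1 ≤ j := by exact_mod_cast h
      have := rpow_neg_half_le (k := j - i) (by linarith)
      rw [abs_sub_comm, abs_of_nonneg (by linarith : (0 : ℝ) ≤ j - i)]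
      rw [Real.sqrt_eq_zero_of_nonpos (show (i : ℝ) - (j + 1) ≤ 0 by linarith),
        Real.sqrt_eq_zero_of_nonpos (show (i : ℝ) - j ≤ 0 by linarith)]
      rw [show (j : ℝ) - i - 1 = j - 1 - i by ring] at this
      rw [show (j : ℝ) + 1 - 1 - i = j - i by ring]
      linarith
    · subst h
      rw [sub_self, abs_zero, Real.zero_rpow (by norm_num)]
      rw [Real.sqrt_eq_zero_of_nonpos (show (i : ℝ) - (i + 1) ≤ 0 by linarith),
        Real.sqrt_eq_zero_of_nonpos (show (i : ℝ) - 1 - i ≤ 0 by linarith)]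
      simp
    · have h1 : (j : ℝ) + 1 ≤ i := by exact_mod_cast h
      have := rpow_neg_half_le (k := i - j) (by linarith)
      rw [abs_of_nonneg (by linarith : (0 : ℝ) ≤ i - j)]
      rw [Real.sqrt_eq_zero_of_nonpos (show (j : ℝ) + 1 - 1 - i ≤ 0 by linarith),
        Real.sqrt_eq_zero_of_nonpos (show (j : ℝ) - 1 - i ≤ 0 by linarith)]
      rw [show (i : ℝ) - j - 1 = i - (j + 1) by ring] at this
      linarith
  refine (Finset.sum_le_sum fun j _ => h j).trans ?_
  rw [Finset.sum_range_sub]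
  simp only [G]
  have hiM : (i : ℝ) ≤ M := by exact_mod_cast hi.le
  have h1 : √((M : ℝ) - 1 - i) ≤ √M := Real.sqrt_le_sqrt (by
    have : (0 : ℝ) ≤ i := by positivity
    linarith)
  have h2 : √((i : ℝ) - (0 : ℕ)) ≤ √M := Real.sqrt_le_sqrt (by simpa using hiM)
  have h3 := Real.sqrt_nonneg ((i : ℝ) - M)
  rw [Real.sqrt_eq_zero_of_nonpos (show ((0 : ℕ) : ℝ) - 1 - i ≤ 0 by
    have : (0 : ℝ) ≤ i := by positivity
    push_cast
    linarith)]
  linarith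

/-- A plane wave evolved by the linear flow. -/
def wave (x : Plane) (τ : ℝ) (ξ : Plane) : ℂ :=
  Complex.exp (((2 * Real.pi * (x 0 * ξ 0 + x 1 * ξ 1) - τ * disp ξ : ℝ) : ℂ) * Complex.I)

theorem norm_wave (x : Plane) (τ : ℝ) (ξ : Plane) : ‖wave x τ ξ‖ = 1 :=
  Complex.norm_exp_ofReal_mul_I _

@[fun_prop] theorem measurable_wave (x : Plane) (τ : ℝ) : Measurable (wave x τ) := by
  unfold wave; fun_prop

theorem wave_mul_conj (x y : Plane) (s t : ℝ) (ξ : Plane) :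
    wave x s ξ * (starRingEnd ℂ) (wave y t ξ) = wave (x - y) (s - t) ξ := by
  rw [wave, wave, wave, ← Complex.exp_conj, ← Complex.exp_add]
  congr 1
  simp only [map_mul, Complex.conj_ofReal, Complex.conj_I, PiLp.sub_apply]
  push_cast
  ring

/-- The almost orthogonality of plane waves at distinct times. -/
theorem exists_integral_norm_sum_sq_le {q : ℝ} (hq : 2 < q) : ∃ C : ℝ, 0 < C ∧
    ∀ (s : ℝ), 0 < s → ∀ (M : ℕ) (x : ℕ → Plane) (c : ℕ → ℂ), (∀ j, ‖c j‖ ≤ 1) →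
    ∫ ξ, br ξ ^ (-q) * ‖∑ j ∈ Finset.range M, c j * wave (x j) (s * j) ξ‖ ^ 2 ≤
      C * (M + s ^ (-(1 / 2) : ℝ) * (M * √M)) := by
  obtain ⟨C, hC, hdec⟩ := exists_decay hq
  have hint := integrable_br_rpow hq
  have hI0 : 0 ≤ ∫ ξ, br ξ ^ (-q) := integral_nonneg fun ξ => Real.rpow_nonneg (br_pos ξ).le _
  refine ⟨(∫ ξ, br ξ ^ (-q)) + 4 * C, by positivity, fun s hs M x c hc => ?_⟩
  have hwi : ∀ y τ, Integrable fun ξ => ((br ξ ^ (-q) : ℝ) : ℂ) * wave y τ ξ := fun y τ =>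
    hint.ofReal.mul_bdd (c := 1) (measurable_wave y τ).aestronglyMeasurable
      (by filter_upwards with ξ using (norm_wave y τ ξ).le)
  have e : ∀ ξ, ((br ξ ^ (-q) * ‖∑ j ∈ Finset.range M, c j * wave (x j) (s * j) ξ‖ ^ 2 : ℝ) : ℂ) =
      ∑ i ∈ Finset.range M, ∑ j ∈ Finset.range M, (c i * (starRingEnd ℂ) (c j)) *
        (((br ξ ^ (-q) : ℝ) : ℂ) * wave (x i - x j) (s * i - s * j) ξ) := fun ξ => by
    rw [Complex.ofReal_mul, Complex.ofReal_pow, ← Complex.mul_conj', map_sum, Finset.sum_mul_sum,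
      Finset.mul_sum]
    refine Finset.sum_congr rfl fun i _ => ?_
    rw [Finset.mul_sum]
    refine Finset.sum_congr rfl fun j _ => ?_
    rw [← wave_mul_conj, map_mul]
    ring
  have hnorm : ((∫ ξ, br ξ ^ (-q) * ‖∑ j ∈ Finset.range M, c j * wave (x j) (s * j) ξ‖ ^ 2 : ℝ) : ℂ)
      = ∑ i ∈ Finset.range M, ∑ j ∈ Finset.range M, (c i * (starRingEnd ℂ) (c j)) *
        ∫ ξ, ((br ξ ^ (-q) : ℝ) : ℂ) * wave (x i - x j) (s * i - s * j) ξ := by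
    rw [← integral_complex_ofReal]
    simp only [e]
    rw [integral_finsetSum _ fun i _ => integrable_finsetSum _ fun j _ => (hwi _ _).const_mul _]
    refine Finset.sum_congr rfl fun i _ => ?_
    rw [integral_finsetSum _ fun j _ => (hwi _ _).const_mul _]
    refine Finset.sum_congr rfl fun j _ => ?_
    rw [integral_const_mul]
  -- For i = j there is no decay and the total mass of the weight appears; the second summand is
  -- then 0 by the convention for 0^{-1/2}. For i ≠ j dispersive decay applies, whatever the points
  -- x are.
  have hterm : ∀ i j : ℕ, ‖∫ ξ, ((br ξ ^ (-q) : ℝ) : ℂ) * wave (x i - x j) (s * i - s * j) ξ‖ ≤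
      (if i = j then ∫ ξ, br ξ ^ (-q) else 0) +
        C * s ^ (-(1 / 2) : ℝ) * |(i : ℝ) - j| ^ (-(1 / 2) : ℝ) := fun i j => by
    rcases eq_or_ne i j with h | h
    · subst h
      rw [if_pos rfl, sub_self (i : ℝ), abs_zero, Real.zero_rpow (by norm_num), mul_zero, add_zero]
      refine (norm_integral_le_integral_norm _).trans (le_of_eq ?_)
      congr 1
      ext ξ
      rw [norm_mul, norm_wave, mul_one, norm_ofReal_rpow_br]
    · rw [if_neg h, zero_add]
      have hne : s * i - s * j ≠ 0 := by
        rw [← mul_sub]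
        exact mul_ne_zero hs.ne' (sub_ne_zero.2 (by exact_mod_cast h))
      refine (hdec (x i - x j) _ hne).trans (le_of_eq ?_)
      rw [← mul_sub, abs_mul, abs_of_pos hs, Real.mul_rpow hs.le (abs_nonneg _), mul_assoc]
  have h0 : 0 ≤ ∫ ξ, br ξ ^ (-q) * ‖∑ j ∈ Finset.range M, c j * wave (x j) (s * j) ξ‖ ^ 2 :=
    integral_nonneg fun ξ => mul_nonneg (Real.rpow_nonneg (br_pos ξ).le _) (by positivity)
  rw [← Real.norm_of_nonneg h0, ← Complex.norm_real, hnorm]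
  have hsp : 0 < s ^ (-(1 / 2) : ℝ) := Real.rpow_pos_of_pos hs _
  calc _ ≤ ∑ i ∈ Finset.range M, ∑ j ∈ Finset.range M, ((if i = j then ∫ ξ, br ξ ^ (-q) else 0) +
        C * s ^ (-(1 / 2) : ℝ) * |(i : ℝ) - j| ^ (-(1 / 2) : ℝ)) := by
          refine (norm_sum_le _ _).trans (Finset.sum_le_sum fun i _ => ?_)
          refine (norm_sum_le _ _).trans (Finset.sum_le_sum fun j _ => ?_)
          rw [norm_mul, norm_mul, RCLike.norm_conj]
          refine le_trans (mul_le_of_le_one_left (norm_nonneg _) ?_) (hterm i j)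
          exact mul_le_one₀ (hc i) (norm_nonneg _) (hc j)
    _ ≤ ∑ i ∈ Finset.range M, ((∫ ξ, br ξ ^ (-q)) + C * s ^ (-(1 / 2) : ℝ) * (4 * √M)) := by
          refine Finset.sum_le_sum fun i hi => ?_
          rw [Finset.sum_add_distrib, Finset.sum_ite_eq, if_pos hi, ← Finset.mul_sum]
          gcongr
          exact sum_abs_sub_rpow_le M (Finset.mem_range.1 hi)
    _ = (∫ ξ, br ξ ^ (-q)) * M + 4 * C * (s ^ (-(1 / 2) : ℝ) * (M * √M)) := by
          rw [Finset.sum_const, Finset.card_range, nsmul_eq_mul]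
          ring
    _ ≤ _ := by
          have h1 : 0 ≤ s ^ (-(1 / 2) : ℝ) * (M * √M) := by positivity
          have h2 : (0 : ℝ) ≤ M := by positivity
          nlinarith [mul_nonneg hI0 h1, mul_nonneg hC.le h2]

theorem wave_add (x : Plane) (s t : ℝ) (ξ : Plane) : wave x (s + t) ξ = wave x s ξ * prop t ξ := by
  rw [wave, wave, prop, ← Complex.exp_add]
  congr 1
  push_cast
  ring

theorem fourierInv_eq_integral_wave (w : Plane → ℂ) (x : Plane) :
    𝓕⁻ w x = ∫ ξ, wave x 0 ξ * w ξ := by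
  rw [Real.fourierInv_eq]
  refine integral_congr_ae (by
    filter_upwards with ξ
    rw [Circle.smul_def, Real.fourierChar_apply, smul_eq_mul, wave]
    congr 3
    rw [EuclideanSpace.inner_eq_star_dotProduct]
    simp [dotProduct, Fin.sum_univ_two])

theorem integrable_wave_mul {w : Plane → ℂ} (hw : Integrable w) (x : Plane) (τ : ℝ) :
    Integrable fun ξ => wave x τ ξ * w ξ :=
  hw.bdd_mul (c := 1) (measurable_wave x τ).aestronglyMeasurable
    (by filter_upwards with ξ using (norm_wave x τ ξ).le)

/-- On shell k the bracket is at least 2^k, so δ extra derivatives buy the factor 2^{-kδ} that later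
makes the sum over shells converge. -/
theorem norm_msym_mul_shell_le {δ : ℝ} (hδ : 0 ≤ δ) (k : ℕ) (i) (g : Plane → ℂ) (ξ : Plane) :
    ‖msym k i ξ * shell k g ξ‖ ≤ ((2 : ℝ) ^ k) ^ (-δ) * (br ξ ^ (1 + δ) * ‖g ξ‖) := by
  have h2 : (0 : ℝ) < 2 ^ k := by positivity
  by_cases h : blk ξ = k
  · have h1 := norm_msym_le i h
    have hb := two_pow_blk_le ξ
    rw [h] at hb
    have h3 : 1 ≤ ((2 : ℝ) ^ k) ^ (-δ) * br ξ ^ δ := by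
      rw [Real.rpow_neg h2.le, ← div_eq_inv_mul, one_le_div (Real.rpow_pos_of_pos h2 _)]
      exact Real.rpow_le_rpow h2.le hb hδ
    have h4 := br_pos ξ
    simp only [shell, Set.indicator_apply, Set.mem_ofPred_eq, h, if_true]
    rw [norm_mul, add_comm 1 δ, Real.rpow_add_one h4.ne']
    calc ‖msym k i ξ‖ * ‖g ξ‖ ≤ br ξ * ‖g ξ‖ := by gcongr
      _ = 1 * (br ξ * ‖g ξ‖) := by ring
      _ ≤ ((2 : ℝ) ^ k) ^ (-δ) * br ξ ^ δ * (br ξ * ‖g ξ‖) := by gcongr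
      _ = _ := by ring
  · simp only [shell, Set.indicator_apply, Set.mem_ofPred_eq, h, if_false, mul_zero, norm_zero]
    have := Real.rpow_nonneg (br_pos ξ).le (1 + δ)
    positivity

/-- The linear dispersive estimate, sampled at discrete times. -/
theorem exists_strichartz_sum {r δ : ℝ} (hδ : 0 ≤ δ) (hr : 2 < 2 * (r - 1 - δ)) : ∃ C : ℝ, 0 < C ∧
    ∀ (K k : ℕ) (i) (g : Plane → ℂ), BL K g → ∀ (s : ℝ), 0 < s →
    ∀ (M : ℕ) (x : ℕ → Plane) (c : ℕ → ℂ), (∀ j, ‖c j‖ ≤ 1) →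
    ‖∑ j ∈ Finset.range M, c j * ∫ ξ, wave (x j) (s * j) ξ * (msym k i ξ * shell k g ξ)‖ ≤
      ((2 : ℝ) ^ k) ^ (-δ) * l2 (fun ξ => ((br ξ ^ r : ℝ) : ℂ) * g ξ) *
        √(C * (M + s ^ (-(1 / 2) : ℝ) * (M * √M))) := by
  obtain ⟨C, hC, hS⟩ := exists_integral_norm_sum_sq_le hr
  refine ⟨C, hC, fun K k i g hg s hs M x c hc => ?_⟩
  have hw := (hg.msym_shell k i).integrable
  let S : Plane → ℂ := fun ξ => ∑ j ∈ Finset.range M, c j * wave (x j) (s * j) ξ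
  have hSm : Measurable S := by
    refine Finset.measurable_sum _ fun j _ => ?_
    fun_prop
  have hSn : ∀ ξ, ‖S ξ‖ ≤ M := fun ξ => by
    refine (norm_sum_le _ _).trans ?_
    refine (Finset.sum_le_sum (g := fun _ => 1) fun j _ => ?_).trans (by simp)
    rw [norm_mul, norm_wave, mul_one]
    exact hc j
  have e : ∑ j ∈ Finset.range M, c j * ∫ ξ, wave (x j) (s * j) ξ * (msym k i ξ * shell k g ξ) =
      ∫ ξ, S ξ * (msym k i ξ * shell k g ξ) := by
    simp only [← integral_const_mul]
    rw [← integral_finsetSum _ fun j _ => (integrable_wave_mul hw _ _).const_mul _]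
    refine integral_congr_ae (by
      filter_upwards with ξ
      simp only [S, Finset.sum_mul, mul_assoc])
  -- This q satisfies br^{1+δ} = br^r · br^{-q/2}. Cauchy-Schwarz then separates the H^r norm of g
  -- from the weighted square norm of the sum of waves.
  set q : ℝ := 2 * (r - 1 - δ) with hq
  let A : Plane → ℂ := fun ξ => ((br ξ ^ (-(q / 2)) * ‖S ξ‖ : ℝ) : ℂ)
  have hbm := fun t : ℝ => measurable_br.pow_const t
  have hA2 : ∀ ξ, ‖A ξ‖ ^ 2 = br ξ ^ (-q) * ‖S ξ‖ ^ 2 := fun ξ => by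
    simp only [A]
    rw [Complex.norm_real, Real.norm_eq_abs, sq_abs, mul_pow, ← Real.rpow_natCast,
      ← Real.rpow_mul (br_pos ξ).le]
    congr 2
    push_cast
    ring
  have hAm : AEStronglyMeasurable A volume :=
    (Complex.measurable_ofReal.comp ((hbm _).mul hSm.norm)).aestronglyMeasurable
  have hA : MemLp A 2 := by
    rw [memLp_two_iff_integrable_sq_norm hAm]
    simp only [hA2]
    refine (integrable_br_rpow hr).mul_bdd (c := (M : ℝ) ^ 2) (by fun_prop) ?_
    filter_upwards with ξ
    rw [norm_pow, norm_norm]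
    have := hSn ξ
    gcongr
  have hB := (hg.br_rpow_mul r).memLp
  have hB' : MemLp (fun ξ => ((br ξ ^ r * ‖g ξ‖ : ℝ) : ℂ)) 2 := by
    refine hB.mono ?_ ?_
    · exact (Complex.continuous_ofReal.comp_aestronglyMeasurable
        ((hbm r).aestronglyMeasurable.mul hg.memLp.1.norm))
    · filter_upwards with ξ
      simp [abs_of_nonneg (Real.rpow_nonneg (br_pos ξ).le r)]
  have hBl : l2 (fun ξ => ((br ξ ^ r * ‖g ξ‖ : ℝ) : ℂ)) ≤ l2 (fun ξ => ((br ξ ^ r : ℝ) : ℂ) * g ξ) :=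
    l2_le_of_norm_le hB fun ξ => by simp
  have hAl : l2 A ≤ √(C * (M + s ^ (-(1 / 2) : ℝ) * (M * √M))) := by
    apply Real.le_sqrt_of_sq_le
    rw [l2_sq hA]
    simp only [hA2]
    exact hS s hs M x c hc
  have key := norm_integral_mul_conj_le hB' hA
  rw [e]
  have h1 : ‖∫ ξ, S ξ * (msym k i ξ * shell k g ξ)‖ ≤
      ((2 : ℝ) ^ k) ^ (-δ) * ∫ ξ, br ξ ^ r * ‖g ξ‖ * (br ξ ^ (-(q / 2)) * ‖S ξ‖) := by
    rw [← integral_const_mul]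
    refine norm_integral_le_of_norm_le ?_ ?_
    · refine Integrable.const_mul ?_ _
      have h0 := (hB'.norm).integrable_mul hA.norm
      refine h0.congr ?_
      filter_upwards with ξ
      simp only [A, Pi.mul_apply, Complex.norm_real, Real.norm_eq_abs]
      rw [abs_of_nonneg (mul_nonneg (Real.rpow_nonneg (br_pos ξ).le _) (norm_nonneg _)),
        abs_of_nonneg (mul_nonneg (Real.rpow_nonneg (br_pos ξ).le _) (norm_nonneg _))]
    · filter_upwards with ξ
      rw [norm_mul, mul_comm]
      refine (mul_le_mul_of_nonneg_right (norm_msym_mul_shell_le hδ k i g ξ)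
        (norm_nonneg _)).trans (le_of_eq ?_)
      have : br ξ ^ (1 + δ) = br ξ ^ r * br ξ ^ (-(q / 2)) := by
        rw [← Real.rpow_add (br_pos ξ), hq]
        congr 1
        ring
      rw [this]
      ring
  have h2 : ∫ ξ, br ξ ^ r * ‖g ξ‖ * (br ξ ^ (-(q / 2)) * ‖S ξ‖) ≤
      l2 (fun ξ => ((br ξ ^ r * ‖g ξ‖ : ℝ) : ℂ)) * l2 A := by
    refine le_trans (le_trans (le_abs_self _) (le_of_eq ?_)) key
    rw [← Real.norm_eq_abs, ← Complex.norm_real, ← integral_complex_ofReal]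
    congr 2
    ext ξ
    simp only [A, Complex.conj_ofReal]
    push_cast
    rfl
  refine h1.trans ?_
  rw [mul_assoc]
  refine mul_le_mul_of_nonneg_left (h2.trans ?_) (by positivity)
  exact mul_le_mul hBl hAl (l2_nonneg _) (l2_nonneg _)

/-! ### Evaluation functionals and Duhamel's formula. -/

theorem supF_le_add {w v : Plane → ℂ} (hw : Integrable w) (hv : Integrable v) :
    supF w ≤ supF v + ∫ ξ, ‖w ξ - v ξ‖ := by
  refine ciSup_le fun x => ?_
  have hwv : Integrable fun ξ => wave x 0 ξ * (w ξ - v ξ) := integrable_wave_mul (hw.sub hv) x 0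
  have e : 𝓕⁻ w x = 𝓕⁻ v x + 𝓕⁻ (fun ξ => w ξ - v ξ) x := by
    rw [fourierInv_eq_integral_wave, fourierInv_eq_integral_wave, fourierInv_eq_integral_wave,
      ← integral_add (integrable_wave_mul hv _ _) hwv]
    refine integral_congr_ae (by filter_upwards with ξ; ring)
  rw [e]
  exact (norm_add_le _ _).trans
    (add_le_add (norm_fourierInv_le_supF v x) (norm_fourierInv_le_integral _ x))

/-- The symbol `msym` restricted to its shell. -/
def mshell (k : ℕ) (i : Fin 2 ⊕ Fin 2 ⊕ (Fin 2 × Fin 2)) : Plane → ℂ :=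
  {ξ | blk ξ = k}.indicator (msym k i)

theorem mshell_mul (k : ℕ) (i) (f : Plane → ℂ) (ξ : Plane) :
    mshell k i ξ * f ξ = msym k i ξ * shell k f ξ := by
  by_cases h : blk ξ = k <;> simp [mshell, shell, h]

@[fun_prop] theorem measurable_mshell (k : ℕ) (i) : Measurable (mshell k i) :=
  (measurable_msym k i).indicator (measurable_blk (measurableSet_singleton k))

theorem norm_mshell_le (k : ℕ) (i) (ξ : Plane) : ‖mshell k i ξ‖ ≤ 2 ^ (k + 1) := by
  by_cases h : blk ξ = k
  · simp only [mshell, Set.indicator_apply, Set.mem_ofPred_eq, h, if_true]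
    refine (norm_msym_le i h).trans ?_
    rw [← h]
    exact (br_lt_two_pow ξ).le
  · simp [mshell, h]

theorem bL_of_bounded {K : ℕ} {f : Plane → ℂ} (hf : Measurable f) {C : ℝ} (hC : ∀ ξ, ‖f ξ‖ ≤ C)
    (hs : ∀ ξ, K ≤ blk ξ → f ξ = 0) : BL K f := by
  refine ⟨?_, hs⟩
  have h1 : MemLp ({ξ : Plane | blk ξ < K}.indicator fun _ => (C : ℂ)) 2 := by
    refine memLp_indicator_const 2 (measurableSet_blk_lt K) _ (Or.inr (measure_blk_lt K).ne)
  refine h1.mono hf.aestronglyMeasurable ?_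
  filter_upwards with ξ
  by_cases h : blk ξ < K
  · simp only [Set.indicator_apply, Set.mem_ofPred_eq, h, if_true]
    rw [Complex.norm_real]
    exact (hC ξ).trans (le_abs_self C)
  · rw [hs ξ (not_lt.1 h)]
    simp

theorem bL_mshell (k : ℕ) (i) : BL (k + 1) (mshell k i) :=
  bL_of_bounded (measurable_mshell k i) (norm_mshell_le k i) fun ξ h => by
    have : blk ξ ≠ k := by omega
    simp [mshell, this]

theorem memLp_waveVec (k : ℕ) (i) (x : Plane) (τ : ℝ) :
    MemLp (fun ξ => (starRingEnd ℂ) (wave x τ ξ * mshell k i ξ)) 2 := by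
  refine (bL_mshell k i).memLp.mono (Measurable.aestronglyMeasurable ?_) ?_
  · exact Complex.continuous_conj.measurable.comp
      ((measurable_wave x τ).mul (measurable_mshell k i))
  · filter_upwards with ξ
    rw [RCLike.norm_conj, norm_mul, norm_wave, one_mul]

/-- The vector representing the evaluation of a frequency localized piece of the evolution. -/
def waveVec (k : ℕ) (i : Fin 2 ⊕ Fin 2 ⊕ (Fin 2 × Fin 2)) (x : Plane) (τ : ℝ) : ComplexL2 :=
  (memLp_waveVec k i x τ).toLp _

theorem inner_waveVec (k : ℕ) (i) (x : Plane) (τ : ℝ) {H : ComplexL2} {h : Plane → ℂ}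
    (hH : H =ᵐ[volume] h) : inner ℂ (waveVec k i x τ) H =
      ∫ ξ, wave x τ ξ * (msym k i ξ * shell k h ξ) := by
  rw [L2.inner_def]
  apply integral_congr_ae
  filter_upwards [(memLp_waveVec k i x τ).coeFn_toLp, hH] with ξ h1 h2
  rw [waveVec, h1, h2, ← mshell_mul, RCLike.inner_apply', Complex.conj_conj]
  ring

theorem coeFn_propOp (τ : ℝ) (g : ComplexL2) : propOp τ g =ᵐ[volume] fun ξ => prop τ ξ * g ξ :=
  coeFn_mulOp (memLp_prop τ) g

/-- Evolving the function is the same as shifting the time of the plane wave it is tested against.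
-/
theorem inner_waveVec_propOp (k : ℕ) (i) (x : Plane) (τ t : ℝ) (H : ComplexL2) :
    inner ℂ (waveVec k i x τ) (propOp t H) = inner ℂ (waveVec k i x (τ + t)) H := by
  rw [inner_waveVec k i x τ (coeFn_propOp t H), inner_waveVec k i x (τ + t) (ae_eq_refl _)]
  refine integral_congr_ae (by
    filter_upwards with ξ
    rw [← mshell_mul, ← mshell_mul, wave_add]
    ring)

theorem mulOp_propOp_comm (τ : ℝ) (g : ComplexL2) :
    mulOp (memLp_rieszSymbol 0) (propOp τ g) = propOp τ (mulOp (memLp_rieszSymbol 0) g) := by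
  apply Lp.ext
  filter_upwards [coeFn_mulOp (memLp_rieszSymbol 0) (propOp τ g), coeFn_propOp τ g,
    coeFn_propOp τ (mulOp (memLp_rieszSymbol 0) g), coeFn_mulOp (memLp_rieszSymbol 0) g]
    with ξ h1 h2 h3 h4
  rw [h1, h2, h3, h4]
  ring

theorem propOp_zero (g : ComplexL2) : propOp 0 g = g := by
  apply Lp.ext
  filter_upwards [coeFn_propOp 0 g] with ξ h1
  rw [h1, prop_zero, one_mul]

/-- Duhamel's formula, tested against a vector. -/
theorem duhamel_inner {κ T : ℝ} {F G : ℝ → ComplexL2}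
    (hF : ∀ t ∈ Icc 0 T, HasDerivWithinAt F
      (κ • mulOp (memLp_rieszSymbol 0) (F t) - G t) (Icc 0 T) t)
    (hG : ContinuousOn G (Icc 0 T)) (v : ComplexL2) {t : ℝ} (ht : t ∈ Icc 0 T) :
    IntervalIntegrable (fun s => (inner ℂ v (propOp (κ * (t - s)) (G s)) : ℂ)) volume 0 t ∧
    (inner ℂ v (F t) : ℂ) = inner ℂ v (propOp (κ * t) (F 0)) -
      ∫ s in (0 : ℝ)..t, (inner ℂ v (propOp (κ * (t - s)) (G s)) : ℂ) := by
  have hsub : Icc 0 t ⊆ Icc 0 T := Icc_subset_Icc_right ht.2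
  have hpc : Continuous propOp :=
    continuous_iff_continuousAt.2 fun τ => (hasDerivAt_propOp τ).continuousAt
  have hpc' : Continuous fun s => propOp (κ * (t - s)) := hpc.comp (by fun_prop)
  let L : ComplexL2 →L[ℝ] ℂ := (innerSL ℂ v).restrictScalars ℝ
  have hFc : ContinuousOn F (Icc 0 T) := fun s hs => (hF s hs).continuousWithinAt
  have hc1 : ContinuousOn (fun s => L (propOp (κ * (t - s)) (G s))) (Icc 0 t) :=
    L.continuous.comp_continuousOn (hpc'.continuousOn.clm_apply (hG.mono hsub))
  have hi : IntervalIntegrable (fun s => L (propOp (κ * (t - s)) (G s))) volume 0 t := by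
    apply ContinuousOn.intervalIntegrable
    rwa [Set.uIcc_of_le ht.1]
  refine ⟨hi, ?_⟩
  -- In the interaction picture the generator cancels against the linear part of the equation, since
  -- it commutes with the group; only the forcing remains.
  have hd : ∀ s ∈ Ioo 0 t, HasDerivAt (fun s => L (propOp (κ * (t - s)) (F s)))
      (-L (propOp (κ * (t - s)) (G s))) s := fun s hs => by
    have hs' : s ∈ Icc 0 T := hsub ⟨hs.1.le, hs.2.le⟩
    have h1 := (hF s hs').hasDerivAt (Icc_mem_nhds hs.1 (hs.2.trans_le ht.2))
    have h2 : HasDerivAt (fun s : ℝ => κ * (t - s)) (κ * -1) s :=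
      ((hasDerivAt_id s).const_sub t).const_mul κ
    have h3 := (hasDerivAt_propOp (κ * (t - s))).scomp s h2
    have h3' : HasDerivAt (fun s => (propOp (κ * (t - s))).restrictScalars ℝ)
        (((κ * -1) • (mulOp (memLp_rieszSymbol 0)).comp (propOp (κ * (t - s)))).restrictScalars ℝ) s :=
      (ContinuousLinearMap.restrictScalarsL ℂ ComplexL2 ComplexL2 ℝ ℝ).hasFDerivAt.comp_hasDerivAt s h3
    have h4 := L.hasFDerivAt.comp_hasDerivAt s (h3'.clm_apply h1)
    refine HasDerivAt.congr_deriv h4 ?_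
    rw [← map_neg]
    congr 1
    simp only [ContinuousLinearMap.coe_restrictScalars', smul_apply,
      ContinuousLinearMap.comp_apply, map_sub, mulOp_propOp_comm]
    have : (propOp (κ * (t - s))) (κ • mulOp (memLp_rieszSymbol 0) (F s)) =
      κ • (propOp (κ * (t - s))) (mulOp (memLp_rieszSymbol 0) (F s)) :=
      ((propOp (κ * (t - s))).restrictScalars ℝ).map_smul κ _
    rw [this]
    module
  have hc2 : ContinuousOn (fun s => L (propOp (κ * (t - s)) (F s))) (Icc 0 t) :=
    L.continuous.comp_continuousOn (hpc'.continuousOn.clm_apply (hFc.mono hsub))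
  have key := intervalIntegral.integral_eq_sub_of_hasDerivAt_of_le ht.1 hc2 hd hi.neg
  rw [intervalIntegral.integral_neg, sub_self, mul_zero, sub_zero, propOp_zero] at key
  have e1 : L (F t) = inner ℂ v (F t) := rfl
  have e2 : L (propOp (κ * t) (F 0)) = inner ℂ v (propOp (κ * t) (F 0)) := rfl
  have e3 : ∫ s in (0 : ℝ)..t, L (propOp (κ * (t - s)) (G s)) =
    ∫ s in (0 : ℝ)..t, (inner ℂ v (propOp (κ * (t - s)) (G s)) : ℂ) := rfl
  rw [e1, e2, e3] at key
  linear_combination -key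

theorem l2_congr {f g : Plane → ℂ} (h : f =ᵐ[volume] g) (hg : MemLp g 2) : l2 f = l2 g := by
  rw [← norm_toLp_eq_l2 hg, ← norm_toLp_eq_l2 (hg.ae_eq h.symm)]
  congr 1
  exact (MemLp.toLp_eq_toLp_iff _ _).2 h

theorem norm_eq_l2 {F : ComplexL2} {f : Plane → ℂ} (h : F =ᵐ[volume] f) : ‖F‖ = l2 f := by
  have hf : MemLp f 2 := (Lp.memLp F).ae_eq h
  rw [← norm_toLp_eq_l2 hf]
  congr 1
  exact (Lp.toLp_coeFn F (Lp.memLp F)).symm.trans ((MemLp.toLp_eq_toLp_iff _ _).2 h)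

/-- The norm of a dyadic piece is Lipschitz in `L²`. -/
theorem supF_shell_sub_le {K : ℕ} (k : ℕ) (i) {f g : Plane → ℂ} (hf : BL K f) (hg : BL K g)
    {F G : ComplexL2} (hF : F =ᵐ[volume] f) (hG : G =ᵐ[volume] g) :
    supF (fun ξ => msym k i ξ * shell k f ξ) ≤ supF (fun ξ => msym k i ξ * shell k g ξ) +
      l2 (mshell k i) * ‖F - G‖ := by
  refine (supF_le_add (hf.msym_shell k i).integrable (hg.msym_shell k i).integrable).trans ?_
  gcongr
  have hfg : (F - G : ComplexL2) =ᵐ[volume] fun ξ => f ξ - g ξ := by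
    filter_upwards [Lp.coeFn_sub F G, hF, hG] with ξ h1 h2 h3
    rw [h1, Pi.sub_apply, h2, h3]
  have hfgm : MemLp (fun ξ => f ξ - g ξ) 2 := hf.memLp.sub hg.memLp
  rw [norm_eq_l2 hfg]
  have l2n : ∀ {f : Plane → ℂ}, MemLp f 2 → l2 (fun ξ => (‖f ξ‖ : ℂ)) = l2 f := fun {f} hf => by
    refine le_antisymm (l2_le_of_norm_le hf fun ξ => by simp)
      (l2_le_of_norm_le hf.norm.ofReal fun ξ => by simp)
  have key := norm_integral_mul_conj_le (c := fun ξ => (‖mshell k i ξ‖ : ℂ))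
    (h := fun ξ => (‖f ξ - g ξ‖ : ℂ)) (bL_mshell k i).memLp.norm.ofReal hfgm.norm.ofReal
  rw [l2n (bL_mshell k i).memLp, l2n hfgm] at key
  refine le_trans (le_trans (le_abs_self _) (le_of_eq ?_)) key
  rw [← Real.norm_eq_abs, ← Complex.norm_real, ← integral_complex_ofReal]
  congr 2
  ext ξ
  rw [← mshell_mul, ← mshell_mul, ← mul_sub, norm_mul, Complex.conj_ofReal]
  push_cast
  rfl

/-- A supremum over an uncountable set of points is not obviously measurable in time; the Lipschitz
bound in L² gives continuity, and with it integrability of the dispersive norm on compact intervals.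
-/
theorem continuousOn_supF_shell {K : ℕ} (k : ℕ) (i) {f : ℝ → Plane → ℂ} {F : ℝ → ComplexL2}
    {s : Set ℝ} (hF : ContinuousOn F s) (hf : ∀ t ∈ s, BL K (f t) ∧ F t =ᵐ[volume] f t) :
    ContinuousOn (fun t => supF (fun ξ => msym k i ξ * shell k (f t) ξ)) s := by
  intro t ht
  rw [ContinuousWithinAt, tendsto_iff_norm_sub_tendsto_zero]
  have h1 : Tendsto (fun u => l2 (mshell k i) * ‖F u - F t‖) (𝓝[s] t) (𝓝 0) := by
    have := (tendsto_iff_norm_sub_tendsto_zero.1 (hF t ht)).const_mul (l2 (mshell k i))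
    rwa [mul_zero] at this
  refine squeeze_zero' (by filter_upwards with u using norm_nonneg _) ?_ h1
  filter_upwards [self_mem_nhdsWithin] with u hu
  have a1 := supF_shell_sub_le k i (hf u hu).1 (hf t ht).1 (hf u hu).2 (hf t ht).2
  have a2 := supF_shell_sub_le k i (hf t ht).1 (hf u hu).1 (hf t ht).2 (hf u hu).2
  rw [norm_sub_rev] at a2
  rw [Real.norm_eq_abs, abs_le]
  constructor <;> linarith

/-! ### Strichartz estimates for the forced linear equation. -/

theorem exists_phase (z : ℂ) : ∃ c : ℂ, ‖c‖ ≤ 1 ∧ c * z = (‖z‖ : ℂ) := by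
  rcases eq_or_ne z 0 with rfl | h
  · exact ⟨0, by simp⟩
  · refine ⟨(starRingEnd ℂ) z / ‖z‖, ?_, ?_⟩
    · rw [norm_div, RCLike.norm_conj, Complex.norm_real, norm_norm, div_self (norm_ne_zero_iff.2 h)]
    · have : (‖z‖ : ℂ) ≠ 0 := by exact_mod_cast norm_ne_zero_iff.2 h
      rw [div_mul_eq_mul_div, Complex.conj_mul', div_eq_iff this]
      ring

/-- Each supremum is nearly attained at some point, and a unimodular or zero coefficient turns the
absolute value into a linear expression. Suprema are thereby linearized and duality becomes
available. -/
theorem sum_supF_le {M : ℕ} {w : ℕ → Plane → ℂ} {B : ℝ}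
    (h : ∀ (x : ℕ → Plane) (c : ℕ → ℂ), (∀ j, ‖c j‖ ≤ 1) →
      ‖∑ j ∈ Finset.range M, c j * 𝓕⁻ (w j) (x j)‖ ≤ B) :
    ∑ j ∈ Finset.range M, supF (w j) ≤ B := by
  refine le_of_forall_pos_le_add fun η hη => ?_
  have hM : (0 : ℝ) < M + 1 := by positivity
  have hx : ∀ j, ∃ x, supF (w j) - η / (M + 1) < ‖𝓕⁻ (w j) x‖ := fun j =>
    exists_lt_of_lt_ciSup (sub_lt_self _ (by positivity))
  choose x hx using hx
  choose c hc1 hc2 using fun j => exists_phase (𝓕⁻ (w j) (x j))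
  have h1 := h x c hc1
  simp only [hc2] at h1
  rw [← Complex.ofReal_sum, Complex.norm_real, Real.norm_of_nonneg
    (Finset.sum_nonneg fun _ _ => norm_nonneg _)] at h1
  have h2 : ∑ j ∈ Finset.range M, supF (w j) ≤
      ∑ j ∈ Finset.range M, (‖𝓕⁻ (w j) (x j)‖ + η / (M + 1)) :=
    Finset.sum_le_sum fun j _ => by linarith [hx j]
  rw [Finset.sum_add_distrib, Finset.sum_const, Finset.card_range, nsmul_eq_mul] at h2
  have h3 : (M : ℝ) * (η / (M + 1)) ≤ η := by
    rw [← mul_div_assoc, div_le_iff₀ hM]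
    nlinarith
  linarith

/-- The dispersive estimate for the forced linear equation, sampled at equidistant times. -/
theorem exists_strichartz_sampled {r δ : ℝ} (hδ : 0 ≤ δ) (hr : 2 < 2 * (r - 1 - δ)) :
    ∃ C : ℝ, 0 < C ∧ ∀ (K k : ℕ) (i) (κ T : ℝ), 0 < κ → 0 < T → ∀ (F G : ℝ → ComplexL2)
    (f g : ℝ → Plane → ℂ),
    (∀ t ∈ Icc 0 T, HasDerivWithinAt F (κ • mulOp (memLp_rieszSymbol 0) (F t) - G t) (Icc 0 T) t) →
    ContinuousOn G (Icc 0 T) →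
    (∀ t ∈ Icc 0 T, BL K (f t) ∧ F t =ᵐ[volume] f t) →
    (∀ t ∈ Icc 0 T, BL K (g t) ∧ G t =ᵐ[volume] g t) →
    IntervalIntegrable (fun t => l2 (fun ξ => ((br ξ ^ r : ℝ) : ℂ) * g t ξ)) volume 0 T →
    ∀ (M : ℕ) (σ ρ : ℝ), 0 < σ → 0 ≤ ρ → (∀ j < M, σ * j + ρ ≤ T) →
    ∑ j ∈ Finset.range M, supF (fun ξ => msym k i ξ * shell k (f (σ * j + ρ)) ξ) ≤
      ((2 : ℝ) ^ k) ^ (-δ) * √(C * (M + (κ * σ) ^ (-(1 / 2) : ℝ) * (M * √M))) *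
      (l2 (fun ξ => ((br ξ ^ r : ℝ) : ℂ) * f 0 ξ) +
        ∫ t in (0 : ℝ)..T, l2 (fun ξ => ((br ξ ^ r : ℝ) : ℂ) * g t ξ)) := by
  obtain ⟨C, hC, hS⟩ := exists_strichartz_sum hδ hr
  refine ⟨C, hC, fun K k i κ T hκ hT F G f g hF hG hf hg hgi M σ ρ hσ hρ hM => ?_⟩
  have h0T : (0 : ℝ) ∈ Icc 0 T := ⟨le_rfl, hT.le⟩
  have ht : ∀ j ∈ Finset.range M, σ * j + ρ ∈ Icc 0 T := fun j hj =>
    ⟨by positivity, hM j (Finset.mem_range.1 hj)⟩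
  set B := ((2 : ℝ) ^ k) ^ (-δ) * √(C * (M + (κ * σ) ^ (-(1 / 2) : ℝ) * (M * √M))) with hB
  refine sum_supF_le fun x c hc => ?_
  -- A common time shift τ is absorbed into the datum by a unimodular factor, so the sampled
  -- estimate holds for any arithmetic progression of times.
  have hlin : ∀ (h : Plane → ℂ) (H : ComplexL2) (τ : ℝ) (c : ℕ → ℂ), (∀ j, ‖c j‖ ≤ 1) → BL K h →
      H =ᵐ[volume] h → ‖∑ j ∈ Finset.range M, c j *
        (inner ℂ (waveVec k i (x j) 0) (propOp (κ * (σ * j) + τ) H) : ℂ)‖ ≤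
        B * l2 (fun ξ => ((br ξ ^ r : ℝ) : ℂ) * h ξ) := by
    intro h H τ c hc hh hH
    have hph : BL K fun ξ => prop τ ξ * h ξ :=
      hh.mul (measurable_prop τ) fun ξ _ => (norm_prop τ ξ).le
    have key := hS K k i _ hph (κ * σ) (by positivity) M x c hc
    have e1 : ∀ j : ℕ, (inner ℂ (waveVec k i (x j) 0) (propOp (κ * (σ * j) + τ) H) : ℂ) =
        ∫ ξ, wave (x j) (κ * σ * j) ξ * (msym k i ξ * shell k (fun ξ => prop τ ξ * h ξ) ξ) :=
      fun j => by
      rw [inner_waveVec_propOp, inner_waveVec k i _ _ hH]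
      refine integral_congr_ae (by
        filter_upwards with ξ
        rw [← mshell_mul, ← mshell_mul, zero_add, wave_add, mul_assoc κ]
        ring)
    simp only [e1]
    refine key.trans ?_
    have e2 : l2 (fun ξ => ((br ξ ^ r : ℝ) : ℂ) * (prop τ ξ * h ξ)) ≤
        l2 (fun ξ => ((br ξ ^ r : ℝ) : ℂ) * h ξ) :=
      l2_le_of_norm_le (hh.br_rpow_mul r).memLp fun ξ => by
        rw [norm_mul, norm_mul, norm_mul, norm_prop, one_mul]
    rw [hB, mul_right_comm]
    gcongr
  have hduh := fun j (hj : j ∈ Finset.range M) => duhamel_inner hF hG (waveVec k i (x j) 0) (ht j hj)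
  have e0 : ∀ j ∈ Finset.range M, c j *
      𝓕⁻ (fun ξ => msym k i ξ * shell k (f (σ * j + ρ)) ξ) (x j) =
      c j * (inner ℂ (waveVec k i (x j) 0) (propOp (κ * (σ * j) + κ * ρ) (F 0)) : ℂ) -
      ∫ s in (0 : ℝ)..T, (Ioc 0 (σ * j + ρ)).indicator (fun s => c j *
        (inner ℂ (waveVec k i (x j) 0) (propOp (κ * (σ * j) + κ * (ρ - s)) (G s)) : ℂ)) s := by
    intro j hj
    have h1 := (hduh j hj).2
    rw [inner_waveVec k i _ _ (hf _ (ht j hj)).2, ← fourierInv_eq_integral_wave] at h1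
    rw [h1, mul_sub, mul_add, ← intervalIntegral.integral_const_mul,
      intervalIntegral.integral_of_le (ht j hj).1, intervalIntegral.integral_of_le hT.le,
      setIntegral_indicator measurableSet_Ioc,
      Set.inter_eq_right.2 (Ioc_subset_Ioc_right (ht j hj).2)]
    congr 2
    ext s
    congr 4
    ring
  have hint : ∀ j ∈ Finset.range M, IntervalIntegrable ((Ioc 0 (σ * j + ρ)).indicator (fun s => c j *
        (inner ℂ (waveVec k i (x j) 0) (propOp (κ * (σ * j) + κ * (ρ - s)) (G s)) : ℂ)))
        volume 0 T := by
    intro j hj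
    have h1 := ((hduh j hj).1).const_mul (c j)
    rw [intervalIntegrable_iff_integrableOn_Ioc_of_le (ht j hj).1] at h1
    rw [intervalIntegrable_iff_integrableOn_Ioc_of_le hT.le]
    refine Integrable.integrableOn ?_
    rw [integrable_indicator_iff measurableSet_Ioc]
    refine h1.congr_fun (fun s _ => ?_) measurableSet_Ioc
    beta_reduce
    congr 4
    ring
  rw [Finset.sum_congr rfl e0, Finset.sum_sub_distrib, ← intervalIntegral.integral_finsetSum hint,
    mul_add]
  refine (norm_sub_le _ _).trans (add_le_add ?_ ?_)
  · exact hlin (f 0) (F 0) (κ * ρ) c hc (hf 0 h0T).1 (hf 0 h0T).2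
  · rw [← intervalIntegral.integral_const_mul]
    refine intervalIntegral.norm_integral_le_of_norm_le hT.le ?_ (hgi.const_mul B)
    filter_upwards with s hs
    have hs' : s ∈ Icc 0 T := ⟨hs.1.le, hs.2⟩
    -- For fixed s the causal restriction s ≤ σj + ρ only sets some of the coefficients to 0. The
    -- retarded estimate is therefore no harder than the homogeneous one.
    have h2 := hlin (g s) (G s) (κ * (ρ - s)) (fun j => if s ≤ σ * j + ρ then c j else 0)
      (fun j => by split_ifs; exacts [hc j, by simp]) (hg s hs').1 (hg s hs').2
    refine le_trans (le_of_eq ?_) h2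
    congr 1
    refine Finset.sum_congr rfl fun j _ => ?_
    by_cases h : s ≤ σ * j + ρ
    · rw [Set.indicator_of_mem (show s ∈ Ioc 0 (σ * j + ρ) from ⟨hs.1, h⟩), if_pos h]
    · rw [Set.indicator_of_notMem (fun h' => h h'.2), if_neg h, zero_mul]

/-- The dispersive estimate for a dyadic piece of the forced linear equation. -/
theorem exists_strichartz {r δ : ℝ} (hδ : 0 ≤ δ) (hr : 2 < 2 * (r - 1 - δ)) :
    ∃ C : ℝ, 0 < C ∧ ∀ (K k : ℕ) (i) (κ T : ℝ), 0 < κ → 0 < T → ∀ (F G : ℝ → ComplexL2)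
    (f g : ℝ → Plane → ℂ),
    (∀ t ∈ Icc 0 T, HasDerivWithinAt F (κ • mulOp (memLp_rieszSymbol 0) (F t) - G t) (Icc 0 T) t) →
    ContinuousOn G (Icc 0 T) →
    (∀ t ∈ Icc 0 T, BL K (f t) ∧ F t =ᵐ[volume] f t) →
    (∀ t ∈ Icc 0 T, BL K (g t) ∧ G t =ᵐ[volume] g t) →
    IntervalIntegrable (fun t => l2 (fun ξ => ((br ξ ^ r : ℝ) : ℂ) * g t ξ)) volume 0 T →
    ∫ t in (0 : ℝ)..T, supF (fun ξ => msym k i ξ * shell k (f t) ξ) ≤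
      ((2 : ℝ) ^ k) ^ (-δ) * (C * (κ ^ (-(1 / 4) : ℝ) * T ^ (3 / 4 : ℝ))) *
      (l2 (fun ξ => ((br ξ ^ r : ℝ) : ℂ) * f 0 ξ) +
        ∫ t in (0 : ℝ)..T, l2 (fun ξ => ((br ξ ^ r : ℝ) : ℂ) * g t ξ)) := by
  obtain ⟨C, hC, hS⟩ := exists_strichartz_sampled hδ hr
  refine ⟨√(2 * C), by positivity, fun K k i κ T hκ hT F G f g hF hG hf hg hgi => ?_⟩
  set φ : ℝ → ℝ := fun t => supF (fun ξ => msym k i ξ * shell k (f t) ξ) with hφ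
  set D := l2 (fun ξ => ((br ξ ^ r : ℝ) : ℂ) * f 0 ξ) +
        ∫ t in (0 : ℝ)..T, l2 (fun ξ => ((br ξ ^ r : ℝ) : ℂ) * g t ξ) with hD
  have hD0 : 0 ≤ D := add_nonneg (l2_nonneg _)
    (intervalIntegral.integral_nonneg hT.le fun t _ => l2_nonneg _)
  have hφc : ContinuousOn φ (Icc 0 T) := continuousOn_supF_shell k i
    (fun t ht => (hF t ht).continuousWithinAt) hf
  -- With σ = T/M the bound is T/M times the square root of M + (κT)^{-1/2} M². From M ≥ √(κT) on,
  -- the second summand dominates, and the result κ^{-1/4} T^{3/4} no longer depends on M.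
  obtain ⟨M, hM0, hM⟩ : ∃ M : ℕ, 0 < M ∧ √(κ * T) ≤ M :=
    ⟨⌈√(κ * T)⌉₊ + 1, Nat.succ_pos _, (Nat.le_ceil _).trans (by push_cast; linarith)⟩
  have hMr : (0 : ℝ) < M := by exact_mod_cast hM0
  obtain ⟨σ, hσ⟩ : ∃ σ, σ = T / M := ⟨_, rfl⟩
  have hσ0 : 0 < σ := hσ ▸ div_pos hT hMr
  have hσM : σ * M = T := by rw [hσ]; field_simp
  have hsub : ∀ j < M, ∀ ρ ∈ Icc 0 σ, σ * j + ρ ∈ Icc 0 T := fun j hj ρ hρ => by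
    have h1 : (j : ℝ) + 1 ≤ M := by exact_mod_cast hj
    have := hρ.1
    refine ⟨by positivity, ?_⟩
    have := hρ.2
    nlinarith
  have hii : ∀ j < M, IntervalIntegrable (fun ρ => φ (σ * j + ρ)) volume 0 σ := fun j hj => by
    apply ContinuousOn.intervalIntegrable
    rw [Set.uIcc_of_le hσ0.le]
    exact hφc.comp (by fun_prop) fun ρ hρ => hsub j hj ρ hρ
  have hii2 : ∀ j < M, IntervalIntegrable φ volume (σ * (j : ℕ)) (σ * ((j + 1 : ℕ) : ℝ)) :=
    fun j hj => by
    apply ContinuousOn.intervalIntegrable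
    refine hφc.mono ?_
    rw [Set.uIcc_of_le (by push_cast; nlinarith)]
    intro t ht
    have := hsub j hj (t - σ * j) ⟨by linarith [ht.1], by
      have := ht.2
      push_cast at this
      linarith⟩
    rwa [add_sub_cancel] at this
  -- The time integral is the average of the sampled sums over all offsets ρ of the grid.
  have hsplit : ∫ t in (0 : ℝ)..T, φ t = ∫ ρ in (0 : ℝ)..σ, ∑ j ∈ Finset.range M, φ (σ * j + ρ) := by
    rw [intervalIntegral.integral_finsetSum fun j hj => hii j (Finset.mem_range.1 hj)]
    have h1 := intervalIntegral.sum_integral_adjacent_intervals (f := φ) (μ := volume)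
      (a := fun j : ℕ => σ * (j : ℝ)) (n := M) hii2
    rw [hσM] at h1
    simp only [Nat.cast_zero, mul_zero] at h1
    rw [← h1]
    refine Finset.sum_congr rfl fun j _ => ?_
    rw [intervalIntegral.integral_comp_add_left]
    congr 1
    · ring
    · push_cast
      ring
  set B := ((2 : ℝ) ^ k) ^ (-δ) * √(C * (M + (κ * σ) ^ (-(1 / 2) : ℝ) * (M * √M))) with hB
  have hbd : ∫ t in (0 : ℝ)..T, φ t ≤ σ * (B * D) := by
    rw [hsplit]
    have : ∫ ρ in (0 : ℝ)..σ, ∑ j ∈ Finset.range M, φ (σ * j + ρ) ≤ ∫ ρ in (0 : ℝ)..σ, B * D := by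
      refine intervalIntegral.integral_mono_on hσ0.le ?_ (by simp) fun ρ hρ => ?_
      · have h2 := IntervalIntegrable.sum (Finset.range M)
          (f := fun (j : ℕ) ρ => φ (σ * j + ρ)) fun j hj => hii j (Finset.mem_range.1 hj)
        have e : (fun ρ => ∑ j ∈ Finset.range M, φ (σ * j + ρ)) =
          ∑ j ∈ Finset.range M, fun ρ => φ (σ * j + ρ) := by ext ρ; simp
        rw [e]
        exact h2
      · exact hS K k i κ T hκ hT F G f g hF hG hf hg hgi M σ ρ hσ0 hρ.1
          fun j hj => (hsub j hj ρ hρ).2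
    refine this.trans (le_of_eq ?_)
    simp
    ring
  have hq : 0 < κ ^ (-(1 / 4) : ℝ) * T ^ (3 / 4 : ℝ) := by positivity
  have hkey : σ * √(C * (M + (κ * σ) ^ (-(1 / 2) : ℝ) * (M * √M))) ≤
      √(2 * C) * (κ ^ (-(1 / 4) : ℝ) * T ^ (3 / 4 : ℝ)) := by
    have hs1 := Real.sqrt_pos.2 hMr
    have hs2 := Real.mul_self_sqrt hMr.le
    have e1 : (κ * σ) ^ (-(1 / 2) : ℝ) = κ ^ (-(1 / 2) : ℝ) * T ^ (-(1 / 2) : ℝ) * √M := by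
      rw [hσ, Real.mul_rpow hκ.le (by positivity), Real.div_rpow hT.le hMr.le,
        Real.rpow_neg hMr.le (1 / 2), ← Real.sqrt_eq_rpow]
      field_simp
    have e2 : (κ ^ (-(1 / 4) : ℝ) * T ^ (3 / 4 : ℝ)) ^ 2 =
        κ ^ (-(1 / 2) : ℝ) * T ^ (-(1 / 2) : ℝ) * T ^ 2 := by
      rw [mul_pow, ← Real.rpow_natCast, ← Real.rpow_natCast, ← Real.rpow_natCast,
        ← Real.rpow_mul hκ.le, ← Real.rpow_mul hT.le, mul_assoc, ← Real.rpow_add hT]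
      norm_num
    have e3 : κ ^ (-(1 / 2) : ℝ) * T ^ (-(1 / 2) : ℝ) * √(κ * T) = 1 := by
      rw [Real.sqrt_eq_rpow, ← Real.mul_rpow hκ.le hT.le, ← Real.rpow_add (mul_pos hκ hT)]
      norm_num
    have hz : 0 ≤ κ ^ (-(1 / 2) : ℝ) * T ^ (-(1 / 2) : ℝ) := by positivity
    have e4 : 1 ≤ κ ^ (-(1 / 2) : ℝ) * T ^ (-(1 / 2) : ℝ) * M :=
      e3.symm.le.trans (mul_le_mul_of_nonneg_left hM hz)
    rw [e1, ← Real.sqrt_sq hq.le, ← Real.sqrt_mul (by positivity), e2]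
    refine Real.le_sqrt_of_sq_le ?_
    rw [mul_pow, Real.sq_sqrt (by positivity)]
    have e5 : κ ^ (-(1 / 2) : ℝ) * T ^ (-(1 / 2) : ℝ) * √M * (M * √M) =
        κ ^ (-(1 / 2) : ℝ) * T ^ (-(1 / 2) : ℝ) * M ^ 2 := by
      linear_combination (κ ^ (-(1 / 2) : ℝ) * T ^ (-(1 / 2) : ℝ) * M) * hs2
    rw [e5]
    set z := κ ^ (-(1 / 2) : ℝ) * T ^ (-(1 / 2) : ℝ)
    rw [← hσM]
    have e6 : (M : ℝ) ≤ z * M ^ 2 := by nlinarith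
    calc σ ^ 2 * (C * (M + z * M ^ 2)) ≤ σ ^ 2 * (C * (z * M ^ 2 + z * M ^ 2)) := by gcongr
      _ = _ := by ring
  refine hbd.trans ?_
  rw [← mul_assoc]
  refine mul_le_mul_of_nonneg_right ?_ hD0
  rw [hB, mul_left_comm]
  gcongr

/-- The dispersive estimate for the forced linear equation. -/
theorem exists_integral_dispN_le {r : ℝ} (hr : 2 < r) :
    ∃ C : ℝ, 0 < C ∧ ∀ (K : ℕ) (κ T : ℝ), 0 < κ → 0 < T → ∀ (F G : ℝ → ComplexL2)
    (f g : ℝ → Plane → ℂ),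
    (∀ t ∈ Icc 0 T, HasDerivWithinAt F (κ • mulOp (memLp_rieszSymbol 0) (F t) - G t) (Icc 0 T) t) →
    ContinuousOn G (Icc 0 T) →
    (∀ t ∈ Icc 0 T, BL K (f t) ∧ F t =ᵐ[volume] f t) →
    (∀ t ∈ Icc 0 T, BL K (g t) ∧ G t =ᵐ[volume] g t) →
    IntervalIntegrable (fun t => l2 (fun ξ => ((br ξ ^ r : ℝ) : ℂ) * g t ξ)) volume 0 T →
    ContinuousOn (fun t => dispN K (f t)) (Icc 0 T) ∧
    ∫ t in (0 : ℝ)..T, dispN K (f t) ≤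
      C * (κ ^ (-(1 / 4) : ℝ) * T ^ (3 / 4 : ℝ)) *
      (l2 (fun ξ => ((br ξ ^ r : ℝ) : ℂ) * f 0 ξ) +
        ∫ t in (0 : ℝ)..T, l2 (fun ξ => ((br ξ ^ r : ℝ) : ℂ) * g t ξ)) := by
  -- Half of the excess r - 2 makes the sum over shells geometric; the other half keeps the weight
  -- exponent 2(r - 1 - δ) = r above 2.
  obtain ⟨δ, hδ⟩ : ∃ δ, δ = (r - 2) / 2 := ⟨_, rfl⟩
  have hδ0 : 0 < δ := by linarith
  obtain ⟨C, hC, hS⟩ := exists_strichartz (r := r) hδ0.le (by linarith)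
  have hb0 : 0 < (2 : ℝ) ^ (-δ) := by positivity
  have hb1 : (2 : ℝ) ^ (-δ) < 1 := Real.rpow_lt_one_of_one_lt_of_neg one_lt_two (by linarith)
  have hgeo : ∀ K : ℕ, ∑ k ∈ Finset.range K, ((2 : ℝ) ^ k) ^ (-δ) ≤ (1 - (2 : ℝ) ^ (-δ))⁻¹ := fun K => by
    have e : ∀ k : ℕ, ((2 : ℝ) ^ k) ^ (-δ) = ((2 : ℝ) ^ (-δ)) ^ k := fun k => by
      rw [← Real.rpow_natCast, ← Real.rpow_natCast, ← Real.rpow_mul zero_le_two,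
        ← Real.rpow_mul zero_le_two, mul_comm]
    simp only [e]
    rw [← tsum_geometric_of_lt_one hb0.le hb1]
    exact (summable_geometric_of_lt_one hb0.le hb1).sum_le_tsum _ fun _ _ => by positivity
  have h1b : 0 < (1 - (2 : ℝ) ^ (-δ))⁻¹ := inv_pos.2 (by linarith)
  refine ⟨8 * C * (1 - (2 : ℝ) ^ (-δ))⁻¹, by positivity,
    fun K κ T hκ hT F G f g hF hG hf hg hgi => ?_⟩
  have hFc : ContinuousOn F (Icc 0 T) := fun t ht => (hF t ht).continuousWithinAt
  have hc : ∀ k i, ContinuousOn (fun t => supF (fun ξ => msym k i ξ * shell k (f t) ξ)) (Icc 0 T) :=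
    fun k i => continuousOn_supF_shell k i hFc hf
  have hcc : ContinuousOn (fun t => dispN K (f t)) (Icc 0 T) := by
    unfold dispN
    exact continuousOn_finsetSum _ fun k _ => continuousOn_finsetSum _ fun i _ => hc k i
  refine ⟨hcc, ?_⟩
  set D := l2 (fun ξ => ((br ξ ^ r : ℝ) : ℂ) * f 0 ξ) +
        ∫ t in (0 : ℝ)..T, l2 (fun ξ => ((br ξ ^ r : ℝ) : ℂ) * g t ξ) with hD
  have hD0 : 0 ≤ D := add_nonneg (l2_nonneg _)
    (intervalIntegral.integral_nonneg hT.le fun t _ => l2_nonneg _)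
  have hi : ∀ k i, IntervalIntegrable (fun t => supF (fun ξ => msym k i ξ * shell k (f t) ξ))
      volume 0 T := fun k i => by
    apply ContinuousOn.intervalIntegrable
    rw [Set.uIcc_of_le hT.le]
    exact hc k i
  set Q := κ ^ (-(1 / 4) : ℝ) * T ^ (3 / 4 : ℝ) with hQ
  have hQ0 : 0 < Q := by positivity
  have hi2 : ∀ k, IntervalIntegrable (fun t => ∑ i, supF (fun ξ => msym k i ξ * shell k (f t) ξ))
      volume 0 T := fun k => by
    apply ContinuousOn.intervalIntegrable
    rw [Set.uIcc_of_le hT.le]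
    exact continuousOn_finsetSum _ fun i _ => hc k i
  unfold dispN
  rw [intervalIntegral.integral_finsetSum fun k _ => hi2 k]
  calc _ ≤ ∑ k ∈ Finset.range K, 8 * (((2 : ℝ) ^ k) ^ (-δ) * (C * Q) * D) := by
        refine Finset.sum_le_sum fun k _ => ?_
        rw [intervalIntegral.integral_finsetSum fun i _ => hi k i]
        refine (Finset.sum_le_sum fun i _ =>
          hS K k i κ T hκ hT F G f g hF hG hf hg hgi).trans (le_of_eq ?_)
        have h8 : Fintype.card (Fin 2 ⊕ Fin 2 ⊕ Fin 2 × Fin 2) = 8 := by simp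
        rw [Finset.sum_const, Finset.card_univ, h8, nsmul_eq_mul,
          Nat.cast_ofNat, hQ, hD]
    _ = 8 * (C * Q) * D * ∑ k ∈ Finset.range K, ((2 : ℝ) ^ k) ^ (-δ) := by
        rw [Finset.mul_sum]
        refine Finset.sum_congr rfl fun k _ => ?_
        ring
    _ ≤ 8 * (C * Q) * D * (1 - (2 : ℝ) ^ (-δ))⁻¹ := by
        gcongr
        exact hgeo K
    _ = _ := by ring

/-! ### The advection term. -/

/-- The advection term `v(a) · ∇ b` on the Fourier side. -/
def adv (a b : Plane → ℂ) (ξ : Plane) : ℂ :=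
  ∑ l, ∫ η, (vsym l (ξ - η) * a (ξ - η)) * (dsym l η * b η)

theorem adv_congr {a a' b b' : Plane → ℂ} (ha : a =ᵐ[volume] a') (hb : b =ᵐ[volume] b') :
    adv a b = adv a' b' := by
  ext ξ
  refine Finset.sum_congr rfl fun l _ => integral_congr_ae ?_
  have : ∀ᵐ η, a (ξ - η) = a' (ξ - η) :=
    (quasiMeasurePreserving_sub_left_of_right_invariant volume ξ).ae_eq_comp ha
  filter_upwards [this, hb] with η h1 h2
  rw [h1, h2]

theorem memLp_dsym_mul {b : Plane → ℂ} (hb : MemLp (fun ξ => (br ξ : ℂ) * b ξ) 2) (l : Fin 2) :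
    MemLp (fun ξ => dsym l ξ * b ξ) 2 ∧
      l2 (fun ξ => dsym l ξ * b ξ) ≤ l2 (fun ξ => (br ξ : ℂ) * b ξ) := by
  have hle : ∀ ξ, ‖dsym l ξ * b ξ‖ ≤ ‖(br ξ : ℂ) * b ξ‖ := fun ξ => by
    rw [norm_mul, norm_mul, Complex.norm_real, Real.norm_of_nonneg (br_pos ξ).le]
    gcongr
    exact norm_dsym_le l ξ
  refine ⟨hb.mono ?_ (Eventually.of_forall hle), l2_le_of_norm_le hb hle⟩
  have e : (fun ξ => dsym l ξ * b ξ) =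
      fun ξ => dsym l ξ * ((br ξ : ℂ)⁻¹ * ((br ξ : ℂ) * b ξ)) := by
    ext ξ
    have : (br ξ : ℂ) ≠ 0 := by exact_mod_cast (br_pos ξ).ne'
    field_simp
  rw [e]
  exact (continuous_dsym l).aestronglyMeasurable.mul
    ((by fun_prop : Measurable fun ξ => (br ξ : ℂ)⁻¹).aestronglyMeasurable.mul hb.1)

theorem integrable_dsym_mul {b : Plane → ℂ} (hb : Integrable (fun ξ => (br ξ : ℂ) * b ξ))
    (l : Fin 2) : Integrable (fun ξ => dsym l ξ * b ξ) ∧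
      ∫ ξ, ‖dsym l ξ * b ξ‖ ≤ ∫ ξ, ‖(br ξ : ℂ) * b ξ‖ := by
  have hle : ∀ ξ, ‖dsym l ξ * b ξ‖ ≤ ‖(br ξ : ℂ) * b ξ‖ := fun ξ => by
    rw [norm_mul, norm_mul, Complex.norm_real, Real.norm_of_nonneg (br_pos ξ).le]
    gcongr
    exact norm_dsym_le l ξ
  have e : (fun ξ => dsym l ξ * b ξ) =
      fun ξ => dsym l ξ * ((br ξ : ℂ)⁻¹ * ((br ξ : ℂ) * b ξ)) := by
    ext ξ
    have : (br ξ : ℂ) ≠ 0 := by exact_mod_cast (br_pos ξ).ne'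
    field_simp
  have hi : Integrable (fun ξ => dsym l ξ * b ξ) := by
    refine hb.mono ?_ (Eventually.of_forall hle)
    rw [e]
    exact (continuous_dsym l).aestronglyMeasurable.mul
      ((by fun_prop : Measurable fun ξ => (br ξ : ℂ)⁻¹).aestronglyMeasurable.mul hb.1)
  exact ⟨hi, integral_mono hi.norm hb.norm hle⟩

theorem memLp_vsym_mul {a : Plane → ℂ} (ha : MemLp a 2) (l : Fin 2) :
    MemLp (fun ξ => vsym l ξ * a ξ) 2 ∧ l2 (fun ξ => vsym l ξ * a ξ) ≤ l2 a := by
  have hle : ∀ ξ, ‖vsym l ξ * a ξ‖ ≤ ‖a ξ‖ := fun ξ => by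
    rw [norm_mul]
    exact mul_le_of_le_one_left (norm_nonneg _) (norm_vsym_le l ξ)
  exact ⟨ha.mono ((measurable_vsym l).aestronglyMeasurable.mul ha.1) (Eventually.of_forall hle),
    l2_le_of_norm_le ha hle⟩

/-- Young's inequality with the advecting function in L¹; the factor 2 counts the coordinates. -/
theorem memLp_adv {a b : Plane → ℂ} (ha : Integrable a)
    (hb : MemLp (fun ξ => (br ξ : ℂ) * b ξ) 2) :
    MemLp (adv a b) 2 ∧ l2 (adv a b) ≤ 2 * (∫ ξ, ‖a ξ‖) * l2 (fun ξ => (br ξ : ℂ) * b ξ) := by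
  have hc := fun l => memLp_conv (integrable_vsym_mul ha l) (memLp_dsym_mul hb l).1
  have e : adv a b = ∑ l, fun ξ => ∫ η, (vsym l (ξ - η) * a (ξ - η)) * (dsym l η * b η) := by
    ext ξ
    simp [adv]
  rw [e]
  refine ⟨memLp_finsetSum' _ fun l _ => (hc l).1, ?_⟩
  refine (lpNorm_sum_le (fun l _ => (hc l).1) (by norm_num)).trans ?_
  have hb2 : ∀ l, l2 (fun ξ => ∫ η, (vsym l (ξ - η) * a (ξ - η)) * (dsym l η * b η)) ≤
      (∫ ξ, ‖a ξ‖) * l2 (fun ξ => (br ξ : ℂ) * b ξ) := fun l => by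
    refine (hc l).2.trans ?_
    refine mul_le_mul ?_ (memLp_dsym_mul hb l).2 (l2_nonneg _)
      (integral_nonneg fun _ => norm_nonneg _)
    refine integral_mono (integrable_vsym_mul ha l).norm ha.norm fun ξ => ?_
    rw [norm_mul]
    exact mul_le_of_le_one_left (norm_nonneg _) (norm_vsym_le l ξ)
  refine (Finset.sum_le_sum fun l _ => hb2 l).trans (le_of_eq ?_)
  simp
  ring

/-- Young's inequality with the roles exchanged: the gradient is in L¹, so the advecting function
needs no derivative. This is the form for differences of solutions. -/
theorem memLp_adv_right {a b : Plane → ℂ} (ha : MemLp a 2)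
    (hb : Integrable (fun ξ => (br ξ : ℂ) * b ξ)) :
    MemLp (adv a b) 2 ∧ l2 (adv a b) ≤ 2 * (∫ ξ, ‖(br ξ : ℂ) * b ξ‖) * l2 a := by
  have hc := fun l => memLp_conv (integrable_dsym_mul hb l).1 (memLp_vsym_mul ha l).1
  have e : adv a b = ∑ l, fun ξ => ∫ η, (dsym l (ξ - η) * b (ξ - η)) * (vsym l η * a η) := by
    ext ξ
    simp only [adv, Finset.sum_apply]
    refine Finset.sum_congr rfl fun l _ => ?_
    rw [← integral_sub_left_eq_self _ _ ξ]
    simp only [sub_sub_cancel]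
    exact integral_congr_ae (by filter_upwards with η using mul_comm _ _)
  rw [e]
  refine ⟨memLp_finsetSum' _ fun l _ => (hc l).1, ?_⟩
  refine (lpNorm_sum_le (fun l _ => (hc l).1) (by norm_num)).trans ?_
  have hb2 : ∀ l, l2 (fun ξ => ∫ η, (dsym l (ξ - η) * b (ξ - η)) * (vsym l η * a η)) ≤
      (∫ ξ, ‖(br ξ : ℂ) * b ξ‖) * l2 a := fun l => by
    refine (hc l).2.trans ?_
    exact mul_le_mul (integrable_dsym_mul hb l).2 (memLp_vsym_mul ha l).2 (l2_nonneg _)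
      (integral_nonneg fun _ => norm_nonneg _)
  refine (Finset.sum_le_sum fun l _ => hb2 l).trans (le_of_eq ?_)
  simp
  ring

theorem integrable_conv_integrand {w g : Plane → ℂ} (hw : MemLp w 2) (hg : MemLp g 2) (ξ : Plane) :
    Integrable fun η => w (ξ - η) * g η := by
  have h : MemLp (fun η => w (ξ - η)) 2 :=
    hw.comp_measurePreserving (Measure.measurePreserving_sub_left volume ξ)
  exact h.integrable_mul hg

/-- The splitting is chosen so that the difference is differentiated only when it is transported by
g, a term that the antisymmetry will remove. -/
theorem adv_self_sub {f g : Plane → ℂ} (hf : MemLp f 2) (hg : MemLp g 2)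
    (hf' : MemLp (fun ξ => (br ξ : ℂ) * f ξ) 2) (hg' : MemLp (fun ξ => (br ξ : ℂ) * g ξ) 2)
    (ξ : Plane) : adv f f ξ - adv g g ξ =
      adv (fun ξ => f ξ - g ξ) f ξ + adv g (fun ξ => f ξ - g ξ) ξ := by
  simp only [adv]
  rw [← Finset.sum_sub_distrib, ← Finset.sum_add_distrib]
  refine Finset.sum_congr rfl fun l _ => ?_
  have h1 := integrable_conv_integrand (memLp_vsym_mul hf l).1 (memLp_dsym_mul hf' l).1 ξ
  have h2 := integrable_conv_integrand (memLp_vsym_mul hg l).1 (memLp_dsym_mul hg' l).1 ξ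
  have h3 := integrable_conv_integrand (memLp_vsym_mul hg l).1 (memLp_dsym_mul hf' l).1 ξ
  have e1 : ∫ η, (vsym l (ξ - η) * (f (ξ - η) - g (ξ - η))) * (dsym l η * f η) =
      (∫ η, (vsym l (ξ - η) * f (ξ - η)) * (dsym l η * f η)) -
      ∫ η, (vsym l (ξ - η) * g (ξ - η)) * (dsym l η * f η) := by
    rw [← integral_sub h1 h3]
    exact integral_congr_ae (by filter_upwards with η; ring)
  have e2 : ∫ η, (vsym l (ξ - η) * g (ξ - η)) * (dsym l η * (f η - g η)) =
      (∫ η, (vsym l (ξ - η) * g (ξ - η)) * (dsym l η * f η)) -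
      ∫ η, (vsym l (ξ - η) * g (ξ - η)) * (dsym l η * g η) := by
    rw [← integral_sub h3 h2]
    exact integral_congr_ae (by filter_upwards with η; ring)
  rw [e1, e2]
  ring

theorem integral_adv_mul_conj {a b h : Plane → ℂ} (ha : Integrable a)
    (hb : MemLp (fun ξ => (br ξ : ℂ) * b ξ) 2) (hh : MemLp h 2) :
    ∫ ξ, adv a b ξ * (starRingEnd ℂ) (h ξ) = ∫ p, ker3 a b h p := by
  have hh' : MemLp (fun ξ => (starRingEnd ℂ) (h ξ)) 2 := hh.star
  obtain ⟨w, hw⟩ : ∃ w : Fin 2 → Plane → ℂ, w = fun l ξ => vsym l ξ * a ξ := ⟨_, rfl⟩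
  obtain ⟨g, hg⟩ : ∃ g : Fin 2 → Plane → ℂ, g = fun l ξ => dsym l ξ * b ξ := ⟨_, rfl⟩
  have hwi : ∀ l, Integrable (w l) := fun l => hw ▸ integrable_vsym_mul ha l
  have hgi : ∀ l, MemLp (g l) 2 := fun l => hg ▸ (memLp_dsym_mul hb l).1
  have hi : ∀ l, Integrable fun ξ => (∫ η, w l (ξ - η) * g l η) * (starRingEnd ℂ) (h ξ) :=
    fun l => (memLp_conv (hwi l) (hgi l)).1.integrable_mul hh'
  have e : ∀ p : Plane × Plane, ker3 a b h p = ∑ l, w l (p.1 - p.2) * g l p.2 *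
      (starRingEnd ℂ) (h p.1) := fun p => by
    rw [ker3_eq_sum]
    refine Finset.sum_congr rfl fun l _ => ?_
    simp only [hw, hg]
    ring
  have e' : ∀ ξ, adv a b ξ = ∑ l, ∫ η, w l (ξ - η) * g l η := fun ξ => by
    simp only [hw, hg, adv]
  simp only [e, e', Finset.sum_mul]
  rw [integral_finsetSum _ fun l _ => hi l,
    integral_finsetSum _ fun l _ => integrable_trilinear (hwi l) (hgi l) hh]
  exact Finset.sum_congr rfl fun l _ => (integral_trilinear (hwi l) (hgi l) hh).symm

theorem herm_adv {a b : Plane → ℂ} (ha : Herm a) (hb : Herm b) : Herm (adv a b) := fun ξ => by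
  simp only [adv, map_sum]
  refine Finset.sum_congr rfl fun l _ => ?_
  rw [← integral_conj, ← integral_neg_eq_self]
  refine integral_congr_ae ?_
  filter_upwards with η
  have e : -ξ - -η = -(ξ - η) := by abel
  rw [e, vsym_neg, ha, dsym_neg, hb]
  simp only [map_mul, conj_dsym]

/-! ### Hermitian parts and frequency truncations. -/

/-- The Hermitian part of a function. -/
def hpart (f : Plane → ℂ) (ξ : Plane) : ℂ := (f ξ + (starRingEnd ℂ) (f (-ξ))) / 2

/-- Truncation to frequencies in the blocks below `K`. -/
def trunc (K : ℕ) (f : Plane → ℂ) : Plane → ℂ := {ξ | blk ξ < K}.indicator f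

theorem herm_hpart (f : Plane → ℂ) : Herm (hpart f) := fun ξ => by
  simp only [hpart, neg_neg, map_div₀, map_add, Complex.conj_conj, map_ofNat]
  ring

theorem Herm.hpart_eq {f : Plane → ℂ} (hf : Herm f) : hpart f = f := by
  ext ξ
  simp only [hpart, hf ξ, Complex.conj_conj]
  ring

theorem hpart_congr {f g : Plane → ℂ} (h : f =ᵐ[volume] g) : hpart f =ᵐ[volume] hpart g := by
  have : ∀ᵐ ξ, f (-ξ) = g (-ξ) :=
    (Measure.measurePreserving_neg (volume : Measure Plane)).quasiMeasurePreserving.ae_eq_comp h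
  filter_upwards [h, this] with ξ h1 h2
  simp only [hpart, h1, h2]

theorem MemLp.hpart {f : Plane → ℂ} (hf : MemLp f 2) :
    MemLp (hpart f) 2 ∧ l2 (DispersiveSQG.hpart f) ≤ l2 f := by
  have h1 : MemLp (fun ξ => f (-ξ)) 2 :=
    hf.comp_measurePreserving (Measure.measurePreserving_neg (volume : Measure Plane))
  have h2 : MemLp (fun ξ => (starRingEnd ℂ) (f (-ξ))) 2 := h1.star
  have h3 : MemLp (fun ξ => f ξ + (starRingEnd ℂ) (f (-ξ))) 2 := hf.add h2
  have e : l2 (fun ξ => (starRingEnd ℂ) (f (-ξ))) = l2 f := by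
    have e1 : l2 (fun ξ => (starRingEnd ℂ) (f (-ξ))) ^ 2 = l2 f ^ 2 := by
      rw [l2_sq h2, l2_sq hf, ← integral_neg_eq_self fun ξ => ‖f ξ‖ ^ 2]
      simp only [RCLike.norm_conj]
    exact (pow_left_inj₀ (l2_nonneg _) (l2_nonneg _) two_ne_zero).1 e1
  have e2 : DispersiveSQG.hpart f = fun ξ => (2⁻¹ : ℂ) * (f ξ + (starRingEnd ℂ) (f (-ξ))) := by
    ext ξ
    simp only [DispersiveSQG.hpart]
    ring
  rw [e2]
  refine ⟨h3.const_mul _, ?_⟩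
  refine (l2_mono (c := 2⁻¹) (by norm_num) h3 fun ξ => by simp).trans ?_
  have := lpNorm_add_le (g := fun ξ => (starRingEnd ℂ) (f (-ξ))) hf (by norm_num)
  have h4 : l2 (fun ξ => f ξ + (starRingEnd ℂ) (f (-ξ))) ≤ l2 f + l2 f := by
    refine this.trans (le_of_eq ?_)
    exact congrArg (l2 f + ·) e
  linarith

theorem bL_trunc (K : ℕ) {f : Plane → ℂ} (hf : MemLp f 2) : BL K (trunc K f) :=
  ⟨hf.indicator (measurableSet_blk_lt K), fun ξ h => by simp [trunc, h]⟩

theorem Herm.trunc (K : ℕ) {f : Plane → ℂ} (hf : Herm f) : Herm (trunc K f) := fun ξ => by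
  by_cases h : blk ξ < K
  · simp [DispersiveSQG.trunc, blk_neg, h, hf ξ]
  · simp [DispersiveSQG.trunc, blk_neg, h]

theorem BL.trunc_eq {K : ℕ} {f : Plane → ℂ} (hf : BL K f) : trunc K f = f := by
  ext ξ
  by_cases h : blk ξ < K
  · simp [trunc, h]
  · simp [trunc, h, hf.supp ξ (not_lt.1 h)]

theorem norm_trunc_le (K : ℕ) (f : Plane → ℂ) (ξ : Plane) : ‖trunc K f ξ‖ ≤ ‖f ξ‖ :=
  norm_indicator_le_norm_self _ _

theorem trunc_congr (K : ℕ) {f g : Plane → ℂ} (h : f =ᵐ[volume] g) :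
    trunc K f =ᵐ[volume] trunc K g := by
  filter_upwards [h] with ξ h1
  simp only [trunc, Set.indicator_apply, h1]

/-! ### Grönwall's inequality and ordinary differential equations in L². -/

/-- Grönwall's inequality with a variable coefficient. -/
theorem le_mul_exp_of_deriv_le {y y' A a : ℝ → ℝ} {T b : ℝ} (hb : 0 ≤ b)
    (hy : ∀ t ∈ Icc 0 T, HasDerivWithinAt y (y' t) (Icc 0 T) t)
    (hA : ∀ t ∈ Icc 0 T, HasDerivWithinAt A (a t) (Icc 0 T) t) (hA0 : A 0 = 0)
    (hAn : ∀ t ∈ Icc 0 T, 0 ≤ A t) (h : ∀ t ∈ Icc 0 T, y' t ≤ a t * y t + b)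
    {t : ℝ} (ht : t ∈ Icc 0 T) : y t ≤ (y 0 + b * t) * Real.exp (A t) := by
  have hz : ∀ s ∈ Icc 0 T, HasDerivWithinAt (fun s => y s * Real.exp (-A s) - b * s)
      ((y' s * Real.exp (-A s) + y s * (Real.exp (-A s) * -a s)) - b * 1) (Icc 0 T) s :=
    fun s hs => ((hy s hs).mul (hA s hs).neg.exp).sub ((hasDerivWithinAt_id s _).const_mul b)
  -- The integrating factor is at most 1 because A ≥ 0, so the inhomogeneity contributes at most b
  -- per unit of time.
  have hanti : AntitoneOn (fun s => y s * Real.exp (-A s) - b * s) (Icc 0 T) := by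
    refine antitoneOn_of_hasDerivWithinAt_nonpos (convex_Icc 0 T)
      (fun s hs => (hz s hs).continuousWithinAt)
      (fun s hs => (hz s (interior_subset hs)).mono interior_subset) fun s hs => ?_
    have hs' := interior_subset hs
    have h1 := h s hs'
    have h2 : Real.exp (-A s) ≤ 1 := Real.exp_le_one_iff.2 (by linarith [hAn s hs'])
    have h3 := Real.exp_pos (-A s)
    nlinarith
  have h0 : (0 : ℝ) ∈ Icc 0 T := ⟨le_rfl, ht.1.trans ht.2⟩
  have := hanti h0 ht ht.1
  simp only [hA0, neg_zero, Real.exp_zero, mul_one, mul_zero, sub_zero] at this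
  have h4 : y t * Real.exp (-A t) ≤ y 0 + b * t := by linarith
  calc y t = y t * Real.exp (-A t) * Real.exp (A t) := by
        rw [mul_assoc, ← Real.exp_add]
        simp
    _ ≤ _ := by gcongr

/-- Radial retraction to a ball. -/
def retract (M : ℝ) (x : ComplexL2) : ComplexL2 := (M / max M ‖x‖) • x

theorem norm_retract_le {M : ℝ} (hM : 0 < M) (x : ComplexL2) : ‖retract M x‖ ≤ M := by
  have h : 0 < max M ‖x‖ := lt_max_of_lt_left hM
  rw [retract, norm_smul, Real.norm_of_nonneg (by positivity), div_mul_eq_mul_div, div_le_iff₀ h]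
  gcongr
  exact le_max_right _ _

theorem norm_retract_sub_le {M : ℝ} (hM : 0 < M) (x y : ComplexL2) :
    ‖retract M x - retract M y‖ ≤ 2 * ‖x - y‖ := by
  have hx : 0 < max M ‖x‖ := lt_max_of_lt_left hM
  have hy : 0 < max M ‖y‖ := lt_max_of_lt_left hM
  have e : retract M x - retract M y = (M / max M ‖x‖) • (x - y) +
      ((M / max M ‖x‖) - (M / max M ‖y‖)) • y := by
    simp only [retract, smul_sub, sub_smul]
    abel
  have h1 : ‖(M / max M ‖x‖) • (x - y)‖ ≤ ‖x - y‖ := by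
    rw [norm_smul, Real.norm_of_nonneg (by positivity)]
    exact mul_le_of_le_one_left (norm_nonneg _) ((div_le_one hx).2 (le_max_left _ _))
  have h2 : ‖((M / max M ‖x‖) - (M / max M ‖y‖)) • y‖ ≤ ‖x - y‖ := by
    have e2 : (M / max M ‖x‖) - (M / max M ‖y‖) =
        (M / max M ‖x‖) * ((max M ‖y‖ - max M ‖x‖) / max M ‖y‖) := by field_simp
    have h3 : |max M ‖y‖ - max M ‖x‖| ≤ ‖x - y‖ := by
      refine (abs_max_sub_max_le_max M ‖y‖ M ‖x‖).trans ?_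
      simp only [sub_self, abs_zero]
      rw [max_eq_right (abs_nonneg _), norm_sub_rev]
      exact abs_norm_sub_norm_le _ _
    rw [norm_smul, e2, norm_mul, Real.norm_of_nonneg (by positivity), norm_div,
      Real.norm_of_nonneg hy.le, Real.norm_eq_abs]
    calc _ ≤ 1 * (‖x - y‖ / max M ‖y‖) * max M ‖y‖ := by
          gcongr
          · exact (div_le_one hx).2 (le_max_left _ _)
          · exact le_max_right _ _
      _ = _ := by field_simp
  rw [e]
  linarith [norm_add_le ((M / max M ‖x‖) • (x - y)) (((M / max M ‖x‖) - (M / max M ‖y‖)) • y)]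

/-- Global solvability of an ordinary differential equation with a conserved norm. -/
theorem exists_integral_curve (P : ComplexL2 →L[ℝ] ComplexL2) (hP : ∀ x, P (P x) = P x)
    (hPn : ∀ x, ‖P x‖ ≤ ‖x‖) (X : ComplexL2 → ComplexL2) (hPX : ∀ x, P (X x) = X x)
    {L : ℝ → ℝ} (hL0 : ∀ M, 0 ≤ L M)
    (hL : ∀ M x y, ‖x‖ ≤ M → ‖y‖ ≤ M → ‖X x - X y‖ ≤ L M * ‖x - y‖)
    (hX : ∀ x, P x = x → (inner ℂ x (X x)).re = 0) (x₀ : ComplexL2) (hx₀ : P x₀ = x₀)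
    {T : ℝ} (hT : 0 < T) :
    ∃ α : ℝ → ComplexL2, α 0 = x₀ ∧ ∀ t ∈ Icc 0 T, P (α t) = α t ∧ ‖α t‖ = ‖x₀‖ ∧
      HasDerivWithinAt α (X (α t)) (Icc 0 T) t := by
  obtain ⟨M, hM, hM0, hMx⟩ : ∃ M, M = ‖x₀‖ + 1 ∧ 0 < M ∧ ‖x₀‖ ≤ M :=
    ⟨_, rfl, by positivity, by linarith⟩
  -- The modified field is bounded and globally Lipschitz, so it has a curve on all of [0, T]. Norm
  -- conservation keeps that curve inside the ball, where the modification is not felt.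
  let Y : ComplexL2 → ComplexL2 := fun x => X (retract M (P x))
  have hYl : ∀ x y, ‖Y x - Y y‖ ≤ (2 * L M) * ‖x - y‖ := fun x y => by
    refine (hL M _ _ (norm_retract_le hM0 _) (norm_retract_le hM0 _)).trans ?_
    have h1 := norm_retract_sub_le hM0 (P x) (P y)
    rw [← map_sub] at h1
    calc _ ≤ L M * (2 * ‖x - y‖) :=
          mul_le_mul_of_nonneg_left (h1.trans (by linarith [hPn (x - y)])) (hL0 M)
      _ = _ := by ring
  have hYb : ∀ x, ‖Y x‖ ≤ ‖X 0‖ + L M * M := fun x => by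
    have h1 := hL M (retract M (P x)) 0 (norm_retract_le hM0 _) (by simpa using hM0.le)
    rw [sub_zero] at h1
    have h2 := norm_le_norm_add_norm_sub' (Y x) (X 0)
    have h3 := mul_le_mul_of_nonneg_left (norm_retract_le hM0 (P x)) (hL0 M)
    linarith
  have hB0 : 0 ≤ ‖X 0‖ + L M * M := by
    have := hL0 M
    positivity
  have hPL : IsPicardLindelof (fun _ : ℝ => Y) (tmin := 0) (tmax := T) ⟨0, le_rfl, hT.le⟩ x₀
      (Real.toNNReal ((‖X 0‖ + L M * M) * T)) 0 (Real.toNNReal (‖X 0‖ + L M * M))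
      (Real.toNNReal (2 * L M)) := by
    refine IsPicardLindelof.of_time_independent (fun x _ => ?_) ?_ ?_
    · rw [Real.coe_toNNReal _ hB0]
      exact hYb x
    · refine LipschitzWith.lipschitzOnWith (LipschitzWith.of_dist_le_mul fun x y => ?_)
      rw [dist_eq_norm, dist_eq_norm, Real.coe_toNNReal _ (mul_nonneg zero_le_two (hL0 M))]
      exact hYl x y
    · rw [Real.coe_toNNReal _ hB0, Real.coe_toNNReal _ (mul_nonneg hB0 hT.le)]
      simp [hT.le]
  obtain ⟨α, hα0, hα⟩ := hPL.exists_eq_forall_mem_Icc_hasDerivWithinAt₀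
  have hβ : ∀ t ∈ Icc 0 T, HasDerivWithinAt (fun t => P (α t)) (X (retract M (P (α t))))
      (Icc 0 T) t := fun t ht => by
    have := P.hasFDerivAt.comp_hasDerivWithinAt t (hα t ht)
    rw [hPX] at this
    exact this
  have hα0' : α 0 = x₀ := hα0
  have hn : ∀ t ∈ Icc 0 T, ‖P (α t)‖ ^ 2 = ‖x₀‖ ^ 2 := by
    have hd : ∀ t ∈ Icc 0 T, HasDerivWithinAt (fun t => ‖P (α t)‖ ^ 2) 0 (Icc 0 T) t :=
      fun t ht => by
      have h1 := (hβ t ht).inner ℂ (hβ t ht)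
      -- The retracted point is a positive multiple of the point itself, so orthogonality of the
      -- field to the former gives orthogonality to the latter.
      have h2 : (inner ℂ (P (α t)) (X (retract M (P (α t))))).re = 0 := by
        have hs : 0 < M / max M ‖P (α t)‖ := div_pos hM0 (lt_max_of_lt_left hM0)
        have h3 := hX (retract M (P (α t))) (by rw [retract, map_smul, hP])
        nth_rewrite 1 [retract] at h3
        rw [RCLike.real_smul_eq_coe_smul (K := ℂ), inner_smul_left, RCLike.conj_ofReal] at h3
        erw [Complex.re_ofReal_mul] at h3
        exact (mul_eq_zero.1 h3).resolve_left hs.ne'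
      have h4 := Complex.reCLM.hasFDerivAt.comp_hasDerivWithinAt t h1
      refine (h4.congr_deriv ?_).congr (fun s _ => ?_) ?_
      · rw [Complex.reCLM_apply, Complex.add_re, h2, zero_add, ← inner_conj_symm, Complex.conj_re, h2]
      · simp only [Function.comp, Complex.reCLM_apply]
        exact (inner_self_eq_norm_sq (𝕜 := ℂ) _).symm
      · simp only [Function.comp, Complex.reCLM_apply]
        exact (inner_self_eq_norm_sq (𝕜 := ℂ) _).symm
    intro t ht
    have := constant_of_has_deriv_right_zero (fun s hs => (hd s hs).continuousWithinAt)
      (fun s hs => (hd s ⟨hs.1, hs.2.le⟩).mono_of_mem_nhdsWithin (Icc_mem_nhdsGE_of_mem hs)) t ht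
    rw [this, hα0', hx₀]
  have hn' : ∀ t ∈ Icc 0 T, ‖P (α t)‖ = ‖x₀‖ := fun t ht =>
    (pow_left_inj₀ (norm_nonneg _) (norm_nonneg _) two_ne_zero).1 (hn t ht)
  refine ⟨fun t => P (α t), by simp only [hα0', hx₀], fun t ht => ⟨hP _, hn' t ht, ?_⟩⟩
  have h5 : retract M (P (α t)) = P (α t) := by
    rw [retract, hn' t ht, max_eq_left hMx, div_self hM0.ne', one_smul]
  have h6 := hβ t ht
  rwa [h5] at h6

/-! ### The Galerkin approximation. -/

theorem memLp_trunc_hpart (K : ℕ) (F : ComplexL2) : MemLp (trunc K (hpart F)) 2 :=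
  (bL_trunc K (MemLp.hpart (Lp.memLp F)).1).memLp

/-- The orthogonal projection to the Hermitian functions with frequencies in blocks below `K`. -/
def proj (K : ℕ) : ComplexL2 →L[ℝ] ComplexL2 :=
  LinearMap.mkContinuous
    { toFun := fun F => (memLp_trunc_hpart K F).toLp _
      map_add' := fun F G => by
        rw [← MemLp.toLp_add]
        refine (MemLp.toLp_eq_toLp_iff _ _).2 ?_
        filter_upwards [trunc_congr K (hpart_congr (Lp.coeFn_add F G))] with ξ h
        rw [h]
        by_cases hb : blk ξ < K
        · simp [trunc, hb, hpart]
          ring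
        · simp [trunc, hb]
      map_smul' := fun c F => by
        rw [RingHom.id_apply, ← MemLp.toLp_const_smul]
        refine (MemLp.toLp_eq_toLp_iff _ _).2 ?_
        filter_upwards [trunc_congr K (hpart_congr (Lp.coeFn_smul c F))] with ξ h
        rw [h]
        by_cases hb : blk ξ < K
        · simp [trunc, hb, hpart]
          ring
        · simp [trunc, hb] } 1 fun F => by
    rw [one_mul]
    change ‖(memLp_trunc_hpart K F).toLp _‖ ≤ _
    rw [norm_toLp_eq_l2, norm_eq_l2 (ae_eq_refl F)]
    exact (l2_le_of_norm_le (MemLp.hpart (Lp.memLp F)).1 (norm_trunc_le K _)).trans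
      (MemLp.hpart (Lp.memLp F)).2

theorem norm_proj_le (K : ℕ) (F : ComplexL2) : ‖proj K F‖ ≤ ‖F‖ := by
  have := (proj K).le_of_opNorm_le (LinearMap.mkContinuous_norm_le _ zero_le_one _) F
  rwa [one_mul] at this

theorem coeFn_proj (K : ℕ) (F : ComplexL2) : proj K F =ᵐ[volume] trunc K (hpart F) :=
  MemLp.coeFn_toLp (memLp_trunc_hpart K F)

theorem coeFn_proj_of_herm (K : ℕ) {F : ComplexL2} {f : Plane → ℂ} (h : F =ᵐ[volume] f)
    (hf : Herm f) : proj K F =ᵐ[volume] trunc K f := by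
  have h1 := trunc_congr K (hpart_congr h)
  rw [hf.hpart_eq] at h1
  exact (coeFn_proj K F).trans h1

theorem proj_eq_self {K : ℕ} {F : ComplexL2} {f : Plane → ℂ} (h : F =ᵐ[volume] f)
    (hf : Herm f) (hb : BL K f) : proj K F = F := by
  have h1 := coeFn_proj_of_herm K h hf
  rw [hb.trunc_eq] at h1
  exact Lp.ext (h1.trans h.symm)

theorem proj_proj (K : ℕ) (F : ComplexL2) : proj K (proj K F) = proj K F :=
  proj_eq_self (coeFn_proj K F) ((herm_hpart F).trunc K) (bL_trunc K (MemLp.hpart (Lp.memLp F)).1)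

theorem BL.br_mul {K : ℕ} {f : Plane → ℂ} (hf : BL K f) : BL K (fun ξ => (br ξ : ℂ) * f ξ) ∧
    l2 (fun ξ => (br ξ : ℂ) * f ξ) ≤ 2 ^ K * l2 f := by
  have hle : ∀ ξ, blk ξ < K → ‖(br ξ : ℂ)‖ ≤ 2 ^ K := fun ξ h => by
    rw [Complex.norm_real, Real.norm_of_nonneg (br_pos ξ).le]
    exact br_le_of_blk_lt h
  refine ⟨hf.mul (by fun_prop) hle, l2_mono (by positivity) hf.memLp fun ξ => ?_⟩
  by_cases h : blk ξ < K
  · rw [norm_mul]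
    gcongr
    exact hle ξ h
  · simp [hf.supp ξ (not_lt.1 h)]

/-- Cauchy-Schwarz against the indicator of the frequency set, which has finite measure. -/
theorem BL.integral_norm_le {K : ℕ} {f : Plane → ℂ} (hf : BL K f) :
    ∫ ξ, ‖f ξ‖ ≤ l2 (trunc K fun _ => 1) * l2 f := by
  have h1 : BL K (trunc K fun _ => 1) := bL_of_bounded (C := 1)
    (measurable_const.indicator (measurableSet_blk_lt K))
    (fun ξ => (norm_trunc_le K _ ξ).trans (by simp)) fun ξ h => by simp [trunc, h]
  have h2 : MemLp (fun ξ => (‖f ξ‖ : ℂ)) 2 := hf.memLp.norm.ofReal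
  have h3 := norm_integral_mul_conj_le h1.memLp h2
  have h4 : l2 (fun ξ => (‖f ξ‖ : ℂ)) ≤ l2 f := l2_le_of_norm_le hf.memLp fun ξ => by simp
  have e : ∫ ξ, trunc K (fun _ => 1) ξ * (starRingEnd ℂ) (‖f ξ‖ : ℂ) = ((∫ ξ, ‖f ξ‖ : ℝ) : ℂ) := by
    rw [← integral_complex_ofReal]
    refine integral_congr_ae ?_
    filter_upwards with ξ
    by_cases h : blk ξ < K
    · simp [trunc, h]
    · simp [trunc, h, hf.supp ξ (not_lt.1 h)]
  rw [e, Complex.norm_real, Real.norm_of_nonneg (integral_nonneg fun _ => norm_nonneg _)] at h3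
  exact h3.trans (mul_le_mul_of_nonneg_left h4 (l2_nonneg _))

/-- The difference of two advection terms. -/
theorem l2_adv_self_sub_le {f g : Plane → ℂ} (hf : MemLp f 2) (hg : MemLp g 2)
    (hf' : MemLp (fun ξ => (br ξ : ℂ) * f ξ) 2) (hg' : MemLp (fun ξ => (br ξ : ℂ) * g ξ) 2)
    (hfi : Integrable fun ξ => (br ξ : ℂ) * f ξ) (hgi : Integrable g) :
    l2 (fun ξ => adv f f ξ - adv g g ξ) ≤
      2 * (∫ ξ, ‖(br ξ : ℂ) * f ξ‖) * l2 (fun ξ => f ξ - g ξ) +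
      2 * (∫ ξ, ‖g ξ‖) * l2 (fun ξ => (br ξ : ℂ) * (f ξ - g ξ)) := by
  have hd : MemLp (fun ξ => f ξ - g ξ) 2 := hf.sub hg
  have hd' : MemLp (fun ξ => (br ξ : ℂ) * (f ξ - g ξ)) 2 := by
    simp only [mul_sub]
    exact hf'.sub hg'
  have h1 := memLp_adv_right hd hfi
  have h2 := memLp_adv hgi hd'
  have e : (fun ξ => adv f f ξ - adv g g ξ) = adv (fun ξ => f ξ - g ξ) f +
      adv g (fun ξ => f ξ - g ξ) := by
    ext ξ
    exact adv_self_sub hf hg hf' hg' ξ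
  rw [e]
  exact (lpNorm_add_le h1.1 (by norm_num)).trans (add_le_add h1.2 h2.2)

theorem integral_ker3_self {f : Plane → ℂ} (hf : Herm f) (g : Plane → ℂ) :
    (∫ p, ker3 f g g p).re = 0 := by
  have := re_integral_ker3_swap hf g fun _ _ => 1
  simp only [Complex.ofReal_one, one_mul] at this
  linarith

theorem BL.memLp_adv {K : ℕ} {f g : Plane → ℂ} (hf : BL K f) (hg : BL K g) :
    MemLp (adv f g) 2 :=
  (DispersiveSQG.memLp_adv hf.integrable hg.br_mul.1.memLp).1

theorem bL_trunc_hpart (K : ℕ) (F : ComplexL2) : BL K (trunc K (hpart F)) :=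
  bL_trunc K (MemLp.hpart (Lp.memLp F)).1

theorem memLp_adv_trunc_hpart (K : ℕ) (F : ComplexL2) :
    MemLp (adv (trunc K (hpart F)) (trunc K (hpart F))) 2 :=
  (bL_trunc_hpart K F).memLp_adv (bL_trunc_hpart K F)

/-- The vector field of the Galerkin approximation. -/
def galerkinField (K : ℕ) (κ : ℝ) (F : ComplexL2) : ComplexL2 :=
  proj K (κ • mulOp (memLp_rieszSymbol 0) F - (memLp_adv_trunc_hpart K F).toLp _)

theorem norm_rieszSymbol_le (ξ : Plane) : ‖rieszSymbol 0 ξ‖ ≤ 1 := by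
  rw [rieszSymbol_eq_disp, norm_mul, norm_neg, Complex.norm_I, mul_one, Complex.norm_real]
  exact abs_disp_le ξ

/-- Below shell K a derivative costs only 2^K and the L¹ norm is controlled by the L² norm, so the
quadratic term is locally Lipschitz on L², with a constant that depends on K. -/
theorem galerkinField_lipschitz (K : ℕ) (κ M : ℝ) (F G : ComplexL2) (hF : ‖F‖ ≤ M)
    (hG : ‖G‖ ≤ M) : ‖galerkinField K κ F - galerkinField K κ G‖ ≤
      (|κ| + 4 * (l2 (trunc K fun _ => 1) * 2 ^ K) * |M|) * ‖F - G‖ := by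
  obtain ⟨f, hf⟩ : ∃ f, f = trunc K (hpart F) := ⟨_, rfl⟩
  obtain ⟨g, hg⟩ : ∃ g, g = trunc K (hpart G) := ⟨_, rfl⟩
  have hFf : proj K F =ᵐ[volume] f := hf ▸ coeFn_proj K F
  have hGg : proj K G =ᵐ[volume] g := hg ▸ coeFn_proj K G
  have hfB : BL K f := hf ▸ bL_trunc_hpart K F
  have hgB : BL K g := hg ▸ bL_trunc_hpart K G
  have hM : M ≤ |M| := le_abs_self M
  have hfl : l2 f ≤ |M| := by
    rw [← norm_eq_l2 hFf]
    exact (norm_proj_le K F).trans (hF.trans hM)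
  have hgl : l2 g ≤ |M| := by
    rw [← norm_eq_l2 hGg]
    exact (norm_proj_le K G).trans (hG.trans hM)
  have hdB : BL K (fun ξ => f ξ - g ξ) :=
    ⟨hfB.memLp.sub hgB.memLp, fun ξ h => by simp [hfB.supp ξ h, hgB.supp ξ h]⟩
  have hdl : l2 (fun ξ => f ξ - g ξ) ≤ ‖F - G‖ := by
    have : (proj K F - proj K G : ComplexL2) =ᵐ[volume] fun ξ => f ξ - g ξ := by
      filter_upwards [Lp.coeFn_sub (proj K F) (proj K G), hFf, hGg] with ξ h1 h2 h3
      rw [h1, Pi.sub_apply, h2, h3]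
    rw [← norm_eq_l2 this, ← map_sub]
    exact norm_proj_le K _
  have hN : ‖(memLp_adv_trunc_hpart K F).toLp _ - (memLp_adv_trunc_hpart K G).toLp _‖ ≤
      4 * (l2 (trunc K fun _ => 1) * 2 ^ K) * |M| * ‖F - G‖ := by
    rw [← MemLp.toLp_sub, norm_toLp_eq_l2, ← hf, ← hg]
    refine (l2_adv_self_sub_le hfB.memLp hgB.memLp hfB.br_mul.1.memLp hgB.br_mul.1.memLp
      hfB.br_mul.1.integrable hgB.integrable).trans ?_
    have hc := l2_nonneg (trunc K fun _ => 1)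
    have h1 : ∫ ξ, ‖(br ξ : ℂ) * f ξ‖ ≤ l2 (trunc K fun _ => 1) * (2 ^ K * |M|) :=
      hfB.br_mul.1.integral_norm_le.trans
        (mul_le_mul_of_nonneg_left (hfB.br_mul.2.trans (by gcongr)) hc)
    have h2 : ∫ ξ, ‖g ξ‖ ≤ l2 (trunc K fun _ => 1) * |M| :=
      hgB.integral_norm_le.trans (by gcongr)
    have h3 : l2 (fun ξ => (br ξ : ℂ) * (f ξ - g ξ)) ≤ 2 ^ K * ‖F - G‖ :=
      hdB.br_mul.2.trans (by gcongr)
    have h4 := l2_nonneg fun ξ => f ξ - g ξ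
    have h5 := l2_nonneg fun ξ => (br ξ : ℂ) * (f ξ - g ξ)
    calc _ ≤ 2 * (l2 (trunc K fun _ => 1) * (2 ^ K * |M|)) * ‖F - G‖ +
          2 * (l2 (trunc K fun _ => 1) * |M|) * (2 ^ K * ‖F - G‖) :=
          add_le_add (mul_le_mul (by linarith) hdl h4 (by positivity))
            (mul_le_mul (by linarith) h3 h5 (by positivity))
      _ = _ := by ring
  rw [galerkinField, galerkinField, ← map_sub]
  refine (norm_proj_le K _).trans ?_
  rw [sub_sub_sub_comm, ← smul_sub, ← map_sub]
  refine (norm_sub_le _ _).trans ?_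
  rw [add_mul]
  refine add_le_add ?_ hN
  rw [norm_smul, Real.norm_eq_abs]
  have := norm_mulOp_le (memLp_rieszSymbol 0) norm_rieszSymbol_le (F - G)
  rw [one_mul] at this
  gcongr

theorem herm_rieszSymbol_mul {f : Plane → ℂ} (hf : Herm f) :
    Herm fun ξ => rieszSymbol 0 ξ * f ξ := fun ξ => by
  simp only [hf ξ, map_mul]
  congr 1
  simp [rieszSymbol, neg_div]

/-- On Hermitian band-limited functions the projection acts trivially on the Riesz term and merely
truncates the advection term, which is Hermitian already. -/
theorem coeFn_galerkinField {K : ℕ} (κ : ℝ) {F : ComplexL2} {f : Plane → ℂ} (h : F =ᵐ[volume] f)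
    (hf : Herm f) (hb : BL K f) :
    (κ • mulOp (memLp_rieszSymbol 0) F - galerkinField K κ F : ComplexL2) =ᵐ[volume]
      trunc K (adv f f) := by
  have h1 : trunc K (hpart F) =ᵐ[volume] f := by
    have := trunc_congr K (hpart_congr h)
    rwa [hf.hpart_eq, hb.trunc_eq] at this
  have h2 : (memLp_adv_trunc_hpart K F).toLp _ =ᵐ[volume] adv f f := by
    refine (memLp_adv_trunc_hpart K F).coeFn_toLp.trans ?_
    rw [adv_congr h1 h1]
  have h3 : proj K (mulOp (memLp_rieszSymbol 0) F) = mulOp (memLp_rieszSymbol 0) F := by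
    refine proj_eq_self (f := fun ξ => rieszSymbol 0 ξ * f ξ) ?_ (herm_rieszSymbol_mul hf) ?_
    · filter_upwards [coeFn_mulOp (memLp_rieszSymbol 0) F, h] with ξ e1 e2
      rw [e1, e2]
    · exact hb.mul (by unfold rieszSymbol; fun_prop) (C := 1) fun ξ _ => norm_rieszSymbol_le ξ
  have h4 : κ • mulOp (memLp_rieszSymbol 0) F - galerkinField K κ F =
      proj K ((memLp_adv_trunc_hpart K F).toLp _) := by
    rw [galerkinField, map_sub, map_smul, h3]
    abel
  rw [h4]
  exact coeFn_proj_of_herm K h2 (herm_adv hf hf)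

theorem hasDerivWithinAt_integral {E : Type*} [NormedAddCommGroup E] [NormedSpace ℝ E]
    [CompleteSpace E] {N : ℝ → E} {T : ℝ} (hN : ContinuousOn N (Icc 0 T)) {t : ℝ}
    (ht : t ∈ Icc 0 T) : HasDerivWithinAt (fun t => ∫ s in (0 : ℝ)..t, N s) (N t) (Icc 0 T) t := by
  have hT : 0 ≤ T := ht.1.trans ht.2
  have hc : Continuous (Set.IccExtend hT ((Icc 0 T).domRestrict N)) :=
    (continuousOn_iff_continuous_domRestrict.1 hN).Icc_extend'
  have he : ∀ s ∈ Icc 0 T, Set.IccExtend hT ((Icc 0 T).domRestrict N) s = N s := fun s hs => by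
    rw [Set.IccExtend_of_mem hT _ hs]
    rfl
  have h1 := (hc.integral_hasStrictDerivAt 0 t).hasDerivAt.hasDerivWithinAt (s := Icc 0 T)
  rw [he t ht] at h1
  have h2 : ∀ s ∈ Icc 0 T, ∫ r in (0 : ℝ)..s, N r =
      ∫ r in (0 : ℝ)..s, Set.IccExtend hT ((Icc 0 T).domRestrict N) r := fun s hs => by
    refine intervalIntegral.integral_congr fun r hr => ?_
    rw [Set.uIcc_of_le hs.1] at hr
    exact (he r ⟨hr.1, hr.2.trans hs.2⟩).symm
  exact h1.congr h2 (h2 t ht)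

theorem hasDerivWithinAt_norm_sq {H : ℝ → ComplexL2} {H' : ComplexL2} {s : Set ℝ} {t : ℝ}
    (h : HasDerivWithinAt H H' s t) :
    HasDerivWithinAt (fun t => ‖H t‖ ^ 2) (2 * (inner ℂ (H t) H').re) s t := by
  have h4 := Complex.reCLM.hasFDerivAt.comp_hasDerivWithinAt t (h.inner ℂ h)
  refine (h4.congr_deriv ?_).congr (fun s _ => ?_) ?_
  · rw [Complex.reCLM_apply, Complex.add_re, ← inner_conj_symm H' (H t), Complex.conj_re, two_mul]
  · simp only [Function.comp, Complex.reCLM_apply]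
    exact (inner_self_eq_norm_sq (𝕜 := ℂ) _).symm
  · simp only [Function.comp, Complex.reCLM_apply]
    exact (inner_self_eq_norm_sq (𝕜 := ℂ) _).symm

theorem inner_eq_integral {H G : ComplexL2} {h g : Plane → ℂ} (hH : H =ᵐ[volume] h)
    (hG : G =ᵐ[volume] g) : inner ℂ H G = ∫ ξ, g ξ * (starRingEnd ℂ) (h ξ) := by
  rw [L2.inner_def]
  apply integral_congr_ae
  filter_upwards [hH, hG] with ξ h1 h2
  rw [h1, h2, RCLike.inner_apply]

theorem inner_real_smul (c : ℝ) (H G : ComplexL2) :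
    (inner ℂ H (c • G) : ℂ).re = c * (inner ℂ H G).re := by
  rw [RCLike.real_smul_eq_coe_smul (K := ℂ), inner_smul_right]
  exact Complex.re_ofReal_mul _ _

/-- The dispersive term is skew-adjoint. -/
theorem re_inner_riesz (H : ComplexL2) :
    (inner ℂ H (mulOp (memLp_rieszSymbol 0) H)).re = 0 := by
  have e1 := inner_eq_integral (ae_eq_refl H) (coeFn_mulOp (memLp_rieszSymbol 0) H)
  have e2 := inner_eq_integral (coeFn_mulOp (memLp_rieszSymbol 0) H) (ae_eq_refl H)
  have e3 : (inner ℂ (mulOp (memLp_rieszSymbol 0) H) H : ℂ) =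
      -inner ℂ H (mulOp (memLp_rieszSymbol 0) H) := by
    rw [e1, e2, ← integral_neg]
    refine integral_congr_ae ?_
    filter_upwards with ξ
    simp only [rieszSymbol_eq_disp, map_mul, map_neg, Complex.conj_ofReal, Complex.conj_I]
    ring
  have e4 := congrArg Complex.re e3
  rw [← inner_conj_symm, Complex.conj_re, Complex.neg_re] at e4
  linarith

theorem mulOp_comm {m m' : Plane → ℂ} (hm : MemLp m ∞) (hm' : MemLp m' ∞) (g : ComplexL2) :
    mulOp hm (mulOp hm' g) = mulOp hm' (mulOp hm g) := by
  apply Lp.ext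
  filter_upwards [coeFn_mulOp hm (mulOp hm' g), coeFn_mulOp hm' g, coeFn_mulOp hm' (mulOp hm g),
    coeFn_mulOp hm g] with ξ h1 h2 h3 h4
  rw [h1, h2, h3, h4]
  ring

/-- A solution of the Galerkin approximation, together with everywhere Hermitian and
band-limited representatives. -/
structure IsGalerkin (K : ℕ) (κ T : ℝ) (F : ℝ → ComplexL2) (f : ℝ → Plane → ℂ) : Prop where
  bl : ∀ t ∈ Icc 0 T, BL K (f t)
  herm : ∀ t ∈ Icc 0 T, Herm (f t)
  ae : ∀ t ∈ Icc 0 T, F t =ᵐ[volume] f t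
  deriv : ∀ t ∈ Icc 0 T, HasDerivWithinAt F (galerkinField K κ (F t)) (Icc 0 T) t

theorem IsGalerkin.mono {K : ℕ} {κ T T' : ℝ} {F : ℝ → ComplexL2} {f : ℝ → Plane → ℂ}
    (h : IsGalerkin K κ T F f) (hT : T' ≤ T) : IsGalerkin K κ T' F f := by
  have hs : Icc 0 T' ⊆ Icc 0 T := Icc_subset_Icc_right hT
  exact ⟨fun t ht => h.bl t (hs ht), fun t ht => h.herm t (hs ht), fun t ht => h.ae t (hs ht),
    fun t ht => (h.deriv t (hs ht)).mono hs⟩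

/-- Both the Riesz term and the transport are skew in L², and the truncation is invisible when
tested against a band-limited function. The norm is conserved and the approximation lives on any
time interval. -/
theorem exists_galerkin (K : ℕ) (κ : ℝ) {T : ℝ} (hT : 0 < T) {F₀ : ComplexL2} {f₀ : Plane → ℂ}
    (h0 : F₀ =ᵐ[volume] f₀) (hf : Herm f₀) (hb : BL K f₀) :
    ∃ F f, F 0 = F₀ ∧ IsGalerkin K κ T F f := by
  have hX : ∀ x, proj K x = x → (inner ℂ x (galerkinField K κ x)).re = 0 := fun x hx => by
    have hxf : x =ᵐ[volume] trunc K (hpart x) := by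
      have := coeFn_proj K x
      rwa [hx] at this
    have hB := bL_trunc_hpart K x
    have hH : Herm (trunc K (hpart x)) := (herm_hpart x).trunc K
    generalize trunc K (hpart x) = f at *
    have h1 := coeFn_galerkinField κ hxf hH hB
    have h2 : galerkinField K κ x = κ • mulOp (memLp_rieszSymbol 0) x -
      (κ • mulOp (memLp_rieszSymbol 0) x - galerkinField K κ x) := by abel
    have h3 : ∀ ξ, trunc K (adv f f) ξ * (starRingEnd ℂ) (f ξ) =
        adv f f ξ * (starRingEnd ℂ) (f ξ) := fun ξ => by
      by_cases h : blk ξ < K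
      · simp [trunc, h]
      · simp [hB.supp ξ (not_lt.1 h)]
    rw [h2, inner_sub_right, Complex.sub_re, inner_real_smul, re_inner_riesz,
      inner_eq_integral hxf h1]
    simp only [h3]
    rw [integral_adv_mul_conj hB.integrable hB.br_mul.1.memLp hB.memLp, integral_ker3_self hH]
    simp
  obtain ⟨α, hα0, hα⟩ := exists_integral_curve (proj K) (proj_proj K) (norm_proj_le K)
    (galerkinField K κ) (fun x => proj_proj K _)
    (L := fun M => |κ| + 4 * (l2 (trunc K fun _ => 1) * 2 ^ K) * |M|)
    (fun M => by have := l2_nonneg (trunc K fun _ => 1); positivity)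
    (fun M x y => galerkinField_lipschitz K κ M x y) hX F₀ (proj_eq_self h0 hf hb) hT
  refine ⟨α, fun t => trunc K (hpart (α t)), hα0, fun t _ => bL_trunc_hpart K _,
    fun t _ => (herm_hpart _).trunc K, fun t ht => ?_, fun t ht => (hα t ht).2.2⟩
  have := coeFn_proj K (α t)
  rwa [(hα t ht).1] at this

section

variable {K : ℕ} {κ T : ℝ} {F : ℝ → ComplexL2} {f : ℝ → Plane → ℂ}

/-- The nonlinear term of a Galerkin solution. -/
def forcing (K : ℕ) (κ : ℝ) (F : ComplexL2) : ComplexL2 :=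
  κ • mulOp (memLp_rieszSymbol 0) F - galerkinField K κ F

theorem galerkinField_eq (K : ℕ) (κ : ℝ) (F : ComplexL2) :
    galerkinField K κ F = κ • mulOp (memLp_rieszSymbol 0) F - forcing K κ F := by
  rw [forcing]
  abel

theorem IsGalerkin.coeFn_forcing (h : IsGalerkin K κ T F f) {t : ℝ} (ht : t ∈ Icc 0 T) :
    forcing K κ (F t) =ᵐ[volume] trunc K (adv (f t) (f t)) :=
  coeFn_galerkinField κ (h.ae t ht) (h.herm t ht) (h.bl t ht)

theorem IsGalerkin.continuousOn (h : IsGalerkin K κ T F f) : ContinuousOn F (Icc 0 T) :=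
  fun t ht => (h.deriv t ht).continuousWithinAt

theorem continuous_galerkinField (K : ℕ) (κ : ℝ) : Continuous (galerkinField K κ) := by
  refine continuous_iff_continuousAt.2 fun x => ?_
  have hl : LipschitzOnWith (Real.toNNReal (|κ| + 4 * (l2 (trunc K fun _ => 1) * 2 ^ K) *
      |‖x‖ + 1|)) (galerkinField K κ) (Metric.ball 0 (‖x‖ + 1)) := by
    refine LipschitzOnWith.of_dist_le_mul fun y hy z hz => ?_
    rw [dist_eq_norm, dist_eq_norm, Real.coe_toNNReal _
      (by have := l2_nonneg (trunc K fun _ => 1); positivity)]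
    exact galerkinField_lipschitz K κ _ y z (by simpa using (Metric.mem_ball.1 hy).le)
      (by simpa using (Metric.mem_ball.1 hz).le)
  exact hl.continuousOn.continuousAt (Metric.isOpen_ball.mem_nhds (by simp))

theorem IsGalerkin.continuousOn_forcing (h : IsGalerkin K κ T F f) :
    ContinuousOn (fun t => forcing K κ (F t)) (Icc 0 T) := by
  have h1 : Continuous (forcing K κ) := by
    unfold forcing
    exact ((mulOp (memLp_rieszSymbol 0)).continuous.const_smul κ).sub (continuous_galerkinField K κ)
  exact h1.comp_continuousOn h.continuousOn

theorem IsGalerkin.hasDerivWithinAt_sub (h : IsGalerkin K κ T F f) {t : ℝ} (ht : t ∈ Icc 0 T) :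
    HasDerivWithinAt F (κ • mulOp (memLp_rieszSymbol 0) (F t) - forcing K κ (F t)) (Icc 0 T) t := by
  rw [← galerkinField_eq]
  exact h.deriv t ht

theorem memLp_trunc_weight {q : Plane → ℝ} (hq : Measurable q) {c : ℝ}
    (hc : ∀ ξ, blk ξ < K → |q ξ| ≤ c) : MemLp (trunc K fun ξ => (q ξ : ℂ)) ∞ := by
  refine memLp_top_of_bound (C := |c|)
    ((by fun_prop : Measurable fun ξ => (q ξ : ℂ)).indicator
      (measurableSet_blk_lt K)).aestronglyMeasurable (Eventually.of_forall fun ξ => ?_)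
  by_cases h : blk ξ < K
  · simp only [trunc, Set.indicator_apply, Set.mem_ofPred_eq, h, if_true, Complex.norm_real,
      Real.norm_eq_abs]
    exact (hc ξ h).trans (le_abs_self c)
  · simp [trunc, h]

theorem BL.trunc_mul {g m : Plane → ℂ} (hg : BL K g) (ξ : Plane) :
    trunc K m ξ * g ξ = m ξ * g ξ := by
  by_cases h : blk ξ < K
  · simp [trunc, h]
  · simp [hg.supp ξ (not_lt.1 h)]

/-- On band-limited functions the weight may be truncated to a bounded symbol, hence acts as a
bounded operator. -/
theorem continuousOn_weighted {q : Plane → ℝ} (hq : Measurable q) {c : ℝ}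
    (hc : ∀ ξ, blk ξ < K → |q ξ| ≤ c) {G : ℝ → ComplexL2} {g : ℝ → Plane → ℂ} {s : Set ℝ}
    (hG : ContinuousOn G s) (hg : ∀ t ∈ s, BL K (g t) ∧ G t =ᵐ[volume] g t) :
    ContinuousOn (fun t => l2 (fun ξ => (q ξ : ℂ) * g t ξ)) s := by
  have h1 := ((mulOp (memLp_trunc_weight hq hc)).continuous.comp_continuousOn hG).norm
  refine h1.congr fun t ht => (norm_eq_l2 ?_).symm
  filter_upwards [coeFn_mulOp (memLp_trunc_weight hq hc) (G t), (hg t ht).2] with ξ h2 h3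
  simp only [Function.comp]
  rw [h2, h3, (hg t ht).1.trunc_mul]

/-- The energy identity for a radial weight. -/
theorem IsGalerkin.hasDerivWithinAt_energy (h : IsGalerkin K κ T F f) {q : Plane → ℝ}
    (hq : Measurable q) {c : ℝ} (hc : ∀ ξ, blk ξ < K → |q ξ| ≤ c) {t : ℝ} (ht : t ∈ Icc 0 T) :
    HasDerivWithinAt (fun t => l2 (fun ξ => (q ξ : ℂ) * f t ξ) ^ 2)
      (-2 * (∫ p : Plane × Plane, ((q p.1 ^ 2 : ℝ) : ℂ) * ker3 (f t) (f t) (f t) p).re)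
      (Icc 0 T) t := by
  obtain ⟨hm, -⟩ : ∃ hm : MemLp (trunc K fun ξ => (q ξ : ℂ)) ∞, True :=
    ⟨memLp_trunc_weight hq hc, trivial⟩
  have hae : ∀ s ∈ Icc 0 T, mulOp hm (F s) =ᵐ[volume] fun ξ => (q ξ : ℂ) * f s ξ := fun s hs => by
    filter_upwards [coeFn_mulOp hm (F s), h.ae s hs] with ξ h2 h3
    rw [h2, h3, (h.bl s hs).trunc_mul]
  have hb := h.bl t ht
  have hqb : ∀ ξ, blk ξ < K → ‖(q ξ : ℂ)‖ ≤ c := fun ξ hξ => by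
    rw [Complex.norm_real]
    exact hc ξ hξ
  have hqB : BL K fun ξ => (q ξ : ℂ) * f t ξ := hb.mul (by fun_prop) hqb
  have hqqB : BL K fun ξ => (q ξ : ℂ) * ((q ξ : ℂ) * f t ξ) := hqB.mul (by fun_prop) hqb
  have hG : mulOp hm (forcing K κ (F t)) =ᵐ[volume] fun ξ =>
      (q ξ : ℂ) * trunc K (adv (f t) (f t)) ξ := by
    filter_upwards [coeFn_mulOp hm (forcing K κ (F t)), h.coeFn_forcing ht] with ξ h2 h3
    rw [h2, h3]
    by_cases hb : blk ξ < K
    · simp [trunc, hb]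
    · simp [trunc, hb]
  have hd := hasDerivWithinAt_norm_sq
    (((mulOp hm).restrictScalars ℝ).hasFDerivAt.comp_hasDerivWithinAt t (h.hasDerivWithinAt_sub ht))
  refine (hd.congr_deriv ?_).congr (fun s hs => ?_) ?_
  · simp only [Function.comp, ContinuousLinearMap.coe_restrictScalars', map_sub]
    have e1 : ((mulOp hm).restrictScalars ℝ) (κ • mulOp (memLp_rieszSymbol 0) (F t)) =
        κ • mulOp (memLp_rieszSymbol 0) (mulOp hm (F t)) := by
      rw [map_smul, ContinuousLinearMap.coe_restrictScalars', mulOp_comm]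
    rw [ContinuousLinearMap.coe_restrictScalars'] at e1
    -- The weight commutes with the Riesz multiplier, so the dispersive term contributes nothing,
    -- for any κ.
    rw [e1, inner_sub_right, Complex.sub_re, inner_real_smul, re_inner_riesz,
      inner_eq_integral (hae t ht) hG]
    have e2 : ∀ ξ, (q ξ : ℂ) * trunc K (adv (f t) (f t)) ξ *
        (starRingEnd ℂ) ((q ξ : ℂ) * f t ξ) =
        adv (f t) (f t) ξ * (starRingEnd ℂ) ((q ξ : ℂ) * ((q ξ : ℂ) * f t ξ)) := fun ξ => by
      by_cases hb' : blk ξ < K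
      · simp [trunc, hb']
        ring
      · simp [hb.supp ξ (not_lt.1 hb')]
    simp only [e2]
    rw [integral_adv_mul_conj hb.integrable hb.br_mul.1.memLp hqqB.memLp]
    have e3 : ∀ p, ker3 (f t) (f t) (fun ξ => (q ξ : ℂ) * ((q ξ : ℂ) * f t ξ)) p =
        ((q p.1 ^ 2 : ℝ) : ℂ) * ker3 (f t) (f t) (f t) p := fun p => by
      simp only [ker3, map_mul, Complex.conj_ofReal]
      push_cast
      ring
    simp only [e3]
    ring
  · exact congrArg (· ^ 2) (norm_eq_l2 (hae s hs)).symm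
  · exact congrArg (· ^ 2) (norm_eq_l2 (hae t ht)).symm

end

/-! ### The a priori bound on the dispersive time scale. -/

/-- The dual product estimate is tested with the weighted nonlinearity itself, and one power of its
norm is cancelled. -/
theorem exists_forcing_bound {r : ℝ} (hr : 0 ≤ r) : ∃ C : ℝ, 0 ≤ C ∧ ∀ (K : ℕ) (f : Plane → ℂ),
    BL K f → l2 (fun ξ => ((br ξ ^ r : ℝ) : ℂ) * trunc K (adv f f) ξ) ≤
      C * dispN K f * l2 (fun ξ => ((br ξ ^ (r + 1) : ℝ) : ℂ) * f ξ) := by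
  obtain ⟨C, hC, h⟩ := exists_product_bound hr
  refine ⟨C, hC, fun K f hf => ?_⟩
  have hg : BL K (trunc K (adv f f)) := bL_trunc K (hf.memLp_adv hf)
  obtain ⟨c, hc⟩ : ∃ c : Plane → ℂ, c = fun ξ => ((br ξ ^ r : ℝ) : ℂ) * trunc K (adv f f) ξ :=
    ⟨_, rfl⟩
  have hcB : BL K c := hc ▸ hg.br_rpow_mul r
  have hcB' := hcB.br_rpow_mul r
  have e1 : ∫ ξ, adv f f ξ * (starRingEnd ℂ) (((br ξ ^ r : ℝ) : ℂ) * c ξ) =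
      ((l2 c ^ 2 : ℝ) : ℂ) := by
    rw [l2_sq hcB.memLp, ← integral_complex_ofReal]
    refine integral_congr_ae ?_
    filter_upwards with ξ
    have h2 : ((‖c ξ‖ ^ 2 : ℝ) : ℂ) = c ξ * (starRingEnd ℂ) (c ξ) := by
      rw [Complex.mul_conj, Complex.normSq_eq_norm_sq]
    rw [h2]
    by_cases hb : blk ξ < K
    · have h3 : c ξ = ((br ξ ^ r : ℝ) : ℂ) * adv f f ξ := by simp [hc, trunc, hb]
      rw [map_mul, Complex.conj_ofReal, h3]
      ring
    · simp [hcB.supp ξ (not_lt.1 hb)]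
  rw [integral_adv_mul_conj hf.integrable hf.br_mul.1.memLp hcB'.memLp] at e1
  have e2 : ∀ p, ker3 f f (fun ξ => ((br ξ ^ r : ℝ) : ℂ) * c ξ) p =
      ((br p.1 ^ r : ℝ) : ℂ) * ker3 f f c p := fun p => by
    simp only [ker3, map_mul, Complex.conj_ofReal]
    ring
  simp only [e2] at e1
  have h3 := h K f c hf hcB
  rw [e1, Complex.norm_real, Real.norm_of_nonneg (sq_nonneg _), sq] at h3
  rw [← hc]
  rcases (l2_nonneg c).eq_or_lt with h0 | h0
  · rw [← h0]
    have := dispN_nonneg K f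
    have := l2_nonneg fun ξ => ((br ξ ^ (r + 1) : ℝ) : ℂ) * f ξ
    positivity
  · exact le_of_mul_le_mul_right h3 h0

theorem abs_br_rpow_le {K : ℕ} {r : ℝ} (hr : 0 ≤ r) (ξ : Plane) (h : blk ξ < K) :
    |br ξ ^ r| ≤ (2 ^ K : ℝ) ^ r := by
  rw [abs_of_nonneg (Real.rpow_nonneg (br_pos ξ).le r)]
  exact Real.rpow_le_rpow (br_pos ξ).le (br_le_of_blk_lt h) hr

theorem IsGalerkin.continuousOn_dispN {K : ℕ} {κ T : ℝ} {F : ℝ → ComplexL2} {f : ℝ → Plane → ℂ}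
    (h : IsGalerkin K κ T F f) : ContinuousOn (fun t => dispN K (f t)) (Icc 0 T) := by
  unfold dispN
  exact continuousOn_finsetSum _ fun k _ => continuousOn_finsetSum _ fun i _ =>
    continuousOn_supF_shell k i h.continuousOn fun t ht => ⟨h.bl t ht, h.ae t ht⟩

/-- Grönwall for the squared norm with coefficient 2C times the dispersive norm, followed by a
square root. -/
theorem exists_galerkin_energy_bound {n : ℝ} (hn : 0 ≤ n) : ∃ C : ℝ, 0 ≤ C ∧
    ∀ (K : ℕ) (κ T : ℝ) (F : ℝ → ComplexL2) (f : ℝ → Plane → ℂ), IsGalerkin K κ T F f →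
    ∀ t ∈ Icc 0 T, l2 (fun ξ => ((br ξ ^ n : ℝ) : ℂ) * f t ξ) ≤
      l2 (fun ξ => ((br ξ ^ n : ℝ) : ℂ) * f 0 ξ) *
        Real.exp (C * ∫ s in (0 : ℝ)..t, dispN K (f s)) := by
  obtain ⟨C, hC, hE⟩ := exists_energy_bound hn
  refine ⟨C, hC, fun K κ T F f h t ht => ?_⟩
  have h1 := le_mul_exp_of_deriv_le (b := 0) (a := fun s => 2 * C * dispN K (f s))
    (A := fun t => 2 * C * ∫ s in (0 : ℝ)..t, dispN K (f s)) le_rfl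
    (fun s hs => h.hasDerivWithinAt_energy (q := fun ξ => br ξ ^ n)
      (measurable_br.pow_const _) (abs_br_rpow_le hn) hs)
    (fun s hs => (hasDerivWithinAt_integral h.continuousOn_dispN hs).const_mul (2 * C))
    (by simp)
    (fun s hs => mul_nonneg (by positivity)
      (intervalIntegral.integral_nonneg hs.1 fun _ _ => dispN_nonneg K _))
    (fun s hs => ?_) ht
  · rw [zero_mul, add_zero] at h1
    refine (pow_le_pow_iff_left₀ (l2_nonneg _)
      (mul_nonneg (l2_nonneg _) (Real.exp_pos _).le) two_ne_zero).1 (h1.trans (le_of_eq ?_))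
    rw [mul_pow, ← Real.exp_nat_mul]
    congr 2
    push_cast
    ring
  · have h2 := hE K (f s) (h.bl s hs) (h.herm s hs)
    have e : ∀ ξ : Plane, (br ξ ^ n) ^ 2 = br ξ ^ (2 * n) := fun ξ => by
      rw [← Real.rpow_natCast, ← Real.rpow_mul (br_pos ξ).le]
      congr 1
      push_cast
      ring
    simp only [e, add_zero]
    have := neg_abs_le (∫ p : Plane × Plane, ((br p.1 ^ (2 * n) : ℝ) : ℂ) *
      ker3 (f s) (f s) (f s) p).re
    linarith

/-- The a priori bound for the Galerkin approximations on the dispersive time scale. -/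
theorem exists_apriori_bound {n : ℝ} (hn : 3 < n) : ∃ c B : ℝ, 0 < c ∧ 0 < B ∧
    ∀ (K : ℕ) (κ ε T : ℝ) (F : ℝ → ComplexL2) (f : ℝ → Plane → ℂ), 0 < κ → 0 < ε →
    T = c * κ ^ (1 / 3 : ℝ) * ε ^ (-4 / 3 : ℝ) → IsGalerkin K κ T F f →
    l2 (fun ξ => ((br ξ ^ n : ℝ) : ℂ) * f 0 ξ) ≤ ε →
    ∀ t ∈ Icc 0 T, l2 (fun ξ => ((br ξ ^ n : ℝ) : ℂ) * f t ξ) ≤ B * ε := by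
  obtain ⟨CS, hCS, hS⟩ := exists_integral_dispN_le (r := n - 1) (by linarith)
  obtain ⟨C1, hC1, hE⟩ := exists_galerkin_energy_bound (n := n) (by linarith)
  obtain ⟨C2, hC2, hP⟩ := exists_forcing_bound (r := n - 1) (by linarith)
  obtain ⟨S, hSd, hS0⟩ : ∃ S, S = CS * (1 + C2 * Real.exp C1) ∧ 0 < S := ⟨_, rfl, by positivity⟩
  -- This c solves S κ^{-1/4} T^{3/4} ε = 1/2 for T = c κ^{1/3} ε^{-4/3}; the powers of κ and ε
  -- cancel.
  obtain ⟨c, hcd, hc0⟩ : ∃ c : ℝ, c = ((2 * S)⁻¹) ^ (4 / 3 : ℝ) ∧ 0 < c :=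
    ⟨_, rfl, by positivity⟩
  refine ⟨c, Real.exp C1, hc0, Real.exp_pos _, fun K κ ε T F f hκ hε hT h h0 => ?_⟩
  have hT0 : 0 < T := hT ▸ by positivity
  have hA : κ ^ (-(1 / 4) : ℝ) * T ^ (3 / 4 : ℝ) * ε = (2 * S)⁻¹ := by
    have hk : 0 < κ ^ (1 / 3 : ℝ) := by positivity
    have hk' : 0 < ε ^ (-4 / 3 : ℝ) := by positivity
    rw [hT, Real.mul_rpow (by positivity) hk'.le, Real.mul_rpow hc0.le hk.le, hcd,
      ← Real.rpow_mul hκ.le, ← Real.rpow_mul hε.le, ← Real.rpow_mul (by positivity)]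
    norm_num
    have e1 : κ ^ (-(1 / 4) : ℝ) * κ ^ (1 / 4 : ℝ) = 1 := by
      rw [← Real.rpow_add hκ]
      norm_num
    have e2 : ε ^ (-1 : ℝ) * ε = 1 := by
      rw [Real.rpow_neg_one, inv_mul_cancel₀ hε.ne']
    linear_combination (S⁻¹ * 2⁻¹ * ε ^ (-1 : ℝ) * ε) * e1 + S⁻¹ * 2⁻¹ * e2
  let X : ℝ → ℝ := fun t => ∫ s in (0 : ℝ)..t, dispN K (f s)
  have hXd : ∀ t ∈ Icc 0 T, HasDerivWithinAt X (dispN K (f t)) (Icc 0 T) t := fun t ht =>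
    hasDerivWithinAt_integral h.continuousOn_dispN ht
  have hXc : ContinuousOn X (Icc 0 T) := fun t ht => (hXd t ht).continuousWithinAt
  have hXm : MonotoneOn X (Icc 0 T) :=
    monotoneOn_of_hasDerivWithinAt_nonneg (convex_Icc 0 T) hXc
      (fun s hs => (hXd s (interior_subset hs)).mono interior_subset) fun s _ => dispN_nonneg K _
  have hX0 : X 0 = 0 := by simp [X]
  have hEb : ∀ t ∈ Icc 0 T, X t ≤ 1 →
      l2 (fun ξ => ((br ξ ^ n : ℝ) : ℂ) * f t ξ) ≤ Real.exp C1 * ε := fun t ht hX1 => by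
    refine (hE K κ T F f h t ht).trans ?_
    rw [mul_comm]
    refine mul_le_mul (Real.exp_le_exp.2 ?_) h0 (l2_nonneg _) (Real.exp_pos _).le
    exact mul_le_of_le_one_right hC1 hX1
  -- While X ≤ 1 the H^n norm is at most e^{C₁} ε, so the forcing has H^{n-1} norm at most C₂ e^{C₁}
  -- ε times the dispersive norm, whose integral is again X ≤ 1. The dispersive estimate then
  -- improves 1 to 1/2.
  have hboot : ∀ t ∈ Icc 0 T, 0 < t → X t ≤ 1 → X t ≤ 1 / 2 := fun t ht ht0 hX1 => by
    have hg := h.mono ht.2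
    have hgB : ∀ s ∈ Icc 0 t, BL K (trunc K (adv (f s) (f s))) ∧
        forcing K κ (F s) =ᵐ[volume] trunc K (adv (f s) (f s)) := fun s hs =>
      ⟨bL_trunc K ((hg.bl s hs).memLp_adv (hg.bl s hs)), hg.coeFn_forcing hs⟩
    have hci : IntervalIntegrable (fun s => l2 (fun ξ => ((br ξ ^ (n - 1) : ℝ) : ℂ) *
        trunc K (adv (f s) (f s)) ξ)) volume 0 t := by
      apply ContinuousOn.intervalIntegrable
      rw [Set.uIcc_of_le ht0.le]
      exact continuousOn_weighted (measurable_br.pow_const _) (abs_br_rpow_le (by linarith))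
        hg.continuousOn_forcing hgB
    obtain ⟨hNc, hN⟩ := hS K κ t hκ ht0 F (fun s => forcing K κ (F s)) f
      (fun s => trunc K (adv (f s) (f s))) (fun s hs => hg.hasDerivWithinAt_sub hs)
      hg.continuousOn_forcing (fun s hs => ⟨hg.bl s hs, hg.ae s hs⟩) hgB hci
    have hNi : IntervalIntegrable (fun s => dispN K (f s)) volume 0 t := by
      apply ContinuousOn.intervalIntegrable
      rwa [Set.uIcc_of_le ht0.le]
    have h1 : l2 (fun ξ => ((br ξ ^ (n - 1) : ℝ) : ℂ) * f 0 ξ) ≤ ε :=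
      (l2_br_rpow_mono (h.bl 0 ⟨le_rfl, hT0.le⟩) (by linarith)).trans h0
    have h2 : ∫ s in (0 : ℝ)..t, l2 (fun ξ => ((br ξ ^ (n - 1) : ℝ) : ℂ) *
        trunc K (adv (f s) (f s)) ξ) ≤ C2 * (Real.exp C1 * ε) := by
      calc _ ≤ ∫ s in (0 : ℝ)..t, C2 * (Real.exp C1 * ε) * dispN K (f s) := by
            refine intervalIntegral.integral_mono_on ht0.le hci (hNi.const_mul _) fun s hs => ?_
            have hs' : s ∈ Icc 0 T := ⟨hs.1, hs.2.trans ht.2⟩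
            have h3 := hP K (f s) (h.bl s hs')
            rw [sub_add_cancel] at h3
            have h4 := hEb s hs' ((hXm hs' ht hs.2).trans hX1)
            refine h3.trans ?_
            calc _ ≤ C2 * dispN K (f s) * (Real.exp C1 * ε) :=
                  mul_le_mul_of_nonneg_left h4 (mul_nonneg hC2 (dispN_nonneg K _))
              _ = _ := by ring
        _ = C2 * (Real.exp C1 * ε) * X t := by rw [intervalIntegral.integral_const_mul]
        _ ≤ C2 * (Real.exp C1 * ε) := mul_le_of_le_one_right (by positivity) hX1
    calc X t ≤ _ := hN
      _ ≤ CS * (κ ^ (-(1 / 4) : ℝ) * T ^ (3 / 4 : ℝ)) * (ε + C2 * (Real.exp C1 * ε)) := by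
          refine mul_le_mul ?_ (add_le_add h1 h2) ?_ (by positivity)
          · have := Real.rpow_le_rpow ht0.le ht.2 (by norm_num : (0 : ℝ) ≤ 3 / 4)
            gcongr
          · exact add_nonneg (l2_nonneg _)
              (intervalIntegral.integral_nonneg ht0.le fun _ _ => l2_nonneg _)
      _ = S * (κ ^ (-(1 / 4) : ℝ) * T ^ (3 / 4 : ℝ) * ε) := by
          rw [hSd]
          ring
      _ = 1 / 2 := by
          rw [hA]
          field_simp
  -- Continuity method: X starts at 0, and at a time where X = 1 the bootstrap would give 1 ≤ 1/2.
  have hXT : X T ≤ 1 := by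
    by_contra hcon
    obtain ⟨t, ht, hXt⟩ := intermediate_value_Icc hT0.le hXc
      (show (1 : ℝ) ∈ Icc (X 0) (X T) from ⟨by rw [hX0]; exact zero_le_one, (not_le.1 hcon).le⟩)
    have ht0 : 0 < t := by
      rcases ht.1.eq_or_lt with h' | h'
      · rw [← h', hX0] at hXt
        norm_num at hXt
      · exact h'
    have := hboot t ht ht0 hXt.le
    rw [hXt] at this
    norm_num at this
  exact fun t ht => hEb t ht ((hXm ht ⟨hT0.le, le_rfl⟩ ht.2).trans hXT)

/-! ### Weighted norms, tails and comparison of Galerkin solutions. -/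

theorem memLp_br_rpow_of_le {f : Plane → ℂ} {r s : ℝ} (hrs : r ≤ s)
    (hf : MemLp (fun ξ => ((br ξ ^ s : ℝ) : ℂ) * f ξ) 2) :
    MemLp (fun ξ => ((br ξ ^ r : ℝ) : ℂ) * f ξ) 2 ∧
      l2 (fun ξ => ((br ξ ^ r : ℝ) : ℂ) * f ξ) ≤ l2 (fun ξ => ((br ξ ^ s : ℝ) : ℂ) * f ξ) := by
  have hle : ∀ ξ, ‖((br ξ ^ r : ℝ) : ℂ) * f ξ‖ ≤ ‖((br ξ ^ s : ℝ) : ℂ) * f ξ‖ := fun ξ => by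
    rw [norm_mul, norm_mul, norm_ofReal_rpow_br, norm_ofReal_rpow_br]
    gcongr
    exact one_le_br ξ
  have e : (fun ξ => ((br ξ ^ r : ℝ) : ℂ) * f ξ) =
      fun ξ => ((br ξ ^ (r - s) : ℝ) : ℂ) * (((br ξ ^ s : ℝ) : ℂ) * f ξ) := by
    ext ξ
    rw [← mul_assoc, ← Complex.ofReal_mul, ← Real.rpow_add (br_pos ξ), sub_add_cancel]
  refine ⟨hf.mono ?_ (Eventually.of_forall hle), l2_le_of_norm_le hf hle⟩
  rw [e]
  exact (Complex.measurable_ofReal.comp (measurable_br.pow_const _)).aestronglyMeasurable.mul hf.1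

theorem memLp_of_br_rpow {f : Plane → ℂ} {s : ℝ} (hs : 0 ≤ s)
    (hf : MemLp (fun ξ => ((br ξ ^ s : ℝ) : ℂ) * f ξ) 2) :
    MemLp f 2 ∧ l2 f ≤ l2 (fun ξ => ((br ξ ^ s : ℝ) : ℂ) * f ξ) := by
  have := memLp_br_rpow_of_le hs hf
  simpa only [Real.rpow_zero, Complex.ofReal_one, one_mul] using this

theorem memLp_br_of_br_rpow {f : Plane → ℂ} {s : ℝ} (hs : 1 ≤ s)
    (hf : MemLp (fun ξ => ((br ξ ^ s : ℝ) : ℂ) * f ξ) 2) :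
    MemLp (fun ξ => (br ξ : ℂ) * f ξ) 2 ∧
      l2 (fun ξ => (br ξ : ℂ) * f ξ) ≤ l2 (fun ξ => ((br ξ ^ s : ℝ) : ℂ) * f ξ) := by
  have := memLp_br_rpow_of_le hs hf
  simpa only [Real.rpow_one] using this

/-- Cauchy-Schwarz against br^{1-n}, which is square integrable on the plane exactly when 2(n - 1) >
2. This is the embedding of H^n into functions whose gradient has an integrable transform. -/
theorem exists_integral_br_le {n : ℝ} (hn : 2 < n) : ∃ c : ℝ, 0 < c ∧ ∀ f : Plane → ℂ,
    MemLp (fun ξ => ((br ξ ^ n : ℝ) : ℂ) * f ξ) 2 → Integrable (fun ξ => (br ξ : ℂ) * f ξ) ∧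
      ∫ ξ, ‖(br ξ : ℂ) * f ξ‖ ≤ c * l2 (fun ξ => ((br ξ ^ n : ℝ) : ℂ) * f ξ) := by
  obtain ⟨w, hw⟩ : ∃ w : Plane → ℂ, w = fun ξ => ((br ξ ^ (1 - n) : ℝ) : ℂ) := ⟨_, rfl⟩
  have hwm : AEStronglyMeasurable w volume := by
    rw [hw]
    exact (Complex.measurable_ofReal.comp (measurable_br.pow_const _)).aestronglyMeasurable
  have hw2 : MemLp w 2 := by
    refine (memLp_two_iff_integrable_sq_norm hwm).2 ?_
    have h1 := integrable_br_rpow (q := 2 * (n - 1)) (by linarith)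
    refine h1.congr (Eventually.of_forall fun ξ => ?_)
    simp only [hw, norm_ofReal_rpow_br]
    rw [← Real.rpow_natCast, ← Real.rpow_mul (br_pos ξ).le]
    congr 1
    push_cast
    ring
  refine ⟨l2 w + 1, by have := l2_nonneg w; positivity, fun f hf => ?_⟩
  have e : ∀ ξ, (br ξ : ℂ) * f ξ = w ξ * (((br ξ ^ n : ℝ) : ℂ) * f ξ) := fun ξ => by
    rw [hw, ← mul_assoc, ← Complex.ofReal_mul, ← Real.rpow_add (br_pos ξ), sub_add_cancel,
      Real.rpow_one]
  obtain ⟨g, hg⟩ : ∃ g : Plane → ℂ, g = fun ξ => ((br ξ ^ n : ℝ) : ℂ) * f ξ := ⟨_, rfl⟩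
  rw [← hg] at hf ⊢
  have e' : (fun ξ => (br ξ : ℂ) * f ξ) = fun ξ => w ξ * g ξ := by
    ext ξ
    rw [e, hg]
  have hi : Integrable fun ξ => w ξ * g ξ := hw2.integrable_mul hf
  rw [e']
  refine ⟨hi, ?_⟩
  have e3 : ∀ ξ, (br ξ : ℂ) * f ξ = w ξ * g ξ := congrFun e'
  simp only [e3]
  have h3 := norm_integral_mul_conj_le (c := fun ξ => (‖w ξ‖ : ℂ)) (h := fun ξ => (‖g ξ‖ : ℂ))
    hw2.norm.ofReal hf.norm.ofReal
  have e2 : ∫ ξ, (‖w ξ‖ : ℂ) * (starRingEnd ℂ) (‖g ξ‖ : ℂ) = ((∫ ξ, ‖w ξ * g ξ‖ : ℝ) : ℂ) := by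
    rw [← integral_complex_ofReal]
    refine integral_congr_ae ?_
    filter_upwards with ξ
    rw [Complex.conj_ofReal, ← Complex.ofReal_mul, ← norm_mul]
  rw [e2, Complex.norm_real, Real.norm_of_nonneg (integral_nonneg fun _ => norm_nonneg _)] at h3
  have h4 : l2 (fun ξ => (‖w ξ‖ : ℂ)) ≤ l2 w := l2_le_of_norm_le hw2 fun ξ => by simp
  have h5 : l2 (fun ξ => (‖g ξ‖ : ℂ)) ≤ l2 g := l2_le_of_norm_le hf fun ξ => by simp
  exact h3.trans (mul_le_mul (h4.trans (le_add_of_nonneg_right zero_le_one)) h5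
    (l2_nonneg _) (add_nonneg (l2_nonneg w) zero_le_one))

/-- Lower semicontinuity of weighted norms under `L²` convergence. -/
theorem memLp_weighted_of_tendsto {w : Plane → ℝ} (hw : Measurable w) {F : ℕ → ComplexL2}
    {G : ComplexL2} (h : Tendsto F atTop (𝓝 G)) {B : ℝ} (hB : 0 ≤ B)
    (hF : ∀ᶠ k in atTop, MemLp (fun ξ => (w ξ : ℂ) * F k ξ) 2 ∧
      l2 (fun ξ => (w ξ : ℂ) * F k ξ) ≤ B) :
    MemLp (fun ξ => (w ξ : ℂ) * G ξ) 2 ∧ l2 (fun ξ => (w ξ : ℂ) * G ξ) ≤ B := by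
  have hm : ∀ H : ComplexL2, AEStronglyMeasurable (fun ξ => (w ξ : ℂ) * H ξ) volume := fun H =>
    (Complex.measurable_ofReal.comp hw).aestronglyMeasurable.mul (Lp.aestronglyMeasurable H)
  obtain ⟨ns, hns, hae⟩ := (tendstoInMeasure_of_tendsto_Lp h).exists_seq_tendsto_ae
  have h1 := Lp.eLpNorm_lim_le_liminf_eLpNorm (p := 2) (fun i => hm (F (ns i)))
    (fun ξ => (w ξ : ℂ) * G ξ) (by filter_upwards [hae] with ξ hξ using hξ.const_mul _)
  have h2 : (atTop.liminf fun i => eLpNorm (fun ξ => (w ξ : ℂ) * F (ns i) ξ) 2 volume) ≤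
      ENNReal.ofReal B := by
    refine liminf_le_of_frequently_le' (Eventually.frequently ?_)
    filter_upwards [hns.tendsto_atTop.eventually hF] with i hi
    rw [← ENNReal.ofReal_toReal hi.1.2.ne, toReal_eLpNorm hi.1.1]
    exact ENNReal.ofReal_le_ofReal hi.2
  have h3 := h1.trans h2
  have h4 : MemLp (fun ξ => (w ξ : ℂ) * G ξ) 2 := ⟨hm G, h3.trans_lt ENNReal.ofReal_lt_top⟩
  refine ⟨h4, ?_⟩
  rw [l2, ← toReal_eLpNorm h4.1]
  exact ENNReal.toReal_le_of_le_ofReal hB h3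

theorem l2_sub_sq_le {f : Plane → ℂ} (hf : MemLp f 2) (g : Plane → ℂ) :
    l2 (fun ξ => f ξ - g ξ) ^ 2 ≤ 2 * (l2 f ^ 2 + l2 g ^ 2) := by
  have h : l2 (fun ξ => f ξ - g ξ) ≤ l2 f + l2 g := lpNorm_sub_le hf (by norm_num)
  nlinarith [l2_nonneg (fun ξ => f ξ - g ξ), l2_nonneg f, l2_nonneg g, sq_nonneg (l2 f - l2 g)]

theorem wt_le_rpow {n R x : ℝ} (hR : 0 ≤ R) (hx : 0 < x) : wt (2 * n + 2) R x ≤ x ^ (2 * n) := by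
  rw [wt, Real.rpow_add hx, div_le_iff₀ (by positivity), Real.rpow_two]
  gcongr
  linarith

/-- Where x² ≥ R the tail weight is at least half of x^{2n}; where x² < R the power itself is at
most R^n. The H^n norm is thus controlled by the tail and R^n times the L² norm. -/
theorem rpow_le_wt {n R x : ℝ} (hn : 0 ≤ n) (hR : 0 < R) (hx : 0 < x) :
    x ^ (2 * n) ≤ 2 * wt (2 * n + 2) R x + R ^ n := by
  have hwt := wt_nonneg (m := 2 * n + 2) hR.le hx.le
  rcases le_or_gt R (x ^ 2) with h | h
  · have : x ^ (2 * n) ≤ 2 * wt (2 * n + 2) R x := by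
      rw [wt, Real.rpow_add hx, ← mul_div_assoc, le_div_iff₀ (by positivity), Real.rpow_two]
      have := Real.rpow_pos_of_pos hx (2 * n)
      nlinarith
    have := Real.rpow_pos_of_pos hR n
    linarith
  · have : x ^ (2 * n) ≤ R ^ n := by
      rw [Real.rpow_mul hx.le, Real.rpow_two]
      exact Real.rpow_le_rpow (by positivity) h.le hn
    linarith

theorem memLp_sqrt_wt {n R : ℝ} (hR : 0 ≤ R) {f : Plane → ℂ}
    (hf : MemLp (fun ξ => ((br ξ ^ n : ℝ) : ℂ) * f ξ) 2) :
    MemLp (fun ξ => ((√(wt (2 * n + 2) R (br ξ)) : ℝ) : ℂ) * f ξ) 2 := by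
  have e : (fun ξ => ((√(wt (2 * n + 2) R (br ξ)) : ℝ) : ℂ) * f ξ) =
      fun ξ => ((√(wt (2 * n + 2) R (br ξ)) * br ξ ^ (-n) : ℝ) : ℂ) *
        (((br ξ ^ n : ℝ) : ℂ) * f ξ) := by
    ext ξ
    rw [← mul_assoc, ← Complex.ofReal_mul, mul_assoc, ← Real.rpow_add (br_pos ξ), neg_add_cancel,
      Real.rpow_zero, mul_one]
  refine hf.mono ?_ (Eventually.of_forall fun ξ => ?_)
  · rw [e]
    exact (Complex.measurable_ofReal.comp ((measurable_sqrt_wt_br _ R).mul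
      (measurable_br.pow_const _))).aestronglyMeasurable.mul hf.1
  · rw [norm_mul, norm_mul, Complex.norm_real, Complex.norm_real,
      Real.norm_of_nonneg (Real.sqrt_nonneg _),
      Real.norm_of_nonneg (Real.rpow_nonneg (br_pos ξ).le n)]
    gcongr
    refine Real.sqrt_le_iff.2 ⟨Real.rpow_nonneg (br_pos ξ).le n, ?_⟩
    rw [← Real.rpow_natCast, ← Real.rpow_mul (br_pos ξ).le, mul_comm n]
    exact_mod_cast wt_le_rpow hR (br_pos ξ)

/-- The high frequencies of a difference are controlled by the tail weights. -/
theorem l2_br_rpow_sub_sq_le {n R : ℝ} (hn : 0 ≤ n) (hR : 0 < R) {f g : Plane → ℂ}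
    (hf : MemLp (fun ξ => ((br ξ ^ n : ℝ) : ℂ) * f ξ) 2)
    (hg : MemLp (fun ξ => ((br ξ ^ n : ℝ) : ℂ) * g ξ) 2) :
    l2 (fun ξ => ((br ξ ^ n : ℝ) : ℂ) * (f ξ - g ξ)) ^ 2 ≤
      4 * (l2 (fun ξ => ((√(wt (2 * n + 2) R (br ξ)) : ℝ) : ℂ) * f ξ) ^ 2 +
        l2 (fun ξ => ((√(wt (2 * n + 2) R (br ξ)) : ℝ) : ℂ) * g ξ) ^ 2) +
      R ^ n * l2 (fun ξ => f ξ - g ξ) ^ 2 := by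
  have hwf := memLp_sqrt_wt hR.le hf
  have hwg := memLp_sqrt_wt hR.le hg
  have h1 := l2_sub_sq_le hwf fun ξ => ((√(wt (2 * n + 2) R (br ξ)) : ℝ) : ℂ) * g ξ
  have hwd : MemLp (fun ξ => ((√(wt (2 * n + 2) R (br ξ)) : ℝ) : ℂ) * f ξ -
    ((√(wt (2 * n + 2) R (br ξ)) : ℝ) : ℂ) * g ξ) 2 := hwf.sub hwg
  have hd : MemLp (fun ξ => f ξ - g ξ) 2 := (memLp_of_br_rpow hn hf).1.sub (memLp_of_br_rpow hn hg).1
  have hdn : MemLp (fun ξ => ((br ξ ^ n : ℝ) : ℂ) * (f ξ - g ξ)) 2 := by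
    simp only [mul_sub]
    exact hf.sub hg
  have h2 : l2 (fun ξ => ((br ξ ^ n : ℝ) : ℂ) * (f ξ - g ξ)) ^ 2 ≤
      2 * l2 (fun ξ => ((√(wt (2 * n + 2) R (br ξ)) : ℝ) : ℂ) * f ξ -
        ((√(wt (2 * n + 2) R (br ξ)) : ℝ) : ℂ) * g ξ) ^ 2 +
      R ^ n * l2 (fun ξ => f ξ - g ξ) ^ 2 := by
    rw [l2_sq hdn, l2_sq hwd, l2_sq hd, ← integral_const_mul, ← integral_const_mul,
      ← integral_add ((memLp_two_iff_integrable_sq_norm hwd.1).1 hwd |>.const_mul _)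
        ((memLp_two_iff_integrable_sq_norm hd.1).1 hd |>.const_mul _)]
    refine integral_mono ((memLp_two_iff_integrable_sq_norm hdn.1).1 hdn)
      (((memLp_two_iff_integrable_sq_norm hwd.1).1 hwd |>.const_mul _).add
        ((memLp_two_iff_integrable_sq_norm hd.1).1 hd |>.const_mul _)) fun ξ => ?_
    have h3 := rpow_le_wt hn hR (br_pos ξ)
    have h4 := Real.sq_sqrt (wt_nonneg (m := 2 * n + 2) hR.le (br_pos ξ).le)
    simp only [← mul_sub, norm_mul, mul_pow, Complex.norm_real,
      Real.norm_of_nonneg (Real.sqrt_nonneg _), h4]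
    have e : (br ξ ^ n) ^ 2 = br ξ ^ (2 * n) := by
      rw [← Real.rpow_natCast, ← Real.rpow_mul (br_pos ξ).le]
      congr 1
      push_cast
      ring
    rw [Real.norm_of_nonneg (Real.rpow_nonneg (br_pos ξ).le n), e]
    have := mul_le_mul_of_nonneg_right h3 (sq_nonneg ‖f ξ - g ξ‖)
    linarith
  linarith

/-- Dominated convergence: the weight is at most br^{2n} and tends to 0 pointwise as R grows. -/
theorem tendsto_l2_sqrt_wt {n : ℝ} {f : Plane → ℂ}
    (hf : MemLp (fun ξ => ((br ξ ^ n : ℝ) : ℂ) * f ξ) 2) :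
    Tendsto (fun R : ℝ => l2 (fun ξ => ((√(wt (2 * n + 2) R (br ξ)) : ℝ) : ℂ) * f ξ) ^ 2)
      atTop (𝓝 0) := by
  have hs : ∀ R : ℝ, 0 ≤ R → ∀ ξ, ‖((√(wt (2 * n + 2) R (br ξ)) : ℝ) : ℂ) * f ξ‖ ^ 2 =
      wt (2 * n + 2) R (br ξ) * ‖f ξ‖ ^ 2 := fun R hR ξ => by
    rw [norm_mul, mul_pow, Complex.norm_real, Real.norm_of_nonneg (Real.sqrt_nonneg _),
      Real.sq_sqrt (wt_nonneg hR (br_pos ξ).le)]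
  have h1 : Tendsto (fun R : ℝ => ∫ ξ, ‖((√(wt (2 * n + 2) R (br ξ)) : ℝ) : ℂ) * f ξ‖ ^ 2)
      atTop (𝓝 (∫ _ : Plane, (0 : ℝ))) := by
    refine tendsto_integral_filter_of_dominated_convergence
      (fun ξ => ‖((br ξ ^ n : ℝ) : ℂ) * f ξ‖ ^ 2) ?_ ?_
      ((memLp_two_iff_integrable_sq_norm hf.1).1 hf) ?_
    · filter_upwards [eventually_ge_atTop 0] with R hR
      exact (memLp_sqrt_wt hR hf).1.norm.pow 2
    · filter_upwards [eventually_ge_atTop 0] with R hR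
      filter_upwards with ξ
      rw [hs R hR, Real.norm_of_nonneg (mul_nonneg (wt_nonneg hR (br_pos ξ).le) (sq_nonneg _)),
        norm_mul, mul_pow, norm_ofReal_rpow_br, ← Real.rpow_natCast (br ξ ^ n),
        ← Real.rpow_mul (br_pos ξ).le, mul_comm n]
      gcongr
      exact_mod_cast wt_le_rpow hR (br_pos ξ)
    · filter_upwards with ξ
      have h2 : Tendsto (fun R : ℝ => wt (2 * n + 2) R (br ξ) * ‖f ξ‖ ^ 2) atTop
          (𝓝 (0 * ‖f ξ‖ ^ 2)) := by
        refine Tendsto.mul_const _ ?_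
        unfold wt
        exact tendsto_const_nhds.div_atTop (tendsto_atTop_add_const_left _ _ tendsto_id)
      rw [zero_mul] at h2
      refine h2.congr' ?_
      filter_upwards [eventually_ge_atTop 0] with R hR using (hs R hR ξ).symm
  rw [integral_zero] at h1
  refine h1.congr' ?_
  filter_upwards [eventually_ge_atTop 0] with R hR using (l2_sq (memLp_sqrt_wt hR hf)).symm

/-- The advection term gains as many derivatives as the velocity has. -/
theorem l2_br_mul_adv_le {f : Plane → ℂ} (hf1 : Integrable fun ξ => (br ξ : ℂ) * f ξ)
    (hf : MemLp (fun ξ => (br ξ : ℂ) * f ξ) 2) (hf2 : MemLp (fun ξ => ((br ξ ^ (2 : ℝ) : ℝ) : ℂ) * f ξ) 2)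
    (hm : AEStronglyMeasurable (adv f f) volume) :
    MemLp (fun ξ => (br ξ : ℂ) * adv f f ξ) 2 ∧ l2 (fun ξ => (br ξ : ℂ) * adv f f ξ) ≤
      4 * (∫ ξ, ‖(br ξ : ℂ) * f ξ‖) * l2 (fun ξ => ((br ξ ^ (2 : ℝ) : ℝ) : ℂ) * f ξ) := by
  obtain ⟨w, hw⟩ : ∃ w : Plane → ℂ, w = fun ξ => (‖(br ξ : ℂ) * f ξ‖ : ℂ) := ⟨_, rfl⟩
  obtain ⟨g, hg⟩ : ∃ g : Plane → ℂ, g = fun ξ => (‖((br ξ ^ (2 : ℝ) : ℝ) : ℂ) * f ξ‖ : ℂ) :=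
    ⟨_, rfl⟩
  have hwi : Integrable w := hw ▸ hf1.norm.ofReal
  have hwm : MemLp w 2 := hw ▸ hf.norm.ofReal
  have hgm : MemLp g 2 := hg ▸ hf2.norm.ofReal
  have hc := memLp_conv hwi hgm
  have hle : ∀ ξ, ‖(br ξ : ℂ) * adv f f ξ‖ ≤ 4 * ‖∫ η, w (ξ - η) * g η‖ := fun ξ => by
    have e1 : (∫ η, w (ξ - η) * g η) = ((∫ η, ‖(br (ξ - η) : ℂ) * f (ξ - η)‖ *
        ‖((br η ^ (2 : ℝ) : ℝ) : ℂ) * f η‖ : ℝ) : ℂ) := by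
      rw [← integral_complex_ofReal, hw, hg]
      simp only [Complex.ofReal_mul]
    have hi := (integrable_conv_integrand hwm hgm ξ).norm
    simp only [hw, hg, norm_mul, Complex.norm_real, norm_norm] at hi
    rw [e1, Complex.norm_real, Real.norm_of_nonneg
      (integral_nonneg fun _ => mul_nonneg (norm_nonneg _) (norm_nonneg _)), norm_mul,
      Complex.norm_real, Real.norm_of_nonneg (br_pos ξ).le]
    have h1 : ∀ l, br ξ * ‖∫ η, (vsym l (ξ - η) * f (ξ - η)) * (dsym l η * f η)‖ ≤
        2 * ∫ η, ‖(br (ξ - η) : ℂ) * f (ξ - η)‖ * ‖((br η ^ (2 : ℝ) : ℝ) : ℂ) * f η‖ := fun l => by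
      calc _ ≤ br ξ * ∫ η, ‖(vsym l (ξ - η) * f (ξ - η)) * (dsym l η * f η)‖ := by
            have := br_pos ξ
            gcongr
            exact norm_integral_le_integral_norm _
        _ = ∫ η, br ξ * ‖(vsym l (ξ - η) * f (ξ - η)) * (dsym l η * f η)‖ := by
            rw [integral_const_mul]
        _ ≤ ∫ η, 2 * (‖(br (ξ - η) : ℂ) * f (ξ - η)‖ * ‖((br η ^ (2 : ℝ) : ℝ) : ℂ) * f η‖) := by
            refine integral_mono_of_nonneg (Eventually.of_forall fun η =>
              mul_nonneg (br_pos ξ).le (norm_nonneg _)) ?_ (Eventually.of_forall fun η => ?_)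
            · simp only [norm_mul, Complex.norm_real]
              exact hi.const_mul 2
            · simp only [norm_mul, Complex.norm_real, Real.norm_of_nonneg (br_pos _).le,
                Real.rpow_two, norm_pow]
              -- The bracket of the output frequency is shared by both inputs: one power goes to ξ -
              -- η, the other joins the derivative at η.
              have h3 := br_le_two_mul ξ η
              have h4 := norm_vsym_le l (ξ - η)
              have h5 := norm_dsym_le l η
              have h6 := (br_pos ξ).le
              have h7 := (br_pos η).le
              have h8 := (br_pos (ξ - η)).le
              calc _ ≤ (2 * (br (ξ - η) * br η)) * ((1 * ‖f (ξ - η)‖) * (br η * ‖f η‖)) := by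
                    gcongr
                _ = _ := by ring
        _ = _ := by rw [integral_const_mul]
    calc _ ≤ br ξ * ∑ l, ‖∫ η, (vsym l (ξ - η) * f (ξ - η)) * (dsym l η * f η)‖ := by
          have := br_pos ξ
          gcongr
          exact norm_sum_le _ _
      _ ≤ _ := by
          rw [Fin.sum_univ_two, mul_add]
          linarith [h1 0, h1 1]
  have hm' : AEStronglyMeasurable (fun ξ => (br ξ : ℂ) * adv f f ξ) volume :=
    (Complex.measurable_ofReal.comp measurable_br).aestronglyMeasurable.mul hm
  refine ⟨MemLp.of_le_mul hc.1 hm' (Eventually.of_forall hle), ?_⟩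
  refine (l2_mono (by norm_num) hc.1 hle).trans ?_
  have e2 : ∫ ξ, ‖w ξ‖ = ∫ ξ, ‖(br ξ : ℂ) * f ξ‖ := by
    simp only [hw, Complex.norm_real, norm_norm]
  have h9 : l2 g ≤ l2 (fun ξ => ((br ξ ^ (2 : ℝ) : ℝ) : ℂ) * f ξ) :=
    l2_le_of_norm_le hf2 fun ξ => by rw [hg, Complex.norm_real, norm_norm]
  have h10 := hc.2
  rw [e2] at h10
  have h11 : 0 ≤ ∫ ξ, ‖(br ξ : ℂ) * f ξ‖ := integral_nonneg fun _ => norm_nonneg _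
  have := mul_le_mul_of_nonneg_left h9 h11
  linarith

/-- The cancellation in the energy of the difference of two solutions. -/
theorem abs_re_integral_adv_sub_le {f g : Plane → ℂ} (hf : MemLp f 2) (hg : MemLp g 2)
    (hf' : MemLp (fun ξ => (br ξ : ℂ) * f ξ) 2) (hg' : MemLp (fun ξ => (br ξ : ℂ) * g ξ) 2)
    (hfi : Integrable fun ξ => (br ξ : ℂ) * f ξ) (hgi : Integrable g) (hgh : Herm g) :
    |(∫ ξ, (adv f f ξ - adv g g ξ) * (starRingEnd ℂ) (f ξ - g ξ)).re| ≤
      2 * (∫ ξ, ‖(br ξ : ℂ) * f ξ‖) * l2 (fun ξ => f ξ - g ξ) ^ 2 := by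
  obtain ⟨d, hd⟩ : ∃ d : Plane → ℂ, d = fun ξ => f ξ - g ξ := ⟨_, rfl⟩
  have hdm : MemLp d 2 := hd ▸ hf.sub hg
  have hdm' : MemLp (fun ξ => (br ξ : ℂ) * d ξ) 2 := by
    simp only [hd, mul_sub]
    exact hf'.sub hg'
  have hdc : MemLp (fun ξ => (starRingEnd ℂ) (d ξ)) 2 := hdm.star
  have h1 := memLp_adv_right hdm hfi
  have h2 := memLp_adv hgi hdm'
  have e : ∀ ξ, (adv f f ξ - adv g g ξ) * (starRingEnd ℂ) (f ξ - g ξ) =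
      adv d f ξ * (starRingEnd ℂ) (d ξ) + adv g d ξ * (starRingEnd ℂ) (d ξ) := fun ξ => by
    rw [adv_self_sub hf hg hf' hg', hd]
    ring
  have i1 : Integrable fun ξ => adv d f ξ * (starRingEnd ℂ) (d ξ) := h1.1.integrable_mul hdc
  have i2 : Integrable fun ξ => adv g d ξ * (starRingEnd ℂ) (d ξ) := h2.1.integrable_mul hdc
  simp only [e]
  rw [integral_add i1 i2, integral_adv_mul_conj hgi hdm' hdm, Complex.add_re,
    integral_ker3_self hgh, add_zero, ← hd]
  refine (Complex.abs_re_le_norm _).trans ((norm_integral_mul_conj_le h1.1 hdm).trans ?_)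
  rw [sq, ← mul_assoc]
  exact mul_le_mul_of_nonneg_right h1.2 (l2_nonneg d)

/-- The difference lives on shells at or above K, where one derivative is worth 2^K. -/
theorem l2_trunc_sub_trunc_le {K K' : ℕ} (hKK : K ≤ K') {a : Plane → ℂ}
    (ha' : MemLp (fun ξ => (br ξ : ℂ) * a ξ) 2) :
    l2 (fun ξ => trunc K' a ξ - trunc K a ξ) ≤ (2 ^ K : ℝ)⁻¹ * l2 (fun ξ => (br ξ : ℂ) * a ξ) := by
  refine l2_mono (by positivity) ha' fun ξ => ?_
  have h2 : (0 : ℝ) < 2 ^ K := by positivity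
  have h0 : 0 ≤ (2 ^ K : ℝ)⁻¹ * ‖(br ξ : ℂ) * a ξ‖ := by positivity
  have h1 : K ≤ blk ξ → ‖a ξ‖ ≤ (2 ^ K : ℝ)⁻¹ * ‖(br ξ : ℂ) * a ξ‖ := fun h => by
    rw [norm_mul, Complex.norm_real, Real.norm_of_nonneg (br_pos ξ).le, ← mul_assoc]
    refine le_mul_of_one_le_left (norm_nonneg _) ?_
    rw [inv_mul_eq_div, one_le_div h2]
    exact (pow_le_pow_right₀ (by norm_num) h).trans (two_pow_blk_le ξ)
  by_cases hK : blk ξ < K <;> by_cases hK' : blk ξ < K'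
  · simpa [trunc, hK, hK'] using h0
  · omega
  · simpa [trunc, hK, hK'] using h1 (not_lt.1 hK)
  · simpa [trunc, hK, hK'] using h0

/-- An L² energy estimate for the difference of two approximations. Transport of the difference
cancels, and the only source is the mismatch of the truncations, of size 2^{-K} since the advection
term has a derivative to spare. -/
theorem IsGalerkin.norm_sub_sq_le {K K' : ℕ} (hK : K ≤ K') {κ T : ℝ} {F F' : ℝ → ComplexL2}
    {f f' : ℝ → Plane → ℂ} (h : IsGalerkin K κ T F f) (h' : IsGalerkin K' κ T F' f') {a E : ℝ}
    (ha : ∀ t ∈ Icc 0 T, ∫ ξ, ‖(br ξ : ℂ) * f t ξ‖ ≤ a)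
    (hE : ∀ t ∈ Icc 0 T, MemLp (fun ξ => (br ξ : ℂ) * adv (f t) (f t) ξ) 2 ∧
      l2 (fun ξ => (br ξ : ℂ) * adv (f t) (f t) ξ) ≤ E) {t : ℝ} (ht : t ∈ Icc 0 T) :
    ‖F t - F' t‖ ^ 2 ≤ (‖F 0 - F' 0‖ ^ 2 + ((2 ^ K : ℝ)⁻¹ * E) ^ 2 * t) *
      Real.exp ((4 * a + 1) * t) := by
  have h00 : (0 : ℝ) ∈ Icc 0 T := ⟨le_rfl, ht.1.trans ht.2⟩
  have ha0 : 0 ≤ a := (integral_nonneg fun _ => norm_nonneg _).trans (ha 0 h00)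
  refine le_mul_exp_of_deriv_le (y := fun t => ‖F t - F' t‖ ^ 2) (A := fun t => (4 * a + 1) * t)
    (a := fun _ => (4 * a + 1) * 1) (sq_nonneg _)
    (fun s hs => hasDerivWithinAt_norm_sq ((h.hasDerivWithinAt_sub hs).sub
      (h'.hasDerivWithinAt_sub hs))) (fun s _ => (hasDerivWithinAt_id s _).const_mul _)
    (mul_zero _) (fun s hs => mul_nonneg (by positivity) hs.1) (fun s hs => ?_) ht
  have hb := h.bl s hs
  have hb' := h'.bl s hs
  obtain ⟨d, hd⟩ : ∃ d : Plane → ℂ, d = fun ξ => f s ξ - f' s ξ := ⟨_, rfl⟩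
  have hdm : MemLp d 2 := hd ▸ hb.memLp.sub hb'.memLp
  have hdae : (F s - F' s : ComplexL2) =ᵐ[volume] d := by
    filter_upwards [Lp.coeFn_sub (F s) (F' s), h.ae s hs, h'.ae s hs] with ξ e1 e2 e3
    rw [e1, Pi.sub_apply, e2, e3, hd]
  have hGae : (forcing K κ (F s) - forcing K' κ (F' s) : ComplexL2) =ᵐ[volume]
      fun ξ => trunc K (adv (f s) (f s)) ξ - trunc K' (adv (f' s) (f' s)) ξ := by
    filter_upwards [Lp.coeFn_sub (forcing K κ (F s)) (forcing K' κ (F' s)), h.coeFn_forcing hs,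
      h'.coeFn_forcing hs] with ξ e1 e2 e3
    rw [e1, Pi.sub_apply, e2, e3]
  obtain ⟨e, he⟩ : ∃ e : Plane → ℂ, e = fun ξ => trunc K' (adv (f s) (f s)) ξ -
      trunc K (adv (f s) (f s)) ξ := ⟨_, rfl⟩
  have hem : MemLp e 2 :=
    he ▸ (bL_trunc K' (hb.memLp_adv hb)).memLp.sub (bL_trunc K (hb.memLp_adv hb)).memLp
  have hel : l2 e ≤ (2 ^ K : ℝ)⁻¹ * E := by
    rw [he]
    refine (l2_trunc_sub_trunc_le hK (hE s hs).1).trans ?_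
    gcongr
    exact (hE s hs).2
  have hdc : MemLp (fun ξ => (starRingEnd ℂ) (d ξ)) 2 := hdm.star
  have e1 : ∀ ξ, (trunc K (adv (f s) (f s)) ξ - trunc K' (adv (f' s) (f' s)) ξ) *
      (starRingEnd ℂ) (d ξ) = (adv (f s) (f s) ξ - adv (f' s) (f' s) ξ) *
      (starRingEnd ℂ) (f s ξ - f' s ξ) - e ξ * (starRingEnd ℂ) (d ξ) := fun ξ => by
    by_cases h1 : blk ξ < K
    · have h2 : blk ξ < K' := h1.trans_le hK
      simp [he, hd, trunc, h1, h2]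
    · by_cases h2 : blk ξ < K'
      · simp [he, hd, trunc, h1, h2]
        ring
      · simp [hd, hb.supp ξ (not_lt.1 h1), hb'.supp ξ (not_lt.1 h2)]
  have i1 : Integrable fun ξ => (adv (f s) (f s) ξ - adv (f' s) (f' s) ξ) *
      (starRingEnd ℂ) (f s ξ - f' s ξ) := by
    rw [hd] at hdc
    exact ((hb.memLp_adv hb).sub (hb'.memLp_adv hb')).integrable_mul hdc
  have i2 : Integrable fun ξ => e ξ * (starRingEnd ℂ) (d ξ) := hem.integrable_mul hdc
  have h3 := abs_re_integral_adv_sub_le hb.memLp hb'.memLp hb.br_mul.1.memLp hb'.br_mul.1.memLp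
    hb.br_mul.1.integrable hb'.integrable (h'.herm s hs)
  have h4 := (Complex.abs_re_le_norm _).trans (norm_integral_mul_conj_le hem hdm)
  have e2 : κ • mulOp (memLp_rieszSymbol 0) (F s) - forcing K κ (F s) -
      (κ • mulOp (memLp_rieszSymbol 0) (F' s) - forcing K' κ (F' s)) =
      κ • mulOp (memLp_rieszSymbol 0) (F s - F' s) - (forcing K κ (F s) - forcing K' κ (F' s)) := by
    rw [map_sub, smul_sub]
    abel
  rw [e2, inner_sub_right, Complex.sub_re, inner_real_smul, re_inner_riesz, mul_zero, zero_sub,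
    inner_eq_integral hdae hGae]
  simp only [e1]
  rw [integral_sub i1 i2, Complex.sub_re, norm_eq_l2 hdae]
  rw [← hd] at h3
  have h5 := neg_abs_le (∫ ξ, (adv (f s) (f s) ξ - adv (f' s) (f' s) ξ) *
      (starRingEnd ℂ) (f s ξ - f' s ξ)).re
  have h6 := le_abs_self (∫ ξ, e ξ * (starRingEnd ℂ) (d ξ)).re
  have h7 := mul_le_mul_of_nonneg_right (ha s hs) (sq_nonneg (l2 d))
  have h8 := mul_le_mul_of_nonneg_right hel (l2_nonneg d)
  -- The source term is split by 2xy ≤ x² + y², which accounts for the summand 1 in the exponent 4a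
  -- + 1.
  nlinarith [sq_nonneg ((2 ^ K : ℝ)⁻¹ * E - l2 d)]

/-- Frequency tails stay small along Galerkin solutions, uniformly in the truncation. -/
theorem IsGalerkin.l2_sqrt_wt_sq_le {K : ℕ} {κ T : ℝ} {F : ℝ → ComplexL2} {f : ℝ → Plane → ℂ}
    (h : IsGalerkin K κ T F f) {n a R : ℝ} (hn : 0 ≤ n) (hR : 0 ≤ R)
    (ha : ∀ t ∈ Icc 0 T, ∫ ξ, ‖(br ξ : ℂ) * f t ξ‖ ≤ a) {t : ℝ} (ht : t ∈ Icc 0 T) :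
    l2 (fun ξ => ((√(wt (2 * n + 2) R (br ξ)) : ℝ) : ℂ) * f t ξ) ^ 2 ≤
      l2 (fun ξ => ((√(wt (2 * n + 2) R (br ξ)) : ℝ) : ℂ) * f 0 ξ) ^ 2 *
        Real.exp (2 * (3 * ((2 * n + 2) * 2 ^ (2 * n + 2)) * a) * T) := by
  have h00 : (0 : ℝ) ∈ Icc 0 T := ⟨le_rfl, ht.1.trans ht.2⟩
  have ha0 : 0 ≤ a := (integral_nonneg fun _ => norm_nonneg _).trans (ha 0 h00)
  obtain ⟨C, hC, hC0⟩ : ∃ C : ℝ, C = 3 * ((2 * n + 2) * 2 ^ (2 * n + 2)) ∧ 0 ≤ C :=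
    ⟨_, rfl, by positivity⟩
  have hwb : ∀ ξ, blk ξ < K → |√(wt (2 * n + 2) R (br ξ))| ≤ √(((2 : ℝ) ^ K) ^ (2 * n)) :=
    fun ξ hξ => by
    rw [abs_of_nonneg (Real.sqrt_nonneg _)]
    refine Real.sqrt_le_sqrt ((wt_le_rpow hR (br_pos ξ)).trans ?_)
    exact Real.rpow_le_rpow (br_pos ξ).le (br_le_of_blk_lt hξ) (by positivity)
  have h1 := le_mul_exp_of_deriv_le (b := 0) (A := fun t => 2 * (C * a) * t)
    (a := fun _ => 2 * (C * a) * 1) le_rfl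
    (fun s hs => h.hasDerivWithinAt_energy (measurable_sqrt_wt_br (2 * n + 2) R) hwb hs)
    (fun s _ => (hasDerivWithinAt_id s _).const_mul _) (mul_zero _)
    (fun s hs => mul_nonneg (by positivity) hs.1) (fun s hs => ?_) ht
  · rw [zero_mul, add_zero] at h1
    rw [← hC]
    refine h1.trans ?_
    gcongr
    exact ht.2
  · have h2 := weighted_energy_bound (m := 2 * n + 2) (by linarith) hR (h.bl s hs) (h.herm s hs)
    have e : ∀ ξ, √(wt (2 * n + 2) R (br ξ)) ^ 2 = wt (2 * n + 2) R (br ξ) := fun ξ =>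
      Real.sq_sqrt (wt_nonneg hR (br_pos ξ).le)
    simp only [e, add_zero]
    rw [← hC] at h2
    have h3 := neg_abs_le (∫ p : Plane × Plane, ((wt (2 * n + 2) R (br p.1) : ℝ) : ℂ) *
      ker3 (f s) (f s) (f s) p).re
    have h4 := mul_le_mul_of_nonneg_right (mul_le_mul_of_nonneg_left (ha s hs) hC0)
      (sq_nonneg (l2 (fun ξ => ((√(wt (2 * n + 2) R (br ξ)) : ℝ) : ℂ) * f s ξ)))
    linarith

/-- The advection term on `L²`, with value `0` if it is not square integrable. -/
def advLp (F : ComplexL2) : ComplexL2 :=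
  open Classical in if h : MemLp (adv F F) 2 then h.toLp _ else 0

theorem coeFn_advLp {F : ComplexL2} (h : MemLp (adv F F) 2) : advLp F =ᵐ[volume] adv F F := by
  rw [advLp, dif_pos h]
  exact h.coeFn_toLp

theorem l2_trunc_sub_le (K : ℕ) {a : Plane → ℂ} (ha' : MemLp (fun ξ => (br ξ : ℂ) * a ξ) 2) :
    l2 (fun ξ => trunc K a ξ - a ξ) ≤ (2 ^ K : ℝ)⁻¹ * l2 (fun ξ => (br ξ : ℂ) * a ξ) := by
  refine l2_mono (by positivity) ha' fun ξ => ?_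
  have h2 : (0 : ℝ) < 2 ^ K := by positivity
  by_cases hK : blk ξ < K
  · simp only [trunc, Set.indicator_apply, Set.mem_ofPred_eq, hK, if_true, sub_self, norm_zero]
    positivity
  · simp only [trunc, Set.indicator_apply, Set.mem_ofPred_eq, hK, if_false, zero_sub, norm_neg]
    rw [norm_mul, Complex.norm_real, Real.norm_of_nonneg (br_pos ξ).le, ← mul_assoc]
    refine le_mul_of_one_le_left (norm_nonneg _) ?_
    rw [inv_mul_eq_div, one_le_div h2]
    exact (pow_le_pow_right₀ (by norm_num) (not_lt.1 hK)).trans (two_pow_blk_le ξ)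

/-- Functions with uniformly small frequency tails that are close in `L²` are close in `H^n`. -/
theorem exists_modulus {n : ℝ} (hn : 0 ≤ n) {ω : ℝ → ℝ} (hω : Tendsto ω atTop (𝓝 0)) {δ : ℝ}
    (hδ : 0 < δ) : ∃ η : ℝ, 0 < η ∧ ∀ u v : Plane → ℂ,
    MemLp (fun ξ => ((br ξ ^ n : ℝ) : ℂ) * u ξ) 2 → MemLp (fun ξ => ((br ξ ^ n : ℝ) : ℂ) * v ξ) 2 →
    (∀ R, 0 < R → l2 (fun ξ => ((√(wt (2 * n + 2) R (br ξ)) : ℝ) : ℂ) * u ξ) ^ 2 ≤ ω R) →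
    (∀ R, 0 < R → l2 (fun ξ => ((√(wt (2 * n + 2) R (br ξ)) : ℝ) : ℂ) * v ξ) ^ 2 ≤ ω R) →
    l2 (fun ξ => u ξ - v ξ) ≤ η → l2 (fun ξ => ((br ξ ^ n : ℝ) : ℂ) * (u ξ - v ξ)) ≤ δ := by
  -- The two tails contribute at most 4(ω + ω) ≤ δ²/2. The other half is left for R^n η² once R is
  -- fixed.
  obtain ⟨R, hR1, hR2⟩ := ((hω.eventually (gt_mem_nhds (show 0 < δ ^ 2 / 16 by positivity))).and
    (eventually_gt_atTop 0)).exists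
  have hRn : 0 < R ^ n := Real.rpow_pos_of_pos hR2 n
  refine ⟨√(δ ^ 2 / (2 * R ^ n)), by positivity, fun u v hu hv hu' hv' huv => ?_⟩
  have h1 := l2_br_rpow_sub_sq_le hn hR2 hu hv
  have h2 : l2 (fun ξ => u ξ - v ξ) ^ 2 ≤ δ ^ 2 / (2 * R ^ n) := by
    rw [← Real.sq_sqrt (show 0 ≤ δ ^ 2 / (2 * R ^ n) by positivity)]
    exact pow_le_pow_left₀ (l2_nonneg _) huv 2
  have h3 : R ^ n * l2 (fun ξ => u ξ - v ξ) ^ 2 ≤ δ ^ 2 / 2 := by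
    calc _ ≤ R ^ n * (δ ^ 2 / (2 * R ^ n)) := by gcongr
      _ = _ := by field_simp
  refine (pow_le_pow_iff_left₀ (l2_nonneg _) hδ.le two_ne_zero).1 ?_
  linarith [hu' R hR2, hv' R hR2]

/-! ### Passage to the limit. -/

/-- A uniformly bounded family of Galerkin solutions that converges in `L²`. -/
structure IsApprox (n κ T B Q : ℝ) (ω : ℝ → ℝ) (F : ℕ → ℝ → ComplexL2) (f : ℕ → ℝ → Plane → ℂ)
    (G : ℝ → ComplexL2) : Prop where
  galerkin : ∀ K, IsGalerkin K κ T (F K) (f K)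
  bound : ∀ K, ∀ t ∈ Icc 0 T, l2 (fun ξ => ((br ξ ^ n : ℝ) : ℂ) * f K t ξ) ≤ B
  tail : ∀ K, ∀ t ∈ Icc 0 T, ∀ R, 0 ≤ R →
    l2 (fun ξ => ((√(wt (2 * n + 2) R (br ξ)) : ℝ) : ℂ) * f K t ξ) ^ 2 ≤ ω R
  close : ∀ K, ∀ t ∈ Icc 0 T, ‖F K t - G t‖ ≤ Q * (2 ^ K : ℝ)⁻¹
  tendsto : Tendsto ω atTop (𝓝 0)

theorem tendsto_mul_two_pow_inv (Q : ℝ) : Tendsto (fun K : ℕ => Q * (2 ^ K : ℝ)⁻¹) atTop (𝓝 0) := by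
  have := (tendsto_pow_atTop_nhds_zero_of_lt_one (r := (2 : ℝ)⁻¹) (by norm_num)
    (by norm_num)).const_mul Q
  simpa only [inv_pow, mul_zero] using this

section

variable {n κ T B Q : ℝ} {ω : ℝ → ℝ} {F : ℕ → ℝ → ComplexL2} {f : ℕ → ℝ → Plane → ℂ}
  {G : ℝ → ComplexL2}

theorem IsApprox.tendsto_lim (h : IsApprox n κ T B Q ω F f G) {t : ℝ} (ht : t ∈ Icc 0 T) :
    Tendsto (fun K => F K t) atTop (𝓝 (G t)) := by
  rw [tendsto_iff_norm_sub_tendsto_zero]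
  exact squeeze_zero (fun _ => norm_nonneg _) (fun K => h.close K t ht) (tendsto_mul_two_pow_inv Q)

theorem IsApprox.bound_nonneg (h : IsApprox n κ T B Q ω F f G) {t : ℝ} (ht : t ∈ Icc 0 T) : 0 ≤ B :=
  (l2_nonneg _).trans (h.bound 0 t ht)

theorem IsApprox.memLp_lim (h : IsApprox n κ T B Q ω F f G) {t : ℝ} (ht : t ∈ Icc 0 T) :
    MemLp (fun ξ => ((br ξ ^ n : ℝ) : ℂ) * G t ξ) 2 ∧
      l2 (fun ξ => ((br ξ ^ n : ℝ) : ℂ) * G t ξ) ≤ B := by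
  refine memLp_weighted_of_tendsto (measurable_br.pow_const n) (h.tendsto_lim ht)
    (h.bound_nonneg ht) (Eventually.of_forall fun K => ?_)
  have hae : (fun ξ => ((br ξ ^ n : ℝ) : ℂ) * f K t ξ) =ᵐ[volume]
      fun ξ => ((br ξ ^ n : ℝ) : ℂ) * F K t ξ := by
    filter_upwards [(h.galerkin K).ae t ht] with ξ hξ
    rw [hξ]
  have hm := (((h.galerkin K).bl t ht).br_rpow_mul n).memLp
  refine ⟨hm.ae_eq hae, ?_⟩
  rw [← l2_congr hae (hm.ae_eq hae)]
  exact h.bound K t ht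

theorem IsApprox.tail_lim (h : IsApprox n κ T B Q ω F f G) {t : ℝ} (ht : t ∈ Icc 0 T) {R : ℝ}
    (hR : 0 ≤ R) : l2 (fun ξ => ((√(wt (2 * n + 2) R (br ξ)) : ℝ) : ℂ) * G t ξ) ^ 2 ≤ ω R := by
  have hω : 0 ≤ ω R := (sq_nonneg _).trans (h.tail 0 t ht R hR)
  have h1 := (memLp_weighted_of_tendsto (measurable_sqrt_wt_br (2 * n + 2) R) (h.tendsto_lim ht)
    (Real.sqrt_nonneg (ω R)) (Eventually.of_forall fun K => ?_)).2
  · rw [← Real.sq_sqrt hω]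
    exact pow_le_pow_left₀ (l2_nonneg _) h1 2
  · have hae : (fun ξ => ((√(wt (2 * n + 2) R (br ξ)) : ℝ) : ℂ) * f K t ξ) =ᵐ[volume]
        fun ξ => ((√(wt (2 * n + 2) R (br ξ)) : ℝ) : ℂ) * F K t ξ := by
      filter_upwards [(h.galerkin K).ae t ht] with ξ hξ
      rw [hξ]
    have hm := memLp_sqrt_wt hR (((h.galerkin K).bl t ht).br_rpow_mul n).memLp
    refine ⟨hm.ae_eq hae, ?_⟩
    rw [← l2_congr hae (hm.ae_eq hae)]
    exact Real.le_sqrt_of_sq_le (h.tail K t ht R hR)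

theorem coeFn_sub_ae {H H' : ComplexL2} {u v : Plane → ℂ} (hu : H =ᵐ[volume] u)
    (hv : H' =ᵐ[volume] v) : (H - H' : ComplexL2) =ᵐ[volume] fun ξ => u ξ - v ξ := by
  filter_upwards [Lp.coeFn_sub H H', hu, hv] with ξ e1 e2 e3
  rw [e1, Pi.sub_apply, e2, e3]

/-- Hermitian symmetry is a closed condition: taking the Hermitian part is a contraction that fixes
the approximations, so the defect of the limit is at most twice the distance to them. -/
theorem IsApprox.herm_lim (h : IsApprox n κ T B Q ω F f G) {t : ℝ} (ht : t ∈ Icc 0 T) :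
    G t =ᵐ[volume] hpart (G t) := by
  have hm := Lp.memLp (G t)
  have hpm := (MemLp.hpart hm).1
  suffices ‖hpm.toLp _ - G t‖ = 0 by
    rw [norm_eq_zero, sub_eq_zero] at this
    nth_rewrite 1 [← this]
    exact hpm.coeFn_toLp
  refine le_antisymm ?_ (norm_nonneg _)
  have h1 : ∀ K, ‖hpm.toLp _ - G t‖ ≤ 2 * (Q * (2 ^ K : ℝ)⁻¹) := fun K => by
    have hb := (h.galerkin K).bl t ht
    have hd : MemLp (fun ξ => f K t ξ - G t ξ) 2 := hb.memLp.sub hm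
    have hd' := MemLp.hpart hd
    have e1 : l2 (fun ξ => f K t ξ - G t ξ) ≤ Q * (2 ^ K : ℝ)⁻¹ := by
      rw [← norm_eq_l2 (coeFn_sub_ae ((h.galerkin K).ae t ht) (ae_eq_refl (G t)))]
      exact h.close K t ht
    have e2 : (fun ξ => hpart (G t) ξ - G t ξ) =
        fun ξ => (f K t ξ - G t ξ) - hpart (fun ξ => f K t ξ - G t ξ) ξ := by
      ext ξ
      have := congrFun ((h.galerkin K).herm t ht).hpart_eq ξ
      simp only [hpart, map_sub] at this ⊢
      linear_combination this
    rw [norm_eq_l2 (coeFn_sub_ae hpm.coeFn_toLp (ae_eq_refl (G t))), e2]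
    have e3 : l2 (fun ξ => (f K t ξ - G t ξ) - hpart (fun ξ => f K t ξ - G t ξ) ξ) ≤
        l2 (fun ξ => f K t ξ - G t ξ) + l2 (hpart fun ξ => f K t ξ - G t ξ) :=
      lpNorm_sub_le hd (by norm_num)
    linarith [hd'.2]
  have h2 := (tendsto_mul_two_pow_inv Q).const_mul 2
  rw [mul_zero] at h2
  exact ge_of_tendsto' h2 h1

theorem IsApprox.tendstoUniformlyOn (h : IsApprox n κ T B Q ω F f G) :
    TendstoUniformlyOn F G atTop (Icc 0 T) := by
  rw [Metric.tendstoUniformlyOn_iff]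
  intro δ hδ
  filter_upwards [(tendsto_mul_two_pow_inv Q).eventually (gt_mem_nhds hδ)] with K hK t ht
  rw [dist_comm, dist_eq_norm]
  exact (h.close K t ht).trans_lt hK

theorem IsApprox.continuousOn_lim (h : IsApprox n κ T B Q ω F f G) : ContinuousOn G (Icc 0 T) :=
  h.tendstoUniformlyOn.continuousOn (Frequently.of_forall fun K => (h.galerkin K).continuousOn)

/-- Tails that are small uniformly in time upgrade continuity in L² to continuity in H^n. -/
theorem IsApprox.tendsto_sobolev (hn : 0 ≤ n) (h : IsApprox n κ T B Q ω F f G) {t : ℝ}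
    (ht : t ∈ Icc 0 T) : Tendsto (fun s => l2 (fun ξ => ((br ξ ^ n : ℝ) : ℂ) * (G s ξ - G t ξ)))
      (𝓝[Icc 0 T] t) (𝓝 0) := by
  rw [Metric.tendsto_nhds]
  intro δ hδ
  obtain ⟨η, hη, hm⟩ := exists_modulus hn h.tendsto (half_pos hδ)
  have h1 := Metric.tendsto_nhds.1 (h.continuousOn_lim t ht) η hη
  filter_upwards [h1, self_mem_nhdsWithin] with s hs hsI
  rw [dist_zero_right, Real.norm_of_nonneg (l2_nonneg _)]
  refine (hm (G s) (G t) (h.memLp_lim hsI).1 (h.memLp_lim ht).1 (fun R hR => h.tail_lim hsI hR.le)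
    (fun R hR => h.tail_lim ht hR.le) ?_).trans_lt (by linarith)
  rw [dist_eq_norm, norm_eq_l2 (coeFn_sub_ae (ae_eq_refl (G s)) (ae_eq_refl (G t)))] at hs
  exact hs.le

/-- The truncation error is of order 2^{-K} by the spare derivative, and the bilinear difference is
controlled by the distance in H^n, which the tails make small uniformly in time. -/
theorem IsApprox.tendstoUniformlyOn_forcing (hn : 3 < n) (h : IsApprox n κ T B Q ω F f G) :
    TendstoUniformlyOn (fun K t => forcing K κ (F K t)) (fun t => advLp (G t)) atTop (Icc 0 T) := by
  rcases (Icc (0 : ℝ) T).eq_empty_or_nonempty with hE | ⟨t₀, ht₀⟩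
  · rw [hE]
    exact tendstoUniformlyOn_empty
  obtain ⟨c, hc, hint⟩ := exists_integral_br_le (n := n) (by linarith)
  have hB := h.bound_nonneg ht₀
  rw [Metric.tendstoUniformlyOn_iff]
  intro δ hδ
  obtain ⟨η, hη, hm⟩ := exists_modulus (n := n) (by linarith) h.tendsto
    -- The Lipschitz constant of the advection term on the bounded set is 4cB, so this closeness
    -- leaves at most δ/2.
    (show 0 < δ / (2 * (4 * (c * B) + 1)) by positivity)
  filter_upwards [(tendsto_mul_two_pow_inv Q).eventually (gt_mem_nhds hη),
    (tendsto_mul_two_pow_inv (4 * (c * B) * B)).eventually (gt_mem_nhds (half_pos hδ))]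
    with K hK1 hK2 t ht
  have hb := (h.galerkin K).bl t ht
  have hfB := h.bound K t ht
  have hfm := (hb.br_rpow_mul n).memLp
  obtain ⟨hGm, hGB⟩ := h.memLp_lim ht
  have hf1 := memLp_br_of_br_rpow (by linarith) hfm
  have hG1 := memLp_br_of_br_rpow (by linarith) hGm
  have hf0 := memLp_of_br_rpow (by linarith) hfm
  have hG0 := memLp_of_br_rpow (by linarith) hGm
  obtain ⟨hfi, hfib⟩ := hint _ hfm
  obtain ⟨hGi, hGib⟩ := hint _ hGm
  have hGi0 : Integrable (G t) ∧ ∫ ξ, ‖G t ξ‖ ≤ ∫ ξ, ‖(br ξ : ℂ) * G t ξ‖ := by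
    have hle : ∀ ξ, ‖G t ξ‖ ≤ ‖(br ξ : ℂ) * G t ξ‖ := fun ξ => by
      rw [norm_mul, Complex.norm_real, Real.norm_of_nonneg (br_pos ξ).le]
      exact le_mul_of_one_le_left (norm_nonneg _) (one_le_br ξ)
    have hi := hGi.mono (Lp.aestronglyMeasurable (G t)) (Eventually.of_forall hle)
    exact ⟨hi, integral_mono hi.norm hGi.norm hle⟩
  have hadvG := (memLp_adv hGi0.1 hG1.1).1
  have hadvf := hb.memLp_adv hb
  have hbr := l2_br_mul_adv_le hfi hf1.1 (memLp_br_rpow_of_le (r := 2) (by linarith) hfm).1 hadvf.1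
  have hd : l2 (fun ξ => ((br ξ ^ n : ℝ) : ℂ) * (f K t ξ - G t ξ)) ≤
      δ / (2 * (4 * (c * B) + 1)) := by
    refine hm _ _ hfm hGm (fun R hR => h.tail K t ht R hR.le) (fun R hR => h.tail_lim ht hR.le) ?_
    rw [← norm_eq_l2 (coeFn_sub_ae ((h.galerkin K).ae t ht) (ae_eq_refl (G t)))]
    exact (h.close K t ht).trans hK1.le
  have hdm : MemLp (fun ξ => ((br ξ ^ n : ℝ) : ℂ) * (f K t ξ - G t ξ)) 2 := by
    simp only [mul_sub]
    exact hfm.sub hGm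
  have hd1 := (memLp_br_of_br_rpow (by linarith) hdm).2
  have hd0 := (memLp_of_br_rpow (by linarith) hdm).2
  have h1 := l2_adv_self_sub_le hf0.1 hG0.1 hf1.1 hG1.1 hfi hGi0.1
  have h2 := l2_trunc_sub_le K hbr.1
  have h3 : l2 (fun ξ => trunc K (adv (f K t) (f K t)) ξ - adv (G t) (G t) ξ) ≤
      l2 (fun ξ => trunc K (adv (f K t) (f K t)) ξ - adv (f K t) (f K t) ξ) +
      l2 (fun ξ => adv (f K t) (f K t) ξ - adv (G t) (G t) ξ) := by
    have e : (fun ξ => trunc K (adv (f K t) (f K t)) ξ - adv (G t) (G t) ξ) =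
        (fun ξ => trunc K (adv (f K t) (f K t)) ξ - adv (f K t) (f K t) ξ) +
        (fun ξ => adv (f K t) (f K t) ξ - adv (G t) (G t) ξ) := by
      ext ξ
      simp
    rw [e]
    exact lpNorm_add_le ((bL_trunc K hadvf).memLp.sub hadvf) (by norm_num)
  have hib0 : 0 ≤ ∫ ξ, ‖(br ξ : ℂ) * f K t ξ‖ := integral_nonneg fun _ => norm_nonneg _
  have hfib' : ∫ ξ, ‖(br ξ : ℂ) * f K t ξ‖ ≤ c * B := hfib.trans (by gcongr)
  have hGib' : ∫ ξ, ‖G t ξ‖ ≤ c * B := (hGi0.2.trans hGib).trans (by gcongr)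
  have h4 : l2 (fun ξ => (br ξ : ℂ) * adv (f K t) (f K t) ξ) ≤ 4 * (c * B) * B := by
    refine hbr.2.trans ?_
    have := (memLp_br_rpow_of_le (r := 2) (by linarith) hfm).2.trans hfB
    exact mul_le_mul (by linarith) this (l2_nonneg _) (by positivity)
  rw [dist_comm, dist_eq_norm,
    norm_eq_l2 (coeFn_sub_ae ((h.galerkin K).coeFn_forcing ht) (coeFn_advLp hadvG))]
  have h5 : l2 (fun ξ => trunc K (adv (f K t) (f K t)) ξ - adv (f K t) (f K t) ξ) < δ / 2 := by
    refine lt_of_le_of_lt (h2.trans ?_) hK2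
    rw [mul_comm]
    gcongr
  obtain ⟨x, hx⟩ : ∃ x, x = l2 (fun ξ => ((br ξ ^ n : ℝ) : ℂ) * (f K t ξ - G t ξ)) := ⟨_, rfl⟩
  rw [← hx] at hd hd1 hd0
  have hx0 : 0 ≤ x := hx ▸ l2_nonneg _
  have h6 : l2 (fun ξ => adv (f K t) (f K t) ξ - adv (G t) (G t) ξ) ≤ 4 * (c * B) * x := by
    refine h1.trans ?_
    have e1 : 2 * (∫ ξ, ‖(br ξ : ℂ) * f K t ξ‖) * l2 (fun ξ => f K t ξ - G t ξ) ≤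
        2 * (c * B) * x := mul_le_mul (by linarith) hd0 (l2_nonneg _) (by positivity)
    have e2 : 2 * (∫ ξ, ‖G t ξ‖) * l2 (fun ξ => (br ξ : ℂ) * (f K t ξ - G t ξ)) ≤
        2 * (c * B) * x := mul_le_mul (by linarith) hd1 (l2_nonneg _) (by positivity)
    linarith
  have h7 : 4 * (c * B) * x ≤ δ / 2 := by
    rw [le_div_iff₀ (by positivity)] at hd
    nlinarith
  linarith

/-- The right-hand sides converge uniformly in time, so the limit satisfies the integrated equation
with a continuous integrand, and this can be differentiated. -/
theorem IsApprox.hasDerivWithinAt (hn : 3 < n) (h : IsApprox n κ T B Q ω F f G) {t : ℝ}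
    (ht : t ∈ Icc 0 T) :
    HasDerivWithinAt G (κ • mulOp (memLp_rieszSymbol 0) (G t) - advLp (G t)) (Icc 0 T) t := by
  obtain ⟨Y, hYd⟩ : ∃ Y : ℝ → ComplexL2,
    Y = fun t => κ • mulOp (memLp_rieszSymbol 0) (G t) - advLp (G t) := ⟨_, rfl⟩
  obtain ⟨Yk, hYkd⟩ : ∃ Yk : ℕ → ℝ → ComplexL2, Yk = fun K t =>
    κ • mulOp (memLp_rieszSymbol 0) (F K t) - forcing K κ (F K t) := ⟨_, rfl⟩
  have hYkc : ∀ K, ContinuousOn (Yk K) (Icc 0 T) := fun K => by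
    rw [hYkd]
    exact (((mulOp (memLp_rieszSymbol 0)).continuous.comp_continuousOn
      (h.galerkin K).continuousOn).const_smul κ).sub (h.galerkin K).continuousOn_forcing
  have hL : UniformContinuous fun x : ComplexL2 => κ • mulOp (memLp_rieszSymbol 0) x :=
    (mulOp (memLp_rieszSymbol 0)).uniformContinuous.const_smul κ
  have hu : TendstoUniformlyOn Yk Y atTop (Icc 0 T) := by
    rw [hYd, hYkd]
    exact (hL.comp_tendstoUniformlyOn h.tendstoUniformlyOn).sub (h.tendstoUniformlyOn_forcing hn)
  have hYc : ContinuousOn Y (Icc 0 T) := hu.continuousOn (Frequently.of_forall hYkc)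
  have hint : ∀ s ∈ Icc 0 T, G s = G 0 + ∫ r in (0 : ℝ)..s, Y r := fun s hs => by
    have hsub : Icc 0 s ⊆ Icc 0 T := Icc_subset_Icc_right hs.2
    have h0 : (0 : ℝ) ∈ Icc 0 T := ⟨le_rfl, hs.1.trans hs.2⟩
    have hi : ∀ {Z : ℝ → ComplexL2}, ContinuousOn Z (Icc 0 T) →
        IntervalIntegrable Z volume 0 s := fun {Z} hZ => by
      apply ContinuousOn.intervalIntegrable
      rw [Set.uIcc_of_le hs.1]
      exact hZ.mono hsub
    have e1 : ∀ K, ∫ r in (0 : ℝ)..s, Yk K r = F K s - F K 0 := fun K => by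
      have hd := fun r hr => (h.galerkin K).hasDerivWithinAt_sub (t := r) hr
      refine intervalIntegral.integral_eq_sub_of_hasDeriv_right_of_le hs.1
        ((h.galerkin K).continuousOn.mono hsub) (fun r hr => ?_) (hi (hYkc K))
      rw [hYkd]
      have hr' : r ∈ Icc 0 T := ⟨hr.1.le, hr.2.le.trans hs.2⟩
      exact ((hd r hr').hasDerivAt (Icc_mem_nhds hr.1 (hr.2.trans_le hs.2))).hasDerivWithinAt
    have e2 : Tendsto (fun K => ∫ r in (0 : ℝ)..s, Yk K r) atTop
        (𝓝 (∫ r in (0 : ℝ)..s, Y r)) := by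
      rw [Metric.tendsto_nhds]
      intro δ hδ
      -- Dividing by s + 1 rather than s covers s = 0.
      filter_upwards [Metric.tendstoUniformlyOn_iff.1 hu (δ / (s + 1))
        (div_pos hδ (by linarith [hs.1]))] with K hK
      rw [dist_eq_norm, ← intervalIntegral.integral_sub (hi (hYkc K)) (hi hYc)]
      have := intervalIntegral.norm_integral_le_of_norm_le_const (a := 0) (b := s)
        (f := fun r => Yk K r - Y r) (C := δ / (s + 1)) fun r hr => by
          rw [Set.uIoc_of_le hs.1] at hr
          rw [← dist_eq_norm, dist_comm]
          exact (hK r ⟨hr.1.le, hr.2.trans hs.2⟩).le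
      refine this.trans_lt ?_
      rw [sub_zero, abs_of_nonneg hs.1, div_mul_eq_mul_div, div_lt_iff₀ (by linarith [hs.1])]
      nlinarith
    simp only [e1] at e2
    have e3 := tendsto_nhds_unique e2 ((h.tendsto_lim hs).sub (h.tendsto_lim h0))
    rw [e3]
    abel
  have h1 := (hasDerivWithinAt_integral hYc ht).const_add (G 0)
  rw [hYd] at h1 hint
  exact h1.congr hint (hint t ht)

end

theorem le_mul_sqrt_of_sq_le {x y z : ℝ} (hx : 0 ≤ x) (hz : 0 ≤ z) (h : x ^ 2 ≤ y ^ 2 * z) (hy : 0 ≤ y) :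
    x ≤ y * √z := by
  refine (pow_le_pow_iff_left₀ hx (by positivity) two_ne_zero).1 ?_
  rwa [mul_pow, Real.sq_sqrt hz]

/-! ### Existence and uniqueness on the Fourier side. -/

/-- Existence of the solution on the Fourier side on the dispersive time scale. -/
theorem exists_fourier_solution {n : ℝ} (hn : 3 < n) : ∃ c : ℝ, 0 < c ∧
    ∀ (κ ε T : ℝ) (F₀ : ComplexL2) (f₀ : Plane → ℂ), 0 < κ → 0 < ε →
    T = c * κ ^ (1 / 3 : ℝ) * ε ^ (-4 / 3 : ℝ) → F₀ =ᵐ[volume] f₀ → Herm f₀ →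
    MemLp (fun ξ => ((br ξ ^ n : ℝ) : ℂ) * f₀ ξ) 2 →
    l2 (fun ξ => ((br ξ ^ n : ℝ) : ℂ) * f₀ ξ) ≤ ε →
    ∃ (B : ℝ) (G : ℝ → ComplexL2), G 0 = F₀ ∧ ∀ t ∈ Icc 0 T, G t =ᵐ[volume] hpart (G t) ∧
      MemLp (fun ξ => ((br ξ ^ n : ℝ) : ℂ) * G t ξ) 2 ∧
      l2 (fun ξ => ((br ξ ^ n : ℝ) : ℂ) * G t ξ) ≤ B ∧
      Tendsto (fun s => l2 (fun ξ => ((br ξ ^ n : ℝ) : ℂ) * (G s ξ - G t ξ))) (𝓝[Icc 0 T] t) (𝓝 0) ∧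
      HasDerivWithinAt G (κ • mulOp (memLp_rieszSymbol 0) (G t) - advLp (G t)) (Icc 0 T) t := by
  obtain ⟨c, B₀, hc, hB₀, hap⟩ := exists_apriori_bound hn
  obtain ⟨ci, hci, hint⟩ := exists_integral_br_le (n := n) (by linarith)
  refine ⟨c, hc, fun κ ε T F₀ f₀ hκ hε hT hF₀ hherm hm₀ hε₀ => ?_⟩
  have hT0 : 0 < T := hT ▸ by positivity
  have h00 : (0 : ℝ) ∈ Icc 0 T := ⟨le_rfl, hT0.le⟩
  obtain ⟨B, hBd, hB⟩ : ∃ B, B = B₀ * ε ∧ 0 < B := ⟨_, rfl, by positivity⟩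
  obtain ⟨hf₀2, hf₀l⟩ := memLp_of_br_rpow (by linarith) hm₀
  have hbr₀ := memLp_br_of_br_rpow (by linarith) hm₀
  have hP : ∀ K, proj K F₀ =ᵐ[volume] trunc K f₀ := fun K => coeFn_proj_of_herm K hF₀ hherm
  choose F f hF0 hG using fun K => exists_galerkin K κ hT0 (hP K) (hherm.trunc K) (bL_trunc K hf₀2)
  have hf0 : ∀ K, f K 0 =ᵐ[volume] trunc K f₀ := fun K =>
    ((hG K).ae 0 h00).symm.trans ((hF0 K).symm ▸ hP K)
  have hw0 : ∀ (w : Plane → ℝ) (K : ℕ), MemLp (fun ξ => (w ξ : ℂ) * f₀ ξ) 2 →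
      l2 (fun ξ => (w ξ : ℂ) * f K 0 ξ) ≤ l2 (fun ξ => (w ξ : ℂ) * f₀ ξ) := fun w K hw => by
    have e : (fun ξ => (w ξ : ℂ) * f K 0 ξ) =ᵐ[volume] trunc K (fun ξ => (w ξ : ℂ) * f₀ ξ) := by
      filter_upwards [hf0 K] with ξ hξ
      rw [hξ]
      by_cases h : blk ξ < K
      · simp [trunc, h]
      · simp [trunc, h]
    rw [l2_congr e (hw.indicator (measurableSet_blk_lt K))]
    exact l2_le_of_norm_le hw (norm_trunc_le K _)
  have hbd : ∀ K, ∀ t ∈ Icc 0 T, l2 (fun ξ => ((br ξ ^ n : ℝ) : ℂ) * f K t ξ) ≤ B :=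
    fun K t ht => hBd ▸ hap K κ ε T (F K) (f K) hκ hε hT (hG K) ((hw0 _ K hm₀).trans hε₀) t ht
  have hmem : ∀ K, ∀ t ∈ Icc 0 T, MemLp (fun ξ => ((br ξ ^ n : ℝ) : ℂ) * f K t ξ) 2 :=
    fun K t ht => (((hG K).bl t ht).br_rpow_mul n).memLp
  have ha : ∀ K, ∀ t ∈ Icc 0 T, ∫ ξ, ‖(br ξ : ℂ) * f K t ξ‖ ≤ ci * B := fun K t ht =>
    (hint _ (hmem K t ht)).2.trans (by have := hbd K t ht; gcongr)
  have hE : ∀ K, ∀ t ∈ Icc 0 T, MemLp (fun ξ => (br ξ : ℂ) * adv (f K t) (f K t) ξ) 2 ∧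
      l2 (fun ξ => (br ξ : ℂ) * adv (f K t) (f K t) ξ) ≤ 4 * (ci * B) * B := fun K t ht => by
    have hb := (hG K).bl t ht
    have hm := hmem K t ht
    have h2 := memLp_br_rpow_of_le (r := 2) (by linarith) hm
    have h := l2_br_mul_adv_le hb.br_mul.1.integrable hb.br_mul.1.memLp h2.1 (hb.memLp_adv hb).1
    refine ⟨h.1, h.2.trans ?_⟩
    have := ha K t ht
    exact mul_le_mul (by linarith) (h2.2.trans (hbd K t ht)) (l2_nonneg _) (by positivity)
  -- The two errors of size 2^{-K}: truncation of the datum and truncation of the advection term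
  -- over the time T.
  obtain ⟨D, hDd, hD0⟩ : ∃ D, D = l2 (fun ξ => (br ξ : ℂ) * f₀ ξ) ^ 2 + (4 * (ci * B) * B) ^ 2 * T ∧
    0 ≤ D := ⟨_, rfl, by positivity⟩
  obtain ⟨Q, hQd, hQ0⟩ : ∃ Q, Q = √(D * Real.exp ((4 * (ci * B) + 1) * T)) ∧ 0 ≤ Q :=
    ⟨_, rfl, Real.sqrt_nonneg _⟩
  have hclose : ∀ K K', K ≤ K' → ∀ t ∈ Icc 0 T, ‖F K t - F K' t‖ ≤ Q * (2 ^ K : ℝ)⁻¹ :=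
    fun K K' hKK t ht => by
    have h1 := (hG K).norm_sub_sq_le hKK (hG K') (ha K) (hE K) ht
    have h2 : ‖F K 0 - F K' 0‖ ≤ (2 ^ K : ℝ)⁻¹ * l2 (fun ξ => (br ξ : ℂ) * f₀ ξ) := by
      have e1 : F K 0 =ᵐ[volume] trunc K f₀ := (hF0 K).symm ▸ hP K
      have e2 : F K' 0 =ᵐ[volume] trunc K' f₀ := (hF0 K').symm ▸ hP K'
      rw [norm_sub_rev, norm_eq_l2 (coeFn_sub_ae e2 e1)]
      exact l2_trunc_sub_trunc_le hKK hbr₀.1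
    have h3 := pow_le_pow_left₀ (norm_nonneg _) h2 2
    have h4 : ‖F K t - F K' t‖ ^ 2 ≤
        ((2 ^ K : ℝ)⁻¹) ^ 2 * (D * Real.exp ((4 * (ci * B) + 1) * T)) := by
      refine h1.trans ?_
      have ht0 := ht.1
      have htT := ht.2
      have e3 : ((2 ^ K : ℝ)⁻¹) ^ 2 * D = ((2 ^ K : ℝ)⁻¹ * l2 (fun ξ => (br ξ : ℂ) * f₀ ξ)) ^ 2 +
          ((2 ^ K : ℝ)⁻¹ * (4 * (ci * B) * B)) ^ 2 * T := by
        rw [hDd]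
        ring
      rw [(mul_assoc (((2 ^ K : ℝ)⁻¹) ^ 2) D _).symm, e3]
      refine mul_le_mul ?_ (Real.exp_le_exp.2 (by gcongr)) (Real.exp_pos _).le (by positivity)
      exact add_le_add h3 (by gcongr)
    have h5 := le_mul_sqrt_of_sq_le (norm_nonneg _) (by positivity) h4 (by positivity)
    rwa [← hQd, mul_comm] at h5
  have hlim : ∀ t, ∃ G : ComplexL2, t ∈ Icc 0 T → Tendsto (fun K => F K t) atTop (𝓝 G) := fun t => by
    by_cases ht : t ∈ Icc 0 T
    · have hcs : CauchySeq fun K => F K t := by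
        refine cauchySeq_of_le_tendsto_0 (fun K => Q * (2 ^ K : ℝ)⁻¹ + Q * (2 ^ K : ℝ)⁻¹)
          (fun k m N hk hm => ?_) ?_
        · have h1 := hclose N k hk t ht
          have h2 := hclose N m hm t ht
          rw [dist_eq_norm]
          have h3 := norm_sub_le_norm_sub_add_norm_sub (F k t) (F N t) (F m t)
          rw [norm_sub_rev (F k t) (F N t)] at h3
          linarith
        · have := (tendsto_mul_two_pow_inv Q).add (tendsto_mul_two_pow_inv Q)
          rwa [add_zero] at this
      exact (cauchySeq_tendsto_of_complete hcs).imp fun G hG _ => hG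
    · exact ⟨0, fun h => absurd h ht⟩
  choose G hGl using hlim
  have happ : IsApprox n κ T B Q (fun R => l2 (fun ξ =>
      ((√(wt (2 * n + 2) R (br ξ)) : ℝ) : ℂ) * f₀ ξ) ^ 2 *
        Real.exp (2 * (3 * ((2 * n + 2) * 2 ^ (2 * n + 2)) * (ci * B)) * T)) F f G := by
    refine ⟨hG, hbd, fun K t ht R hR => ?_, fun K t ht => ?_, ?_⟩
    · refine ((hG K).l2_sqrt_wt_sq_le (by linarith) hR (ha K) ht).trans ?_
      have := hw0 _ K (memLp_sqrt_wt hR hm₀)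
      have := l2_nonneg fun ξ => ((√(wt (2 * n + 2) R (br ξ)) : ℝ) : ℂ) * f K 0 ξ
      gcongr
    · refine le_of_tendsto ((hGl t ht).const_sub (F K t)).norm ?_
      filter_upwards [eventually_ge_atTop K] with K' hK' using hclose K K' hK' t ht
    · have := (tendsto_l2_sqrt_wt hm₀).mul_const
        (Real.exp (2 * (3 * ((2 * n + 2) * 2 ^ (2 * n + 2)) * (ci * B)) * T))
      rwa [zero_mul] at this
  refine ⟨B, G, ?_, fun t ht => ⟨happ.herm_lim ht, (happ.memLp_lim ht).1, (happ.memLp_lim ht).2,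
    happ.tendsto_sobolev (by linarith) ht, happ.hasDerivWithinAt hn ht⟩⟩
  refine tendsto_nhds_unique (hGl 0 h00) ?_
  rw [tendsto_iff_norm_sub_tendsto_zero]
  refine squeeze_zero (fun _ => norm_nonneg _) (fun K => ?_)
    (tendsto_mul_two_pow_inv (l2 fun ξ => (br ξ : ℂ) * f₀ ξ))
  rw [hF0 K, norm_eq_l2 (coeFn_sub_ae (hP K) hF₀), mul_comm]
  exact l2_trunc_sub_le K hbr₀.1

/-- Uniqueness on the Fourier side. -/
theorem fourier_solution_unique {n κ T B : ℝ} (hn : 3 < n) {F G : ℝ → ComplexL2} (h0 : F 0 = G 0)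
    (hF : ∀ t ∈ Icc 0 T, MemLp (fun ξ => ((br ξ ^ n : ℝ) : ℂ) * F t ξ) 2 ∧
      l2 (fun ξ => ((br ξ ^ n : ℝ) : ℂ) * F t ξ) ≤ B)
    (hG : ∀ t ∈ Icc 0 T, MemLp (fun ξ => ((br ξ ^ n : ℝ) : ℂ) * G t ξ) 2)
    (hGh : ∀ t ∈ Icc 0 T, G t =ᵐ[volume] hpart (G t))
    (hFd : ∀ t ∈ Icc 0 T,
      HasDerivWithinAt F (κ • mulOp (memLp_rieszSymbol 0) (F t) - advLp (F t)) (Icc 0 T) t)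
    (hGd : ∀ t ∈ Icc 0 T,
      HasDerivWithinAt G (κ • mulOp (memLp_rieszSymbol 0) (G t) - advLp (G t)) (Icc 0 T) t)
    {t : ℝ} (ht : t ∈ Icc 0 T) : F t = G t := by
  obtain ⟨c, hc, hint⟩ := exists_integral_br_le (n := n) (by linarith)
  have hB : 0 ≤ B := (l2_nonneg _).trans (hF t ht).2
  have key := le_mul_exp_of_deriv_le (b := 0) (y := fun t => ‖F t - G t‖ ^ 2)
    (A := fun t => 4 * (c * B) * t) (a := fun _ => 4 * (c * B) * 1) le_rfl
    (fun s hs => hasDerivWithinAt_norm_sq ((hFd s hs).sub (hGd s hs)))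
    (fun s _ => (hasDerivWithinAt_id s _).const_mul _)
    (mul_zero _) (fun s hs => mul_nonneg (by positivity) hs.1) (fun s hs => ?_) ht
  · rw [h0] at key
    simp only [sub_self, norm_zero, zero_mul, add_zero, ne_eq, OfNat.ofNat_ne_zero,
      not_false_eq_true, zero_pow] at key
    have h1 : ‖F t - G t‖ ^ 2 = 0 := le_antisymm key (sq_nonneg _)
    exact sub_eq_zero.1 (norm_eq_zero.1 (pow_eq_zero_iff two_ne_zero |>.1 h1))
  · obtain ⟨hFm, hFB⟩ := hF s hs
    have hae := hGh s hs
    have hherm := herm_hpart (G s)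
    obtain ⟨g, hg⟩ : ∃ g, g = hpart (G s) := ⟨_, rfl⟩
    rw [← hg] at hae hherm
    have hGm : MemLp (fun ξ => ((br ξ ^ n : ℝ) : ℂ) * g ξ) 2 := by
      refine (hG s hs).ae_eq ?_
      filter_upwards [hae] with ξ hξ
      rw [hξ]
    have hF1 := memLp_br_of_br_rpow (by linarith) hFm
    have hG1 := memLp_br_of_br_rpow (by linarith) hGm
    have hF0 := memLp_of_br_rpow (by linarith) hFm
    have hG0 := memLp_of_br_rpow (by linarith) hGm
    obtain ⟨hFi, hFib⟩ := hint _ hFm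
    obtain ⟨hGi, -⟩ := hint _ hGm
    have hi0 : ∀ {u : Plane → ℂ}, MemLp u 2 → Integrable (fun ξ => (br ξ : ℂ) * u ξ) →
        Integrable u := fun {u} hu hi => hi.mono hu.1 (Eventually.of_forall fun ξ => by
      rw [norm_mul, Complex.norm_real, Real.norm_of_nonneg (br_pos ξ).le]
      exact le_mul_of_one_le_left (norm_nonneg _) (one_le_br ξ))
    have hadvF := (memLp_adv (hi0 hF0.1 hFi) hF1.1).1
    have hadvG := (memLp_adv (hi0 hG0.1 hGi) hG1.1).1
    have e1 : advLp (G s) =ᵐ[volume] adv g g := by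
      have e := adv_congr hae hae
      rw [← e] at hadvG ⊢
      exact coeFn_advLp hadvG
    have e2 : κ • mulOp (memLp_rieszSymbol 0) (F s) - advLp (F s) -
        (κ • mulOp (memLp_rieszSymbol 0) (G s) - advLp (G s)) =
        κ • mulOp (memLp_rieszSymbol 0) (F s - G s) - (advLp (F s) - advLp (G s)) := by
      rw [map_sub, smul_sub]
      abel
    rw [e2, inner_sub_right, Complex.sub_re, inner_real_smul, re_inner_riesz, mul_zero, zero_sub,
      inner_eq_integral (coeFn_sub_ae (ae_eq_refl (F s)) hae)
        (coeFn_sub_ae (coeFn_advLp hadvF) e1),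
      norm_eq_l2 (coeFn_sub_ae (ae_eq_refl (F s)) hae)]
    -- Only the gradient of F enters, so a uniform H^n bound is needed for one of the two solutions
    -- only; of the other, Hermitian symmetry is used for the cancellation.
    have h3 := abs_re_integral_adv_sub_le hF0.1 hG0.1 hF1.1 hG1.1 hFi (hi0 hG0.1 hGi) hherm
    have h4 := neg_abs_le (∫ ξ, (adv (F s) (F s) ξ - adv g g ξ) *
      (starRingEnd ℂ) (F s ξ - g ξ)).re
    have h5 : ∫ ξ, ‖(br ξ : ℂ) * F s ξ‖ ≤ c * B := hFib.trans (by gcongr)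
    have h6 := mul_le_mul_of_nonneg_right h5 (sq_nonneg (l2 fun ξ => F s ξ - g ξ))
    linarith

/-! ### Real-valued functions and the equation in physical space. -/

/-- The inverse Fourier transform of a Hermitian function is real. -/
theorem Herm.conj_fourierInv {f : Plane → ℂ} (hf : Herm f) (x : Plane) :
    (starRingEnd ℂ) (𝓕⁻ f x) = 𝓕⁻ f x := by
  rw [Real.fourierInv_eq', ← integral_conj, ← integral_neg_eq_self]
  refine integral_congr_ae (by
    filter_upwards with ξ
    simp only [smul_eq_mul, map_mul, hf ξ, Complex.conj_conj, ← Complex.exp_conj, inner_neg_left,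
      Complex.conj_ofReal, Complex.conj_I]
    congr 2
    push_cast
    ring)

theorem integrable_hpart {f : Plane → ℂ} (hf : Integrable f) : Integrable (hpart f) := by
  have h1 : Integrable fun ξ => f (-ξ) := hf.comp_neg
  have h2 : Integrable fun ξ => (starRingEnd ℂ) (f (-ξ)) :=
    (Complex.conjCLE : ℂ →L[ℝ] ℂ).integrable_comp h1
  exact (hf.add h2).div_const 2

/-- The inverse Fourier transform of a Hermitian element of `L²` is real. -/
theorem fourierInv_eq_re {F : ComplexL2} (hF : Integrable F) (h : F =ᵐ[volume] hpart F) :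
    (𝓕⁻ F : ComplexL2) =ᵐ[volume] fun x => (((𝓕⁻ F : ComplexL2) x).re : ℂ) := by
  have hm : MemLp (hpart F) 2 := (MemLp.hpart (Lp.memLp F)).1
  have e : F = hm.toLp _ := Lp.ext (h.trans hm.coeFn_toLp.symm)
  have h1 := fourierInv_toLp_ae_eq (integrable_hpart hF) hm
  rw [← e] at h1
  filter_upwards [h1] with x hx
  rw [hx]
  exact (Complex.conj_eq_iff_re.1 ((herm_hpart F).conj_fourierInv x)).symm

/-- The inclusion of the real-valued into the complex-valued functions. -/
def toComplexL : RealL2 →L[ℝ] ComplexL2 := Complex.ofRealCLM.compLpL 2 volume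

/-- The real part on `L²`. -/
def reL : ComplexL2 →L[ℝ] RealL2 := Complex.reCLM.compLpL 2 volume

/-- The Fourier transform of real-valued functions. -/
def realFourier : RealL2 →L[ℝ] ComplexL2 :=
  ((Lp.fourierTransformₗᵢ Plane ℂ).toContinuousLinearEquiv : ComplexL2 →L[ℂ] ComplexL2).restrictScalars
    ℝ ∘L toComplexL

/-- The real part of the inverse Fourier transform. -/
def realFourierInv : ComplexL2 →L[ℝ] RealL2 :=
  reL ∘L ((Lp.fourierTransformₗᵢ Plane ℂ).symm.toContinuousLinearEquiv :
    ComplexL2 →L[ℂ] ComplexL2).restrictScalars ℝ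

theorem coeFn_toComplex (f : RealL2) : toComplex f =ᵐ[volume] fun x => (f x : ℂ) :=
  Complex.ofRealCLM.coeFn_compLp f

theorem realFourier_apply (f : RealL2) : realFourier f = (𝓕 (toComplex f) : ComplexL2) := rfl

theorem fourierInv_realFourier (f : RealL2) : (𝓕⁻ (realFourier f) : ComplexL2) = toComplex f :=
  (Lp.fourierTransformₗᵢ Plane ℂ).symm_apply_apply (toComplex f)

theorem realFourierInv_realFourier (f : RealL2) : realFourierInv (realFourier f) = f := by
  have h : realFourierInv (realFourier f) = reL (toComplex f) :=
    congrArg reL (fourierInv_realFourier f)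
  rw [h]
  apply Lp.ext
  filter_upwards [Complex.reCLM.coeFn_compLp (toComplex f), coeFn_toComplex f] with x h1 h2
  refine h1.trans ?_
  rw [h2]
  rfl

theorem realFourier_injective : Function.Injective realFourier :=
  Function.LeftInverse.injective realFourierInv_realFourier

theorem toComplex_realFourierInv {F : ComplexL2} (hF : Integrable F) (h : F =ᵐ[volume] hpart F) :
    toComplex (realFourierInv F) = (𝓕⁻ F : ComplexL2) := by
  apply Lp.ext
  filter_upwards [coeFn_toComplex (realFourierInv F), fourierInv_eq_re hF h,
    Complex.reCLM.coeFn_compLp (𝓕⁻ F : ComplexL2)] with x h1 h2 h3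
  rw [h1, h2]
  exact congrArg _ h3

theorem realFourier_realFourierInv {F : ComplexL2} (hF : Integrable F) (h : F =ᵐ[volume] hpart F) :
    realFourier (realFourierInv F) = F := by
  rw [realFourier_apply, toComplex_realFourierInv hF h]
  exact (Lp.fourierTransformₗᵢ Plane ℂ).apply_symm_apply F

/-- The Fourier transform of a real-valued function is Hermitian. -/
theorem realFourier_eq_hpart {f : RealL2} (hf : Integrable (realFourier f)) :
    realFourier f =ᵐ[volume] hpart (realFourier f) := by
  obtain ⟨F, hFd⟩ : ∃ F, F = realFourier f := ⟨_, rfl⟩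
  rw [← hFd] at hf ⊢
  have hm1 : MemLp (hpart F) 2 := (MemLp.hpart (Lp.memLp F)).1
  have hm2 : MemLp (hpart fun ξ => -Complex.I * F ξ) 2 :=
    (MemLp.hpart ((Lp.memLp F).const_mul (-Complex.I))).1
  have hi2 : Integrable (hpart fun ξ => -Complex.I * F ξ) :=
    integrable_hpart (hf.const_mul (-Complex.I))
  -- Every function is a Hermitian one plus i times a Hermitian one. Both have real inverse
  -- transforms u and v, and u + iv is real by assumption, so v = 0.
  have e : F = (hm1.toLp _ : ComplexL2) + Complex.I • (hm2.toLp _ : ComplexL2) := by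
    apply Lp.ext
    filter_upwards [hm1.coeFn_toLp, hm2.coeFn_toLp,
      Lp.coeFn_add (hm1.toLp _ : ComplexL2) (Complex.I • (hm2.toLp _ : ComplexL2)),
      Lp.coeFn_smul Complex.I (hm2.toLp _ : ComplexL2)] with ξ h1 h2 h3 h4
    rw [h3, Pi.add_apply, h4, Pi.smul_apply, h1, h2]
    simp only [hpart, map_mul, map_neg, Complex.conj_I, smul_eq_mul]
    linear_combination (1 / 2 * F ξ - 1 / 2 * (starRingEnd ℂ) (F (-ξ))) * Complex.I_sq
  obtain ⟨u, hu⟩ : ∃ u : ComplexL2, u = 𝓕⁻ (hm1.toLp _ : ComplexL2) := ⟨_, rfl⟩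
  obtain ⟨v, hv⟩ : ∃ v : ComplexL2, v = 𝓕⁻ (hm2.toLp _ : ComplexL2) := ⟨_, rfl⟩
  have e2 : toComplex f = u + Complex.I • v := by
    rw [← fourierInv_realFourier, ← hFd, hu, hv]
    refine (congrArg (Lp.fourierTransformₗᵢ Plane ℂ).symm e).trans ?_
    rw [map_add, map_smul]
    rfl
  have hr : ∀ {w : Plane → ℂ} (hw : MemLp w 2), Integrable w → Herm w → ∀ᵐ x,
      ((𝓕⁻ (hw.toLp w : ComplexL2) : ComplexL2) x).im = 0 := fun {w} hw hwi hwh => by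
    filter_upwards [fourierInv_toLp_ae_eq hwi hw] with x hx
    rw [hx]
    exact Complex.conj_eq_iff_im.1 (hwh.conj_fourierInv x)
  have hv0 : v = 0 := by
    apply Lp.ext
    filter_upwards [hr hm1 (integrable_hpart hf) (herm_hpart _), hr hm2 hi2 (herm_hpart _),
      coeFn_toComplex f, Lp.coeFn_add u (Complex.I • v), Lp.coeFn_smul Complex.I v,
      Lp.coeFn_zero ℂ 2 (volume : Measure Plane)] with x h1 h2 h3 h4 h5 h6
    rw [← hu] at h1
    rw [← hv] at h2
    rw [e2, h4, Pi.add_apply, h5, Pi.smul_apply, smul_eq_mul] at h3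
    have h7 := congrArg Complex.im h3
    rw [h6]
    apply Complex.ext
    · simpa [h1] using h7
    · exact h2
  have h0 : (hm2.toLp _ : ComplexL2) = 0 :=
    (Lp.fourierTransformₗᵢ Plane ℂ).symm.injective ((hv.symm.trans hv0).trans (map_zero _).symm)
  rw [h0, smul_zero, add_zero] at e
  have := hm1.coeFn_toLp
  rwa [← e] at this

theorem toTemperedDistribution_injective {f g : ComplexL2}
    (h : (f : 𝓢'(Plane, ℂ)) = (g : 𝓢'(Plane, ℂ))) : f = g :=
  LinearMap.ker_eq_bot.1 (Lp.ker_toTemperedDistributionCLM_eq_bot (F := ℂ)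
    (μ := (volume : Measure Plane)) (p := 2)) h

/-- The gradient in `IsSolution` is only asserted to exist; uniqueness lets it be replaced by the
one given by Fourier multipliers. -/
theorem IsGradient.eq {f : RealL2} {g g' : Fin 2 → ComplexL2} (h : IsGradient f g)
    (h' : IsGradient f g') : g = g' :=
  funext fun j => toTemperedDistribution_injective ((h j).trans (h' j).symm)

/-- On tempered distributions a derivative is multiplication of the Fourier transform by 2πi ξ_j. -/
theorem isGradient_fourierInv {f : RealL2} (h : ∀ j, MemLp (fun ξ => dsym j ξ * realFourier f ξ) 2) :
    IsGradient f fun j => (𝓕⁻ ((h j).toLp _ : ComplexL2) : ComplexL2) := by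
  intro j
  rw [← Lp.fourierInv_toTemperedDistribution_eq, ← fourierInv_realFourier,
    ← Lp.fourierInv_toTemperedDistribution_eq, TemperedDistribution.lineDerivOp_fourierInv_eq]
  congr 1
  ext φ
  have ht : (fun ξ : Plane => ((inner ℝ ξ (EuclideanSpace.single j (1 : ℝ)) : ℝ) : ℂ)).HasTemperateGrowth := by
    fun_prop
  simp only [_root_.smul_apply, TemperedDistribution.smulLeftCLM_apply_apply,
    Lp.toTemperedDistribution_apply, ← integral_smul]
  refine integral_congr_ae ?_
  filter_upwards [(h j).coeFn_toLp] with ξ hξ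
  rw [hξ, SchwartzMap.smulLeftCLM_apply_apply ht]
  simp only [smul_eq_mul, dsym, EuclideanSpace.inner_single_right]
  simp
  ring

/-- The components of the velocity are given by the symbols `vsym`. -/
theorem velocity_eq {f : RealL2} (j : Fin 2)
    (h : MemLp (fun ξ => vsym j ξ * realFourier f ξ) 2) :
    velocity f j = (𝓕⁻ (h.toLp _ : ComplexL2) : ComplexL2) := by
  have key : ∀ k, gradInvSqrtLaplacian k (toComplex f) =
      (Lp.fourierTransformₗᵢ Plane ℂ).symm (mulOp (memLp_gradSymbol k) (realFourier f)) := fun k => rfl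
  have e : velocity f j = (Lp.fourierTransformₗᵢ Plane ℂ).symm
      (if j = 0 then -mulOp (memLp_gradSymbol 1) (realFourier f)
        else mulOp (memLp_gradSymbol 0) (realFourier f)) := by
    fin_cases j
    · simp only [velocity, key]
      simp
    · simp only [velocity, key]
      simp
  rw [e]
  change _ = (Lp.fourierTransformₗᵢ Plane ℂ).symm (h.toLp _)
  congr 1
  apply Lp.ext
  fin_cases j
  · filter_upwards [h.coeFn_toLp, Lp.coeFn_neg (mulOp (memLp_gradSymbol 1) (realFourier f)),
      coeFn_mulOp (memLp_gradSymbol 1) (realFourier f)] with ξ h1 h2 h3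
    rw [h1]
    simp only [Fin.zero_eta, if_true]
    rw [h2, Pi.neg_apply, h3]
    simp [vsym]
  · filter_upwards [h.coeFn_toLp, coeFn_mulOp (memLp_gradSymbol 0) (realFourier f)] with ξ h1 h3
    rw [h1]
    simp only [Fin.mk_one, one_ne_zero, if_false]
    rw [h3]
    simp [vsym]

/-- The product of the velocity with the gradient on the Fourier side. -/
theorem sum_velocity_mul {f : RealL2} {g : Fin 2 → ComplexL2} (hg : IsGradient f g)
    (h1 : Integrable fun ξ => (br ξ : ℂ) * realFourier f ξ)
    (h2 : MemLp (fun ξ => (br ξ : ℂ) * realFourier f ξ) 2) (h0 : Integrable (realFourier f)) :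
    ∀ᵐ x, ∑ j, velocity f j x * g j x = (𝓕⁻ (advLp (realFourier f)) : ComplexL2) x := by
  have hd : ∀ j, MemLp (fun ξ => dsym j ξ * realFourier f ξ) 2 := fun j => (memLp_dsym_mul h2 j).1
  have hv : ∀ j, MemLp (fun ξ => vsym j ξ * realFourier f ξ) 2 :=
    fun j => (memLp_vsym_mul (Lp.memLp (realFourier f)) j).1
  have hdi : ∀ j, Integrable fun ξ => dsym j ξ * realFourier f ξ :=
    fun j => (integrable_dsym_mul h1 j).1
  have hvi : ∀ j, Integrable fun ξ => vsym j ξ * realFourier f ξ :=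
    fun j => integrable_vsym_mul h0 j
  have ha : MemLp (adv (realFourier f) (realFourier f)) 2 := (memLp_adv h0 h2).1
  have hai : Integrable (adv (realFourier f) (realFourier f)) :=
    integrable_finsetSum _ fun j _ => integrable_conv (hvi j) (hdi j)
  have hadv : advLp (realFourier f) = ha.toLp _ := by rw [advLp, dif_pos ha]
  rw [hg.eq (isGradient_fourierInv hd), hadv]
  filter_upwards [ae_all_iff.2 fun j => fourierInv_toLp_ae_eq (hdi j) (hd j),
    ae_all_iff.2 fun j => fourierInv_toLp_ae_eq (hvi j) (hv j),
    fourierInv_toLp_ae_eq hai ha] with x e1 e2 e3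
  rw [e3]
  have e4 : 𝓕⁻ (adv (realFourier f) (realFourier f)) x =
      ∑ j, 𝓕⁻ (fun ξ => ∫ η, (vsym j (ξ - η) * realFourier f (ξ - η)) *
        (dsym j η * realFourier f η)) x := by
    simp only [Real.fourierInv_eq', adv, smul_eq_mul, Finset.mul_sum]
    rw [integral_finsetSum]
    intro j _
    refine (integrable_conv (hvi j) (hdi j)).bdd_mul (c := 1) (by fun_prop) ?_
    filter_upwards with ξ
    rw [Complex.norm_exp_ofReal_mul_I]
  rw [e4]
  refine Finset.sum_congr rfl fun j _ => ?_
  rw [velocity_eq j (hv j), e1, e2]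
  exact (fourierInv_conv (hvi j) (hdi j) x).symm

/-- The dispersive equation on the Fourier side. -/
theorem equation_iff {κ : ℝ} {f f' : RealL2} {g : Fin 2 → ComplexL2} (hg : IsGradient f g)
    (h1 : Integrable fun ξ => (br ξ : ℂ) * realFourier f ξ)
    (h2 : MemLp (fun ξ => (br ξ : ℂ) * realFourier f ξ) 2) (h0 : Integrable (realFourier f)) :
    (∀ᵐ x, ((f' x : ℝ) : ℂ) + ∑ j, velocity f j x * g j x = (κ : ℂ) * riesz 0 (toComplex f) x) ↔
      realFourier f' = κ • mulOp (memLp_rieszSymbol 0) (realFourier f) - advLp (realFourier f) := by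
  obtain ⟨Φ, hΦ⟩ : ∃ Φ, Φ = Lp.fourierTransformₗᵢ Plane ℂ := ⟨_, rfl⟩
  obtain ⟨R, hR⟩ : ∃ R, R = riesz 0 (toComplex f) := ⟨_, rfl⟩
  obtain ⟨A, hA⟩ : ∃ A, A = Φ.symm (advLp (realFourier f)) := ⟨_, rfl⟩
  have hR' : R = Φ.symm (mulOp (memLp_rieszSymbol 0) (realFourier f)) := by rw [hR, hΦ]; rfl
  have hf' : toComplex f' = Φ.symm (realFourier f') := by rw [hΦ]; exact (fourierInv_realFourier f').symm
  have hs := sum_velocity_mul hg h1 h2 h0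
  have e1 : realFourier f' = κ • mulOp (memLp_rieszSymbol 0) (realFourier f) - advLp (realFourier f) ↔
      toComplex f' = (κ : ℂ) • R - A := by
    have hk : κ • mulOp (memLp_rieszSymbol 0) (realFourier f) =
        (κ : ℂ) • mulOp (memLp_rieszSymbol 0) (realFourier f) :=
      RCLike.real_smul_eq_coe_smul (K := ℂ) _ _
    rw [hk, hf', hR', hA, ← map_smul Φ.symm, ← map_sub Φ.symm, Φ.symm.injective.eq_iff]
  rw [e1, ← hR]
  have e2 : (toComplex f' = (κ : ℂ) • R - A) ↔ toComplex f' =ᵐ[volume] ((κ : ℂ) • R - A : ComplexL2) :=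
    Lp.ext_iff
  rw [e2]
  have hA' : ∀ᵐ x, ∑ j, velocity f j x * g j x = A x := by
    rw [hA, hΦ]; exact hs
  refine eventually_congr ?_
  filter_upwards [hA', coeFn_toComplex f', Lp.coeFn_sub ((κ : ℂ) • R) A, Lp.coeFn_smul (κ : ℂ) R]
    with x h3 h4 h5 h6
  rw [h3, h4, h5, Pi.sub_apply, h6, Pi.smul_apply, smul_eq_mul, eq_sub_iff_add_eq]

/-- The Sobolev norm on the Fourier side. -/
theorem sobolevENorm_eq (s : ℝ) (f : RealL2) : sobolevENorm s f =
    eLpNorm (fun ξ => ((br ξ ^ s : ℝ) : ℂ) * realFourier f ξ) 2 volume := by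
  simp only [← J_rpow_half]
  rfl

theorem aestronglyMeasurable_br_rpow_mul (s : ℝ) (F : ComplexL2) :
    AEStronglyMeasurable (fun ξ => ((br ξ ^ s : ℝ) : ℂ) * F ξ) volume := by
  have : Measurable fun ξ => ((br ξ ^ s : ℝ) : ℂ) := by
    have := continuous_br.measurable
    fun_prop
  exact this.aestronglyMeasurable.mul (Lp.aestronglyMeasurable F)

theorem sobolevENorm_lt_top_iff {s : ℝ} {f : RealL2} : sobolevENorm s f < ∞ ↔
    MemLp (fun ξ => ((br ξ ^ s : ℝ) : ℂ) * realFourier f ξ) 2 := by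
  rw [sobolevENorm_eq, MemLp, and_iff_right (aestronglyMeasurable_br_rpow_mul s _)]

theorem sobolevENorm_eq_ofReal {s : ℝ} {f : RealL2}
    (h : MemLp (fun ξ => ((br ξ ^ s : ℝ) : ℂ) * realFourier f ξ) 2) :
    sobolevENorm s f = ENNReal.ofReal (l2 fun ξ => ((br ξ ^ s : ℝ) : ℂ) * realFourier f ξ) := by
  rw [sobolevENorm_eq, l2, ← toReal_eLpNorm h.1, ENNReal.ofReal_toReal h.2.ne]

/-- The regularity of functions of class `H^n` that the equation needs. -/
theorem regular_of_br_rpow {n : ℝ} (hn : 3 < n) {f : RealL2}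
    (h : MemLp (fun ξ => ((br ξ ^ n : ℝ) : ℂ) * realFourier f ξ) 2) :
    Integrable (fun ξ => (br ξ : ℂ) * realFourier f ξ) ∧
    MemLp (fun ξ => (br ξ : ℂ) * realFourier f ξ) 2 ∧ Integrable (realFourier f) := by
  obtain ⟨c, -, hc⟩ := exists_integral_br_le (n := n) (by linarith)
  refine ⟨(hc _ h).1, (memLp_br_of_br_rpow (by linarith) h).1, (hc _ h).1.mono (Lp.aestronglyMeasurable _) ?_⟩
  filter_upwards with ξ
  rw [norm_mul, Complex.norm_real, Real.norm_of_nonneg (br_pos ξ).le]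
  exact le_mul_of_one_le_left (norm_nonneg _) (one_le_br ξ)

theorem exists_isGradient {f : RealL2} (h : MemLp (fun ξ => (br ξ : ℂ) * realFourier f ξ) 2) :
    ∃ g, IsGradient f g :=
  ⟨_, isGradient_fourierInv fun j => (memLp_dsym_mul h j).1⟩

/-- A solution in the sense of `IsSolution` solves the equation on the Fourier side. -/
theorem IsSolution.hasDerivWithinAt_realFourier {n κ T : ℝ} {θ₀ : RealL2} {θ : ℝ → RealL2}
    (hn : 3 < n) (h : IsSolution n κ T θ₀ θ) {t : ℝ} (ht : t ∈ Icc 0 T) :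
    HasDerivWithinAt (fun t => realFourier (θ t)) (κ • mulOp (memLp_rieszSymbol 0)
      (realFourier (θ t)) - advLp (realFourier (θ t))) (Icc 0 T) t := by
  obtain ⟨θ', g, hd, hg, he⟩ := h.equation t ht
  obtain ⟨h1, h2, h3⟩ := regular_of_br_rpow hn (sobolevENorm_lt_top_iff.1 (h.continuous.1 t ht))
  rw [← (equation_iff hg h1 h2 h3).1 he]
  exact realFourier.hasFDerivAt.comp_hasDerivWithinAt t hd

/-- A solution on the Fourier side is a solution in the sense of `IsSolution`. -/
theorem isSolution_realFourierInv {n κ T : ℝ} (hn : 3 < n) (hT : 0 < T) {θ₀ : RealL2}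
    {G : ℝ → ComplexL2} (h0 : G 0 = realFourier θ₀)
    (hh : ∀ t ∈ Icc 0 T, G t =ᵐ[volume] hpart (G t))
    (hm : ∀ t ∈ Icc 0 T, MemLp (fun ξ => ((br ξ ^ n : ℝ) : ℂ) * G t ξ) 2)
    (hc : ∀ t ∈ Icc 0 T, Tendsto (fun s => l2 (fun ξ => ((br ξ ^ n : ℝ) : ℂ) * (G s ξ - G t ξ)))
      (𝓝[Icc 0 T] t) (𝓝 0))
    (hd : ∀ t ∈ Icc 0 T, HasDerivWithinAt G
      (κ • mulOp (memLp_rieszSymbol 0) (G t) - advLp (G t)) (Icc 0 T) t) :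
    IsSolution n κ T θ₀ (fun t => realFourierInv (G t)) ∧
      ∀ t ∈ Icc 0 T, realFourier (realFourierInv (G t)) = G t := by
  obtain ⟨c, -, hint⟩ := exists_integral_br_le (n := n) (by linarith)
  have hi : ∀ t ∈ Icc 0 T, Integrable (G t) := fun t ht => by
    refine (hint _ (hm t ht)).1.mono (Lp.aestronglyMeasurable _) ?_
    filter_upwards with ξ
    rw [norm_mul, Complex.norm_real, Real.norm_of_nonneg (br_pos ξ).le]
    exact le_mul_of_one_le_left (norm_nonneg _) (one_le_br ξ)
  have hG : ∀ t ∈ Icc 0 T, realFourier (realFourierInv (G t)) = G t :=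
    fun t ht => realFourier_realFourierInv (hi t ht) (hh t ht)
  refine ⟨⟨⟨fun t ht => ?_, fun t ht => ?_⟩, ?_, fun t ht => ?_⟩, hG⟩
  · rw [sobolevENorm_lt_top_iff, hG t ht]
    exact hm t ht
  · have e : ∀ r ∈ Icc 0 T, sobolevENorm n (realFourierInv (G r) - realFourierInv (G t)) =
        ENNReal.ofReal (l2 fun ξ => ((br ξ ^ n : ℝ) : ℂ) * (G r ξ - G t ξ)) := fun r hr => by
      have e1 : (fun ξ => ((br ξ ^ n : ℝ) : ℂ) *
          realFourier (realFourierInv (G r) - realFourierInv (G t)) ξ) =ᵐ[volume]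
          fun ξ => ((br ξ ^ n : ℝ) : ℂ) * (G r ξ - G t ξ) := by
        rw [map_sub, hG r hr, hG t ht]
        filter_upwards [Lp.coeFn_sub (G r) (G t)] with ξ hξ
        rw [hξ, Pi.sub_apply]
      have e2 : MemLp (fun ξ => ((br ξ ^ n : ℝ) : ℂ) * (G r ξ - G t ξ)) 2 := by
        simp only [mul_sub]
        exact (hm r hr).sub (hm t ht)
      rw [sobolevENorm_eq_ofReal ((memLp_congr_ae e1).2 e2), l2_congr e1 e2]
    have h2 := ENNReal.tendsto_ofReal (hc t ht)
    rw [ENNReal.ofReal_zero] at h2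
    exact h2.congr' (eventually_nhdsWithin_of_forall fun r hr => (e r hr).symm)
  · simp only [h0, realFourierInv_realFourier]
  · have hm' := hm t ht
    rw [← hG t ht] at hm'
    obtain ⟨h1, h2, h3⟩ := regular_of_br_rpow hn hm'
    obtain ⟨g, hg⟩ := exists_isGradient h2
    have hd1 := realFourierInv.hasFDerivAt.comp_hasDerivWithinAt t (hd t ht)
    refine ⟨_, g, hd1, hg, (equation_iff hg h1 h2 h3).2 ?_⟩
    rw [hG t ht]
    -- The derivative of the real function is a real part, so a priori information could be lost.
    -- Transforming back and using uniqueness of derivatives on the nondegenerate interval shows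
    -- that its transform is the full right-hand side.
    have hd2 := realFourier.hasFDerivAt.comp_hasDerivWithinAt t hd1
    have hd3 := hd2.congr_of_mem (fun s hs => (hG s hs).symm) ht
    exact (uniqueDiffOn_Icc hT t ht).eq_deriv _ hd3 (hd t ht)



end DispersiveSQG

end

open DispersiveSQG

/-! ### The theorem. -/

theorem theorem1p2 (n : ℝ) (hn : 3 < n) :
    ∃ C : ℝ, 0 < C ∧
      ∀ (κ : ℝ), 0 < κ → ∀ (ε : ℝ), 0 < ε → ∀ (θ₀ : DispersiveSQG.RealL2),
        DispersiveSQG.sobolevENorm n θ₀ = ENNReal.ofReal ε →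
        ∃ T : ℝ, C * κ ^ (1 / 3 : ℝ) * ε ^ (-4 / 3 : ℝ) ≤ T ∧
          ∃ θ : ℝ → DispersiveSQG.RealL2, DispersiveSQG.IsSolution n κ T θ₀ θ ∧
            ∀ θ' : ℝ → DispersiveSQG.RealL2, DispersiveSQG.IsSolution n κ T θ₀ θ' →
              Set.EqOn θ' θ (Set.Icc 0 T) := by
  obtain ⟨c, hc, hex⟩ := exists_fourier_solution hn
  refine ⟨c, hc, fun κ hκ ε hε θ₀ hθ₀ => ⟨_, le_rfl, ?_⟩⟩
  obtain ⟨T, hTd⟩ : ∃ T, T = c * κ ^ (1 / 3 : ℝ) * ε ^ (-4 / 3 : ℝ) := ⟨_, rfl⟩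
  rw [← hTd]
  have hT : 0 < T := hTd ▸ by positivity
  have hm : MemLp (fun ξ => ((br ξ ^ n : ℝ) : ℂ) * realFourier θ₀ ξ) 2 :=
    sobolevENorm_lt_top_iff.1 (hθ₀ ▸ ENNReal.ofReal_lt_top)
  have hle : l2 (fun ξ => ((br ξ ^ n : ℝ) : ℂ) * realFourier θ₀ ξ) ≤ ε :=
    (ENNReal.ofReal_le_ofReal_iff hε.le).1 ((sobolevENorm_eq_ofReal hm).symm.trans hθ₀).le
  have hh := realFourier_eq_hpart (regular_of_br_rpow hn hm).2.2
  have hae : (fun ξ => ((br ξ ^ n : ℝ) : ℂ) * hpart (realFourier θ₀) ξ) =ᵐ[volume]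
      fun ξ => ((br ξ ^ n : ℝ) : ℂ) * realFourier θ₀ ξ := by
    filter_upwards [hh] with ξ hξ
    rw [← hξ]
  -- The Hermitian part serves as the representative of the datum that is Hermitian at every
  -- frequency, not only almost everywhere.
  obtain ⟨B, G, hG0, hG⟩ := hex κ ε T (realFourier θ₀) (hpart (realFourier θ₀)) hκ hε hTd hh
    (herm_hpart _) ((memLp_congr_ae hae).2 hm) ((l2_congr hae hm).trans_le hle)
  obtain ⟨hsol, hGF⟩ := isSolution_realFourierInv hn hT hG0 (fun t ht => (hG t ht).1)
    (fun t ht => (hG t ht).2.1) (fun t ht => (hG t ht).2.2.2.1) fun t ht => (hG t ht).2.2.2.2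
  refine ⟨_, hsol, fun θ hθ t ht => realFourier_injective ?_⟩
  have hmem : ∀ t ∈ Set.Icc 0 T, MemLp (fun ξ => ((br ξ ^ n : ℝ) : ℂ) * realFourier (θ t) ξ) 2 :=
    fun t ht => sobolevENorm_lt_top_iff.1 (hθ.continuous.1 t ht)
  refine Eq.trans ?_ (hGF t ht).symm
  refine (fourier_solution_unique hn (F := G) (G := fun t => realFourier (θ t)) ?_
    (fun t ht => ⟨(hG t ht).2.1, (hG t ht).2.2.1⟩) hmem
    (fun t ht => realFourier_eq_hpart (regular_of_br_rpow hn (hmem t ht)).2.2)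
    (fun t ht => (hG t ht).2.2.2.2) (fun t ht => hθ.hasDerivWithinAt_realFourier hn ht) ht).symm
  rw [hG0, hθ.initial]
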